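/- Let $t_i$ ($i\in I$, $I$ finite) be distinct points of $\mathbb C$ with multiplicities $n_i+1\ge 1$, and suppose that at least two of them, $t_p$ and $t_q$, have $n_p=n_q=0$; let $m+1=\sum_i(n_i+1)$. (The point $\infty$ is a further marked point, of multiplicity one.) Put $\mathbb C[\varepsilon_i]=\mathbb C[X]/(X^{n_i+1})$ and let $\chi_i(\sum_j b_j\varepsilon_i^j)=i\,\mathrm{Re}\sum_j c^{(i)}_j b_j$, where $c^{(i)}_j\in\mathbb C$, $\mathrm{Im}\,c^{(i)}_0\in\mathbb Z$, $\sum_i c^{(i)}_0=0$, and $c^{(i)}_{n_i}\ne 0$ whenever $n_i\geq 1$. Let $\mathcal H$ be the Hilbert space of square-integrable half-densities on $\mathbb P^{m-1}_{\mathbb C}$, realized as functions $\psi((\mathbf u_i)_{i\in I})$ of $\mathbf u_i=\sum_j u_i^{(j)}\varepsilon_i^j\in\mathbb C[\varepsilon_i]$ which are invariant under $(\mathbf u_i)_i\mapsto(\mathbf u_i+\tau)_i$, $\tau\in\mathbb C$, and satisfy $\psi(z\mathbf u)=|z|^{-m}\psi(\mathbf u)$ for $z\in\mathbb C^\times$,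 with the $L^2$-norm of the restriction to $\{u_p=0,\ u_q=1\}\cong\mathbb C^{m-1}$. For $x\in\mathbb C\setminus\{t_i\}$ let the modified Hecke operator be $$(\mathbb H_x\psi)(\mathbf u)=\int_{\mathbb C}\psi\Big(\Big(\frac{t_i+\varepsilon_i-x}{s-\mathbf u_i}\Big)_{i}\Big)\,\frac{\exp\big(\sum_i\chi_i(\log(s-\mathbf u_i))\big)}{\prod_i|s-u_i^{(0)}|^{2n_i+2}}\,ds\,d\bar s ,$$ where $ds\,d\bar s$ is Lebesgue measure on $\mathbb C$, and let the Hecke operator be $$H_x=\prod_i|t_i-x|^{n_i+1}\exp\big(-\tfrac12\chi_i(\log(t_i+\varepsilon_i-x))\big)\cdot\mathbb H_x .$$ ($H_x$ depends on the choice of the logarithms of the $t_i-x$ at most by a sign, and not at all if all $\mathrm{Im}\,c_0^{(i)}$ are even.) Then for every $x\in\mathbb C\setminus\{t_i\}$ and every $\psi\in\mathcal H$ the integral converges absolutely for almost every $\mathbf u$ and defines a bounded operator $\mathbb H_x$ on $\mathcal H$. The operators $\mathbb H_x$ and $H_x$ are compact. The operator $\mathbb H_x$ depends continuously on $x\in\mathbb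 C\setminus\{t_i\}$ in the operator norm, and $H_x$ depends continuously, in the operator norm, on $x$ and the choice of the logarithms of the $t_i-x$ (so $x\mapsto H_x$ is norm-continuous wherever these are chosen continuously, and on all of $\mathbb C\setminus\{t_i\}$ if all $\mathrm{Im}\,c_0^{(i)}$ are even). -/

import Mathlib

open MeasureTheory PowerSeries

noncomputable section

namespace WildHecke

/-- An element `w 0 + w 1 ε + … + w n ε ^ n` of `ℂ[ε] = ℂ[X] / (X ^ (n + 1))`, written as a power
series in `X`.  Only coefficients of index at most `n` of expressions in such series are ever used;
for sums, products, inverses and logarithms these depend only on the classes modulo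
`X ^ (n + 1)`, so the computations below are computations in `ℂ[ε]`. -/
def toSeries {n : ℕ} (w : Fin (n + 1) → ℂ) : ℂ⟦X⟧ :=
  PowerSeries.mk fun j => if h : j < n + 1 then w ⟨j, h⟩ else 0

/-- The coefficients of `log w` for a series `w` with nonzero constant term `w₀`, where `ℓ` is a
chosen logarithm of `w₀`:
`log w = ℓ + ∑_{r ≥ 1} (-1) ^ (r + 1) / r * (w / w₀ - 1) ^ r`. -/
def logCoeff (ℓ : ℂ) (w : ℂ⟦X⟧) (j : ℕ) : ℂ :=
  if j = 0 then ℓ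
  else ∑ r ∈ Finset.Icc 1 j, (-1 : ℂ) ^ (r + 1) / (r : ℂ) *
    coeff j ((C ((constantCoeff w)⁻¹) * w - 1) ^ r)

/-- The `ℝ`-linear functional `∑ b_j ε ^ j ↦ i Re (∑ c_j b_j)` from `ℂ[ε]` to `iℝ`
(the argument is the sequence of coefficients `b_j`). -/
def chi {n : ℕ} (c : Fin (n + 1) → ℂ) (b : ℕ → ℂ) : ℂ :=
  Complex.I * ((∑ j : Fin (n + 1), c j * b j).re : ℂ)

/-- The ramification data on `ℙ¹`: distinct finite points `t i` of multiplicity `n i + 1`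
(the point `∞` being a further point of multiplicity one), two of which, `t p` and `t q`, have
multiplicity one, together with the coefficients `c i j` of the functionals `χ_i`. -/
structure RamificationData (ι : Type*) [Fintype ι] where
  /-- `n i + 1` is the multiplicity of the `i`-th point -/
  n : ι → ℕ
  /-- the marked points -/
  t : ι → ℂ
  /-- the coefficients of the functional `χ_i` -/
  c : ∀ i, Fin (n i + 1) → ℂ
  /-- the first point which is not glued -/
  p : ι
  /-- the second point which is not glued -/
  q : ι
  t_injective : Function.Injective t
  p_ne_q : p ≠ q
  n_p : n p = 0
  n_q : n q = 0
  im_c_zero : ∀ i, ∃ k : ℤ, (c i 0).im = (k : ℝ)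
  c_last : ∀ i, n i ≠ 0 → c i (Fin.last (n i)) ≠ 0
  sum_c_zero : ∑ i, c i 0 = 0

variable {ι : Type*} [Fintype ι] (D : RamificationData ι)

namespace RamificationData

/-- Configurations `(𝐮_i)_i`, with `𝐮_i = ∑ j, u i j ε_i ^ j ∈ ℂ[ε_i]` the parameter of the line
`(1, 𝐮_i)` over the `i`-th point. -/
abbrev Conf : Type _ := ∀ i, Fin (D.n i + 1) → ℂ

/-- The number `m`, where `m + 1` is the total multiplicity of the finite points. -/
def m : ℕ := (∑ i, (D.n i + 1)) - 1

/-- The action of the affine transformation `z ↦ l z + τ` on configurations. -/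
def affine (l τ : ℂ) (u : D.Conf) : D.Conf :=
  fun i j => l * u i j + if j = 0 then τ else 0

/-- Coordinates `ℂ ^ (m - 1)` on configurations modulo translations and dilations (birationally
`ℙ ^ (m - 1)`): normalize the configuration by `u_p = 0`, `u_q = 1`. -/
abbrev Slice : Type _ := ∀ i : {i : ι // i ≠ D.p ∧ i ≠ D.q}, Fin (D.n i + 1) → ℂ

/-- The normalized configuration with given coordinates. -/
def point [DecidableEq ι] (v : D.Slice) : D.Conf :=
  fun i j => if h : i ≠ D.p ∧ i ≠ D.q then v ⟨i, h⟩ j else if i = D.q then 1 else 0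

/-- The coordinates of the normalized configuration in the orbit of `u`. -/
def slice (u : D.Conf) : D.Slice :=
  fun i j => (u i j - if j = 0 then u D.p 0 else 0) / (u D.q 0 - u D.p 0)

/-- The function on configurations, translation invariant and homogeneous of degree `-m`
(`ψ (l u) = |l| ^ (-m) ψ u`), whose restriction to normalized configurations is `f`. -/
def homogExt (f : D.Slice → ℂ) (u : D.Conf) : ℂ :=
  ((‖u D.q 0 - u D.p 0‖ ^ D.m)⁻¹ : ℝ) * f (D.slice u)

/-- The Hilbert space of square-integrable half-densities on `ℙ ^ (m - 1)`.  A half-density is a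
translation invariant function of degree `-m` on configurations; its norm is the `L²` norm of its
restriction to the normalized configurations (an affine chart with complement of measure zero). -/
abbrev HilbertSp [DecidableEq ι] : Type _ := Lp ℂ 2 (volume : Measure D.Slice)

/-- The Hecke modification of a configuration: `(t_i + ε_i - x) / (s - 𝐮_i)`. -/
def modify (x s : ℂ) (u : D.Conf) : D.Conf :=
  fun i j => coeff (j : ℕ) ((C (D.t i - x) + X) * (C s - toSeries (u i))⁻¹)

/-- `exp (∑ i, χ_i (log (s - 𝐮_i)))`.  It does not depend on the branch of the logarithm because
the imaginary parts of the `c i 0` are integers. -/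
def phase (s : ℂ) (u : D.Conf) : ℂ :=
  Complex.exp (∑ i, chi (D.c i) (logCoeff (Complex.log (s - u i 0)) (C s - toSeries (u i))))

/-- The integrand of the modified Hecke operator applied to `ψ`, at the configuration `u`. -/
def integrand (x : ℂ) (ψ : D.Conf → ℂ) (u : D.Conf) (s : ℂ) : ℂ :=
  ψ (D.modify x s u) * D.phase s u / ((∏ i, ‖s - u i 0‖ ^ (2 * D.n i + 2) : ℝ) : ℂ)

/-- `T` is the modified Hecke operator at `x`: for every half-density `ψ` in the Hilbert
space, and at all configurations `u` in almost every orbit of the affine group, the integral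
over `s` that defines the modified Hecke operator converges and equals `(T ψ) u`. -/
def IsModifiedHecke [DecidableEq ι] (x : ℂ) (T : D.HilbertSp →L[ℂ] D.HilbertSp) : Prop :=
  ∀ f : D.HilbertSp, ∀ᵐ v : D.Slice, ∀ l τ : ℂ, l ≠ 0 →
    Integrable (D.integrand x (D.homogExt f) (D.affine l τ (D.point v))) ∧
    D.homogExt (T f) (D.affine l τ (D.point v)) =
      ∫ s : ℂ, D.integrand x (D.homogExt f) (D.affine l τ (D.point v)) s

/-- The scalar `∏ i, |t_i - x| ^ (n_i + 1) exp (-½ χ_i (log (t_i + ε_i - x)))` by which the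
modified Hecke operator is multiplied to give the Hecke operator, computed with a choice `ℓ i` of
`log (t_i - x)`. Another choice changes it by a sign at most, and not at all if the imaginary
parts of all `c i 0` are even. -/
def heckeFactor (x : ℂ) (ℓ : ι → ℂ) : ℂ :=
  ∏ i, ((‖D.t i - x‖ ^ (D.n i + 1) : ℝ) : ℂ) *
    Complex.exp (-(1 / 2) * chi (D.c i) (logCoeff (ℓ i) (C (D.t i - x) + X)))

/-- Choices of `x`, different from all marked points, and of a logarithm of each `t_i - x`. -/
def logChoices : Set (ℂ × (ι → ℂ)) :=
  {z | z.1 ∉ Set.range D.t ∧ ∀ i, Complex.exp (z.2 i) = D.t i - z.1}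

theorem slice_affine {l : ℂ} (hl : l ≠ 0) (τ : ℂ) (u : D.Conf) :
    D.slice (D.affine l τ u) = D.slice u := by
  funext i j
  have h : l * u D.q 0 + τ - (l * u D.p 0 + τ) = l * (u D.q 0 - u D.p 0) := by ring
  simp only [slice, affine, if_true, h]
  split_ifs
  · rw [← mul_div_mul_left (u i j - u D.p 0) _ hl]
    congr 1
    ring
  · rw [← mul_div_mul_left (u i j - 0) _ hl]
    congr 1
    ring

/-- The functions `homogExt f` are translation invariant and homogeneous of degree `-m`. -/
theorem homogExt_affine (f : D.Slice → ℂ) {l : ℂ} (hl : l ≠ 0) (τ : ℂ) (u : D.Conf) :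
    D.homogExt f (D.affine l τ u) = ((‖l‖ ^ D.m)⁻¹ : ℝ) * D.homogExt f u := by
  have h : l * u D.q 0 + τ - (l * u D.p 0 + τ) = l * (u D.q 0 - u D.p 0) := by ring
  rw [homogExt, slice_affine D hl, homogExt, ← mul_assoc]
  simp only [affine, if_true, h, norm_mul, mul_pow, mul_inv, Complex.ofReal_mul]

/-- On normalized configurations `homogExt f` is `f`. -/
theorem homogExt_point [DecidableEq ι] (f : D.Slice → ℂ) (v : D.Slice) : D.homogExt f (D.point v) = f v := by
  have hp : D.point v D.p 0 = 0 := by simp [point, D.p_ne_q]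
  have hq : D.point v D.q 0 = 1 := by simp [point]
  have hs : D.slice (D.point v) = v := by
    funext i j
    simp only [slice, hp, hq]
    simp [point, i.2.1, i.2.2]
  simp [homogExt, hp, hq, hs]

/-- The defining property of the modified Hecke operator determines it. -/
theorem IsModifiedHecke.unique [DecidableEq ι] {x : ℂ} {T T' : D.HilbertSp →L[ℂ] D.HilbertSp}
    (h : D.IsModifiedHecke x T) (h' : D.IsModifiedHecke x T') : T = T' := by
  ext1 f
  apply Lp.ext
  filter_upwards [h f, h' f] with v hv hv'
  have h1 := (hv 1 0 one_ne_zero).2.trans (hv' 1 0 one_ne_zero).2.symm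
  simpa only [homogExt_affine D _ one_ne_zero, homogExt_point, norm_one, one_pow, inv_one,
    Complex.ofReal_one, one_mul] using h1

end RamificationData

end WildHecke

end

open MeasureTheory PowerSeries

noncomputable section

namespace WildHecke

open Filter Topology Set

set_option linter.unusedSectionVars false

section TotalVariation

variable {P E F : Type*} [NormedAddCommGroup P] [NormedSpace ℝ P] [FiniteDimensional ℝ P]
  [NormedAddCommGroup E] [NormedSpace ℝ E] [FiniteDimensional ℝ E]
  [NormedAddCommGroup F] [NormedSpace ℝ F] [FiniteDimensional ℝ F]

variable {Φ : P × E → F} {p₀ : P}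

/-- Near a point where `Φ (p₀, ·)` is a submersion, the maps `Φ (p, ·)` arise from `Φ (p₀, ·)` by
reparametrizations close to the identity. -/
theorem exists_reparametrization (hΦ : ContDiff ℝ 1 Φ) {s₀ : E}
    (hs : (fderiv ℝ (fun s => Φ (p₀, s)) s₀).range = ⊤) :
    ∃ ψ : P × E → E, ContDiffAt ℝ 1 ψ (p₀, s₀) ∧ (∀ᶠ t in 𝓝 s₀, ψ (p₀, t) = t) ∧
      (∀ᶠ q in 𝓝 (p₀, s₀), Φ (q.1, ψ q) = Φ (p₀, q.2)) ∧
      ∃ B ∈ 𝓝 s₀, ∀ᶠ p in 𝓝 p₀, InjOn (fun t => ψ (p, t)) B := by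
  set A := fderiv ℝ (fun s => Φ (p₀, s)) s₀ with hA
  obtain ⟨L, hL⟩ := A.ker.exists_isCompl.imp fun q hq => hq
  obtain ⟨pr, hpr⟩ : ∃ pr : E →L[ℝ] A.ker, ∀ x : A.ker, pr x = x := by
    obtain ⟨f, hf⟩ := (A.ker.subtype).exists_leftInverse_of_injective (by simp)
    exact ⟨f.toContinuousLinearMap, fun x => LinearMap.congr_fun hf x⟩
  have hbij : Function.Bijective (A.prod pr) := by
    constructor
    · rw [injective_iff_map_eq_zero]
      intro x hx
      have h1 : A x = 0 := congrArg Prod.fst hx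
      have h2 : pr x = 0 := congrArg Prod.snd hx
      have := hpr ⟨x, h1⟩
      rw [h2] at this
      exact (congrArg Subtype.val this).symm
    · rintro ⟨y, w⟩
      have : y ∈ A.range := by rw [hs]; trivial
      obtain ⟨x, hx⟩ := this
      refine ⟨x + ((w - pr x : A.ker) : E), ?_⟩
      have h0 : A ((w - pr x : A.ker) : E) = 0 := (w - pr x).2
      have h1 := hpr (w - pr x)
      have hx' : A x = y := hx
      ext
      · show A (x + _) = y
        rw [map_add, h0, add_zero, hx']
      · show ((pr (x + _) : A.ker) : E) = w
        rw [map_add, h1]; simp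
  have hfs : ContDiff ℝ 1 (fun s => Φ (p₀, s)) := by fun_prop
  have hdA : HasStrictFDerivAt (fun s => Φ (p₀, s)) A s₀ :=
    hfs.contDiffAt.hasStrictFDerivAt one_ne_zero
  let e : E ≃L[ℝ] F × A.ker :=
    (LinearEquiv.ofBijective (A.prod pr).toLinearMap hbij).toContinuousLinearEquiv
  have he : (e : E →L[ℝ] F × A.ker) = A.prod pr := by ext x <;> rfl
  let f : (P × E) × E → F × A.ker := fun v => (Φ (v.1.1, v.2) - Φ (p₀, v.1.2), pr v.2 - pr v.1.2)
  have hf : ContDiff ℝ 1 f := by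
    refine ContDiff.prodMk ?_ ?_
    · fun_prop
    · fun_prop
  have hf0 : f ((p₀, s₀), s₀) = 0 := by simp [f]
  have hd : fderiv ℝ f ((p₀, s₀), s₀) ∘L .inr ℝ (P × E) E = A.prod pr := by
    have h1 : HasFDerivAt f (fderiv ℝ f ((p₀, s₀), s₀)) ((p₀, s₀), s₀) :=
      (hf.differentiable one_ne_zero _).hasFDerivAt
    have h2 : HasFDerivAt (fun s : E => (((p₀, s₀), s) : (P × E) × E)) (.inr ℝ (P × E) E) s₀ :=
      hasFDerivAt_prodMk_right _ _
    have h3 := h1.comp s₀ h2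
    have h4 : HasFDerivAt (f ∘ fun s : E => (((p₀, s₀), s) : (P × E) × E)) (A.prod pr) s₀ := by
      have := (hdA.hasFDerivAt.sub_const (Φ (p₀, s₀))).prodMk (pr.hasFDerivAt.sub_const (pr s₀))
      exact this
    exact h3.unique h4
  have hinv : (fderiv ℝ f ((p₀, s₀), s₀) ∘L .inr ℝ (P × E) E).IsInvertible := by
    rw [hd, ← he]; exact ⟨e, rfl⟩
  have cdf : ContDiffAt ℝ 1 f ((p₀, s₀), s₀) := hf.contDiffAt
  refine ⟨cdf.implicitFunction one_ne_zero hinv, cdf.contDiffAt_implicitFunction _ _, ?_, ?_, ?_⟩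
  · have := cdf.eventually_apply_eq_iff_implicitFunction one_ne_zero hinv
    have ht : Tendsto (fun t : E => (((p₀, t), t) : (P × E) × E)) (𝓝 s₀) (𝓝 ((p₀, s₀), s₀)) := by
      refine Continuous.tendsto (by fun_prop) _
    filter_upwards [ht.eventually this] with t ht
    refine ht.1 ?_
    rw [hf0]; simp [f]
  · filter_upwards [cdf.eventually_apply_implicitFunction one_ne_zero hinv] with q hq
    rw [hf0] at hq
    exact sub_eq_zero.1 (congrArg Prod.fst hq)
  · have hst : HasStrictFDerivAt (fun s => (Φ (p₀, s), pr s)) (e : E →L[ℝ] F × A.ker) s₀ := by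
      rw [he]; exact hdA.prodMk pr.hasStrictFDerivAt
    obtain ⟨B, hB, hinj⟩ : ∃ B ∈ 𝓝 s₀, InjOn (fun s => (Φ (p₀, s), pr s)) B := by
      refine ⟨(hst.toOpenPartialHomeomorph _).source,
        (hst.toOpenPartialHomeomorph _).open_source.mem_nhds hst.mem_toOpenPartialHomeomorph_source,
        ?_⟩
      exact (hst.toOpenPartialHomeomorph _).injOn
    have := cdf.eventually_apply_implicitFunction one_ne_zero hinv
    rw [nhds_prod_eq, eventually_prod_iff] at this
    obtain ⟨pa, hpa, pb, hpb, h⟩ := this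
    refine ⟨B ∩ {t | pb t}, inter_mem hB hpb, ?_⟩
    filter_upwards [hpa] with p hp
    intro t ht t' ht' htt
    have h1 := h hp ht.2
    have h2 := h hp ht'.2
    simp only at htt
    rw [hf0] at h1 h2
    refine hinj ht.1 ht'.1 ?_
    have h11 := congrArg Prod.fst h1
    have h12 := congrArg Prod.snd h1
    have h21 := congrArg Prod.fst h2
    have h22 := congrArg Prod.snd h2
    simp only [f, Prod.fst_zero, Prod.snd_zero, sub_eq_zero] at h11 h12 h21 h22
    rw [htt] at h11 h12
    simp only [Prod.mk.injEq]
    exact ⟨h11.symm.trans h21, h12.symm.trans h22⟩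

variable [MeasurableSpace E] [BorelSpace E] (μ : Measure E) [μ.IsAddHaarMeasure]
  [MeasurableSpace F] [BorelSpace F]

/-- The images of the complex measure `k μ` under the maps `Φ (p, ·)` depend continuously on `p` at
`p₀`, in total variation. -/
def PushforwardContinuousAt (Φ : P × E → F) (p₀ : P) (k : E → ℂ) : Prop :=
  ∀ ε > 0, ∀ᶠ p in 𝓝 p₀, ∀ m : F → ℂ, Measurable m → (∀ y, ‖m y‖ ≤ 1) →
    ‖(∫ s, k s * m (Φ (p, s)) ∂μ) - ∫ s, k s * m (Φ (p₀, s)) ∂μ‖ ≤ ε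

variable {μ}

theorem integrable_mul_comp (hΦ : Continuous Φ) {k : E → ℂ} (hk : Integrable k μ) {m : F → ℂ}
    (hm : Measurable m) (hm1 : ∀ y, ‖m y‖ ≤ 1) (p : P) :
    Integrable (fun s => k s * m (Φ (p, s))) μ := by
  have h : Continuous fun s => Φ (p, s) := by fun_prop
  refine hk.mul_bdd (c := 1) (hm.comp h.measurable).aestronglyMeasurable ?_
  exact Eventually.of_forall fun s => hm1 _

theorem PushforwardContinuousAt.add {k k' : E → ℂ} (hΦ : Continuous Φ)
    (hk : Integrable k μ) (hk' : Integrable k' μ)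
    (h : PushforwardContinuousAt μ Φ p₀ k) (h' : PushforwardContinuousAt μ Φ p₀ k') :
    PushforwardContinuousAt μ Φ p₀ (k + k') := by
  intro ε hε
  filter_upwards [h (ε / 2) (by positivity), h' (ε / 2) (by positivity)] with p h1 h2 m hm hm1
  have e : ∀ p, ∫ s, (k + k') s * m (Φ (p, s)) ∂μ
      = (∫ s, k s * m (Φ (p, s)) ∂μ) + ∫ s, k' s * m (Φ (p, s)) ∂μ := by
    intro p
    rw [← integral_add (integrable_mul_comp hΦ hk hm hm1 p) (integrable_mul_comp hΦ hk' hm hm1 p)]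
    simp [add_mul]
  rw [e, e, add_sub_add_comm]
  refine (norm_add_le _ _).trans ?_
  linarith [h1 m hm hm1, h2 m hm hm1]

/-- The class of weights is closed under approximation in `L¹`. -/
theorem PushforwardContinuousAt.of_approx {k : E → ℂ} (hΦ : Continuous Φ) (hk : Integrable k μ)
    (h : ∀ ε > 0, ∃ k', Integrable k' μ ∧ PushforwardContinuousAt μ Φ p₀ k' ∧
      ∫ s, ‖k s - k' s‖ ∂μ ≤ ε) :
    PushforwardContinuousAt μ Φ p₀ k := by
  intro ε hε
  obtain ⟨k', hk', hc, hle⟩ := h (ε / 3) (by positivity)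
  filter_upwards [hc (ε / 3) (by positivity)] with p h1 m hm hm1
  have e : ∀ p, ‖(∫ s, k s * m (Φ (p, s)) ∂μ) - ∫ s, k' s * m (Φ (p, s)) ∂μ‖ ≤ ε / 3 := by
    intro p
    rw [← integral_sub (integrable_mul_comp hΦ hk hm hm1 p) (integrable_mul_comp hΦ hk' hm hm1 p)]
    refine (norm_integral_le_integral_norm _).trans (le_trans ?_ hle)
    refine integral_mono_of_nonneg (Eventually.of_forall fun _ => norm_nonneg _)
      (hk.sub hk').norm (Eventually.of_forall fun s => ?_)
    simp only
    rw [← sub_mul, norm_mul]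
    exact mul_le_of_le_one_right (norm_nonneg _) (hm1 _)
  have e1 := e p
  have e2 := e p₀
  rw [norm_sub_rev] at e2
  have e3 := h1 m hm hm1
  set a := ∫ s, k s * m (Φ (p, s)) ∂μ
  set b := ∫ s, k' s * m (Φ (p, s)) ∂μ
  set c := ∫ s, k' s * m (Φ (p₀, s)) ∂μ
  set d := ∫ s, k s * m (Φ (p₀, s)) ∂μ
  calc ‖a - d‖ = ‖(a - b) + (b - c) + (c - d)‖ := by congr 1; ring
    _ ≤ ‖a - b‖ + ‖b - c‖ + ‖c - d‖ := norm_add₃_le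
    _ ≤ ε := by linarith

theorem pushforwardContinuousAt_of_continuous (hΦ : ContDiff ℝ 1 Φ) {s₀ : E}
    (hs : (fderiv ℝ (fun s => Φ (p₀, s)) s₀).range = ⊤) :
    ∃ V ∈ 𝓝 s₀, ∀ k : E → ℂ, Continuous k → HasCompactSupport k → Function.support k ⊆ V →
      PushforwardContinuousAt μ Φ p₀ k := by
  obtain ⟨ψ, hψ, hψ0, hψΦ, B, hB, hinj⟩ := exists_reparametrization hΦ hs
  have hψ1 : ∀ᶠ q in 𝓝 (p₀, s₀), ContDiffAt ℝ 1 ψ q := hψ.eventually (by simp)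
  let D : P × E → (E →L[ℝ] E) := fun q => fderiv ℝ ψ q ∘L .inr ℝ P E
  have hD : ∀ q, ContDiffAt ℝ 1 ψ q → ContinuousAt D q := fun q hq => by
    have : ContinuousAt (fderiv ℝ ψ) q := (hq.fderiv_right (m := 0) (by simp)).continuousAt
    exact this.clm_comp continuousAt_const
  have hdet : ∀ q, ContDiffAt ℝ 1 ψ q → ContinuousAt (fun q => |(D q).det|) q := fun q hq =>
    (ContinuousLinearMap.continuous_det.continuousAt.comp (hD q hq)).abs
  obtain ⟨C, hC⟩ : ∃ C : ℝ, ∀ᶠ q in 𝓝 (p₀, s₀), |(D q).det| ≤ C :=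
    ⟨|(D (p₀, s₀)).det| + 1, (hdet _ hψ).eventually_le_const (by simp)⟩
  obtain ⟨pa, hpa, pb, hpb, hall⟩ := eventually_prod_iff.1
    (nhds_prod_eq (x := p₀) (y := s₀) ▸ (hψΦ.and (hψ1.and hC)))
  obtain ⟨r, hr, hball⟩ := Metric.mem_nhds_iff.1 (inter_mem hB (inter_mem hpb (eventually_eventually_nhds.2 hψ0)))
  set V := Metric.ball s₀ r with hV
  have hVo : IsOpen V := Metric.isOpen_ball
  refine ⟨V, Metric.ball_mem_nhds _ hr, fun k hk hkc hkV ε hε => ?_⟩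
  have hkint : Integrable k μ := hk.integrable_of_hasCompactSupport hkc
  obtain ⟨K, hK⟩ := hk.bounded_above_of_compact_support hkc
  have hKnn : 0 ≤ K := (norm_nonneg _).trans (hK s₀)
  have hCnn : 0 ≤ C := (abs_nonneg _).trans hC.self_of_nhds
  have hder : ∀ p, pa p → ∀ t ∈ V, HasFDerivWithinAt (fun t => ψ (p, t)) (D (p, t)) V t := by
    intro p hp t ht
    have h1 := (hall hp (hball ht).2.1).2.1
    have h2 : HasFDerivAt ψ (fderiv ℝ ψ (p, t)) (p, t) :=
      (h1.differentiableAt one_ne_zero).hasFDerivAt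
    exact (h2.comp t (hasFDerivAt_prodMk_right p t)).hasFDerivWithinAt
  have hlim : Tendsto (fun p => ∫ t in V, ‖|(D (p, t)).det| • k (ψ (p, t)) - k t‖ ∂μ) (𝓝 p₀)
      (𝓝 (∫ t in V, (0 : ℝ) ∂μ)) := by
    refine tendsto_integral_filter_of_dominated_convergence (fun _ => C * K + K) ?_ ?_ ?_ ?_
    · filter_upwards [hpa] with p hp
      refine ContinuousOn.aestronglyMeasurable ?_ hVo.measurableSet
      intro t ht
      have h1 := (hall hp (hball ht).2.1).2.1
      have hpt : ContinuousAt (fun t : E => (p, t)) t := by fun_prop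
      have h2 : ContinuousAt (fun t => |(D (p, t)).det|) t :=
        ContinuousAt.comp (f := fun t : E => (p, t)) (g := fun q => |(D q).det|) (hdet _ h1) hpt
      have h3 : ContinuousAt (fun t => k (ψ (p, t))) t :=
        hk.continuousAt.comp (ContinuousAt.comp (f := fun t : E => (p, t)) h1.continuousAt hpt)
      exact ((h2.smul h3).sub hk.continuousAt).norm.continuousWithinAt
    · filter_upwards [hpa] with p hp
      refine (ae_restrict_iff' hVo.measurableSet).2 (Eventually.of_forall fun t ht => ?_)
      have h1 := (hall hp (hball ht).2.1).2.2
      rw [norm_norm]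
      refine (norm_sub_le _ _).trans (add_le_add ?_ (hK t))
      rw [norm_smul, Real.norm_eq_abs, abs_abs]
      exact mul_le_mul h1 (hK _) (norm_nonneg _) hCnn
    · exact integrableOn_const (measure_ball_lt_top.ne)
    · refine (ae_restrict_iff' hVo.measurableSet).2 (Eventually.of_forall fun t ht => ?_)
      have hp0 : pa p₀ := hpa.self_of_nhds
      have h1 := (hall hp0 (hball ht).2.1).2.1
      have hpt : ContinuousAt (fun p : P => (p, t)) p₀ := by fun_prop
      have h2 : ContinuousAt (fun p => |(D (p, t)).det|) p₀ :=
        ContinuousAt.comp (f := fun p : P => (p, t)) (g := fun q => |(D q).det|) (hdet _ h1) hpt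
      have h3 : ContinuousAt (fun p => k (ψ (p, t))) p₀ :=
        hk.continuousAt.comp (ContinuousAt.comp (f := fun p : P => (p, t)) h1.continuousAt hpt)
      have h4 : ContinuousAt (fun p => ‖|(D (p, t)).det| • k (ψ (p, t)) - k t‖) p₀ :=
        ((h2.smul h3).sub continuousAt_const).norm
      have hid : ∀ᶠ t' in 𝓝 t, ψ (p₀, t') = t' := (hball ht).2.2
      have hDid : D (p₀, t) = ContinuousLinearMap.id ℝ E := by
        have h5 := ((hder p₀ hp0 t ht).hasFDerivAt (hVo.mem_nhds ht))
        refine h5.unique ((hasFDerivAt_id t).congr_of_eventuallyEq ?_)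
        filter_upwards [hid] with t' ht' using ht'
      have h6 : ‖|(D (p₀, t)).det| • k (ψ (p₀, t)) - k t‖ = 0 := by
        rw [hDid, hid.self_of_nhds]; simp [ContinuousLinearMap.det]
      have h7 := h4.tendsto
      rwa [h6] at h7
  rw [integral_zero] at hlim
  filter_upwards [hlim.eventually_le_const (show (0 : ℝ) < ε / 2 by positivity), hpa, hinj]
    with p hpε hp hpinj m hm hm1
  have hinjV : InjOn (fun t => ψ (p, t)) V := hpinj.mono fun t ht => (hball ht).1
  set W := (fun t => ψ (p, t)) '' V with hW
  have hWm : MeasurableSet W :=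
    measurable_image_of_fderivWithin hVo.measurableSet (hder p hp) hinjV
  have hcv : ∀ g : E → ℂ, ∫ s in W, g s ∂μ = ∫ t in V, |(D (p, t)).det| • g (ψ (p, t)) ∂μ :=
    fun g => integral_image_eq_integral_abs_det_fderiv_smul μ hVo.measurableSet (hder p hp) hinjV g
  have hcv' : ∀ g : E → ℝ, ∫ s in W, g s ∂μ = ∫ t in V, |(D (p, t)).det| • g (ψ (p, t)) ∂μ :=
    fun g => integral_image_eq_integral_abs_det_fderiv_smul μ hVo.measurableSet (hder p hp) hinjV g
  have hi1 : IntegrableOn (fun t => |(D (p, t)).det| • k (ψ (p, t))) V μ :=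
    (integrableOn_image_iff_integrableOn_abs_det_fderiv_smul μ hVo.measurableSet (hder p hp)
      hinjV k).1 hkint.integrableOn
  have hm0 : AEStronglyMeasurable (fun t => m (Φ (p₀, t))) (μ.restrict V) :=
    (hm.comp (hΦ.continuous.comp (by fun_prop : Continuous fun t : E => (p₀, t))).measurable
      ).aestronglyMeasurable
  have hkV0 : ∀ t ∉ V, k t = 0 := fun t ht => by
    by_contra h; exact ht (hkV h)
  have e0 : ∫ s, k s * m (Φ (p₀, s)) ∂μ = ∫ t in V, k t * m (Φ (p₀, t)) ∂μ := by
    rw [setIntegral_eq_integral_of_forall_compl_eq_zero]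
    intro t ht; rw [hkV0 t ht, zero_mul]
  have e0' : ∫ s, ‖k s‖ ∂μ = ∫ t in V, ‖k t‖ ∂μ := by
    rw [setIntegral_eq_integral_of_forall_compl_eq_zero]
    intro t ht; rw [hkV0 t ht, norm_zero]
  have hΦeq : ∀ t ∈ V, Φ (p, ψ (p, t)) = Φ (p₀, t) := fun t ht => (hall hp (hball ht).2.1).1
  have e1 : ∫ s in W, k s * m (Φ (p, s)) ∂μ
      = ∫ t in V, (|(D (p, t)).det| • k (ψ (p, t))) * m (Φ (p₀, t)) ∂μ := by
    rw [hcv]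
    refine setIntegral_congr_fun hVo.measurableSet fun t ht => ?_
    rw [hΦeq t ht, smul_mul_assoc]
  have hdiff : ‖(∫ s in W, k s * m (Φ (p, s)) ∂μ) - ∫ s, k s * m (Φ (p₀, s)) ∂μ‖ ≤ ε / 2 := by
    rw [e0, e1, ← integral_sub]
    · refine (norm_integral_le_integral_norm _).trans (le_trans ?_ hpε)
      refine integral_mono_of_nonneg (Eventually.of_forall fun _ => norm_nonneg _)
        (hi1.sub hkint.integrableOn).norm (Eventually.of_forall fun s => ?_)
      simp only
      rw [← sub_mul, norm_mul]
      exact mul_le_of_le_one_right (norm_nonneg _) (hm1 _)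
    · exact hi1.mul_bdd (c := 1) hm0 (Eventually.of_forall fun s => hm1 _)
    · exact hkint.integrableOn.mul_bdd (c := 1) hm0 (Eventually.of_forall fun s => hm1 _)
  have hcompl : ‖∫ s in Wᶜ, k s * m (Φ (p, s)) ∂μ‖ ≤ ε / 2 := by
    have h1 : ‖∫ s in Wᶜ, k s * m (Φ (p, s)) ∂μ‖ ≤ ∫ s in Wᶜ, ‖k s‖ ∂μ := by
      refine (norm_integral_le_integral_norm _).trans ?_
      refine integral_mono_of_nonneg (Eventually.of_forall fun _ => norm_nonneg _)
        hkint.norm.integrableOn (Eventually.of_forall fun s => ?_)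
      simp only
      rw [norm_mul]
      exact mul_le_of_le_one_right (norm_nonneg _) (hm1 _)
    have h2 := integral_add_compl hWm hkint.norm
    have h3 : (∫ t in V, ‖k t‖ ∂μ) - ∫ s in W, ‖k s‖ ∂μ ≤ ε / 2 := by
      rw [hcv', ← integral_sub hkint.norm.integrableOn]
      · refine le_trans (integral_mono_ae ?_ ?_ (Eventually.of_forall fun t => ?_)) hpε
        · exact hkint.norm.integrableOn.sub (by simpa [norm_smul, IntegrableOn] using hi1.norm)
        · exact (hi1.sub hkint.integrableOn).norm
        · simp only
          have := norm_sub_norm_le (k t) (|(D (p, t)).det| • k (ψ (p, t)))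
          rw [norm_smul, Real.norm_eq_abs, abs_abs, norm_sub_rev] at this
          simpa using this
      · simpa [norm_smul, IntegrableOn] using hi1.norm
    linarith
  have hsplit := integral_add_compl hWm (integrable_mul_comp hΦ.continuous hkint hm hm1 p)
  rw [← hsplit, add_sub_right_comm]
  refine (norm_add_le _ _).trans ?_
  linarith

/-- Localization of weights to a neighbourhood of a point of submersion. -/
theorem exists_nhds_pushforwardContinuousAt (hΦ : ContDiff ℝ 1 Φ) {s₀ : E}
    (hs : (fderiv ℝ (fun s => Φ (p₀, s)) s₀).range = ⊤) :
    ∃ U, IsOpen U ∧ s₀ ∈ U ∧ ∀ k : E → ℂ, Integrable k μ → (∀ s ∉ U, k s = 0) →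
      PushforwardContinuousAt μ Φ p₀ k := by
  obtain ⟨V, hV, h⟩ := pushforwardContinuousAt_of_continuous (μ := μ) hΦ hs
  obtain ⟨r, hr, hrV⟩ := Metric.mem_nhds_iff.1 hV
  let b : ContDiffBump s₀ := ⟨r / 4, r / 2, by positivity, by linarith⟩
  refine ⟨Metric.ball s₀ (r / 4), Metric.isOpen_ball, Metric.mem_ball_self (by positivity),
    fun k hk hk0 => ?_⟩
  refine PushforwardContinuousAt.of_approx hΦ.continuous hk fun ε hε => ?_
  obtain ⟨k', hk'c, hk'ε, hk', hk'i⟩ := hk.exists_hasCompactSupport_integral_sub_le hε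
  have hbc : Continuous b := b.continuous
  refine ⟨fun s => (b s : ℂ) * k' s, ?_, ?_, ?_⟩
  · refine Continuous.integrable_of_hasCompactSupport (by fun_prop) hk'c.mul_left
  · refine h _ (by fun_prop) hk'c.mul_left fun s hs => hrV ?_
    have h1 : b s ≠ 0 := by
      intro h0; apply hs; simp [h0]
    have h2 : s ∈ Function.support b := h1
    rw [b.support_eq] at h2
    exact Metric.ball_subset_ball (by simp [b]; linarith) h2
  · refine (integral_mono_of_nonneg (Eventually.of_forall fun _ => norm_nonneg _)
      (hk.sub hk'i).norm (Eventually.of_forall fun s => ?_)).trans hk'ε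
    simp only
    have h1 : k s = (b s : ℂ) * k s := by
      by_cases hsb : s ∈ Metric.ball s₀ (r / 4)
      · rw [b.one_of_mem_closedBall (Metric.ball_subset_closedBall hsb)]; simp
      · rw [hk0 s hsb, mul_zero]
    have h2 : k s - (b s : ℂ) * k' s = (b s : ℂ) * (k s - k' s) := by rw [mul_sub, ← h1]
    rw [h2, norm_mul]
    refine mul_le_of_le_one_left (norm_nonneg _) ?_
    rw [Complex.norm_real, Real.norm_eq_abs, abs_of_nonneg b.nonneg]
    exact b.le_one

/-- If `Φ (p₀, ·)` is a submersion almost everywhere, then the images of a finite complex measure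
`k μ` under the maps `Φ (p, ·)` depend continuously on `p` at `p₀`, in total variation. -/
theorem pushforwardContinuousAt_of_ae_submersion (hΦ : ContDiff ℝ 1 Φ)
    (hs : ∀ᵐ s ∂μ, (fderiv ℝ (fun s => Φ (p₀, s)) s).range = ⊤) {k : E → ℂ}
    (hk : Integrable k μ) : PushforwardContinuousAt μ Φ p₀ k := by
  set G := {s | (fderiv ℝ (fun s => Φ (p₀, s)) s).range = ⊤} with hG
  choose! U hUo hUs hU using fun (s : E) (h : s ∈ G) =>
    exists_nhds_pushforwardContinuousAt (μ := μ) hΦ h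
  obtain ⟨T, hTG, hTc, hTU⟩ := TopologicalSpace.countable_cover_nhdsWithin
    (s := G) (f := U) fun s h => mem_nhdsWithin_of_mem_nhds ((hUo s h).mem_nhds (hUs s h))
  rcases T.eq_empty_or_nonempty with hT | hT
  · have h0 : k =ᵐ[μ] 0 := by
      filter_upwards [hs] with s h
      have := hTU h
      simp [hT] at this
    intro ε hε
    refine Eventually.of_forall fun p m hm hm1 => ?_
    have : ∀ p, ∫ s, k s * m (Φ (p, s)) ∂μ = 0 := fun p => by
      rw [← integral_zero E ℂ (μ := μ)]
      refine integral_congr_ae ?_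
      filter_upwards [h0] with s h using by simp [h]
    rw [this, this]; simpa using hε.le
  obtain ⟨f, hf⟩ := hTc.exists_eq_range hT
  have hfG : ∀ n, f n ∈ G := fun n => hTG (hf ▸ mem_range_self n)
  let A : ℕ → Set E := fun n => ⋃ i < n, U (f i)
  have hAm : ∀ n, MeasurableSet (A n) := fun n =>
    MeasurableSet.biUnion (to_countable _) fun i _ => (hUo _ (hfG i)).measurableSet
  have hA : ∀ n, PushforwardContinuousAt μ Φ p₀ ((A n).indicator k) := by
    intro n
    induction n with
    | zero =>
      intro ε hε
      refine Eventually.of_forall fun p m hm hm1 => ?_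
      simp [A, hε.le]
    | succ n ih =>
      have hAs : A (n + 1) = A n ∪ (U (f n) \ A n) := by
        rw [union_sdiff_self]; simp only [A]; rw [biUnion_lt_succ]
      rw [hAs, indicator_union_of_disjoint disjoint_sdiff_self_right]
      refine PushforwardContinuousAt.add hΦ.continuous (hk.indicator (hAm n))
        (hk.indicator ((hUo _ (hfG n)).measurableSet.diff (hAm n))) ih
        (hU _ (hfG n) _ (hk.indicator ((hUo _ (hfG n)).measurableSet.diff (hAm n))) ?_)
      intro s hs
      exact indicator_of_notMem (fun h => hs h.1) _
  refine PushforwardContinuousAt.of_approx hΦ.continuous hk fun ε hε => ?_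
  have hlim : Tendsto (fun n => ∫ s, ‖k s - (A n).indicator k s‖ ∂μ) atTop (𝓝 (∫ _, (0 : ℝ) ∂μ)) := by
    refine tendsto_integral_of_dominated_convergence (fun s => ‖k s‖) ?_ hk.norm ?_ ?_
    · exact fun n => (hk.sub (hk.indicator (hAm n))).norm.aestronglyMeasurable
    · refine fun n => Eventually.of_forall fun s => ?_
      by_cases h : s ∈ A n <;> simp [h]
    · filter_upwards [hs] with s h
      have h1 := hTU h
      rw [hf] at h1
      simp only [mem_iUnion, mem_range, exists_prop, exists_exists_eq_and] at h1
      obtain ⟨i, hi⟩ := h1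
      refine tendsto_const_nhds.congr' ?_
      filter_upwards [eventually_gt_atTop i] with n hn
      have : s ∈ A n := mem_biUnion (show i < n from hn) hi
      simp [this]
  rw [integral_zero] at hlim
  obtain ⟨n, hn⟩ := (hlim.eventually_le_const hε).exists
  exact ⟨_, hk.indicator (hAm n), hA n, hn⟩

end TotalVariation

section AnalyticNull

variable {E : Type*} [NormedAddCommGroup E] [NormedSpace ℝ E] [FiniteDimensional ℝ E]
  [MeasurableSpace E] [BorelSpace E] (μ : Measure E) [μ.IsAddHaarMeasure]

/-- An analytic function which does not vanish identically is nonzero almost everywhere. -/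
theorem ae_ne_zero_of_analytic {f : E → ℂ} (hf : AnalyticOnNhd ℝ f univ) {s₀ : E}
    (h0 : f s₀ ≠ 0) : ∀ᵐ s ∂μ, f s ≠ 0 := by
  have hfc : Continuous f := continuousOn_univ.1 hf.continuousOn
  have h1 : ∀ v : E, ∀ᵐ t : ℝ, f (s₀ + t • v) ≠ 0 := by
    intro v
    have ha : AnalyticOnNhd ℝ (fun t : ℝ => f (s₀ + t • v)) univ := by
      intro t _
      exact AnalyticAt.fun_comp (f := fun t : ℝ => s₀ + t • v) (hf _ trivial)
        (by fun_prop)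
    have h2 := ha.preimage_zero_mem_codiscrete (x := 0) (by simpa using h0)
    have h3 := ae_restrict_le_codiscreteWithin (μ := (volume : Measure ℝ)) MeasurableSet.univ
      (U := univ) h2
    rw [Measure.restrict_univ] at h3
    exact h3
  have h2 : ∀ᵐ v ∂μ, ∀ᵐ t : ℝ, f (s₀ + t • v) ≠ 0 := Eventually.of_forall h1
  rw [Measure.ae_ae_comm] at h2
  · obtain ⟨t, ht, ht0⟩ := (h2.and (Measure.ae_ne volume (0 : ℝ))).exists
    have h3 : μ ((fun v => t • v) ⁻¹' {v | f (s₀ + v) = 0}) = 0 := by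
      have := ae_iff.1 ht
      simpa using this
    rw [Measure.addHaar_preimage_smul μ ht0, mul_eq_zero] at h3
    have h4 : μ {v | f (s₀ + v) = 0} = 0 := by
      rcases h3 with h3 | h3
      · exfalso
        rw [ENNReal.ofReal_eq_zero] at h3
        have : 0 < |(t ^ Module.finrank ℝ E)⁻¹| := by positivity
        linarith
      · exact h3
    have h5 : {v | f (s₀ + v) = 0} = (fun v => s₀ + v) ⁻¹' {s | f s = 0} := rfl
    rw [h5, measure_preimage_add] at h4
    rw [ae_iff]
    simpa using h4
  · have : Continuous fun q : E × ℝ => f (s₀ + q.2 • q.1) := by fun_prop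
    exact (isOpen_ne.preimage this).measurableSet

end AnalyticNull

section CompactCriteria

variable {E F G : Type*} [NormedAddCommGroup E] [NormedSpace ℂ E] [NormedAddCommGroup F]
  [NormedSpace ℂ F] [CompleteSpace F] [NormedAddCommGroup G] [NormedSpace ℂ G]

/-- An operator which is dominated by finitely many compact operators up to small errors is
compact. -/
theorem isCompactOperator_of_norm_le {T : E →L[ℂ] F}
    (h : ∀ ε > 0, ∃ (n : ℕ) (S : Fin n → E →L[ℂ] G) (C : ℝ), (∀ i, IsCompactOperator (S i)) ∧
      ∀ x, ‖T x‖ ≤ C * ∑ i, ‖S i x‖ + ε * ‖x‖) : IsCompactOperator T := by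
  refine (isCompactOperator_iff_isCompact_closure_image_closedBall (T : E →ₗ[ℂ] F) one_pos).2 ?_
  refine (TotallyBounded.closure ?_).isCompact_of_isClosed isClosed_closure
  rw [Metric.totallyBounded_iff]
  intro δ hδ
  obtain ⟨n, S, C, hS, hle⟩ := h (δ / 8) (by positivity)
  have hK : TotallyBounded ((fun x => fun i => S i x) '' Metric.closedBall (0 : E) 1) := by
    choose K hKc hK using fun i => (hS i).image_closedBall_subset_compact 1
    refine (isCompact_univ_pi hKc).totallyBounded.subset ?_
    rintro _ ⟨x, hx, rfl⟩ i -
    exact hK i (mem_image_of_mem _ hx)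
  set η := δ / (4 * ((|C| + 1) * (n + 1))) with hη
  have hη0 : 0 < η := by positivity
  obtain ⟨t, ht, htf, hcov⟩ := Metric.finite_approx_of_totallyBounded hK η hη0
  choose! c hc hct using fun y (hy : y ∈ t) => ht hy
  refine ⟨(fun y => T (c y)) '' t, htf.image _, ?_⟩
  rintro _ ⟨x, hx, rfl⟩
  obtain ⟨y, hy, hxy⟩ := mem_iUnion₂.1 (hcov (mem_image_of_mem _ hx))
  refine mem_iUnion₂.2 ⟨_, mem_image_of_mem _ hy, ?_⟩
  rw [Metric.mem_ball, dist_eq_norm]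
  show ‖T x - T (c y)‖ < δ
  rw [← map_sub]
  refine (hle _).trans_lt ?_
  have h1 : ‖x - c y‖ ≤ 2 := by
    have h2 := hc y hy
    rw [mem_closedBall_zero_iff] at h2 hx
    linarith [norm_sub_le x (c y)]
  have h2 : ∀ i, ‖S i (x - c y)‖ ≤ η := by
    intro i
    rw [Metric.mem_ball, ← hct y hy, dist_pi_lt_iff hη0] at hxy
    have := hxy i
    rw [dist_eq_norm, ← map_sub] at this
    exact this.le
  have h3 : ∑ i, ‖S i (x - c y)‖ ≤ n * η := by
    refine (Finset.sum_le_sum fun i _ => h2 i).trans ?_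
    simp
  have h4 : C * ∑ i, ‖S i (x - c y)‖ ≤ (|C| + 1) * ((n + 1) * η) := by
    have : 0 ≤ ∑ i, ‖S i (x - c y)‖ := Finset.sum_nonneg fun _ _ => norm_nonneg _
    have h5 : C ≤ |C| + 1 := by linarith [le_abs_self C]
    refine mul_le_mul h5 (h3.trans (by nlinarith)) this (by positivity)
  have h5 : (|C| + 1) * ((n + 1) * η) = δ / 4 := by
    rw [hη]; field_simp
  nlinarith

theorem isCompactOperator_of_norm_sq_le {T : E →L[ℂ] F} {S : E →L[ℂ] G} (hS : IsCompactOperator S)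
    {C : ℝ} (hC : 0 ≤ C) (h : ∀ x, ‖T x‖ ^ 2 ≤ C * ‖S x‖ * ‖x‖) : IsCompactOperator T := by
  refine isCompactOperator_of_norm_le (G := G) fun ε hε => ⟨1, fun _ => S, C / ε, fun _ => hS, fun x => ?_⟩
  simp only [Finset.univ_unique, Finset.sum_const, Finset.card_singleton, one_smul]
  refine abs_le_of_sq_le_sq' ?_ (by positivity) |>.2
  refine (h x).trans ?_
  have h1 : 0 ≤ C / ε * ‖S x‖ := by positivity
  have h2 : 0 ≤ ε * ‖x‖ := by positivity
  have h3 : C * ‖S x‖ * ‖x‖ = (C / ε * ‖S x‖) * (ε * ‖x‖) := by field_simp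
  rw [h3]; nlinarith

end CompactCriteria

section Hilbert

variable {H E : Type*} [NormedAddCommGroup H] [InnerProductSpace ℂ H] [CompleteSpace H]
  [NormedAddCommGroup E] [NormedSpace ℂ E]

open ContinuousLinearMap

theorem norm_sq_le_of_normal {A : H →L[ℂ] H} (hA : ∀ x, ‖adjoint A x‖ = ‖A x‖) (y : H) :
    ‖A y‖ ^ 2 ≤ ‖A (A y)‖ * ‖y‖ := by
  rw [← hA (A y)]
  have h : ((‖A y‖ ^ 2 : ℝ) : ℂ) = inner ℂ (adjoint A (A y)) y := by
    rw [adjoint_inner_left, inner_self_eq_norm_sq_to_K]; push_cast; rfl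
  have h2 := norm_inner_le_norm (𝕜 := ℂ) (adjoint A (A y)) y
  rw [← h, Complex.norm_real, Real.norm_of_nonneg (by positivity)] at h2
  exact h2

/-- Powers of normal operators can be cancelled in compactness statements. -/
theorem isCompactOperator_of_normal {A : H →L[ℂ] H} (hA : ∀ x, ‖adjoint A x‖ = ‖A x‖)
    {V : E →L[ℂ] H} {n : ℕ} (h : IsCompactOperator ((A ^ (n + 1)) ∘L V)) :
    IsCompactOperator (A ∘L V) := by
  induction n with
  | zero => simpa using h
  | succ n ih =>
    apply ih
    refine isCompactOperator_of_norm_sq_le h (C := ‖(A ^ n) ∘L V‖) (norm_nonneg _) fun x => ?_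
    have h1 : (A ^ (n + 1)) (V x) = A ((A ^ n) (V x)) := by rw [pow_succ']; rfl
    have h2 : (A ^ (n + 1 + 1)) (V x) = A (A ((A ^ n) (V x))) := by
      rw [pow_succ', pow_succ']; rfl
    simp only [comp_apply]
    rw [h1, h2]
    refine (norm_sq_le_of_normal hA _).trans ?_
    have := ((A ^ n) ∘L V).le_opNorm x
    simp only [comp_apply] at this
    nlinarith [norm_nonneg (A (A ((A ^ n) (V x)))), mul_le_mul_of_nonneg_left this (norm_nonneg (A (A ((A ^ n) (V x)))))]

theorem norm_adjoint_apply_of_eq_smul {T : H →L[ℂ] H} {c : ℂ} (hc : ‖c‖ = 1)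
    (h : adjoint T = c • T) (x : H) : ‖adjoint T x‖ = ‖T x‖ := by
  rw [h, smul_apply, norm_smul, hc, one_mul]

theorem isCompactOperator_of_pow {T : H →L[ℂ] H} {c : ℂ} (hc : ‖c‖ = 1)
    (h : adjoint T = c • T) {n : ℕ} (hn : IsCompactOperator ((T ^ (n + 1) : H →L[ℂ] H))) :
    IsCompactOperator T := by
  have := isCompactOperator_of_normal (norm_adjoint_apply_of_eq_smul hc h)
    (V := ContinuousLinearMap.id ℂ H) (n := n) (by simpa using hn)
  simpa using this

theorem continuousAt_of_continuousAt_words {X : Type*} [TopologicalSpace X] {T : X → H →L[ℂ] H}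
    {c : X → ℂ} {x₀ : X} (hc : ContinuousAt c x₀)
    (h : ∀ᶠ x in 𝓝 x₀, adjoint (T x) = c x • T x) {k : ℕ}
    (hw : ContinuousAt (fun y : Fin (2 * 2 ^ k) → X => (List.ofFn fun i => T (y i)).prod)
      fun _ => x₀) : ContinuousAt T x₀ := by
  set N := 2 * 2 ^ k with hN
  let word : List Bool → X → H →L[ℂ] H := fun w y =>
    (w.map fun b => if b then T y else T x₀).prod
  have hword : ∀ w : List Bool, w.length = N → Tendsto (word w) (𝓝 x₀) (𝓝 (T x₀ ^ N)) := by
    intro w hwN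
    have h1 : ∀ y, word w y = (List.ofFn fun i : Fin N =>
        T (if w.get (i.cast hwN.symm) then y else x₀)).prod := by
      intro y
      simp only [word]
      congr 1
      refine List.ext_get (by simp [hwN]) fun n h1 h2 => ?_
      simp only [List.get_eq_getElem, List.getElem_map, List.getElem_ofFn, Fin.cast_mk]
      split_ifs <;> rfl
    have h2 : Tendsto (fun y : X => fun i : Fin N => if w.get (i.cast hwN.symm) then y else x₀)
        (𝓝 x₀) (𝓝 fun _ => x₀) := by
      refine tendsto_pi_nhds.2 fun i => ?_
      split_ifs
      · exact tendsto_id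
      · exact tendsto_const_nhds
    have h3 := hw.tendsto.comp h2
    simp only [List.ofFn_const, List.prod_replicate] at h3
    exact h3.congr fun y => (h1 y).symm
  let α : Bool → X → ℂ := fun t y => if t then c y else 1
  have hα : ∀ t, Tendsto (α t) (𝓝 x₀) (𝓝 (α t x₀)) := by
    intro t
    cases t
    · simp [α]
    · simpa [α] using hc.tendsto
  let D : Bool → X → H →L[ℂ] H := fun t y => α t y • T y - α t x₀ • T x₀
  have key : ∀ e : List Bool, e ≠ [] → ∀ w : List Bool, w.length + e.length = N →
      Tendsto (fun y => word w y * (e.map fun t => D t y).prod) (𝓝 x₀) (𝓝 0) := by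
    intro e
    induction e with
    | nil => intro h; exact absurd rfl h
    | cons t e ih =>
      intro _ w hwl
      have hx : ∀ y, word w y * ((t :: e).map fun t => D t y).prod
          = α t y • (word (w ++ [true]) y * (e.map fun t => D t y).prod)
            - α t x₀ • (word (w ++ [false]) y * (e.map fun t => D t y).prod) := by
        intro y
        simp only [word, D, List.map_cons, List.prod_cons, List.map_append, List.map_nil,
          List.prod_append, List.prod_nil, mul_one, if_true, Bool.false_eq_true, if_false]
        simp only [mul_sub, sub_mul, mul_smul_comm, smul_mul_assoc, mul_assoc]
      rw [tendsto_congr hx]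
      rcases eq_or_ne e [] with rfl | he
      · have h1 := (hα t).smul (hword (w ++ [true]) (by simpa using hwl))
        have h2 := (hword (w ++ [false]) (by simpa using hwl)).const_smul (α t x₀)
        have h3 := h1.sub h2
        simpa using h3
      · have hl : ∀ b : Bool, (w ++ [b]).length + e.length = N := by
          intro b
          simp only [List.length_append, List.length_cons, List.length_nil] at hwl ⊢
          omega
        have h1 := (hα t).smul (ih he (w ++ [true]) (hl _))
        have h2 := (ih he (w ++ [false]) (hl _)).const_smul (α t x₀)
        have h3 := h1.sub h2
        simpa using h3
  have hpow : ∀ (a b : H →L[ℂ] H) (n : ℕ),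
      ((List.replicate n [true, false]).flatten.map fun t => if t then a else b).prod
        = (a * b) ^ n := by
    intro a b n
    induction n with
    | zero => simp
    | succ n ih =>
      rw [List.replicate_succ, List.flatten_cons, List.map_append, List.prod_append, ih, pow_succ']
      simp
  have hlen : ((List.replicate (2 ^ k) [true, false]).flatten).length = N := by
    simp [hN, mul_comm]
  have h1 := key ((List.replicate (2 ^ k) [true, false]).flatten)
    (by intro h; rw [h] at hlen; simp [hN] at hlen) [] (by simpa using hlen)
  have h2 : ∀ᶠ y in 𝓝 x₀, ‖T y - T x₀‖ ^ N
      = ‖word [] y * (((List.replicate (2 ^ k) [true, false]).flatten).map fun t => D t y).prod‖ := by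
    filter_upwards [h] with y hy
    have e1 : (fun t => D t y) = fun t : Bool => if t then adjoint (T y - T x₀) else T y - T x₀ := by
      funext t
      cases t
      · simp [D, α]
      · simp [D, α, hy, h.self_of_nhds]
    rw [e1, hpow]
    simp only [word, List.map_nil, List.prod_nil, one_mul]
    have hsa : IsSelfAdjoint (adjoint (T y - T x₀) * (T y - T x₀)) :=
      IsSelfAdjoint.star_mul_self _
    have e2 := hsa.nnnorm_pow_two_pow k
    have e3 : ‖adjoint (T y - T x₀) * (T y - T x₀)‖ = ‖T y - T x₀‖ * ‖T y - T x₀‖ :=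
      CStarRing.norm_star_mul_self
    have e4 : ‖(adjoint (T y - T x₀) * (T y - T x₀)) ^ 2 ^ k‖
        = ‖adjoint (T y - T x₀) * (T y - T x₀)‖ ^ 2 ^ k := congrArg NNReal.toReal e2
    rw [e4, e3, ← pow_two, ← pow_mul]
  have h3 : Tendsto (fun y => ‖T y - T x₀‖ ^ N) (𝓝 x₀) (𝓝 0) := by
    rw [tendsto_congr' h2]
    simpa using h1.norm
  have h4 : Tendsto (fun y => ‖T y - T x₀‖) (𝓝 x₀) (𝓝 0) := by
    have hN0 : N ≠ 0 := by simp [hN]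
    rw [Metric.tendsto_nhds] at h3 ⊢
    intro ε hε
    filter_upwards [h3 (ε ^ N) (by positivity)] with y hy
    rw [Real.dist_eq, sub_zero, abs_of_nonneg (by positivity)] at hy ⊢
    exact lt_of_pow_lt_pow_left₀ N hε.le hy
  exact tendsto_iff_norm_sub_tendsto_zero.2 h4

/-- A Hilbert–Schmidt operator is compact. -/
theorem isCompactOperator_of_sum_norm_sq_le {T : H →L[ℂ] E} [CompleteSpace E] {C : ℝ}
    (h : ∀ (w : Set H) (e : w → H), Orthonormal ℂ e → ∀ s : Finset w, ∑ i ∈ s, ‖T (e i)‖ ^ 2 ≤ C) :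
    IsCompactOperator T := by
  classical
  obtain ⟨w, b, hb⟩ := exists_hilbertBasis ℂ H
  have hsum : Summable fun i => ‖T (b i)‖ ^ 2 :=
    summable_of_sum_le (fun _ => by positivity) (h _ b b.orthonormal)
  refine isCompactOperator_of_norm_le (G := E) fun ε hε => ?_
  obtain ⟨s, hs⟩ := summable_iff_vanishing_norm.1 hsum (ε ^ 2) (by positivity)
  let S : H →L[ℂ] E := ∑ i ∈ s, (innerSL ℂ (b i)).smulRight (T (b i))
  have hSx : ∀ x, S x = ∑ i ∈ s, inner ℂ (b i) x • T (b i) := by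
    intro x; simp [S]
  refine ⟨1, fun _ => S, 1, fun _ => ?_, fun x => ?_⟩
  · refine Submodule.sum_mem (compactOperator (RingHom.id ℂ) H E) fun i _ => ?_
    have h1 : IsCompactOperator ((ContinuousLinearMap.id ℂ ℂ).smulRight (T (b i))) :=
      isCompactOperator_of_locallyCompactSpace_rng (_ : ℂ →L[ℂ] E)
    exact h1.comp_clm (innerSL ℂ (b i))
  · have h1 : ‖T x - S x‖ ≤ ε * ‖x‖ := by
      have hlim : Tendsto (fun t : Finset w => T (∑ i ∈ t, b.repr x i • b i) - S x) atTop
          (𝓝 (T x - S x)) :=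
        ((T.continuous.tendsto _).comp (b.hasSum_repr x)).sub_const _
      refine le_of_tendsto hlim.norm ?_
      filter_upwards [eventually_ge_atTop s] with t hst
      have e1 : T (∑ i ∈ t, b.repr x i • b i) - S x
          = ∑ i ∈ t \ s, inner ℂ (b i) x • T (b i) := by
        rw [hSx, map_sum, sub_eq_iff_eq_add, Finset.sum_sdiff hst]
        simp [b.repr_apply_apply]
      rw [e1]
      have e2 : ‖∑ i ∈ t \ s, inner ℂ (b i) x • T (b i)‖
          ≤ ∑ i ∈ t \ s, ‖inner ℂ (b i) x‖ * ‖T (b i)‖ :=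
        (norm_sum_le _ _).trans (Finset.sum_le_sum fun i _ => (norm_smul _ _).le)
      refine e2.trans ?_
      have e3 := Finset.sum_mul_sq_le_sq_mul_sq (t \ s) (fun i => ‖inner ℂ (b i) x‖)
        (fun i => ‖T (b i)‖)
      have e4 := b.orthonormal.sum_inner_products_le x (s := t \ s)
      have e5 := hs (t \ s) Finset.sdiff_disjoint
      rw [Real.norm_of_nonneg (Finset.sum_nonneg fun _ _ => by positivity)] at e5
      refine abs_le_of_sq_le_sq' (e3.trans ?_) (by positivity) |>.2
      rw [mul_pow, mul_comm]
      exact mul_le_mul e5.le e4 (Finset.sum_nonneg fun _ _ => by positivity) (by positivity)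
    simp only [Finset.univ_unique, Finset.sum_const, Finset.card_singleton, one_smul, one_mul]
    calc ‖T x‖ = ‖S x + (T x - S x)‖ := by congr 1; abel
      _ ≤ _ := (norm_add_le _ _).trans (by gcongr)

end Hilbert

section Kernel

variable {X : Type*} [MeasurableSpace X] {μ : Measure X} [SFinite μ]

/-- An integral operator with square-integrable kernel is compact. -/
theorem isCompactOperator_of_kernel {T : Lp ℂ 2 μ →L[ℂ] Lp ℂ 2 μ} {s : X → X → ℂ}
    (hs : Measurable (Function.uncurry s)) (hfin : ∫⁻ v, ∫⁻ y, ‖s v y‖ₑ ^ 2 ∂μ ∂μ ≠ ⊤)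
    (hT : ∀ f : Lp ℂ 2 μ, ∀ᵐ v ∂μ, T f v = ∫ y, s v y * f y ∂μ) : IsCompactOperator T := by
  refine isCompactOperator_of_sum_norm_sq_le (C := (∫⁻ v, ∫⁻ y, ‖s v y‖ₑ ^ 2 ∂μ ∂μ).toReal) ?_
  intro w e he F
  have hn : ∀ f : Lp ℂ 2 μ, ENNReal.ofReal (‖f‖ ^ 2) = ∫⁻ v, ‖f v‖ₑ ^ 2 ∂μ := by
    intro f
    rw [ENNReal.ofReal_pow (norm_nonneg _), Lp.norm_def, ENNReal.ofReal_toReal (Lp.eLpNorm_ne_top f),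
      eLpNorm_eq_lintegral_rpow_enorm_toReal (by norm_num) (by norm_num)]
    simp [← ENNReal.rpow_mul_natCast]
  rw [← ENNReal.ofReal_le_iff_le_toReal hfin,
    ENNReal.ofReal_sum_of_nonneg fun i _ => by positivity]
  simp only [hn]
  rw [← lintegral_finsetSum']
  · have hmeas : Measurable fun v => ∫⁻ y, ‖s v y‖ₑ ^ 2 ∂μ :=
      Measurable.lintegral_prod_right' (f := fun q : X × X => ‖s q.1 q.2‖ₑ ^ 2)
        (by exact hs.enorm.pow_const 2)
    refine lintegral_mono_ae ?_
    have hall : ∀ᵐ v ∂μ, ∀ i ∈ F, T (e i) v = ∫ y, s v y * e i y ∂μ :=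
      (Finset.eventually_all F).2 fun i _ => hT (e i)
    filter_upwards [hall, ae_lt_top hmeas hfin] with v hv hvt
    have hsv : Measurable (s v) := hs.of_uncurry_left
    have hg : MemLp (fun y => starRingEnd ℂ (s v y)) 2 μ := by
      refine ⟨(Complex.continuous_conj.measurable.comp hsv).aestronglyMeasurable, ?_⟩
      rw [eLpNorm_eq_lintegral_rpow_enorm_toReal (by norm_num) (by norm_num)]
      simp only [ENNReal.toReal_ofNat, ENNReal.rpow_ofNat, RCLike.enorm_conj]
      exact ENNReal.rpow_lt_top_of_nonneg (by norm_num) hvt.ne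
    have hin : ∀ i ∈ F, T (e i) v = inner ℂ (hg.toLp _) (e i) := by
      intro i hi
      rw [hv i hi, L2.inner_def]
      refine integral_congr_ae ?_
      filter_upwards [hg.coeFn_toLp] with y hy
      rw [hy]; simp [mul_comm]
    have hb := he.sum_inner_products_le (hg.toLp _) (s := F)
    have e1 : ∑ i ∈ F, ‖T (e i) v‖ₑ ^ 2
        = ENNReal.ofReal (∑ i ∈ F, ‖inner ℂ (e i) (hg.toLp _)‖ ^ 2) := by
      rw [ENNReal.ofReal_sum_of_nonneg fun i _ => by positivity]
      refine Finset.sum_congr rfl fun i hi => ?_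
      rw [hin i hi, ENNReal.ofReal_pow (norm_nonneg _), ofReal_norm, ← enorm_norm,
        norm_inner_symm, enorm_norm]
    rw [e1]
    refine (ENNReal.ofReal_le_ofReal hb).trans ?_
    rw [hn]
    refine le_of_eq (lintegral_congr_ae ?_)
    filter_upwards [hg.coeFn_toLp] with y hy
    rw [hy, RCLike.enorm_conj]
  · intro i _
    exact (Lp.aestronglyMeasurable _).enorm.pow_const 2

end Kernel

section Plancherel

open FourierTransform SchwartzMap in
/-- Plancherel's theorem for integrable and square-integrable functions. -/
theorem lintegral_enorm_sq_fourier {V : Type*} [NormedAddCommGroup V] [InnerProductSpace ℝ V]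
    [FiniteDimensional ℝ V] [MeasurableSpace V] [BorelSpace V] {u : V → ℂ}
    (h1 : Integrable u) (h2 : MemLp u 2) :
    ∫⁻ ζ, ‖𝓕 u ζ‖ₑ ^ 2 = ∫⁻ v, ‖u v‖ₑ ^ 2 := by
  have hcont : Continuous (𝓕 u) := by
    exact VectorFourier.fourierIntegral_continuous Real.continuous_fourierChar
      (L := innerₗ V) continuous_inner h1
  have hae : ∀ᵐ ζ, (𝓕 (h2.toLp u) : Lp ℂ 2 (volume : Measure V)) ζ = 𝓕 u ζ := by
    refine ae_eq_of_integral_contDiff_smul_eq ((Lp.memLp _).locallyIntegrable (by norm_num))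
      hcont.locallyIntegrable fun g hg hgc => ?_
    have hg₁ : HasCompactSupport (Complex.ofRealCLM ∘ g) := hgc.comp_left rfl
    have hg₂ : ContDiff ℝ (⊤ : ℕ∞) (Complex.ofRealCLM ∘ g) := by fun_prop
    let φ : 𝓢(V, ℂ) := hg₁.toSchwartzMap hg₂
    have e1 := congrArg (fun T => T φ) (Lp.fourier_toTemperedDistribution_eq (h2.toLp u))
    simp only [TemperedDistribution.fourier_apply, Lp.toTemperedDistribution_apply] at e1
    have e2 : ∀ x, φ x = (g x : ℂ) := fun x => rfl
    have e3 : ∀ (x : V) (z : ℂ), g x • z = φ x • z := by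
      intro x z; rw [e2]; simp
    simp only [e3]
    rw [← e1]
    have e4 : ∫ x, (𝓕 φ) x • (h2.toLp u) x = ∫ x, (𝓕 φ) x • u x := by
      refine integral_congr_ae ?_
      filter_upwards [h2.coeFn_toLp] with x hx
      rw [hx]
    rw [e4]
    have e5 := VectorFourier.integral_fourierIntegral_smul_eq_flip (L := innerₗ V)
      (μ := volume) (ν := volume) (f := φ) (g := u) Real.continuous_fourierChar continuous_inner
      φ.integrable h1
    rw [flip_innerₗ] at e5
    rw [fourier_coe]
    exact e5
  have hn : ∀ f : Lp ℂ 2 (volume : Measure V), ENNReal.ofReal (‖f‖ ^ 2) = ∫⁻ v, ‖f v‖ₑ ^ 2 := by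
    intro f
    rw [ENNReal.ofReal_pow (norm_nonneg _), Lp.norm_def, ENNReal.ofReal_toReal (Lp.eLpNorm_ne_top f),
      eLpNorm_eq_lintegral_rpow_enorm_toReal (by norm_num) (by norm_num)]
    simp [← ENNReal.rpow_mul_natCast]
  calc ∫⁻ ζ, ‖𝓕 u ζ‖ₑ ^ 2
      = ∫⁻ ζ, ‖(𝓕 (h2.toLp u) : Lp ℂ 2 (volume : Measure V)) ζ‖ₑ ^ 2 := by
        refine lintegral_congr_ae ?_
        filter_upwards [hae] with ζ hζ
        rw [hζ]
    _ = ∫⁻ v, ‖(h2.toLp u) v‖ₑ ^ 2 := by rw [← hn, ← hn, Lp.norm_fourier_eq]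
    _ = _ := by
        refine lintegral_congr_ae ?_
        filter_upwards [h2.coeFn_toLp] with ζ hζ
        rw [hζ]

variable {E : Type*} [NormedAddCommGroup E] [NormedSpace ℝ E] [FiniteDimensional ℝ E]
  [MeasurableSpace E] [BorelSpace E] (μ : Measure E) [μ.IsAddHaarMeasure]

theorem exists_isAddHaar_smul (ν : Measure E) [ν.IsAddHaarMeasure] :
    ∃ c : ENNReal, c ≠ 0 ∧ c ≠ ⊤ ∧ μ = c • ν :=
  ⟨Measure.addHaarScalarFactor μ ν, by
    simpa using (Measure.addHaarScalarFactor_pos_of_isAddHaarMeasure μ ν).ne', by simp,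
    Measure.isAddLeftInvariant_eq_smul μ ν⟩

/-- The Fourier transform with respect to a bilinear pairing. -/
def pairingFourier (B : E →ₗ[ℝ] E →ₗ[ℝ] ℝ) (u : E → ℂ) (ζ : E) : ℂ :=
  ∫ v, Complex.exp (-(Complex.I * (B v ζ : ℝ))) * u v ∂μ

open FourierTransform in
/-- Plancherel's theorem for a nondegenerate pairing, up to a constant. -/
theorem exists_plancherel_const (B : E →ₗ[ℝ] E →ₗ[ℝ] ℝ) (hB : ∀ ζ, (∀ v, B v ζ = 0) → ζ = 0) :
    ∃ C : ENNReal, C ≠ 0 ∧ C ≠ ⊤ ∧ ∀ u : E → ℂ, Integrable u μ → MemLp u 2 μ →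
      ∫⁻ ζ, ‖pairingFourier μ B u ζ‖ₑ ^ 2 ∂μ = C * ∫⁻ v, ‖u v‖ₑ ^ 2 ∂μ := by
  let V := EuclideanSpace ℝ (Fin (Module.finrank ℝ E))
  let L : V ≃L[ℝ] E := ContinuousLinearEquiv.ofFinrankEq (by simp [V])
  have hfun : ∀ ζ, ∃ a : V, ∀ x, B (L x) ζ = 2 * Real.pi * inner ℝ x a := by
    intro ζ
    let φ : V →L[ℝ] ℝ := LinearMap.toContinuousLinearMap ((B.flip ζ) ∘ₗ L.toLinearMap)
    refine ⟨(2 * Real.pi)⁻¹ • (InnerProductSpace.toDual ℝ V).symm φ, fun x => ?_⟩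
    rw [inner_smul_right, real_inner_comm, InnerProductSpace.toDual_symm_apply]
    have : (2 * Real.pi) ≠ 0 := by positivity
    simp only [φ, LinearMap.coe_toContinuousLinearMap', LinearMap.comp_apply, LinearMap.flip_apply]
    field_simp
    rfl
  choose a ha using hfun
  have hpi : (2 * Real.pi) ≠ 0 := by positivity
  have hau : ∀ {z w : V}, (∀ x, inner ℝ x z = inner ℝ x w) → z = w := fun h =>
    ext_inner_left ℝ h
  let A : E →ₗ[ℝ] V :=
    { toFun := a
      map_add' := fun z w => hau fun x => by
        have := ha (z + w) x
        rw [map_add, ha, ha, ← mul_add] at this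
        rw [inner_add_right]; exact (mul_left_cancel₀ hpi this).symm
      map_smul' := fun c w => hau fun x => by
        have := ha (c • w) x
        rw [map_smul, ha, smul_eq_mul] at this
        simp only [RingHom.id_apply]
        rw [inner_smul_right]
        refine (mul_left_cancel₀ hpi ?_).symm
        rw [← this]; ring }
  have hAinj : Function.Injective A := by
    rw [← LinearMap.ker_eq_bot, LinearMap.ker_eq_bot']
    intro ζ hζ
    refine hB ζ fun v => ?_
    have := ha ζ (L.symm v)
    rw [L.apply_symm_apply, show a ζ = 0 from hζ, inner_zero_right, mul_zero] at this
    exact this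
  let A' : E ≃L[ℝ] V :=
    (LinearEquiv.ofInjectiveOfFinrankEq A hAinj (by simp [V])).toContinuousLinearEquiv
  have hA' : ∀ ζ, A' ζ = a ζ := fun ζ => rfl
  have haar1 : (Measure.map L (volume : Measure V)).IsAddHaarMeasure :=
    L.isAddHaarMeasure_map _
  obtain ⟨c, hc0, hct, hc⟩ : ∃ c : ENNReal, c ≠ 0 ∧ c ≠ ⊤ ∧ μ = c • Measure.map L (volume : Measure V) :=
    (exists_isAddHaar_smul _ _)
  have haar2 : (Measure.map A' μ).IsAddHaarMeasure := A'.isAddHaarMeasure_map _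
  obtain ⟨d, hd0, hdt, hd⟩ : ∃ d : ENNReal, d ≠ 0 ∧ d ≠ ⊤ ∧ Measure.map A' μ = d • (volume : Measure V) :=
    (exists_isAddHaar_smul _ _)
  have hLm : MeasurableEmbedding L := L.toHomeomorph.measurableEmbedding
  have hAm : MeasurableEmbedding A' := A'.toHomeomorph.measurableEmbedding
  refine ⟨c * d, mul_ne_zero hc0 hd0, ENNReal.mul_ne_top hct hdt, fun u h1 h2 => ?_⟩
  have g1 : Integrable (u ∘ L) := by
    rw [hc, integrable_smul_measure hc0 hct] at h1
    exact (hLm.integrable_map_iff).1 h1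
  have g2 : MemLp (u ∘ L) 2 := by
    rw [hc] at h2
    have h3 : MemLp u 2 (Measure.map L (volume : Measure V)) := by
      have := h2.smul_measure (c := c⁻¹) (ENNReal.inv_ne_top.2 hc0)
      rwa [smul_smul, ENNReal.inv_mul_cancel hc0 hct, one_smul] at this
    exact (hLm.memLp_map_measure_iff).1 h3
  have hF : ∀ ζ, pairingFourier μ B u ζ = c.toReal * 𝓕 (u ∘ L) (A' ζ) := by
    intro ζ
    rw [pairingFourier, hc, integral_smul_measure, hLm.integral_map, Real.fourier_eq']
    rw [Complex.real_smul]
    congr 1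
    refine integral_congr_ae (Eventually.of_forall fun x => ?_)
    simp only [Function.comp_apply, smul_eq_mul, hA']
    congr 2
    rw [ha]; push_cast; ring
  simp only [hF]
  have e1 : ∀ ζ, ‖(c.toReal : ℂ) * 𝓕 (u ∘ L) (A' ζ)‖ₑ ^ 2 = c ^ 2 * ‖𝓕 (u ∘ L) (A' ζ)‖ₑ ^ 2 := by
    intro ζ
    rw [enorm_mul, mul_pow]
    congr 2
    rw [← ofReal_norm, Complex.norm_real, Real.norm_of_nonneg ENNReal.toReal_nonneg,
      ENNReal.ofReal_toReal hct]
  simp only [e1]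
  rw [lintegral_const_mul' _ _ (by finiteness)]
  have e2 : ∫⁻ ζ, ‖𝓕 (u ∘ L) (A' ζ)‖ₑ ^ 2 ∂μ = d * ∫⁻ x, ‖u (L x)‖ₑ ^ 2 := by
    rw [← hAm.lintegral_map (μ := μ) (fun x => ‖𝓕 (u ∘ L) x‖ₑ ^ 2), hd, lintegral_smul_measure,
      lintegral_enorm_sq_fourier g1 g2]
    rfl
  have e3 : ∫⁻ v, ‖u v‖ₑ ^ 2 ∂μ = c * ∫⁻ x, ‖u (L x)‖ₑ ^ 2 := by
    rw [hc, lintegral_smul_measure, hLm.lintegral_map]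
    rfl
  rw [e2, e3]; ring

end Plancherel

/-- The matrix with rows `(a, b)` and `(c, d)`. -/
@[ext] structure Mat (R : Type*) where
  /-- upper left entry -/
  a : R
  /-- upper right entry -/
  b : R
  /-- lower left entry -/
  c : R
  /-- lower right entry -/
  d : R

namespace Mat

variable {R : Type*} [NormedCommRing R] [NormedAlgebra ℂ R]

instance : Zero (Mat R) := ⟨⟨0, 0, 0, 0⟩⟩
instance : One (Mat R) := ⟨⟨1, 0, 0, 1⟩⟩
instance : Add (Mat R) := ⟨fun g h => ⟨g.a + h.a, g.b + h.b, g.c + h.c, g.d + h.d⟩⟩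
instance : Neg (Mat R) := ⟨fun g => ⟨-g.a, -g.b, -g.c, -g.d⟩⟩
instance : Sub (Mat R) := ⟨fun g h => ⟨g.a - h.a, g.b - h.b, g.c - h.c, g.d - h.d⟩⟩
instance : Mul (Mat R) := ⟨fun g h => ⟨g.a * h.a + g.b * h.c, g.a * h.b + g.b * h.d,
  g.c * h.a + g.d * h.c, g.c * h.b + g.d * h.d⟩⟩
instance : SMul R (Mat R) := ⟨fun r g => ⟨r * g.a, r * g.b, r * g.c, r * g.d⟩⟩
instance : SMul ℂ (Mat R) := ⟨fun r g => ⟨r • g.a, r • g.b, r • g.c, r • g.d⟩⟩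

@[simp] theorem mul_a (g h : Mat R) : (g * h).a = g.a * h.a + g.b * h.c := rfl
@[simp] theorem mul_b (g h : Mat R) : (g * h).b = g.a * h.b + g.b * h.d := rfl
@[simp] theorem mul_c (g h : Mat R) : (g * h).c = g.c * h.a + g.d * h.c := rfl
@[simp] theorem mul_d (g h : Mat R) : (g * h).d = g.c * h.b + g.d * h.d := rfl
@[simp] theorem add_a (g h : Mat R) : (g + h).a = g.a + h.a := rfl
@[simp] theorem add_b (g h : Mat R) : (g + h).b = g.b + h.b := rfl
@[simp] theorem add_c (g h : Mat R) : (g + h).c = g.c + h.c := rfl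
@[simp] theorem add_d (g h : Mat R) : (g + h).d = g.d + h.d := rfl
@[simp] theorem sub_a (g h : Mat R) : (g - h).a = g.a - h.a := rfl
@[simp] theorem sub_b (g h : Mat R) : (g - h).b = g.b - h.b := rfl
@[simp] theorem sub_c (g h : Mat R) : (g - h).c = g.c - h.c := rfl
@[simp] theorem sub_d (g h : Mat R) : (g - h).d = g.d - h.d := rfl
@[simp] theorem neg_a (g : Mat R) : (-g).a = -g.a := rfl
@[simp] theorem neg_b (g : Mat R) : (-g).b = -g.b := rfl
@[simp] theorem neg_c (g : Mat R) : (-g).c = -g.c := rfl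
@[simp] theorem neg_d (g : Mat R) : (-g).d = -g.d := rfl
@[simp] theorem smul_a (r : R) (g : Mat R) : (r • g).a = r * g.a := rfl
@[simp] theorem smul_b (r : R) (g : Mat R) : (r • g).b = r * g.b := rfl
@[simp] theorem smul_c (r : R) (g : Mat R) : (r • g).c = r * g.c := rfl
@[simp] theorem smul_d (r : R) (g : Mat R) : (r • g).d = r * g.d := rfl
@[simp] theorem csmul_a (r : ℂ) (g : Mat R) : (r • g).a = r • g.a := rfl
@[simp] theorem csmul_b (r : ℂ) (g : Mat R) : (r • g).b = r • g.b := rfl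
@[simp] theorem csmul_c (r : ℂ) (g : Mat R) : (r • g).c = r • g.c := rfl
@[simp] theorem csmul_d (r : ℂ) (g : Mat R) : (r • g).d = r • g.d := rfl
@[simp] theorem one_a : (1 : Mat R).a = 1 := rfl
@[simp] theorem one_b : (1 : Mat R).b = 0 := rfl
@[simp] theorem one_c : (1 : Mat R).c = 0 := rfl
@[simp] theorem one_d : (1 : Mat R).d = 1 := rfl
@[simp] theorem zero_a : (0 : Mat R).a = 0 := rfl
@[simp] theorem zero_b : (0 : Mat R).b = 0 := rfl
@[simp] theorem zero_c : (0 : Mat R).c = 0 := rfl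
@[simp] theorem zero_d : (0 : Mat R).d = 0 := rfl

instance : Ring (Mat R) where
  add_assoc _ _ _ := by ext <;> simp [add_assoc]
  zero_add _ := by ext <;> simp
  add_zero _ := by ext <;> simp
  add_comm _ _ := by ext <;> simp [add_comm]
  left_distrib _ _ _ := by ext <;> simp <;> ring
  right_distrib _ _ _ := by ext <;> simp <;> ring
  zero_mul _ := by ext <;> simp
  mul_zero _ := by ext <;> simp
  mul_assoc _ _ _ := by ext <;> simp <;> ring
  one_mul _ := by ext <;> simp
  mul_one _ := by ext <;> simp
  neg_add_cancel _ := by ext <;> simp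
  sub_eq_add_neg _ _ := by ext <;> simp [sub_eq_add_neg]
  nsmul := nsmulRec
  zsmul := zsmulRec

instance : Module ℂ (Mat R) where
  one_smul _ := by ext <;> simp
  mul_smul _ _ _ := by ext <;> simp [mul_smul]
  smul_zero _ := by ext <;> simp
  smul_add _ _ _ := by ext <;> simp
  add_smul _ _ _ := by ext <;> simp [add_smul]
  zero_smul _ := by ext <;> simp

instance : Algebra ℂ (Mat R) :=
  Algebra.ofModule (fun r x y => by ext <;> simp) (fun r x y => by ext <;> simp)

/-- The identification with a product, as a linear map. -/
def equivProd : Mat R ≃ₗ[ℂ] R × R × R × R where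
  toFun g := (g.a, g.b, g.c, g.d)
  invFun q := ⟨q.1, q.2.1, q.2.2.1, q.2.2.2⟩
  map_add' _ _ := rfl
  map_smul' _ _ := rfl
  left_inv _ := rfl
  right_inv _ := rfl

instance : Norm (Mat R) := ⟨fun g => ‖g.a‖ + ‖g.b‖ + ‖g.c‖ + ‖g.d‖⟩

theorem norm_def (g : Mat R) : ‖g‖ = ‖g.a‖ + ‖g.b‖ + ‖g.c‖ + ‖g.d‖ := rfl

instance : NormedAddCommGroup (Mat R) :=
  NormedAddCommGroup.ofCore (𝕜 := ℂ)
    { norm_nonneg := fun g => by rw [norm_def]; positivity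
      norm_smul := fun c g => by simp only [norm_def, csmul_a, csmul_b, csmul_c, csmul_d, norm_smul]; ring
      norm_triangle := fun g h => by
        simp only [norm_def, add_a, add_b, add_c, add_d]
        linarith [norm_add_le g.a h.a, norm_add_le g.b h.b, norm_add_le g.c h.c, norm_add_le g.d h.d]
      norm_eq_zero_iff := fun g => by
        constructor
        · intro hg
          rw [norm_def] at hg
          have h1 := norm_nonneg g.a
          have h2 := norm_nonneg g.b
          have h3 := norm_nonneg g.c
          have h4 := norm_nonneg g.d
          ext
          · exact norm_eq_zero.1 (by linarith)
          · exact norm_eq_zero.1 (by linarith)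
          · exact norm_eq_zero.1 (by linarith)
          · exact norm_eq_zero.1 (by linarith)
        · rintro rfl
          simp [norm_def] }

instance : NormedRing (Mat R) :=
  { (inferInstance : NormedAddCommGroup (Mat R)), (inferInstance : Ring (Mat R)) with
    norm_mul_le := fun g h => by
      simp only [norm_def, mul_a, mul_b, mul_c, mul_d]
      have h1 : ∀ x y z w : R, ‖x * y + z * w‖ ≤ ‖x‖ * ‖y‖ + ‖z‖ * ‖w‖ := fun x y z w =>
        (norm_add_le _ _).trans (add_le_add (norm_mul_le _ _) (norm_mul_le _ _))
      have e1 := h1 g.a h.a g.b h.c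
      have e2 := h1 g.a h.b g.b h.d
      have e3 := h1 g.c h.a g.d h.c
      have e4 := h1 g.c h.b g.d h.d
      have p1 := mul_nonneg (norm_nonneg g.a) (norm_nonneg h.c)
      have p2 := mul_nonneg (norm_nonneg g.a) (norm_nonneg h.d)
      have p3 := mul_nonneg (norm_nonneg g.b) (norm_nonneg h.a)
      have p4 := mul_nonneg (norm_nonneg g.b) (norm_nonneg h.b)
      have p5 := mul_nonneg (norm_nonneg g.c) (norm_nonneg h.c)
      have p6 := mul_nonneg (norm_nonneg g.c) (norm_nonneg h.d)
      have p7 := mul_nonneg (norm_nonneg g.d) (norm_nonneg h.a)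
      have p8 := mul_nonneg (norm_nonneg g.d) (norm_nonneg h.b)
      nlinarith }

instance : NormedAlgebra ℂ (Mat R) where
  norm_smul_le c g := by
    simp only [norm_def, csmul_a, csmul_b, csmul_c, csmul_d, norm_smul]
    exact le_of_eq (by ring)

instance : MeasurableSpace (Mat R) := borel _
instance : BorelSpace (Mat R) := ⟨rfl⟩
instance [FiniteDimensional ℂ R] : FiniteDimensional ℂ (Mat R) :=
  LinearEquiv.finiteDimensional (equivProd (R := R)).symm
instance [FiniteDimensional ℂ R] : SecondCountableTopology (Mat R) :=
  have : ProperSpace (Mat R) := FiniteDimensional.proper ℂ (Mat R)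
  inferInstance

/-- The determinant. -/
def det (g : Mat R) : R := g.a * g.d - g.b * g.c

/-- The adjugate matrix. -/
def adj (g : Mat R) : Mat R := ⟨g.d, -g.b, -g.c, g.a⟩

instance : Module R (Mat R) where
  one_smul _ := by ext <;> simp
  mul_smul _ _ _ := by ext <;> simp [mul_assoc]
  smul_zero _ := by ext <;> simp
  smul_add _ _ _ := by ext <;> simp [mul_add]
  add_smul _ _ _ := by ext <;> simp [add_mul]
  zero_smul _ := by ext <;> simp

theorem det_mul (g h : Mat R) : det (g * h) = det g * det h := by
  simp only [det, mul_a, mul_b, mul_c, mul_d]; ring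

theorem det_smul (r : R) (g : Mat R) : det (r • g) = r ^ 2 * det g := by
  simp only [det, smul_a, smul_b, smul_c, smul_d]; ring

@[simp] theorem det_adj (g : Mat R) : det (adj g) = det g := by
  simp only [det, adj]; ring

@[simp] theorem det_one : det (1 : Mat R) = 1 := by simp [det]

theorem mul_adj (g : Mat R) : g * adj g = det g • (1 : Mat R) := by
  ext <;> simp [det, adj] <;> ring

theorem adj_mul (g : Mat R) : adj g * g = det g • (1 : Mat R) := by
  ext <;> simp [det, adj] <;> ring

@[simp] theorem adj_adj (g : Mat R) : adj (adj g) = g := by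
  ext <;> simp [adj]

variable [FiniteDimensional ℂ R]

@[fun_prop] theorem continuous_a : Continuous (Mat.a : Mat R → R) :=
  LinearMap.continuous_of_finiteDimensional
    ({ toFun := fun g => g.a, map_add' := fun _ _ => rfl, map_smul' := fun _ _ => rfl } :
      Mat R →ₗ[ℂ] R)

@[fun_prop] theorem continuous_b : Continuous (Mat.b : Mat R → R) :=
  LinearMap.continuous_of_finiteDimensional
    ({ toFun := fun g => g.b, map_add' := fun _ _ => rfl, map_smul' := fun _ _ => rfl } :
      Mat R →ₗ[ℂ] R)

@[fun_prop] theorem continuous_c : Continuous (Mat.c : Mat R → R) :=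
  LinearMap.continuous_of_finiteDimensional
    ({ toFun := fun g => g.c, map_add' := fun _ _ => rfl, map_smul' := fun _ _ => rfl } :
      Mat R →ₗ[ℂ] R)

@[fun_prop] theorem continuous_d : Continuous (Mat.d : Mat R → R) :=
  LinearMap.continuous_of_finiteDimensional
    ({ toFun := fun g => g.d, map_add' := fun _ _ => rfl, map_smul' := fun _ _ => rfl } :
      Mat R →ₗ[ℂ] R)

/-- The matrix with given entries, as a linear map. -/
def mkL : (R × R × R × R) →L[ℂ] Mat R :=
  LinearMap.toContinuousLinearMap
    { toFun := fun q => ⟨q.1, q.2.1, q.2.2.1, q.2.2.2⟩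
      map_add' := fun _ _ => rfl
      map_smul' := fun _ _ => rfl }

theorem mkL_apply (a b c d : R) : mkL (a, b, c, d) = ⟨a, b, c, d⟩ := rfl

@[fun_prop] theorem continuous_det : Continuous (det : Mat R → R) := by
  unfold det; fun_prop

end Mat

/-- The data on a finite-dimensional commutative algebra `R` (a product of algebras
`ℂ[ε_i]`) used in the study of the principal series of `GL₂ R` induced from the character `χ`:
the residue maps `proj i`, idempotents `e i`, generators `ω i` of the socles, and a nondegenerate
functional `ℓ`. -/
structure SiteData (κ : Type*) [Fintype κ] (R : Type*) [NormedCommRing R] [NormedAlgebra ℂ R] where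
  /-- the residue maps -/
  proj : κ → R →ₐ[ℂ] ℂ
  /-- the nilpotency orders -/
  n : κ → ℕ
  abs_det : ∀ x : R, |LinearMap.det (LinearMap.mulLeft ℝ x)| = ∏ i, ‖proj i x‖ ^ (2 * (n i + 1))
  /-- a unitary character of the units -/
  χ : R → ℂ
  χ_mul : ∀ {x y : R}, IsUnit x → IsUnit y → χ (x * y) = χ x * χ y
  norm_χ : ∀ {x : R}, IsUnit x → ‖χ x‖ = 1
  χ_nonunit : ∀ {x : R}, ¬ IsUnit x → χ x = 0
  continuousOn_χ : ContinuousOn χ {x | IsUnit x}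
  /-- the idempotents -/
  e : κ → R
  /-- generators of the socles -/
  ω : κ → R
  e_mul_e : ∀ i, e i * e i = e i
  e_mul_ω : ∀ i, e i * ω i = ω i
  e_mul_ω_ne : ∀ {i j}, i ≠ j → e i * ω j = 0
  mul_ω : ∀ i x, x * ω i = proj i x • ω i
  proj_e : ∀ i, proj i (e i) = 1
  proj_e_ne : ∀ {i j}, i ≠ j → proj i (e j) = 0
  ω_tame : ∀ {i}, n i = 0 → ω i = e i
  proj_ω_wild : ∀ {i}, n i ≠ 0 → proj i (ω i) = 0
  χ_wild : ∀ {i}, n i ≠ 0 → ∃ c : ℂ, c ≠ 0 ∧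
    ∀ β : ℂ, χ (1 + β • ω i) = Complex.exp (Complex.I * ((c * β).re : ℝ))
  /-- a nondegenerate functional -/
  ℓ : R →ₗ[ℂ] ℂ
  ℓ_ω : ∀ i, ℓ (ω i) = 1
  ℓ_nondeg : ∀ ζ, (∀ v, ℓ (v * ζ) = 0) → ζ = 0

namespace SiteData

variable {κ : Type*} [Fintype κ] {R : Type*} [NormedCommRing R] [NormedAlgebra ℂ R]
  [FiniteDimensional ℂ R] (S : SiteData κ R)

/-- The absolute value of the norm of an element of `R`, as a real algebra. -/
def nm (x : R) : ℝ := ∏ i, ‖S.proj i x‖ ^ (2 * (S.n i + 1))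

theorem nm_nonneg (x : R) : 0 ≤ S.nm x := Finset.prod_nonneg fun _ _ => by positivity

theorem nm_mul (x y : R) : S.nm (x * y) = S.nm x * S.nm y := by
  simp only [nm, map_mul, norm_mul, mul_pow, Finset.prod_mul_distrib]

@[simp] theorem nm_one : S.nm 1 = 1 := by simp [nm]

theorem nm_pow (x : R) (k : ℕ) : S.nm (x ^ k) = S.nm x ^ k := by
  induction k with
  | zero => simp
  | succ k ih => rw [pow_succ, nm_mul, ih, pow_succ]

theorem isUnit_iff_nm_ne_zero {x : R} : IsUnit x ↔ S.nm x ≠ 0 := by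
  constructor
  · rintro hx h0
    obtain ⟨y, hy⟩ := hx.exists_right_inv
    have := S.nm_mul x y
    rw [hy, h0, nm_one, zero_mul] at this
    exact one_ne_zero this
  · intro h
    rw [nm, ← S.abs_det] at h
    have h1 : IsUnit (LinearMap.det (LinearMap.mulLeft ℝ x)) := isUnit_iff_ne_zero.2 (abs_ne_zero.1 h)
    rw [← LinearMap.isUnit_iff_isUnit_det, Module.End.isUnit_iff] at h1
    obtain ⟨y, hy⟩ := h1.2 1
    exact IsUnit.of_mul_eq_one y hy

theorem isUnit_iff_proj_ne_zero {x : R} : IsUnit x ↔ ∀ i, S.proj i x ≠ 0 := by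
  rw [S.isUnit_iff_nm_ne_zero, nm, Finset.prod_ne_zero_iff]
  refine forall_congr' fun i => ?_
  simp

theorem nm_pos {x : R} (hx : IsUnit x) : 0 < S.nm x :=
  lt_of_le_of_ne (S.nm_nonneg x) (S.isUnit_iff_nm_ne_zero.1 hx).symm

theorem continuous_proj (i : κ) : Continuous (S.proj i) :=
  (S.proj i).toLinearMap.continuous_of_finiteDimensional

theorem continuous_nm : Continuous S.nm :=
  continuous_finsetProd _ fun i _ => ((S.continuous_proj i).norm).pow _

theorem nm_ringInverse {x : R} (hx : IsUnit x) : S.nm (Ring.inverse x) = (S.nm x)⁻¹ := by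
  have := S.nm_mul x (Ring.inverse x)
  rw [Ring.mul_inverse_cancel _ hx, nm_one] at this
  exact eq_inv_of_mul_eq_one_right this.symm

@[simp] theorem χ_one : S.χ 1 = 1 := by
  have h := S.χ_mul (isUnit_one (M := R)) isUnit_one
  have h1 := S.norm_χ (isUnit_one (M := R))
  rw [one_mul] at h
  have h0 : S.χ 1 ≠ 0 := by intro h0; rw [h0] at h1; simp at h1
  exact (mul_eq_left₀ h0).1 h.symm

theorem norm_χ_le (x : R) : ‖S.χ x‖ ≤ 1 := by
  by_cases hx : IsUnit x
  · exact (S.norm_χ hx).le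
  · rw [S.χ_nonunit hx]; simp

/-- `χ` is multiplicative on all of `R`. -/
theorem χ_mul' (x y : R) : S.χ (x * y) = S.χ x * S.χ y := by
  by_cases hx : IsUnit x
  · by_cases hy : IsUnit y
    · exact S.χ_mul hx hy
    · rw [S.χ_nonunit hy, S.χ_nonunit fun h => hy (isUnit_of_mul_isUnit_right h), mul_zero]
  · rw [S.χ_nonunit hx, S.χ_nonunit fun h => hx (isUnit_of_mul_isUnit_left h), zero_mul]

section Measure

variable [MeasurableSpace R] [BorelSpace R]

theorem isOpen_units : IsOpen {x : R | IsUnit x} :=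
  have := FiniteDimensional.complete ℂ R
  Units.isOpen

theorem measurable_χ : Measurable S.χ := by
  classical
  have h : S.χ = Set.piecewise {x | IsUnit x} S.χ (fun _ => 0) := by
    funext x
    by_cases hx : IsUnit x
    · simp [Set.piecewise, hx]
    · simp [Set.piecewise, hx, S.χ_nonunit hx]
  rw [h]
  exact ContinuousOn.measurable_piecewise S.continuousOn_χ continuousOn_const
    isOpen_units.measurableSet

theorem _root_.WildHecke.measurable_ringInverse : Measurable (Ring.inverse : R → R) := by
  classical
  have := FiniteDimensional.complete ℂ R
  have h : (Ring.inverse : R → R) = Set.piecewise {x | IsUnit x} Ring.inverse (fun _ => 0) := by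
    funext x
    by_cases hx : IsUnit x
    · simp [Set.piecewise, hx]
    · simp [Set.piecewise, hx, Ring.inverse_non_unit _ hx]
  rw [h]
  refine ContinuousOn.measurable_piecewise (fun x hx => ?_) continuousOn_const
    isOpen_units.measurableSet
  obtain ⟨u, rfl⟩ := hx
  exact (NormedRing.inverse_continuousAt u).continuousWithinAt

end Measure

/-- The denominator of the fractional linear transformation. -/
def den (g : Mat R) (v : R) : R := g.c * v + g.d

/-- The fractional linear transformation. -/
def act (g : Mat R) (v : R) : R := (g.a * v + g.b) * Ring.inverse (den g v)

theorem den_mul (h g : Mat R) {v : R} (hv : IsUnit (den g v)) :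
    den (h * g) v = den h (act g v) * den g v := by
  have h1 := Ring.inverse_mul_cancel _ hv
  simp only [den, act, Mat.mul_a, Mat.mul_b, Mat.mul_c, Mat.mul_d] at *
  linear_combination (-(h.c * (g.a * v + g.b))) * h1

theorem act_mul (h g : Mat R) {v : R} (hv : IsUnit (den g v)) :
    act (h * g) v = act h (act g v) := by
  have h1 := Ring.inverse_mul_cancel _ hv
  have e1 : (h * g).a * v + (h * g).b = (h.a * act g v + h.b) * den g v := by
    simp only [den, act, Mat.mul_a, Mat.mul_b, Mat.mul_c, Mat.mul_d] at *
    linear_combination (-(h.a * (g.a * v + g.b))) * h1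
  have e2 : act (h * g) v = ((h.a * act g v + h.b) * den g v) *
      (Ring.inverse (den h (act g v)) * Ring.inverse (den g v)) := by
    rw [act, den_mul h g hv, e1, Ring.mul_inverse_rev, mul_comm (Ring.inverse (den g v))]
  have h3 : act h (act g v) = (h.a * act g v + h.b) * Ring.inverse (den h (act g v)) := rfl
  rw [e2, h3]
  linear_combination ((h.a * act g v + h.b) * Ring.inverse (den h (act g v))) * h1

theorem act_smul_one (r : R) (hr : IsUnit r) (v : R) : act (r • (1 : Mat R)) v = v := by
  simp [act, den, mul_comm r v, mul_assoc, Ring.mul_inverse_cancel _ hr]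

theorem act_adj_act (g : Mat R) (hg : IsUnit g.det) {v : R} (hv : IsUnit (den g v)) :
    act g.adj (act g v) = v := by
  rw [← act_mul _ _ hv, Mat.adj_mul, act_smul_one _ hg]

theorem isUnit_den_adj (g : Mat R) (hg : IsUnit g.det) {v : R} (hv : IsUnit (den g v)) :
    IsUnit (den g.adj (act g v)) := by
  have h := den_mul g.adj g hv
  rw [Mat.adj_mul] at h
  have h2 : den (g.det • (1 : Mat R)) v = g.det := by simp [den]
  rw [h2] at h
  exact isUnit_of_mul_isUnit_left (h ▸ hg)

section Measure

variable [MeasurableSpace R] [BorelSpace R] (μ : Measure R) [μ.IsAddHaarMeasure]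

theorem ae_isUnit_mul_add {a b : R} (h : ∀ i, S.proj i a ≠ 0 ∨ S.proj i b ≠ 0) :
    ∀ᵐ v ∂μ, IsUnit (a * v + b) := by
  have h1 : ∀ i, ∀ᵐ v ∂μ, S.proj i (a * v + b) ≠ 0 := by
    intro i
    let L : R →L[ℝ] ℂ := LinearMap.toContinuousLinearMap
      (((S.proj i).toLinearMap ∘ₗ (LinearMap.mulLeft ℂ a)).restrictScalars ℝ)
    have hL : ∀ v, S.proj i (a * v + b) = L v + S.proj i b := by intro v; rw [map_add]; rfl
    obtain ⟨v₀, hv₀⟩ : ∃ v₀, S.proj i (a * v₀ + b) ≠ 0 := by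
      by_cases hb : S.proj i b = 0
      · refine ⟨1, ?_⟩
        rw [mul_one, map_add, hb, add_zero]
        exact (h i).resolve_right (fun h' => h' hb)
      · exact ⟨0, by simpa using hb⟩
    refine ae_ne_zero_of_analytic μ (f := fun v => S.proj i (a * v + b)) ?_ hv₀
    intro v _
    simp only [hL]
    exact (L.analyticAt v).add analyticAt_const
  filter_upwards [ae_all_iff.2 h1] with v hv
  exact S.isUnit_iff_proj_ne_zero.2 hv

theorem ae_isUnit_den (S : SiteData κ R) {g : Mat R} (hg : IsUnit g.det) : ∀ᵐ v ∂μ, IsUnit (den g v) := by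
  refine S.ae_isUnit_mul_add μ fun i => ?_
  by_contra hcon
  push Not at hcon
  have := S.isUnit_iff_proj_ne_zero.1 hg i
  apply this
  rw [Mat.det, map_sub, map_mul, map_mul, hcon.1, hcon.2]; simp

theorem hasFDerivAt_act (g : Mat R) {v : R} (hv : IsUnit (den g v)) :
    HasFDerivAt (act g) (ContinuousLinearMap.mul ℝ R (g.det * Ring.inverse (den g v) ^ 2)) v := by
  have := FiniteDimensional.complete ℂ R
  have hlin : ∀ a b : R, HasFDerivAt (fun v : R => a * v + b) (ContinuousLinearMap.mul ℝ R a) v :=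
    fun a b => (ContinuousLinearMap.mul ℝ R a).hasFDerivAt.add_const b
  obtain ⟨u, hu⟩ := hv
  have h1 : HasFDerivAt (Ring.inverse : R → R)
      (-ContinuousLinearMap.mulLeftRight ℝ R ↑u⁻¹ ↑u⁻¹) (den g v) := by
    rw [← hu]; exact hasFDerivAt_ringInverse (𝕜 := ℝ) u
  have h2 : HasFDerivAt (fun v => Ring.inverse (den g v)) _ v :=
    HasFDerivAt.comp v h1 (hlin (g.c) (g.d))
  have h3 := (hlin (g.a) (g.b)).mul h2
  refine h3.congr_fderiv ?_
  ext w
  have h4 : den g v * ↑u⁻¹ = 1 := by rw [← hu]; exact u.mul_inv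
  simp only [_root_.add_apply, _root_.smul_apply,
    ContinuousLinearMap.comp_apply, _root_.neg_apply,
    ContinuousLinearMap.mulLeftRight_apply, ContinuousLinearMap.mul_apply', smul_eq_mul,
    Mat.det, ← hu, Ring.inverse_unit]
  simp only [den] at h4
  linear_combination (-(g.a * w * (↑u⁻¹ : R))) * h4

theorem lintegral_act {g : Mat R} (hg : IsUnit g.det) (F : R → ENNReal) :
    ∫⁻ v, ENNReal.ofReal (S.nm g.det * (S.nm (den g v))⁻¹ ^ 2) * F (act g v) ∂μ
      = ∫⁻ v, F v ∂μ := by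
  set U : Set R := {v | IsUnit (den g v)} with hU
  have hUo : IsOpen U := isOpen_units.preimage (by unfold den; fun_prop)
  have hg' : IsUnit g.adj.det := by simpa using hg
  have hinj : InjOn (act g) U := fun v hv w hw h => by
    rw [← act_adj_act g hg hv, h, act_adj_act g hg hw]
  have h1 := lintegral_image_eq_lintegral_abs_det_fderiv_mul μ hUo.measurableSet
    (f := act g) (fun v hv => (hasFDerivAt_act g hv).hasFDerivWithinAt) hinj F
  have himg : act g '' U =ᵐ[μ] univ := by
    rw [eventuallyEq_univ]
    filter_upwards [S.ae_isUnit_den μ hg'] with v hv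
    refine ⟨act g.adj v, ?_, ?_⟩
    · have := isUnit_den_adj g.adj hg' hv
      rwa [Mat.adj_adj] at this
    · have := act_adj_act g.adj hg' hv
      rwa [Mat.adj_adj] at this
  have hUu : U =ᵐ[μ] univ := by
    rw [eventuallyEq_univ]; exact S.ae_isUnit_den μ hg
  rw [setLIntegral_congr himg, setLIntegral_univ] at h1
  rw [h1, ← setLIntegral_univ (fun v => ENNReal.ofReal _ * F (act g v)), setLIntegral_congr hUu.symm]
  refine setLIntegral_congr_fun hUo.measurableSet fun v hv => ?_
  have h2 : |(ContinuousLinearMap.mul ℝ R (g.det * Ring.inverse (den g v) ^ 2)).det|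
      = S.nm (g.det * Ring.inverse (den g v) ^ 2) := S.abs_det _
  simp only [h2]
  rw [S.nm_mul, S.nm_pow, S.nm_ringInverse hv]

theorem measurable_den : Measurable fun q : Mat R × R => den q.1 q.2 := by
  have : Continuous fun q : Mat R × R => den q.1 q.2 := by
    unfold den
    exact ((Mat.continuous_c.comp continuous_fst).mul continuous_snd).add
      (Mat.continuous_d.comp continuous_fst)
  have hR : ProperSpace R := FiniteDimensional.proper ℂ R
  exact this.measurable

theorem measurable_act : Measurable fun q : Mat R × R => act q.1 q.2 := by
  have hR : ProperSpace R := FiniteDimensional.proper ℂ R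
  have : Continuous fun q : Mat R × R => q.1.a * q.2 + q.1.b :=
    ((Mat.continuous_a.comp continuous_fst).mul continuous_snd).add
      (Mat.continuous_b.comp continuous_fst)
  exact this.measurable.mul (measurable_ringInverse.comp measurable_den)

theorem quasiMeasurePreserving_act (S : SiteData κ R) {g : Mat R} (hg : IsUnit g.det) :
    Measure.QuasiMeasurePreserving (act g) μ μ := by
  have hm : Measurable (act g) := measurable_act.comp (measurable_const.prodMk measurable_id)
  refine ⟨hm, Measure.AbsolutelyContinuous.mk fun A hA hA0 => ?_⟩
  rw [Measure.map_apply hm hA]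
  have h := S.lintegral_act μ hg (A.indicator 1)
  rw [lintegral_indicator_one hA, hA0, lintegral_eq_zero_iff] at h
  · refine measure_eq_zero_iff_ae_notMem.2 ?_
    filter_upwards [h, S.ae_isUnit_den μ hg] with v hv hv2 hvA
    have h1 : 0 < S.nm g.det * (S.nm (den g v))⁻¹ ^ 2 :=
      mul_pos (S.nm_pos hg) (pow_pos (inv_pos.2 (S.nm_pos hv2)) 2)
    simp only [Pi.zero_apply, mul_eq_zero, ENNReal.ofReal_eq_zero] at hv
    rcases hv with hv | hv
    · linarith
    · rw [indicator_of_mem (by exact hvA)] at hv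
      simp at hv
  · have h1 : Measurable fun v => den g v :=
      measurable_den.comp (measurable_const.prodMk measurable_id)
    exact ((((S.continuous_nm.measurable.comp h1).inv.pow_const 2).const_mul _).ennreal_ofReal).mul
      ((measurable_one.indicator hA).comp hm)

end Measure

end SiteData

theorem ofReal_norm_sq {X : Type*} [MeasurableSpace X] {μ : Measure X} (f : Lp ℂ 2 μ) :
    ENNReal.ofReal (‖f‖ ^ 2) = ∫⁻ v, ‖f v‖ₑ ^ 2 ∂μ := by
  rw [ENNReal.ofReal_pow (norm_nonneg _), Lp.norm_def, ENNReal.ofReal_toReal (Lp.eLpNorm_ne_top f),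
    eLpNorm_eq_lintegral_rpow_enorm_toReal (by norm_num) (by norm_num)]
  simp [← ENNReal.rpow_mul_natCast]

theorem memLp_two_of_lintegral {X : Type*} [MeasurableSpace X] {μ : Measure X} {f : X → ℂ}
    (hf : AEStronglyMeasurable f μ) (h : ∫⁻ v, ‖f v‖ₑ ^ 2 ∂μ ≠ ⊤) : MemLp f 2 μ := by
  refine ⟨hf, ?_⟩
  rw [eLpNorm_eq_lintegral_rpow_enorm_toReal (by norm_num) (by norm_num)]
  simp only [ENNReal.toReal_ofNat, ENNReal.rpow_ofNat]
  exact ENNReal.rpow_lt_top_of_nonneg (by norm_num) h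

theorem norm_le_of_lintegral_le {X : Type*} [MeasurableSpace X] {μ : Measure X} {f g : Lp ℂ 2 μ}
    {C : ℝ} (hC : 0 ≤ C)
    (h : ∫⁻ v, ‖f v‖ₑ ^ 2 ∂μ ≤ ENNReal.ofReal (C ^ 2) * ∫⁻ v, ‖g v‖ₑ ^ 2 ∂μ) :
    ‖f‖ ≤ C * ‖g‖ := by
  rw [← ofReal_norm_sq, ← ofReal_norm_sq, ← ENNReal.ofReal_mul (by positivity),
    ENNReal.ofReal_le_ofReal_iff (by positivity), ← mul_pow] at h
  exact le_of_sq_le_sq h (by positivity)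

theorem lintegral_mul_sq_le {X : Type*} [MeasurableSpace X] (ν : Measure X) {a b : X → ENNReal}
    (ha : AEMeasurable a ν) (hb : AEMeasurable b ν) :
    (∫⁻ s, a s * b s ∂ν) ^ 2 ≤ (∫⁻ s, a s ∂ν) * ∫⁻ s, a s * b s ^ 2 ∂ν := by
  have h := ENNReal.lintegral_mul_le_Lp_mul_Lq ν Real.HolderConjugate.two_two
    (f := fun s => a s ^ (1 / 2 : ℝ)) (g := fun s => a s ^ (1 / 2 : ℝ) * b s)
    (ha.pow_const _) ((ha.pow_const _).mul hb)
  have e1 : ∀ s, a s ^ (1 / 2 : ℝ) * (a s ^ (1 / 2 : ℝ) * b s) = a s * b s := by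
    intro s
    rw [← mul_assoc, ← ENNReal.rpow_add_of_nonneg _ _ (by norm_num) (by norm_num)]
    norm_num
  have e2 : ∀ s, (a s ^ (1 / 2 : ℝ)) ^ (2 : ℝ) = a s := by
    intro s; rw [← ENNReal.rpow_mul]; norm_num
  have e3 : ∀ s, (a s ^ (1 / 2 : ℝ) * b s) ^ (2 : ℝ) = a s * b s ^ 2 := by
    intro s; rw [ENNReal.mul_rpow_of_nonneg _ _ (by norm_num), e2]; norm_num
  simp only [Pi.mul_apply, e1, e2, e3] at h
  have h2 := pow_le_pow_left₀ (by positivity) h 2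
  refine h2.trans (le_of_eq ?_)
  rw [mul_pow]
  congr 1 <;> rw [← ENNReal.rpow_natCast, ← ENNReal.rpow_mul] <;> norm_num

namespace SiteData

variable {κ : Type*} [Fintype κ] {R : Type*} [NormedCommRing R] [NormedAlgebra ℂ R]
  [FiniteDimensional ℂ R] (S : SiteData κ R)

/-- The formula for the principal series representation. -/
def rhoFun (g : Mat R) (f : R → ℂ) (v : R) : ℂ :=
  S.χ (den g v) * ((√(S.nm g.det) * (S.nm (den g v))⁻¹ : ℝ) : ℂ) * f (act g v)

theorem nm_nonunit {x : R} (hx : ¬ IsUnit x) : S.nm x = 0 := by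
  by_contra h
  exact hx (S.isUnit_iff_nm_ne_zero.2 h)

theorem rhoFun_of_not_isUnit {g : Mat R} (hg : ¬ IsUnit g.det) (f : R → ℂ) (v : R) :
    S.rhoFun g f v = 0 := by
  simp [rhoFun, S.nm_nonunit hg]

theorem enorm_rhoFun_sq (g : Mat R) (f : R → ℂ) (v : R) : ‖S.rhoFun g f v‖ₑ ^ 2
    = ENNReal.ofReal (S.nm g.det * (S.nm (den g v))⁻¹ ^ 2) * ‖f (act g v)‖ₑ ^ 2 := by
  by_cases hv : IsUnit (den g v)
  · rw [rhoFun, enorm_mul, enorm_mul, mul_pow, mul_pow, ← ofReal_norm (S.χ _), S.norm_χ hv,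
      ← ofReal_norm, Complex.norm_real, ← ENNReal.ofReal_pow (norm_nonneg _), Real.norm_eq_abs,
      sq_abs, mul_pow, Real.sq_sqrt (S.nm_nonneg _)]
    simp
  · simp [rhoFun, S.χ_nonunit hv, S.nm_nonunit hv]

section Measure

variable [MeasurableSpace R] [BorelSpace R] (μ : Measure R) [μ.IsAddHaarMeasure]

theorem measurable_rhoFun {f : R → ℂ} (hf : Measurable f) :
    Measurable fun q : Mat R × R => S.rhoFun q.1 f q.2 := by
  refine ((S.measurable_χ.comp measurable_den).mul ?_).mul (hf.comp measurable_act)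
  refine Complex.measurable_ofReal.comp (Measurable.mul ?_ ?_)
  · exact ((S.continuous_nm.comp Mat.continuous_det).sqrt.measurable).comp measurable_fst
  · exact (S.continuous_nm.measurable.comp measurable_den).inv

theorem lintegral_rhoFun {g : Mat R} (hg : IsUnit g.det) (f : R → ℂ) :
    ∫⁻ v, ‖S.rhoFun g f v‖ₑ ^ 2 ∂μ = ∫⁻ v, ‖f v‖ₑ ^ 2 ∂μ := by
  simp only [S.enorm_rhoFun_sq]
  exact S.lintegral_act μ hg fun v => ‖f v‖ₑ ^ 2

theorem lintegral_rhoFun_le (g : Mat R) (f : R → ℂ) :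
    ∫⁻ v, ‖S.rhoFun g f v‖ₑ ^ 2 ∂μ ≤ ∫⁻ v, ‖f v‖ₑ ^ 2 ∂μ := by
  by_cases hg : IsUnit g.det
  · exact (S.lintegral_rhoFun μ hg f).le
  · simp [S.rhoFun_of_not_isUnit hg]

variable {μ} in
theorem rhoFun_congr {f f' : R → ℂ} (h : f =ᵐ[μ] f') (g : Mat R) :
    S.rhoFun g f =ᵐ[μ] S.rhoFun g f' := by
  by_cases hg : IsUnit g.det
  · filter_upwards [(S.quasiMeasurePreserving_act μ hg).ae_eq_comp h] with v hv
    simp only [Function.comp_apply] at hv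
    rw [rhoFun, rhoFun, hv]
  · exact Eventually.of_forall fun v => by simp [S.rhoFun_of_not_isUnit hg]

theorem memLp_rhoFun (g : Mat R) (f : Lp ℂ 2 μ) : MemLp (S.rhoFun g f) 2 μ := by
  refine memLp_two_of_lintegral ?_ ?_
  · exact ((S.measurable_rhoFun (Lp.stronglyMeasurable f).measurable).comp
      (measurable_const.prodMk measurable_id)).aestronglyMeasurable
  · refine ((S.lintegral_rhoFun_le μ g f).trans_lt ?_).ne
    rw [← ofReal_norm_sq]; exact ENNReal.ofReal_lt_top

/-- The principal series representation (a representation of the opposite group). -/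
def rho (g : Mat R) : Lp ℂ 2 μ →L[ℂ] Lp ℂ 2 μ :=
  LinearMap.mkContinuous
    { toFun := fun f => (S.memLp_rhoFun μ g f).toLp
      map_add' := fun f f' => by
        rw [← MemLp.toLp_add]
        refine MemLp.toLp_congr _ _ ((S.rhoFun_congr (Lp.coeFn_add f f') g).trans ?_)
        exact Eventually.of_forall fun v => by simp [rhoFun]; ring
      map_smul' := fun c f => by
        rw [RingHom.id_apply, ← MemLp.toLp_const_smul]
        refine MemLp.toLp_congr _ _ ((S.rhoFun_congr (Lp.coeFn_smul c f) g).trans ?_)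
        exact Eventually.of_forall fun v => by simp [rhoFun]; ring }
    1 fun f => by
      refine norm_le_of_lintegral_le zero_le_one ?_
      simp only [LinearMap.coe_mk, AddHom.coe_mk, one_pow, ENNReal.ofReal_one, one_mul]
      refine le_trans (le_of_eq (lintegral_congr_ae ?_)) (S.lintegral_rhoFun_le μ g f)
      filter_upwards [(S.memLp_rhoFun μ g f).coeFn_toLp] with v hv
      rw [hv]

theorem rho_ae (g : Mat R) (f : Lp ℂ 2 μ) : S.rho μ g f =ᵐ[μ] S.rhoFun g f :=
  (S.memLp_rhoFun μ g f).coeFn_toLp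

theorem norm_rho_apply_le (g : Mat R) (f : Lp ℂ 2 μ) : ‖S.rho μ g f‖ ≤ ‖f‖ := by
  simpa using (S.rho μ g).le_of_opNorm_le (LinearMap.mkContinuous_norm_le _ zero_le_one _) f

theorem rho_of_not_isUnit {g : Mat R} (hg : ¬ IsUnit g.det) : S.rho μ g = 0 := by
  ext1 f
  apply Lp.ext
  filter_upwards [S.rho_ae μ g f, Lp.coeFn_zero ℂ 2 μ] with v hv _
  rw [hv, S.rhoFun_of_not_isUnit hg]
  simp

theorem rho_mul (h g : Mat R) : S.rho μ (h * g) = S.rho μ g * S.rho μ h := by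
  by_cases hg : IsUnit g.det
  · ext1 f
    apply Lp.ext
    filter_upwards [S.rho_ae μ (h * g) f, S.rho_ae μ g (S.rho μ h f),
      S.rhoFun_congr (S.rho_ae μ h f) g, S.ae_isUnit_den μ hg] with v h1 h2 h3 hv
    rw [h1, mul_apply_eq_comp, h2, h3]
    simp only [rhoFun]
    rw [act_mul h g hv, den_mul h g hv, S.χ_mul', Mat.det_mul, S.nm_mul, S.nm_mul,
      Real.sqrt_mul (S.nm_nonneg _), mul_inv]
    push_cast
    ring
  · have : ¬ IsUnit (h * g).det := by
      rw [Mat.det_mul]; exact fun h' => hg (isUnit_of_mul_isUnit_right h')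
    rw [S.rho_of_not_isUnit μ this, S.rho_of_not_isUnit μ hg, zero_mul]

theorem rho_smul (r : R) (g : Mat R) : S.rho μ (r • g) = S.χ r • S.rho μ g := by
  by_cases hr : IsUnit r
  · ext1 f
    apply Lp.ext
    filter_upwards [S.rho_ae μ (r • g) f, S.rho_ae μ g f,
      Lp.coeFn_smul (S.χ r) (S.rho μ g f)] with v h1 h2 h3
    rw [h1, _root_.smul_apply, h3, Pi.smul_apply, h2]
    have e1 : den (r • g) v = r * den g v := by simp [den]; ring
    have e2 : act (r • g) v = act g v := by
      rw [act, e1, Ring.mul_inverse_rev]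
      have := Ring.mul_inverse_cancel _ hr
      simp only [act, Mat.smul_a, Mat.smul_b]
      linear_combination ((g.a * v + g.b) * Ring.inverse (den g v)) * this
    simp only [rhoFun, smul_eq_mul]
    rw [e1, e2, S.χ_mul', Mat.det_smul, S.nm_mul, S.nm_mul, S.nm_pow,
      Real.sqrt_mul (by positivity), Real.sqrt_sq (S.nm_nonneg _), mul_inv]
    have e3 : S.nm r * √(S.nm g.det) * ((S.nm r)⁻¹ * (S.nm (den g v))⁻¹)
        = √(S.nm g.det) * (S.nm (den g v))⁻¹ := by
      have := S.isUnit_iff_nm_ne_zero.1 hr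
      field_simp
    rw [e3]; ring
  · have : ¬ IsUnit (r • g).det := by
      rw [Mat.det_smul, pow_two, mul_assoc]; exact fun h' => hr (isUnit_of_mul_isUnit_left h')
    rw [S.rho_of_not_isUnit μ this, S.χ_nonunit hr, zero_smul]

theorem rho_one : S.rho μ 1 = 1 := by
  ext1 f
  apply Lp.ext
  filter_upwards [S.rho_ae μ 1 f] with v h1
  rw [h1]
  simp [rhoFun, den, act]

theorem norm_rho_apply {g : Mat R} (hg : IsUnit g.det) (f : Lp ℂ 2 μ) : ‖S.rho μ g f‖ = ‖f‖ := by
  have h : ENNReal.ofReal (‖S.rho μ g f‖ ^ 2) = ENNReal.ofReal (‖f‖ ^ 2) := by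
    rw [ofReal_norm_sq, ofReal_norm_sq, ← S.lintegral_rhoFun μ hg f]
    refine lintegral_congr_ae ?_
    filter_upwards [S.rho_ae μ g f] with v hv
    rw [hv]
  rw [ENNReal.ofReal_eq_ofReal_iff (by positivity) (by positivity)] at h
  exact (pow_left_inj₀ (norm_nonneg _) (norm_nonneg _) two_ne_zero).1 h

theorem adjoint_rho (g : Mat R) : ContinuousLinearMap.adjoint (S.rho μ g)
    = starRingEnd ℂ (S.χ g.det) • S.rho μ g.adj := by
  by_cases hg : IsUnit g.det
  · have h1 : S.rho μ g * S.rho μ g.adj = S.χ g.det • (1 : Lp ℂ 2 μ →L[ℂ] Lp ℂ 2 μ) := by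
      rw [← S.rho_mul, Mat.adj_mul, S.rho_smul, S.rho_one]
    have h2 : ContinuousLinearMap.adjoint (S.rho μ g) * S.rho μ g = 1 :=
      ((S.rho μ g).norm_map_iff_adjoint_comp_self).1 fun f => S.norm_rho_apply μ hg f
    have h3 : S.χ g.det * starRingEnd ℂ (S.χ g.det) = 1 := by
      rw [Complex.mul_conj, Complex.normSq_eq_norm_sq, S.norm_χ hg]; simp
    calc ContinuousLinearMap.adjoint (S.rho μ g)
        = ContinuousLinearMap.adjoint (S.rho μ g) *
          (starRingEnd ℂ (S.χ g.det) • (S.rho μ g * S.rho μ g.adj)) := by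
          rw [h1, smul_smul, mul_comm, h3, one_smul, mul_one]
      _ = _ := by rw [mul_smul_comm, ← mul_assoc, h2, one_mul]
  · have : ¬ IsUnit g.adj.det := by simpa using hg
    rw [S.rho_of_not_isUnit μ hg, S.rho_of_not_isUnit μ this]; simp

theorem inner_rho (g : Mat R) (h f : Lp ℂ 2 μ) :
    inner ℂ h (S.rho μ g f) = ∫ v, starRingEnd ℂ (h v) * S.rhoFun g f v ∂μ := by
  rw [L2.inner_def]
  refine integral_congr_ae ?_
  filter_upwards [S.rho_ae μ g f] with v hv
  rw [hv, RCLike.inner_apply, mul_comm]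

theorem measurable_inner_rho (h f : Lp ℂ 2 μ) : Measurable fun g => inner ℂ h (S.rho μ g f) := by
  have hR : ProperSpace R := FiniteDimensional.proper ℂ R
  simp only [S.inner_rho]
  have h1 : Measurable fun q : Mat R × R => starRingEnd ℂ (h q.2) * S.rhoFun q.1 f q.2 :=
    (Complex.continuous_conj.measurable.comp
      ((Lp.stronglyMeasurable h).measurable.comp measurable_snd)).mul
      (S.measurable_rhoFun (Lp.stronglyMeasurable f).measurable)
  exact h1.stronglyMeasurable.integral_prod_right'.measurable

theorem norm_inner_rho_le (g : Mat R) (h f : Lp ℂ 2 μ) :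
    ‖inner ℂ h (S.rho μ g f)‖ ≤ ‖h‖ * ‖f‖ :=
  (norm_inner_le_norm _ _).trans
    (mul_le_mul_of_nonneg_left (S.norm_rho_apply_le μ g f) (norm_nonneg _))

section Average

variable {T : Type*} [MeasurableSpace T] (ν : Measure T) [SFinite ν] {k : T → ℂ} {Φ : T → Mat R}

theorem measurable_rhoFun_comp (hΦ : Measurable Φ) {f : R → ℂ} (hf : Measurable f) :
    Measurable fun q : R × T => S.rhoFun (Φ q.2) f q.1 := by
  have h1 : Measurable fun q : R × T => (Φ q.2, q.1) :=
    (hΦ.comp measurable_snd).prodMk measurable_fst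
  have h2 := S.measurable_rhoFun hf
  generalize S.rhoFun = F at h2 ⊢
  exact h2.comp h1

/-- The bound on which the construction of averages is based. -/
theorem lintegral_average_le (hk : Integrable k ν) (hΦ : Measurable Φ) (f : Lp ℂ 2 μ) :
    ∫⁻ v, (∫⁻ s, ‖k s * S.rhoFun (Φ s) f v‖ₑ ∂ν) ^ 2 ∂μ
      ≤ (∫⁻ s, ‖k s‖ₑ ∂ν) ^ 2 * ∫⁻ v, ‖f v‖ₑ ^ 2 ∂μ := by
  have hR : ProperSpace R := FiniteDimensional.proper ℂ R
  have hm : Measurable fun q : R × T => S.rhoFun (Φ q.2) f q.1 :=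
    S.measurable_rhoFun_comp hΦ (Lp.stronglyMeasurable f).measurable
  have hkm : AEMeasurable (fun s => ‖k s‖ₑ) ν := hk.aestronglyMeasurable.enorm
  calc ∫⁻ v, (∫⁻ s, ‖k s * S.rhoFun (Φ s) f v‖ₑ ∂ν) ^ 2 ∂μ
      ≤ ∫⁻ v, (∫⁻ s, ‖k s‖ₑ ∂ν) * ∫⁻ s, ‖k s‖ₑ * ‖S.rhoFun (Φ s) f v‖ₑ ^ 2 ∂ν ∂μ := by
        refine lintegral_mono fun v => ?_
        simp only [enorm_mul]
        exact lintegral_mul_sq_le ν hkm (hm.comp measurable_prodMk_left).enorm.aemeasurable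
    _ = (∫⁻ s, ‖k s‖ₑ ∂ν) * ∫⁻ s, ∫⁻ v, ‖k s‖ₑ * ‖S.rhoFun (Φ s) f v‖ₑ ^ 2 ∂μ ∂ν := by
        rw [lintegral_const_mul' _ _ hk.2.ne, lintegral_lintegral_swap]
        exact (hkm.comp_snd).mul (hm.enorm.pow_const 2).aemeasurable
    _ ≤ (∫⁻ s, ‖k s‖ₑ ∂ν) * ∫⁻ s, ‖k s‖ₑ * ∫⁻ v, ‖f v‖ₑ ^ 2 ∂μ ∂ν := by
        gcongr with s
        rw [lintegral_const_mul' _ _ enorm_ne_top]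
        exact mul_le_mul_right (S.lintegral_rhoFun_le μ _ f) _
    _ = _ := by
        rw [lintegral_mul_const'' _ hkm, pow_two, mul_assoc]

theorem ae_integrable_average (hk : Integrable k ν) (hΦ : Measurable Φ) (f : Lp ℂ 2 μ) :
    ∀ᵐ v ∂μ, Integrable (fun s => k s * S.rhoFun (Φ s) f v) ν := by
  have hR : ProperSpace R := FiniteDimensional.proper ℂ R
  have hm : Measurable fun q : R × T => S.rhoFun (Φ q.2) f q.1 :=
    S.measurable_rhoFun_comp hΦ (Lp.stronglyMeasurable f).measurable
  have hkm : AEMeasurable (fun s => ‖k s‖ₑ) ν := hk.aestronglyMeasurable.enorm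
  have h1 : ∫⁻ v, (∫⁻ s, ‖k s * S.rhoFun (Φ s) f v‖ₑ ∂ν) ^ 2 ∂μ ≠ ⊤ := by
    refine ((S.lintegral_average_le μ ν hk hΦ f).trans_lt (ENNReal.mul_lt_top ?_ ?_)).ne
    · exact ENNReal.pow_lt_top hk.2
    · rw [← ofReal_norm_sq]; exact ENNReal.ofReal_lt_top
  have h2 : AEMeasurable (fun v => (∫⁻ s, ‖k s * S.rhoFun (Φ s) f v‖ₑ ∂ν) ^ 2) μ := by
    simp only [enorm_mul]
    exact (AEMeasurable.lintegral_prod_right'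
      (f := fun q : R × T => ‖k q.2‖ₑ * ‖S.rhoFun (Φ q.2) f q.1‖ₑ)
      (hkm.comp_snd.mul hm.enorm.aemeasurable)).pow_const 2
  filter_upwards [ae_lt_top' h2 h1] with v hv
  refine ⟨hk.aestronglyMeasurable.mul (hm.comp measurable_prodMk_left).aestronglyMeasurable, ?_⟩
  rw [HasFiniteIntegral]
  by_contra hcon
  rw [not_lt, top_le_iff] at hcon
  rw [hcon] at hv
  simp at hv

theorem memLp_average (hk : Integrable k ν) (hΦ : Measurable Φ) (f : Lp ℂ 2 μ) :
    MemLp (fun v => ∫ s, k s * S.rhoFun (Φ s) f v ∂ν) 2 μ ∧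
      ∫⁻ v, ‖∫ s, k s * S.rhoFun (Φ s) f v ∂ν‖ₑ ^ 2 ∂μ
        ≤ ENNReal.ofReal ((∫ s, ‖k s‖ ∂ν) ^ 2) * ∫⁻ v, ‖f v‖ₑ ^ 2 ∂μ := by
  have hR : ProperSpace R := FiniteDimensional.proper ℂ R
  have hm : Measurable fun q : R × T => S.rhoFun (Φ q.2) f q.1 :=
    S.measurable_rhoFun_comp hΦ (Lp.stronglyMeasurable f).measurable
  have h1 : ∫⁻ v, ‖∫ s, k s * S.rhoFun (Φ s) f v ∂ν‖ₑ ^ 2 ∂μ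
        ≤ ENNReal.ofReal ((∫ s, ‖k s‖ ∂ν) ^ 2) * ∫⁻ v, ‖f v‖ₑ ^ 2 ∂μ := by
    rw [ENNReal.ofReal_pow (by positivity), ofReal_integral_norm_eq_lintegral_enorm hk]
    refine le_trans (lintegral_mono fun v => ?_) (S.lintegral_average_le μ ν hk hΦ f)
    gcongr
    exact enorm_integral_le_lintegral_enorm _
  refine ⟨memLp_two_of_lintegral ?_ ?_, h1⟩
  · exact AEStronglyMeasurable.integral_prod_right'
      (f := fun q : R × T => k q.2 * S.rhoFun (Φ q.2) f q.1)
      (hk.aestronglyMeasurable.comp_snd.mul hm.aestronglyMeasurable)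
  · refine (h1.trans_lt (ENNReal.mul_lt_top ENNReal.ofReal_lt_top ?_)).ne
    rw [← ofReal_norm_sq]; exact ENNReal.ofReal_lt_top

open Classical in
/-- The average of the operators `rho (Φ s)` with weights `k s`. -/
def avgOp (k : T → ℂ) (Φ : T → Mat R) : Lp ℂ 2 μ →L[ℂ] Lp ℂ 2 μ :=
  if h : Integrable k ν ∧ Measurable Φ then
    LinearMap.mkContinuous
      { toFun := fun f => (S.memLp_average μ ν h.1 h.2 f).1.toLp
        map_add' := fun f f' => by
          rw [← MemLp.toLp_add]
          refine MemLp.toLp_congr _ _ ?_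
          have h2 : ∀ᵐ v ∂μ, ∀ᵐ s ∂ν, S.rhoFun (Φ s) (f + f' : Lp ℂ 2 μ) v
              = S.rhoFun (Φ s) f v + S.rhoFun (Φ s) f' v := by
            have hm : ∀ f : Lp ℂ 2 μ, Measurable fun q : R × T => S.rhoFun (Φ q.2) f q.1 :=
              fun f => S.measurable_rhoFun_comp h.2 (Lp.stronglyMeasurable f).measurable
            have hR : ProperSpace R := FiniteDimensional.proper ℂ R
            rw [Measure.ae_ae_comm]
            · refine Eventually.of_forall fun s => ?_
              filter_upwards [S.rhoFun_congr (Lp.coeFn_add f f') (Φ s)] with v hv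
              rw [hv]; simp [rhoFun]; ring
            · exact measurableSet_eq_fun (hm _) ((hm f).add (hm f'))
          filter_upwards [S.ae_integrable_average μ ν h.1 h.2 f,
            S.ae_integrable_average μ ν h.1 h.2 f', h2] with v hv hv' hs
          rw [Pi.add_apply, ← integral_add hv hv']
          refine integral_congr_ae ?_
          filter_upwards [hs] with s hs
          rw [hs]; ring
        map_smul' := fun c f => by
          rw [RingHom.id_apply, ← MemLp.toLp_const_smul]
          refine MemLp.toLp_congr _ _ ?_
          have h2 : ∀ᵐ v ∂μ, ∀ᵐ s ∂ν, S.rhoFun (Φ s) (c • f : Lp ℂ 2 μ) v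
              = c * S.rhoFun (Φ s) f v := by
            have hm : ∀ f : Lp ℂ 2 μ, Measurable fun q : R × T => S.rhoFun (Φ q.2) f q.1 :=
              fun f => S.measurable_rhoFun_comp h.2 (Lp.stronglyMeasurable f).measurable
            have hR : ProperSpace R := FiniteDimensional.proper ℂ R
            rw [Measure.ae_ae_comm]
            · refine Eventually.of_forall fun s => ?_
              filter_upwards [S.rhoFun_congr (Lp.coeFn_smul c f) (Φ s)] with v hv
              rw [hv]; simp [rhoFun]; ring
            · exact measurableSet_eq_fun (hm _) ((hm f).const_mul c)
          filter_upwards [h2] with v hs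
          rw [Pi.smul_apply, smul_eq_mul, ← integral_const_mul]
          refine integral_congr_ae ?_
          filter_upwards [hs] with s hs
          rw [hs]; ring }
      (∫ s, ‖k s‖ ∂ν) fun f => by
        refine norm_le_of_lintegral_le (by positivity) ?_
        simp only [LinearMap.coe_mk, AddHom.coe_mk]
        refine le_trans (le_of_eq (lintegral_congr_ae ?_)) (S.memLp_average μ ν h.1 h.2 f).2
        filter_upwards [(S.memLp_average μ ν h.1 h.2 f).1.coeFn_toLp] with v hv
        rw [hv]
  else 0

variable {ν}

theorem avgOp_ae (hk : Integrable k ν) (hΦ : Measurable Φ) (f : Lp ℂ 2 μ) :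
    S.avgOp μ ν k Φ f =ᵐ[μ] fun v => ∫ s, k s * S.rhoFun (Φ s) f v ∂ν := by
  have h : Integrable k ν ∧ Measurable Φ := ⟨hk, hΦ⟩
  rw [avgOp, dif_pos h]
  exact (S.memLp_average μ ν h.1 h.2 f).1.coeFn_toLp

theorem inner_avgOp (hk : Integrable k ν) (hΦ : Measurable Φ) (h f : Lp ℂ 2 μ) :
    inner ℂ h (S.avgOp μ ν k Φ f) = ∫ s, k s * inner ℂ h (S.rho μ (Φ s) f) ∂ν := by
  have hR : ProperSpace R := FiniteDimensional.proper ℂ R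
  have hm : Measurable fun q : R × T => S.rhoFun (Φ q.2) f q.1 :=
    S.measurable_rhoFun_comp hΦ (Lp.stronglyMeasurable f).measurable
  have e1 : inner ℂ h (S.avgOp μ ν k Φ f)
      = ∫ v, ∫ s, starRingEnd ℂ (h v) * (k s * S.rhoFun (Φ s) f v) ∂ν ∂μ := by
    rw [L2.inner_def]
    refine integral_congr_ae ?_
    filter_upwards [S.avgOp_ae μ hk hΦ f] with v hv
    rw [hv, RCLike.inner_apply, mul_comm, integral_const_mul]
  rw [e1, integral_integral_swap]
  · refine integral_congr_ae (Eventually.of_forall fun s => ?_)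
    simp only [S.inner_rho]
    rw [← integral_const_mul]
    refine integral_congr_ae (Eventually.of_forall fun v => ?_)
    simp only
    ring
  · have hmeas : AEStronglyMeasurable (Function.uncurry fun v s =>
        starRingEnd ℂ (h v) * (k s * S.rhoFun (Φ s) f v)) (μ.prod ν) :=
      ((Complex.continuous_conj.measurable.comp
        (Lp.stronglyMeasurable h).measurable).comp measurable_fst).aestronglyMeasurable.mul
        (hk.aestronglyMeasurable.comp_snd.mul hm.aestronglyMeasurable)
    refine ⟨hmeas, ?_⟩
    rw [HasFiniteIntegral, lintegral_prod _ hmeas.enorm]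
    simp only [Function.uncurry_apply_pair]
    have hkm : AEMeasurable (fun s => ‖k s‖ₑ) ν := hk.aestronglyMeasurable.enorm
    have hG : AEMeasurable (fun v => ∫⁻ s, ‖k s * S.rhoFun (Φ s) f v‖ₑ ∂ν) μ := by
      simp only [enorm_mul]
      exact (AEMeasurable.lintegral_prod_right'
        (f := fun q : R × T => ‖k q.2‖ₑ * ‖S.rhoFun (Φ q.2) f q.1‖ₑ)
        (hkm.comp_snd.mul hm.enorm.aemeasurable))
    have e2 : ∀ v, ∫⁻ s, ‖starRingEnd ℂ (h v) * (k s * S.rhoFun (Φ s) f v)‖ₑ ∂ν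
        = ‖h v‖ₑ * ∫⁻ s, ‖k s * S.rhoFun (Φ s) f v‖ₑ ∂ν := by
      intro v
      rw [← lintegral_const_mul' _ _ enorm_ne_top]
      refine lintegral_congr fun s => ?_
      rw [enorm_mul, RCLike.enorm_conj]
    simp only [e2]
    have e3 := ENNReal.lintegral_mul_le_Lp_mul_Lq μ Real.HolderConjugate.two_two
      (f := fun v => ‖h v‖ₑ) (Lp.aestronglyMeasurable h).enorm hG
    refine e3.trans_lt (ENNReal.mul_lt_top ?_ ?_)
    · refine ENNReal.rpow_lt_top_of_nonneg (by norm_num) ?_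
      have := ofReal_norm_sq h
      simp only [ENNReal.rpow_ofNat]
      rw [← this]; exact ENNReal.ofReal_ne_top
    · refine ENNReal.rpow_lt_top_of_nonneg (by norm_num) ?_
      simp only [ENNReal.rpow_ofNat]
      refine ((S.lintegral_average_le μ ν hk hΦ f).trans_lt (ENNReal.mul_lt_top ?_ ?_)).ne
      · exact ENNReal.pow_lt_top hk.2
      · rw [← ofReal_norm_sq]; exact ENNReal.ofReal_lt_top

theorem integrable_mul_inner (hk : Integrable k ν) (hΦ : Measurable Φ) (h f : Lp ℂ 2 μ) :
    Integrable (fun s => k s * inner ℂ h (S.rho μ (Φ s) f)) ν :=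
  hk.mul_bdd (c := ‖h‖ * ‖f‖) ((S.measurable_inner_rho μ h f).comp hΦ).aestronglyMeasurable
    (Eventually.of_forall fun s => S.norm_inner_rho_le μ (Φ s) h f)

end Average

end Measure

end SiteData

theorem opNorm_le_of_inner_le {H : Type*} [NormedAddCommGroup H] [InnerProductSpace ℂ H]
    {A : H →L[ℂ] H} {C : ℝ} (hC : 0 ≤ C) (h : ∀ x y, ‖inner ℂ x (A y)‖ ≤ C * (‖x‖ * ‖y‖)) :
    ‖A‖ ≤ C := by
  refine A.opNorm_le_bound hC fun y => ?_
  have h1 := h (A y) y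
  rw [inner_self_eq_norm_sq_to_K, norm_pow, RCLike.norm_ofReal, abs_norm] at h1
  by_cases h0 : ‖A y‖ = 0
  · rw [h0]; positivity
  · have : 0 < ‖A y‖ := lt_of_le_of_ne (norm_nonneg _) (Ne.symm h0)
    nlinarith

theorem clm_ext_inner {H : Type*} [NormedAddCommGroup H] [InnerProductSpace ℂ H]
    {A B : H →L[ℂ] H} (h : ∀ x y, inner ℂ x (A y) = inner ℂ x (B y)) : A = B := by
  ext y
  exact ext_inner_left ℂ fun x => h x y

theorem opNorm_le_of_inner_le_one {H : Type*} [NormedAddCommGroup H] [InnerProductSpace ℂ H]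
    {A : H →L[ℂ] H} {C : ℝ} (hC : 0 ≤ C)
    (h : ∀ x y, ‖x‖ ≤ 1 → ‖y‖ ≤ 1 → ‖inner ℂ x (A y)‖ ≤ C) : ‖A‖ ≤ C := by
  refine opNorm_le_of_inner_le hC fun x y => ?_
  by_cases hx : x = 0
  · simp [hx]
  by_cases hy : y = 0
  · simp [hy]
  have hx' : 0 < ‖x‖ := norm_pos_iff.2 hx
  have hy' : 0 < ‖y‖ := norm_pos_iff.2 hy
  have h1 := h (((‖x‖⁻¹ : ℝ) : ℂ) • x) (((‖y‖⁻¹ : ℝ) : ℂ) • y)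
    (by rw [norm_smul, Complex.norm_real, norm_inv, norm_norm, inv_mul_cancel₀ hx'.ne'])
    (by rw [norm_smul, Complex.norm_real, norm_inv, norm_norm, inv_mul_cancel₀ hy'.ne'])
  rw [map_smul, inner_smul_left, inner_smul_right, Complex.conj_ofReal, norm_mul, norm_mul,
    Complex.norm_real, Complex.norm_real, norm_inv, norm_inv, norm_norm, norm_norm] at h1
  have h2 : ‖inner ℂ x (A y)‖ = (‖x‖ * ‖y‖) * (‖x‖⁻¹ * (‖y‖⁻¹ * ‖inner ℂ x (A y)‖)) := by
    field_simp
  rw [h2, mul_comm C]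
  gcongr

namespace SiteData

variable {κ : Type*} [Fintype κ] {R : Type*} [NormedCommRing R] [NormedAlgebra ℂ R]
  [FiniteDimensional ℂ R] (S : SiteData κ R)
  [MeasurableSpace R] [BorelSpace R] (μ : Measure R) [μ.IsAddHaarMeasure]
  {T : Type*} [MeasurableSpace T] {ν : Measure T} [SFinite ν] {k k' : T → ℂ} {Φ Φ' : T → Mat R}

theorem inner_adjoint_rho (g : Mat R) (h f : Lp ℂ 2 μ) :
    inner ℂ (ContinuousLinearMap.adjoint (S.rho μ g) h) f = inner ℂ h (S.rho μ g f) :=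
  ContinuousLinearMap.adjoint_inner_left _ _ _

theorem norm_avgOp_sub_le (hk : Integrable k ν) (hk' : Integrable k' ν) (hΦ : Measurable Φ) :
    ‖S.avgOp μ ν k Φ - S.avgOp μ ν k' Φ‖ ≤ ∫ s, ‖k s - k' s‖ ∂ν := by
  refine opNorm_le_of_inner_le (by positivity) fun h f => ?_
  rw [_root_.sub_apply, inner_sub_right, S.inner_avgOp μ hk hΦ, S.inner_avgOp μ hk' hΦ,
    ← integral_sub (S.integrable_mul_inner μ hk hΦ h f) (S.integrable_mul_inner μ hk' hΦ h f),
    ← integral_mul_const]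
  refine norm_integral_le_of_norm_le ((hk.sub hk').norm.mul_const _) (Eventually.of_forall fun s => ?_)
  rw [← sub_mul, norm_mul]
  exact mul_le_mul_of_nonneg_left (S.norm_inner_rho_le μ _ _ _) (norm_nonneg _)

theorem norm_avgOp_sub_le_of_forall (hk : Integrable k ν) (hΦ : Measurable Φ) (hΦ' : Measurable Φ')
    {ε : ℝ} (hε : 0 ≤ ε) (h : ∀ m : Mat R → ℂ, Measurable m → (∀ y, ‖m y‖ ≤ 1) →
      ‖∫ s, k s * m (Φ s) ∂ν - ∫ s, k s * m (Φ' s) ∂ν‖ ≤ ε) :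
    ‖S.avgOp μ ν k Φ - S.avgOp μ ν k Φ'‖ ≤ ε := by
  refine opNorm_le_of_inner_le_one hε fun x y hx hy => ?_
  rw [_root_.sub_apply, inner_sub_right, S.inner_avgOp μ hk hΦ, S.inner_avgOp μ hk hΦ']
  refine h _ (S.measurable_inner_rho μ x y) fun g => (S.norm_inner_rho_le μ g x y).trans ?_
  nlinarith [norm_nonneg x, norm_nonneg y]

theorem rho_mul_avgOp (hk : Integrable k ν) (hΦ : Measurable Φ) (g : Mat R) :
    S.rho μ g * S.avgOp μ ν k Φ = S.avgOp μ ν k fun s => Φ s * g := by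
  refine clm_ext_inner fun x y => ?_
  rw [mul_apply_eq_comp, ← S.inner_adjoint_rho, S.inner_avgOp μ hk hΦ,
    S.inner_avgOp μ hk (hΦ.mul_const g)]
  simp only [S.inner_adjoint_rho, S.rho_mul, mul_apply_eq_comp]

theorem avgOp_mul {T' : Type*} [MeasurableSpace T'] {ν' : Measure T'} [SFinite ν'] {l : T' → ℂ}
    {Ψ : T' → Mat R} (hk : Integrable k ν) (hΦ : Measurable Φ) (hl : Integrable l ν')
    (hΨ : Measurable Ψ) : S.avgOp μ ν k Φ * S.avgOp μ ν' l Ψ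
      = S.avgOp μ (ν.prod ν') (fun q => k q.1 * l q.2) fun q => Ψ q.2 * Φ q.1 := by
  have hm : Measurable fun q : T × T' => Ψ q.2 * Φ q.1 :=
    (hΨ.comp measurable_snd).mul (hΦ.comp measurable_fst)
  have hkl := hk.mul_prod hl
  refine clm_ext_inner fun x y => ?_
  rw [mul_apply_eq_comp, S.inner_avgOp μ hk hΦ, S.inner_avgOp μ hkl hm,
    integral_prod _ (S.integrable_mul_inner μ hkl hm x y)]
  refine integral_congr_ae (Eventually.of_forall fun s => ?_)
  simp only
  rw [← S.inner_adjoint_rho, S.inner_avgOp μ hl hΨ, ← integral_const_mul]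
  refine integral_congr_ae (Eventually.of_forall fun s' => ?_)
  simp only [S.inner_adjoint_rho, S.rho_mul, mul_apply_eq_comp]
  ring

theorem avgOp_comp_measurePreserving {T' : Type*} [MeasurableSpace T'] {ν' : Measure T'}
    [SFinite ν'] (e : T' ≃ᵐ T) (he : MeasurePreserving e ν' ν) (hk : Integrable k ν)
    (hΦ : Measurable Φ) : S.avgOp μ ν' (k ∘ e) (Φ ∘ e) = S.avgOp μ ν k Φ := by
  refine clm_ext_inner fun x y => ?_
  rw [S.inner_avgOp μ hk hΦ, S.inner_avgOp μ (he.integrable_comp_of_integrable hk)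
    (hΦ.comp e.measurable), ← he.integral_comp e.measurableEmbedding]
  rfl

theorem continuous_adj : Continuous (Mat.adj : Mat R → Mat R) := by
  have h : (Mat.adj : Mat R → Mat R) = fun g => Mat.mkL (g.d, -g.b, -g.c, g.a) := rfl
  rw [h]; fun_prop

theorem adjoint_avgOp (hk : Integrable k ν) (hΦ : Measurable Φ) :
    ContinuousLinearMap.adjoint (S.avgOp μ ν k Φ)
      = S.avgOp μ ν (fun s => starRingEnd ℂ (k s * S.χ (Φ s).det)) fun s => (Φ s).adj := by
  have hR : ProperSpace R := FiniteDimensional.proper ℂ R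
  have hk' : Integrable (fun s => starRingEnd ℂ (k s * S.χ (Φ s).det)) ν := by
    have := hk.mul_bdd (c := 1) (g := fun s => S.χ (Φ s).det) (S.measurable_χ.comp
      (Mat.continuous_det.measurable.comp hΦ)).aestronglyMeasurable
      (Eventually.of_forall fun s => S.norm_χ_le _)
    exact (LinearIsometryEquiv.integrable_comp_iff Complex.conjLIE).2 this
  have hΦ' : Measurable fun s => (Φ s).adj := continuous_adj.measurable.comp hΦ
  refine clm_ext_inner fun x y => ?_
  rw [ContinuousLinearMap.adjoint_inner_right, ← inner_conj_symm, S.inner_avgOp μ hk hΦ,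
    S.inner_avgOp μ hk' hΦ', ← integral_conj]
  refine integral_congr_ae (Eventually.of_forall fun s => ?_)
  simp only [map_mul, inner_conj_symm]
  rw [← ContinuousLinearMap.adjoint_inner_right, S.adjoint_rho, _root_.smul_apply,
    inner_smul_right]
  ring

theorem norm_avgOp_mul_sub_le {W : Lp ℂ 2 μ →L[ℂ] Lp ℂ 2 μ} (hk : Integrable k ν)
    (hΦ : Measurable Φ) {ε : ℝ} (hε : 0 ≤ ε)
    (h : ∀ᵐ s ∂ν, k s ≠ 0 → ‖S.rho μ (Φ s) * W - W‖ ≤ ε) :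
    ‖S.avgOp μ ν k Φ * W - (∫ s, k s ∂ν) • W‖ ≤ ε * ∫ s, ‖k s‖ ∂ν := by
  refine opNorm_le_of_inner_le (by positivity) fun x y => ?_
  rw [_root_.sub_apply, inner_sub_right, mul_apply_eq_comp, S.inner_avgOp μ hk hΦ,
    _root_.smul_apply, inner_smul_right, ← integral_mul_const,
    ← integral_sub (S.integrable_mul_inner μ hk hΦ _ _) (hk.mul_const _)]
  rw [mul_comm ε, mul_assoc, ← integral_mul_const]
  refine norm_integral_le_of_norm_le (hk.norm.mul_const _) ?_
  filter_upwards [h] with s hs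
  rw [← mul_sub, norm_mul]
  by_cases hks : k s = 0
  · simp [hks]
  refine mul_le_mul_of_nonneg_left ?_ (norm_nonneg _)
  have e : inner ℂ x (S.rho μ (Φ s) (W y)) - inner ℂ x (W y)
      = inner ℂ x ((S.rho μ (Φ s) * W - W) y) := by
    rw [_root_.sub_apply, inner_sub_right, mul_apply_eq_comp]
  rw [e]
  calc _ ≤ ‖x‖ * ‖(S.rho μ (Φ s) * W - W) y‖ := norm_inner_le_norm _ _
    _ ≤ ‖x‖ * (ε * ‖y‖) := by
        gcongr
        exact ContinuousLinearMap.le_of_opNorm_le _ (hs hks) y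
    _ = _ := by ring

end SiteData

theorem memLp_two_of_integrable_of_bdd {X : Type*} [MeasurableSpace X] {μ : Measure X} {f : X → ℂ}
    (hf : Integrable f μ) {M : ℝ} (hM : ∀ x, ‖f x‖ ≤ M) : MemLp f 2 μ := by
  refine memLp_two_of_lintegral hf.aestronglyMeasurable ?_
  have h1 : ∫⁻ x, ‖f x‖ₑ ^ 2 ∂μ ≤ ∫⁻ x, ENNReal.ofReal M * ‖f x‖ₑ ∂μ := by
    refine lintegral_mono fun x => ?_
    rw [pow_two]
    gcongr
    rw [← ofReal_norm]
    exact ENNReal.ofReal_le_ofReal (hM x)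
  rw [lintegral_const_mul' _ _ ENNReal.ofReal_ne_top] at h1
  exact (h1.trans_lt (ENNReal.mul_lt_top ENNReal.ofReal_lt_top hf.2)).ne

/-- Bounded measurable functions vanishing outside of a ball. -/
structure BddCpt {E : Type*} [NormedAddCommGroup E] [MeasurableSpace E] (f : E → ℂ) : Prop where
  measurable : Measurable f
  bdd : ∃ M : ℝ, ∀ x, ‖f x‖ ≤ M
  cpt : ∃ r : ℝ, ∀ x, r < ‖x‖ → f x = 0

namespace BddCpt

variable {E : Type*} [NormedAddCommGroup E] [NormedSpace ℝ E] [FiniteDimensional ℝ E]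
  [MeasurableSpace E] [BorelSpace E] (μ : Measure E) [μ.IsAddHaarMeasure] {f g : E → ℂ}

theorem memLp (hf : BddCpt f) (p : ENNReal) : MemLp f p μ := by
  have hE : ProperSpace E := FiniteDimensional.proper ℝ E
  obtain ⟨M, hM⟩ := hf.bdd
  obtain ⟨r, hr⟩ := hf.cpt
  have h1 : f = (Metric.closedBall (0 : E) r).indicator f := by
    funext x
    by_cases hx : x ∈ Metric.closedBall (0 : E) r
    · rw [indicator_of_mem hx]
    · rw [indicator_of_notMem hx]
      rw [mem_closedBall_zero_iff, not_le] at hx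
      exact hr x hx
  rw [h1, memLp_indicator_iff_restrict Metric.isClosed_closedBall.measurableSet]
  have : IsFiniteMeasure (μ.restrict (Metric.closedBall (0 : E) r)) :=
    ⟨by rw [Measure.restrict_apply_univ]; exact (isCompact_closedBall _ _).measure_lt_top⟩
  exact MemLp.of_bound hf.measurable.aestronglyMeasurable M (Eventually.of_forall hM)

theorem integrable (hf : BddCpt f) : Integrable f μ := memLp_one_iff_integrable.1 (hf.memLp μ 1)

theorem sub (hf : BddCpt f) (hg : BddCpt g) : BddCpt fun x => f x - g x := by
  obtain ⟨M, hM⟩ := hf.bdd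
  obtain ⟨r, hr⟩ := hf.cpt
  obtain ⟨M', hM'⟩ := hg.bdd
  obtain ⟨r', hr'⟩ := hg.cpt
  refine ⟨hf.measurable.sub hg.measurable, ⟨M + M', fun x => (norm_sub_le _ _).trans
    (add_le_add (hM x) (hM' x))⟩, ⟨max r r', fun x hx => ?_⟩⟩
  rw [hr x ((le_max_left _ _).trans_lt hx), hr' x ((le_max_right _ _).trans_lt hx), sub_zero]

theorem comp_sub (hf : BddCpt f) (h : E) : BddCpt fun x => f (x - h) := by
  have hE : ProperSpace E := FiniteDimensional.proper ℝ E
  obtain ⟨M, hM⟩ := hf.bdd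
  obtain ⟨r, hr⟩ := hf.cpt
  refine ⟨hf.measurable.comp (by fun_prop), ⟨M, fun x => hM _⟩, ⟨r + ‖h‖, fun x hx => hr _ ?_⟩⟩
  have := norm_sub_norm_le x h
  linarith

theorem mul_bdd (hf : BddCpt f) (hg : Measurable g)
    (hb : ∀ r : ℝ, ∃ M : ℝ, ∀ x, ‖x‖ ≤ r → ‖g x‖ ≤ M) : BddCpt fun x => f x * g x := by
  obtain ⟨M, hM⟩ := hf.bdd
  obtain ⟨r, hr⟩ := hf.cpt
  obtain ⟨M', hM'⟩ := hb r
  refine ⟨hf.measurable.mul hg, ⟨|M| * |M'|, fun x => ?_⟩, ⟨r, fun x hx => by rw [hr x hx, zero_mul]⟩⟩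
  by_cases hx : r < ‖x‖
  · rw [hr x hx, zero_mul, norm_zero]; positivity
  · rw [norm_mul]
    exact mul_le_mul ((hM x).trans (le_abs_self _)) ((hM' x (not_lt.1 hx)).trans (le_abs_self _))
      (norm_nonneg _) (abs_nonneg _)

end BddCpt

namespace SiteData

variable {κ : Type*} [Fintype κ] {R : Type*} [NormedCommRing R] [NormedAlgebra ℂ R]
  [FiniteDimensional ℂ R] (S : SiteData κ R)

/-- Multiplication by a unit, as a homeomorphism. -/
def unitHomeo (b : Rˣ) : R ≃ₜ R where
  toFun y := b * y
  invFun y := (b⁻¹ : Rˣ) * y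
  left_inv y := by simp
  right_inv y := by simp
  continuous_toFun := by fun_prop
  continuous_invFun := by fun_prop

/-- The pairing `Re (ℓ (v * ζ))`. -/
def pairing : R →ₗ[ℝ] R →ₗ[ℝ] ℝ :=
  LinearMap.mk₂ ℝ (fun v ζ => (S.ℓ (v * ζ)).re)
    (fun v w ζ => by simp [add_mul]) (fun c v ζ => by
      have : (c • v) * ζ = (c : ℂ) • (v * ζ) := by
        rw [smul_mul_assoc]; exact (Complex.coe_smul c (v * ζ)).symm
      rw [this, map_smul]; simp)
    (fun v w ζ => by simp [mul_add]) (fun c v ζ => by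
      have : v * (c • ζ) = (c : ℂ) • (v * ζ) := by
        rw [mul_smul_comm]; exact (Complex.coe_smul c (v * ζ)).symm
      rw [this, map_smul]; simp)

theorem pairing_apply (v ζ : R) : S.pairing v ζ = (S.ℓ (v * ζ)).re := rfl

theorem pairing_nondeg (ζ : R) (h : ∀ v, S.pairing v ζ = 0) : ζ = 0 := by
  refine S.ℓ_nondeg ζ fun v => Complex.ext (h v) ?_
  have h1 := h (Complex.I • v)
  rw [pairing_apply, smul_mul_assoc, map_smul, smul_eq_mul, Complex.mul_re] at h1
  simpa using h1

theorem continuous_pairing : Continuous fun q : R × R => S.pairing q.1 q.2 := by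
  have : Continuous S.ℓ := S.ℓ.continuous_of_finiteDimensional
  simp only [pairing_apply]
  fun_prop

/-- The matrices with rows `(1, y)` and `(0, b)`. -/
def aff (q : R × R) : Mat R := ⟨1, q.2, 0, q.1⟩

theorem continuous_aff : Continuous (aff : R × R → Mat R) := by
  have : (aff : R × R → Mat R) = fun q => Mat.mkL (1, q.2, 0, q.1) := rfl
  rw [this]; fun_prop

variable [MeasurableSpace R] [BorelSpace R] (μ : Measure R) [μ.IsAddHaarMeasure]

theorem map_unitHomeo (b : Rˣ) : Measure.map (unitHomeo b) μ = ENNReal.ofReal (S.nm b)⁻¹ • μ := by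
  have h1 : |LinearMap.det (LinearMap.mulLeft ℝ (b : R))| = S.nm b := S.abs_det _
  have h2 : LinearMap.det (LinearMap.mulLeft ℝ (b : R)) ≠ 0 := by
    rw [← abs_ne_zero, h1]; exact S.isUnit_iff_nm_ne_zero.1 b.isUnit
  have h3 := Measure.map_linearMap_addHaar_eq_smul_addHaar μ h2
  rw [abs_inv, h1] at h3
  exact h3

theorem lintegral_comp_mul {b : R} (hb : IsUnit b) (w : R) (G : R → ENNReal) :
    ∫⁻ y, G (b * y - w) ∂μ = ENNReal.ofReal (S.nm b)⁻¹ * ∫⁻ y, G y ∂μ := by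
  obtain ⟨b, rfl⟩ := hb
  have h := (unitHomeo b).measurableEmbedding.lintegral_map (μ := μ) fun y => G (y - w)
  rw [S.map_unitHomeo, lintegral_smul_measure, smul_eq_mul, lintegral_sub_right_eq_self] at h
  exact h.symm

theorem integral_comp_mul {b : R} (hb : IsUnit b) (w : R) (G : R → ℂ) :
    ∫ y, G (b * y - w) ∂μ = ((S.nm b)⁻¹ : ℝ) • ∫ y, G y ∂μ := by
  obtain ⟨b, rfl⟩ := hb
  have h := (unitHomeo b).measurableEmbedding.integral_map (μ := μ) fun y => G (y - w)
  rw [S.map_unitHomeo, integral_smul_measure, integral_sub_right_eq_self,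
    ENNReal.toReal_ofReal (inv_nonneg.2 (S.nm_nonneg _))] at h
  exact h.symm

theorem rhoFun_aff (q : R × R) (f : R → ℂ) (v : R) : S.rhoFun (aff q) f v
    = S.χ q.1 * ((√(S.nm q.1) * (S.nm q.1)⁻¹ : ℝ) : ℂ) * f ((v + q.2) * Ring.inverse q.1) := by
  have h1 : den (aff q) v = q.1 := by simp [den, aff]
  have h2 : (aff q).det = q.1 := by simp [Mat.det, aff]
  rw [rhoFun, act, h1, h2]
  simp [aff]

/-- The function by which dilations are averaged. -/
def dilWeight (a : R → ℂ) (b : R) : ℂ := a b * (S.χ b * (√(S.nm b) : ℝ))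

theorem bddCpt_dilWeight {a : R → ℂ} (ha : BddCpt a) : BddCpt (S.dilWeight a) := by
  have hR : ProperSpace R := FiniteDimensional.proper ℂ R
  refine ha.mul_bdd (S.measurable_χ.mul
    (Complex.measurable_ofReal.comp S.continuous_nm.sqrt.measurable)) fun r => ?_
  obtain ⟨M, hM⟩ := (isCompact_closedBall (0 : R) r).exists_bound_of_continuousOn
    (S.continuous_nm.sqrt.continuousOn (s := Metric.closedBall 0 r))
  refine ⟨M, fun x hx => ?_⟩
  rw [norm_mul, Complex.norm_real]
  have := hM x (mem_closedBall_zero_iff.2 hx)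
  nlinarith [S.norm_χ_le x, norm_nonneg (√(S.nm x))]

/-- The kernel of an average of translations and dilations. -/
def affKernel (a c : R → ℂ) (v y : R) : ℂ := ∫ b, S.dilWeight a b * c (b * y - v) ∂μ

theorem avgOp_aff_ae {a c : R → ℂ} (ha : BddCpt a) (hc : BddCpt c) (f : Lp ℂ 2 μ) :
    ∀ᵐ v ∂μ, S.avgOp μ (μ.prod μ) (fun q => a q.1 * c q.2) aff f v
      = ∫ y, S.affKernel μ a c v y * f y ∂μ := by
  have hR : ProperSpace R := FiniteDimensional.proper ℂ R
  have hk : Integrable (fun q : R × R => a q.1 * c q.2) (μ.prod μ) :=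
    (ha.integrable μ).mul_prod (hc.integrable μ)
  have hΦ : Measurable (aff : R × R → Mat R) := continuous_aff.measurable
  have hunit : ∀ᵐ b ∂μ, IsUnit b := by
    have := S.ae_isUnit_mul_add μ (a := 1) (b := 0) fun i => by simp
    simpa using this
  have hfm : Measurable f := (Lp.stronglyMeasurable f).measurable
  filter_upwards [S.avgOp_ae μ hk hΦ f, S.ae_integrable_average μ _ hk hΦ f] with v hv hint
  set F : R × R → ℂ := fun q => a q.1 * c q.2 * S.rhoFun (aff q) f v with hF
  set G : R × R → ℂ := fun q => S.dilWeight a q.1 * c (q.1 * q.2 - v) * f q.2 with hG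
  have hFG : ∀ b, IsUnit b → ∀ y, F (b, b * y - v) = ((S.nm b)⁻¹ : ℝ) * G (b, y) := by
    intro b hb y
    simp only [hF, hG, S.rhoFun_aff, dilWeight]
    have h1 : (v + (b * y - v)) * Ring.inverse b = y := by
      rw [add_sub_cancel, mul_comm b, mul_assoc, Ring.mul_inverse_cancel _ hb, mul_one]
    rw [h1]; push_cast; ring
  have hGm : Measurable G := by
    have h1 : Measurable fun q : R × R => q.1 * q.2 - v := by fun_prop
    exact (((S.bddCpt_dilWeight ha).measurable.comp measurable_fst).mul
      (hc.measurable.comp h1)).mul (hfm.comp measurable_snd)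
  have hin : ∀ b, IsUnit b → ∫ y, F (b, y) ∂μ = ∫ y, G (b, y) ∂μ := by
    intro b hb
    have h1 := S.integral_comp_mul μ hb v fun y => F (b, y)
    simp only [hFG b hb] at h1
    rw [integral_const_mul, Complex.real_smul] at h1
    have h2 : ((S.nm b)⁻¹ : ℝ) ≠ 0 := inv_ne_zero (S.isUnit_iff_nm_ne_zero.1 hb)
    exact (mul_left_cancel₀ (Complex.ofReal_ne_zero.2 h2) h1).symm
  have hlin : ∀ b, IsUnit b → ∫⁻ y, ‖F (b, y)‖ₑ ∂μ = ∫⁻ y, ‖G (b, y)‖ₑ ∂μ := by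
    intro b hb
    have h1 := S.lintegral_comp_mul μ hb v fun y => ‖F (b, y)‖ₑ
    have h2 : 0 < ((S.nm b)⁻¹ : ℝ) := inv_pos.2 (S.nm_pos hb)
    simp only [hFG b hb, enorm_mul] at h1
    have h3 : ‖(((S.nm b)⁻¹ : ℝ) : ℂ)‖ₑ = ENNReal.ofReal (S.nm b)⁻¹ := by
      rw [← ofReal_norm, Complex.norm_real, Real.norm_of_nonneg h2.le]
    rw [lintegral_const_mul' _ _ enorm_ne_top, h3] at h1
    exact ((ENNReal.mul_right_inj (ENNReal.ofReal_pos.2 h2).ne' ENNReal.ofReal_ne_top).1 h1).symm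
  have hGi : Integrable G (μ.prod μ) := by
    refine ⟨hGm.aestronglyMeasurable, ?_⟩
    have h1 : ∫⁻ q, ‖G q‖ₑ ∂(μ.prod μ) = ∫⁻ q, ‖F q‖ₑ ∂(μ.prod μ) := by
      rw [lintegral_prod _ hGm.enorm.aemeasurable, lintegral_prod _ hint.aestronglyMeasurable.enorm]
      refine lintegral_congr_ae ?_
      filter_upwards [hunit] with b hb
      rw [hlin b hb]
    rw [HasFiniteIntegral, h1]
    exact hint.2
  rw [hv]
  calc ∫ q, F q ∂(μ.prod μ) = ∫ b, ∫ y, F (b, y) ∂μ ∂μ := integral_prod _ hint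
    _ = ∫ b, ∫ y, G (b, y) ∂μ ∂μ := by
        refine integral_congr_ae ?_
        filter_upwards [hunit] with b hb
        exact hin b hb
    _ = ∫ y, ∫ b, G (b, y) ∂μ ∂μ := integral_integral_swap hGi
    _ = _ := by
        refine integral_congr_ae (Eventually.of_forall fun y => ?_)
        simp only [hG, affKernel]
        rw [integral_mul_const]

theorem measurable_affKernel {a c : R → ℂ} (ha : BddCpt a) (hc : BddCpt c) :
    Measurable (Function.uncurry (S.affKernel μ a c)) := by
  have hR : ProperSpace R := FiniteDimensional.proper ℂ R
  have h1 : Measurable fun q : (R × R) × R => S.dilWeight a q.2 * c (q.2 * q.1.2 - q.1.1) :=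
    ((S.bddCpt_dilWeight ha).measurable.comp measurable_snd).mul
      (hc.measurable.comp (by fun_prop))
  exact h1.stronglyMeasurable.integral_prod_right'.measurable

theorem affKernel_fourier {a c : R → ℂ} (ha : BddCpt a) (hc : BddCpt c) (y : R) :
    Integrable (fun v => S.affKernel μ a c v y) μ ∧ MemLp (fun v => S.affKernel μ a c v y) 2 μ ∧
    ∀ ζ, pairingFourier μ S.pairing (fun v => S.affKernel μ a c v y) ζ
      = pairingFourier μ S.pairing (S.dilWeight a) (y * ζ) * pairingFourier μ S.pairing c (-ζ) := by
  have hR : ProperSpace R := FiniteDimensional.proper ℂ R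
  have hw := S.bddCpt_dilWeight ha
  have hswap : Integrable (fun q : R × R => S.dilWeight a q.1 * c (q.1 * y - q.2)) (μ.prod μ) := by
    have hm : Measurable fun q : R × R => S.dilWeight a q.1 * c (q.1 * y - q.2) :=
      (hw.measurable.comp measurable_fst).mul (hc.measurable.comp (by fun_prop))
    refine ⟨hm.aestronglyMeasurable, ?_⟩
    rw [HasFiniteIntegral, lintegral_prod _ hm.enorm.aemeasurable]
    simp only [enorm_mul]
    have h1 : ∀ b, ∫⁻ v, ‖S.dilWeight a b‖ₑ * ‖c (b * y - v)‖ₑ ∂μ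
        = ‖S.dilWeight a b‖ₑ * ∫⁻ v, ‖c v‖ₑ ∂μ := by
      intro b
      rw [lintegral_const_mul' _ _ enorm_ne_top, lintegral_sub_left_eq_self (fun v => ‖c v‖ₑ)]
    simp only [h1]
    rw [lintegral_mul_const'' _ hw.measurable.enorm.aemeasurable]
    exact ENNReal.mul_lt_top (hw.integrable μ).2 (hc.integrable μ).2
  have hi : Integrable (fun v => S.affKernel μ a c v y) μ := hswap.integral_prod_right
  obtain ⟨M, hM⟩ := hc.bdd
  have hbd : ∀ v, ‖S.affKernel μ a c v y‖ ≤ ∫ b, ‖S.dilWeight a b‖ * M ∂μ := by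
    intro v
    refine norm_integral_le_of_norm_le ((hw.integrable μ).norm.mul_const M)
      (Eventually.of_forall fun b => ?_)
    rw [norm_mul]
    exact mul_le_mul_of_nonneg_left (hM _) (norm_nonneg _)
  refine ⟨hi, ?_, fun ζ => ?_⟩
  · exact memLp_two_of_integrable_of_bdd hi hbd
  · simp only [pairingFourier, affKernel]
    have e1 : ∀ v, Complex.exp (-(Complex.I * (S.pairing v ζ : ℝ))) *
        ∫ b, S.dilWeight a b * c (b * y - v) ∂μ
        = ∫ b, Complex.exp (-(Complex.I * (S.pairing v ζ : ℝ))) *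
          (S.dilWeight a b * c (b * y - v)) ∂μ := fun v => (integral_const_mul _ _).symm
    simp only [e1]
    rw [integral_integral_swap]
    · rw [← integral_mul_const]
      refine integral_congr_ae (Eventually.of_forall fun b => ?_)
      simp only
      rw [← integral_sub_left_eq_self _ μ (b * y), ← integral_const_mul]
      refine integral_congr_ae (Eventually.of_forall fun v => ?_)
      simp only [sub_sub_cancel]
      have e2 : Complex.exp (-(Complex.I * (S.pairing (b * y - v) ζ : ℝ)))
          = Complex.exp (-(Complex.I * (S.pairing b (y * ζ) : ℝ))) *
            Complex.exp (-(Complex.I * (S.pairing v (-ζ) : ℝ))) := by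
        rw [← Complex.exp_add]
        congr 1
        have : S.pairing (b * y) ζ = S.pairing b (y * ζ) := by
          simp only [pairing_apply, mul_assoc]
        rw [map_sub, LinearMap.sub_apply, this, map_neg]
        push_cast; ring
      rw [e2]; ring
    · have hsw := hswap.swap
      refine hsw.bdd_mul (c := 1) (f := fun q : R × R =>
        Complex.exp (-(Complex.I * (S.pairing q.1 ζ : ℝ)))) ?_ (Eventually.of_forall fun q => ?_)
      · have : Continuous fun q : R × R => S.pairing q.1 ζ :=
          S.continuous_pairing.comp (by fun_prop : Continuous fun q : R × R => (q.1, ζ))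
        exact (by fun_prop : Continuous fun q : R × R =>
          Complex.exp (-(Complex.I * (S.pairing q.1 ζ : ℝ)))).aestronglyMeasurable
      · rw [Complex.norm_exp]; simp

theorem measurable_pairingFourier {u : R → ℂ} (hu : Measurable u) :
    Measurable (pairingFourier μ S.pairing u) := by
  have hR : ProperSpace R := FiniteDimensional.proper ℂ R
  have h1 : Measurable fun q : R × R => Complex.exp (-(Complex.I * (S.pairing q.2 q.1 : ℝ))) * u q.2 := by
    refine Measurable.mul ?_ (hu.comp measurable_snd)
    have : Continuous fun q : R × R => S.pairing q.2 q.1 :=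
      S.continuous_pairing.comp (by fun_prop : Continuous fun q : R × R => (q.2, q.1))
    exact (by fun_prop : Continuous fun q : R × R =>
      Complex.exp (-(Complex.I * (S.pairing q.2 q.1 : ℝ)))).measurable
  exact h1.stronglyMeasurable.integral_prod_right'.measurable

theorem lintegral_pairingFourier_lt_top {u : R → ℂ} (hu : BddCpt u) :
    ∫⁻ ζ, ‖pairingFourier μ S.pairing u ζ‖ₑ ^ 2 ∂μ < ⊤ := by
  obtain ⟨C, hC0, hCt, hC⟩ := exists_plancherel_const μ S.pairing S.pairing_nondeg
  rw [hC u (hu.integrable μ) (hu.memLp μ 2)]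
  refine ENNReal.mul_lt_top hCt.lt_top ?_
  have h := (hu.memLp μ 2).2
  rw [eLpNorm_eq_lintegral_rpow_enorm_toReal (by norm_num) (by norm_num)] at h
  simp only [ENNReal.toReal_ofNat, ENNReal.rpow_ofNat] at h
  by_contra hcon
  rw [not_lt, top_le_iff] at hcon
  rw [hcon] at h
  simp at h

theorem nm_neg (x : R) : S.nm (-x) = S.nm x := by simp [nm]

/-- Averages of translations and dilations are compact if the Fourier transform of the weight of
the translations vanishes suitably on the singular elements. -/
theorem isCompactOperator_avgOp_aff {a c c₀ : R → ℂ} (ha : BddCpt a) (hc : BddCpt c)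
    (hc₀ : BddCpt c₀) {C : ℝ} (h : ∀ ζ, ‖pairingFourier μ S.pairing c ζ‖ ^ 2
      ≤ C * S.nm ζ * ‖pairingFourier μ S.pairing c₀ ζ‖ ^ 2) :
    IsCompactOperator (S.avgOp μ (μ.prod μ) (fun q => a q.1 * c q.2) aff) := by
  have hR : ProperSpace R := FiniteDimensional.proper ℂ R
  refine isCompactOperator_of_kernel (S.measurable_affKernel μ ha hc) ?_ (S.avgOp_aff_ae μ ha hc)
  obtain ⟨P, hP0, hPt, hP⟩ := exists_plancherel_const μ S.pairing S.pairing_nondeg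
  have hunit : ∀ᵐ b ∂μ, IsUnit b := by
    have := S.ae_isUnit_mul_add μ (a := 1) (b := 0) fun i => by simp
    simpa using this
  set A := pairingFourier μ S.pairing (S.dilWeight a) with hA
  set F := pairingFourier μ S.pairing c with hF
  set F₀ := pairingFourier μ S.pairing c₀ with hF₀
  have hAm : Measurable A := S.measurable_pairingFourier μ (S.bddCpt_dilWeight ha).measurable
  have hFm : Measurable F := S.measurable_pairingFourier μ hc.measurable
  have hAfin : ∫⁻ ζ, ‖A ζ‖ₑ ^ 2 ∂μ < ⊤ := S.lintegral_pairingFourier_lt_top μ (S.bddCpt_dilWeight ha)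
  have h1 : ∀ y, ∫⁻ v, ‖S.affKernel μ a c v y‖ₑ ^ 2 ∂μ
      = P⁻¹ * ∫⁻ ζ, ‖A (y * ζ)‖ₑ ^ 2 * ‖F (-ζ)‖ₑ ^ 2 ∂μ := by
    intro y
    obtain ⟨e1, e2, e3⟩ := S.affKernel_fourier μ ha hc y
    have e4 := hP _ e1 e2
    simp only [e3, enorm_mul, mul_pow] at e4
    rw [e4, ← mul_assoc, ENNReal.inv_mul_cancel hP0 hPt, one_mul]
  have h2 : ∫⁻ v, ∫⁻ y, ‖S.affKernel μ a c v y‖ₑ ^ 2 ∂μ ∂μ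
      = ∫⁻ y, ∫⁻ v, ‖S.affKernel μ a c v y‖ₑ ^ 2 ∂μ ∂μ :=
    lintegral_lintegral_swap ((S.measurable_affKernel μ ha hc).enorm.pow_const 2).aemeasurable
  rw [h2]
  simp only [h1]
  rw [lintegral_const_mul' _ _ (ENNReal.inv_ne_top.2 hP0)]
  refine ENNReal.mul_ne_top (ENNReal.inv_ne_top.2 hP0) ?_
  rw [lintegral_lintegral_swap]
  · have h3 : ∀ᵐ ζ ∂μ, ∫⁻ y, ‖A (y * ζ)‖ₑ ^ 2 * ‖F (-ζ)‖ₑ ^ 2 ∂μ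
        ≤ (ENNReal.ofReal C * ∫⁻ ζ, ‖A ζ‖ₑ ^ 2 ∂μ) * ‖F₀ (-ζ)‖ₑ ^ 2 := by
      filter_upwards [hunit] with ζ hζ
      rw [lintegral_mul_const' _ _ (by finiteness)]
      have e1 := S.lintegral_comp_mul μ hζ 0 fun y => ‖A y‖ₑ ^ 2
      simp only [sub_zero, mul_comm ζ] at e1
      rw [e1]
      have e2 : ‖F (-ζ)‖ₑ ^ 2 ≤ ENNReal.ofReal C * ENNReal.ofReal (S.nm ζ) * ‖F₀ (-ζ)‖ₑ ^ 2 := by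
        have e3 := ENNReal.ofReal_le_ofReal (h (-ζ))
        rw [S.nm_neg, ENNReal.ofReal_mul' (by positivity), ENNReal.ofReal_mul' (S.nm_nonneg _),
          ENNReal.ofReal_pow (norm_nonneg _), ENNReal.ofReal_pow (norm_nonneg _), ofReal_norm,
          ofReal_norm] at e3
        exact e3
      have e4 : ENNReal.ofReal (S.nm ζ)⁻¹ * ENNReal.ofReal (S.nm ζ) = 1 := by
        rw [← ENNReal.ofReal_mul (inv_nonneg.2 (S.nm_nonneg _)),
          inv_mul_cancel₀ (S.nm_pos hζ).ne', ENNReal.ofReal_one]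
      calc ENNReal.ofReal (S.nm ζ)⁻¹ * (∫⁻ y, ‖A y‖ₑ ^ 2 ∂μ) * ‖F (-ζ)‖ₑ ^ 2
          ≤ ENNReal.ofReal (S.nm ζ)⁻¹ * (∫⁻ y, ‖A y‖ₑ ^ 2 ∂μ) *
            (ENNReal.ofReal C * ENNReal.ofReal (S.nm ζ) * ‖F₀ (-ζ)‖ₑ ^ 2) := by gcongr
        _ = (ENNReal.ofReal (S.nm ζ)⁻¹ * ENNReal.ofReal (S.nm ζ)) *
            ((ENNReal.ofReal C * ∫⁻ ζ, ‖A ζ‖ₑ ^ 2 ∂μ) * ‖F₀ (-ζ)‖ₑ ^ 2) := by ring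
        _ = _ := by rw [e4, one_mul]
    refine ((lintegral_mono_ae h3).trans_lt ?_).ne
    rw [lintegral_const_mul' _ _ (ENNReal.mul_ne_top ENNReal.ofReal_ne_top hAfin.ne),
      lintegral_neg_eq_self (fun ζ => ‖F₀ ζ‖ₑ ^ 2)]
    exact ENNReal.mul_lt_top (ENNReal.mul_lt_top ENNReal.ofReal_lt_top hAfin)
      (S.lintegral_pairingFourier_lt_top μ hc₀)
  · refine Measurable.aemeasurable ?_
    refine Measurable.mul ((hAm.comp ?_).enorm.pow_const 2) ((hFm.comp ?_).enorm.pow_const 2)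
    · exact (by fun_prop : Continuous fun q : R × R => q.1 * q.2).measurable
    · exact measurable_snd.neg

/-- The unipotent matrix with upper right entry `h`. -/
def unip (h : R) : Mat R := ⟨1, h, 0, 1⟩

theorem pairingFourier_sub_comp_sub {c : R → ℂ} (hc : BddCpt c) (h ζ : R) :
    pairingFourier μ S.pairing (fun y => c y - c (y - h)) ζ
      = (1 - Complex.exp (-(Complex.I * (S.pairing h ζ : ℝ)))) * pairingFourier μ S.pairing c ζ := by
  have hR : ProperSpace R := FiniteDimensional.proper ℂ R
  have hint : ∀ u : R → ℂ, BddCpt u →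
      Integrable (fun v => Complex.exp (-(Complex.I * (S.pairing v ζ : ℝ))) * u v) μ := by
    intro u hu
    refine (hu.integrable μ).bdd_mul (c := 1) ?_ (Eventually.of_forall fun q => ?_)
    · have : Continuous fun v : R => S.pairing v ζ :=
        S.continuous_pairing.comp (by fun_prop : Continuous fun q : R => (q, ζ))
      exact (by fun_prop : Continuous fun q : R =>
        Complex.exp (-(Complex.I * (S.pairing q ζ : ℝ)))).aestronglyMeasurable
    · rw [Complex.norm_exp]; simp
  simp only [pairingFourier, mul_sub]
  rw [integral_sub (hint c hc) (hint _ (hc.comp_sub h)), sub_mul, one_mul]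
  congr 1
  rw [← integral_add_right_eq_self _ h, ← integral_const_mul]
  refine integral_congr_ae (Eventually.of_forall fun v => ?_)
  simp only [add_sub_cancel_right]
  rw [map_add, LinearMap.add_apply, ← mul_assoc, ← Complex.exp_add]
  congr 2
  push_cast; ring

theorem one_sub_rho_unip_mul_avgOp {a c : R → ℂ} (ha : BddCpt a) (hc : BddCpt c) (h : R) :
    (1 - S.rho μ (unip h)) * S.avgOp μ (μ.prod μ) (fun q => a q.1 * c q.2) aff
      = S.avgOp μ (μ.prod μ) (fun q => a q.1 * (c q.2 - c (q.2 - h))) aff := by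
  have hR : ProperSpace R := FiniteDimensional.proper ℂ R
  have hk : ∀ {c : R → ℂ}, BddCpt c → Integrable (fun q : R × R => a q.1 * c q.2) (μ.prod μ) :=
    fun hc => (ha.integrable μ).mul_prod (hc.integrable μ)
  have hΦ : Measurable (aff : R × R → Mat R) := continuous_aff.measurable
  rw [sub_mul, one_mul, S.rho_mul_avgOp μ (hk hc) hΦ]
  let e : R × R ≃ᵐ R × R := (MeasurableEquiv.refl R).prodCongr (MeasurableEquiv.addRight h)
  have he : MeasurePreserving e (μ.prod μ) (μ.prod μ) :=
    (MeasurePreserving.id μ).prod (measurePreserving_add_right μ h)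
  have he' : ∀ q, e q = (q.1, q.2 + h) := fun q => rfl
  have h1 := S.avgOp_comp_measurePreserving μ e he (hk (hc.comp_sub h)) hΦ
  have h2 : ((fun q : R × R => a q.1 * c (q.2 - h)) ∘ e) = fun q => a q.1 * c q.2 := by
    funext q
    simp [he']
  have h3 : (aff ∘ e : R × R → Mat R) = fun q => aff q * unip h := by
    funext q
    ext <;> simp [he', aff, unip, add_comm]
  rw [h2, h3] at h1
  rw [h1]
  refine clm_ext_inner fun x y => ?_
  rw [_root_.sub_apply, inner_sub_right, S.inner_avgOp μ (hk hc) hΦ,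
    S.inner_avgOp μ (hk (hc.comp_sub h)) hΦ, S.inner_avgOp μ (hk (hc.sub (hc.comp_sub h))) hΦ,
    ← integral_sub (S.integrable_mul_inner μ (hk hc) hΦ _ _)
      (S.integrable_mul_inner μ (hk (hc.comp_sub h)) hΦ _ _)]
  refine integral_congr_ae (Eventually.of_forall fun q => ?_)
  simp only
  ring

theorem norm_one_sub_exp_le (t : ℝ) : ‖1 - Complex.exp (-(Complex.I * t))‖ ≤ |t| := by
  have h := Real.norm_exp_I_mul_ofReal_sub_one_le (x := -t)
  rw [norm_sub_rev]
  have e : -(Complex.I * (t : ℂ)) = Complex.I * ((-t : ℝ) : ℂ) := by push_cast; ring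
  rw [e]
  simpa using h

theorem abs_pairing_le (i : κ) (h : ℂ) (ζ : R) :
    |S.pairing (h • S.ω i) ζ| ≤ ‖h‖ * ‖S.proj i ζ‖ := by
  rw [pairing_apply, smul_mul_assoc, map_smul, mul_comm (S.ω i), S.mul_ω, map_smul, S.ℓ_ω]
  refine (Complex.abs_re_le_norm _).trans ?_
  simp

theorem exists_pow_mul_avgOp {a c : R → ℂ} (ha : BddCpt a) (hc : BddCpt c) (i : κ) (h : ℂ) (k : ℕ) :
    ∃ c', BddCpt c' ∧ (1 - S.rho μ (unip (h • S.ω i))) ^ k *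
        S.avgOp μ (μ.prod μ) (fun q => a q.1 * c q.2) aff
        = S.avgOp μ (μ.prod μ) (fun q => a q.1 * c' q.2) aff ∧
      ∀ ζ, ‖pairingFourier μ S.pairing c' ζ‖
        ≤ (‖h‖ * ‖S.proj i ζ‖) ^ k * ‖pairingFourier μ S.pairing c ζ‖ := by
  induction k with
  | zero => exact ⟨c, hc, by simp, by simp⟩
  | succ k ih =>
    obtain ⟨c', hc', h1, h2⟩ := ih
    refine ⟨fun y => c' y - c' (y - h • S.ω i), hc'.sub (hc'.comp_sub _), ?_, fun ζ => ?_⟩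
    · rw [pow_succ', mul_assoc, h1, S.one_sub_rho_unip_mul_avgOp μ ha hc']
    · rw [S.pairingFourier_sub_comp_sub μ hc', norm_mul, pow_succ', mul_assoc]
      exact mul_le_mul ((norm_one_sub_exp_le _).trans (S.abs_pairing_le i h ζ)) (h2 ζ)
        (norm_nonneg _) (by positivity)

/-- Products of differences of translations in the directions of the socles. -/
def diffProd (h : κ → ℂ) (L : List κ) : Lp ℂ 2 μ →L[ℂ] Lp ℂ 2 μ :=
  (L.map fun i => (1 - S.rho μ (unip (h i • S.ω i))) ^ (S.n i + 1)).prod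

theorem exists_diffProd_mul_avgOp {a c : R → ℂ} (ha : BddCpt a) (hc : BddCpt c) (h : κ → ℂ)
    (L : List κ) :
    ∃ c', BddCpt c' ∧ S.diffProd μ h L * S.avgOp μ (μ.prod μ) (fun q => a q.1 * c q.2) aff
        = S.avgOp μ (μ.prod μ) (fun q => a q.1 * c' q.2) aff ∧
      ∀ ζ, ‖pairingFourier μ S.pairing c' ζ‖
        ≤ (L.map fun i => (‖h i‖ * ‖S.proj i ζ‖) ^ (S.n i + 1)).prod *
          ‖pairingFourier μ S.pairing c ζ‖ := by
  induction L with
  | nil => exact ⟨c, hc, by simp [diffProd], by simp⟩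
  | cons i L ih =>
    obtain ⟨c', hc', h1, h2⟩ := ih
    obtain ⟨c'', hc'', h3, h4⟩ := S.exists_pow_mul_avgOp μ ha hc' i (h i) (S.n i + 1)
    refine ⟨c'', hc'', ?_, fun ζ => ?_⟩
    · rw [diffProd, List.map_cons, List.prod_cons, mul_assoc, ← diffProd, h1, h3]
    · refine (h4 ζ).trans ?_
      rw [List.map_cons, List.prod_cons, mul_assoc]
      exact mul_le_mul_of_nonneg_left (h2 ζ) (by positivity)

theorem isCompactOperator_diffProd_mul_avgOp {a c : R → ℂ} (ha : BddCpt a) (hc : BddCpt c)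
    (h : κ → ℂ) : IsCompactOperator (S.diffProd μ h Finset.univ.toList *
      S.avgOp μ (μ.prod μ) (fun q => a q.1 * c q.2) aff) := by
  obtain ⟨c', hc', h1, h2⟩ := S.exists_diffProd_mul_avgOp μ ha hc h Finset.univ.toList
  rw [h1]
  refine S.isCompactOperator_avgOp_aff μ ha hc' hc (C := ∏ i, ‖h i‖ ^ (2 * (S.n i + 1))) fun ζ => ?_
  have h3 := pow_le_pow_left₀ (norm_nonneg _) (h2 ζ) 2
  refine h3.trans (le_of_eq ?_)
  rw [mul_pow, Finset.prod_map_toList, ← Finset.prod_pow, nm, ← Finset.prod_mul_distrib]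
  congr 1
  refine Finset.prod_congr rfl fun i _ => ?_
  rw [← pow_mul, mul_comm (S.n i + 1), mul_pow]

/-- Operators `W` such that `g ↦ rho g * W` is norm-continuous at the identity. -/
def RhoContinuous (W : Lp ℂ 2 μ →L[ℂ] Lp ℂ 2 μ) : Prop :=
  Tendsto (fun g => S.rho μ g * W) (𝓝 1) (𝓝 W)

theorem isCompactOperator_diffProd_mul {W : Lp ℂ 2 μ →L[ℂ] Lp ℂ 2 μ} (hW : S.RhoContinuous μ W)
    (h : κ → ℂ) : IsCompactOperator (S.diffProd μ h Finset.univ.toList * W) := by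
  have hR : ProperSpace R := FiniteDimensional.proper ℂ R
  refine isCompactOperator_of_norm_le (G := Lp ℂ 2 μ) fun ε hε => ?_
  set U := S.diffProd μ h Finset.univ.toList with hU
  have hε' : 0 < ε / (‖U‖ + 1) := by positivity
  have h1 : ∀ᶠ q : R × R in 𝓝 (1, 0), ‖S.rho μ (aff q) * W - W‖ ≤ ε / (‖U‖ + 1) := by
    have e1 : Tendsto (fun q : R × R => S.rho μ (aff q) * W) (𝓝 (1, 0)) (𝓝 W) := by
      refine hW.comp ?_
      have := (continuous_aff (R := R)).tendsto (1, 0)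
      exact this
    filter_upwards [(tendsto_iff_norm_sub_tendsto_zero.1 e1).eventually (gt_mem_nhds hε')] with q hq
    exact hq.le
  rw [nhds_prod_eq] at h1
  obtain ⟨p₁, hp₁, p₂, hp₂, h12⟩ := eventually_prod_iff.1 h1
  obtain ⟨r₁, hr₁, h₁⟩ := Metric.eventually_nhds_iff_ball.1 hp₁
  obtain ⟨r₂, hr₂, h₂⟩ := Metric.eventually_nhds_iff_ball.1 hp₂
  have hbump : ∀ (x : R) (r : ℝ), 0 < r → ∃ a : R → ℂ, BddCpt a ∧ (∀ y, a y ≠ 0 → y ∈ Metric.ball x r) ∧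
      ∫ y, a y ∂μ = 1 ∧ ∫ y, ‖a y‖ ∂μ = 1 := by
    intro x r hr
    have hm : MeasurableSet (Metric.ball x r) := measurableSet_ball
    have hv0 : 0 < μ.real (Metric.ball x r) :=
      ENNReal.toReal_pos (Metric.measure_ball_pos μ x hr).ne' measure_ball_lt_top.ne
    refine ⟨(Metric.ball x r).indicator fun _ => (((μ.real (Metric.ball x r))⁻¹ : ℝ) : ℂ),
      ⟨measurable_const.indicator hm, ⟨(μ.real (Metric.ball x r))⁻¹, fun y => ?_⟩,
        ⟨‖x‖ + r, fun y hy => ?_⟩⟩, fun y hy => ?_, ?_, ?_⟩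
    · refine (norm_indicator_le_norm_self _ _).trans ?_
      rw [Complex.norm_real, Real.norm_of_nonneg (by positivity)]
    · refine indicator_of_notMem (fun hy' => ?_) _
      rw [mem_ball_iff_norm] at hy'
      have := norm_le_insert' y x
      linarith
    · by_contra hy'
      exact hy (indicator_of_notMem hy' _)
    · rw [integral_indicator hm, setIntegral_const, Complex.real_smul, ← Complex.ofReal_mul,
        mul_inv_cancel₀ hv0.ne', Complex.ofReal_one]
    · simp_rw [norm_indicator_eq_indicator_norm]
      rw [integral_indicator hm, setIntegral_const, Complex.norm_real,
        Real.norm_of_nonneg (by positivity), smul_eq_mul, mul_inv_cancel₀ hv0.ne']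
  obtain ⟨a, ha, ha1, ha2, ha3⟩ := hbump 1 r₁ hr₁
  obtain ⟨c, hc, hc1, hc2, hc3⟩ := hbump 0 r₂ hr₂
  set K := S.avgOp μ (μ.prod μ) (fun q => a q.1 * c q.2) aff with hK
  have hcomp : IsCompactOperator (U * K * W) :=
    (S.isCompactOperator_diffProd_mul_avgOp μ ha hc h).comp_clm W
  have hnorm : ‖K * W - W‖ ≤ ε / (‖U‖ + 1) := by
    have := S.norm_avgOp_mul_sub_le μ (W := W) ((ha.integrable μ).mul_prod (hc.integrable μ))
      continuous_aff.measurable hε'.le (Eventually.of_forall fun q hq => h12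
        (h₁ _ (ha1 _ (left_ne_zero_of_mul hq))) (h₂ _ (hc1 _ (right_ne_zero_of_mul hq))))
    rw [integral_prod_mul, ha2, hc2, one_mul, one_smul] at this
    simp only [norm_mul] at this
    rw [integral_prod_mul (fun x => ‖a x‖) (fun x => ‖c x‖), ha3, hc3, one_mul, mul_one] at this
    exact this
  refine ⟨1, fun _ => U * K * W, 1, fun _ => hcomp, fun x => ?_⟩
  simp only [Finset.univ_unique, Finset.sum_const, Finset.card_singleton, one_smul, one_mul]
  have e1 : (U * W) x = (U * K * W) x - U ((K * W - W) x) := by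
    simp only [mul_apply_eq_comp, _root_.sub_apply, map_sub]
    abel
  rw [e1]
  refine (norm_sub_le _ _).trans (add_le_add le_rfl ?_)
  calc ‖U ((K * W - W) x)‖ ≤ ‖U‖ * (ε / (‖U‖ + 1) * ‖x‖) :=
        (U.le_opNorm _).trans (mul_le_mul_of_nonneg_left
          (ContinuousLinearMap.le_of_opNorm_le _ hnorm x) (norm_nonneg _))
    _ = (‖U‖ / (‖U‖ + 1)) * (ε * ‖x‖) := by ring
    _ ≤ 1 * (ε * ‖x‖) := by
        gcongr
        rw [div_le_one (by positivity)]; linarith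
    _ = _ := one_mul _

end SiteData

theorem enorm_add_sq_le (a b : ℂ) : ‖a + b‖ₑ ^ 2 ≤ 2 * ‖a‖ₑ ^ 2 + 2 * ‖b‖ₑ ^ 2 := by
  have h : ‖a + b‖ ^ 2 ≤ 2 * ‖a‖ ^ 2 + 2 * ‖b‖ ^ 2 := by
    have := norm_add_le a b
    nlinarith [norm_nonneg (a + b), sq_nonneg (‖a‖ - ‖b‖)]
  have h1 := ENNReal.ofReal_le_ofReal h
  rw [ENNReal.ofReal_add (by positivity) (by positivity), ENNReal.ofReal_mul (by norm_num),
    ENNReal.ofReal_mul (by norm_num), ENNReal.ofReal_pow (norm_nonneg _),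
    ENNReal.ofReal_pow (norm_nonneg _), ENNReal.ofReal_pow (norm_nonneg _), ofReal_norm,
    ofReal_norm, ofReal_norm] at h1
  simpa using h1

namespace SiteData

variable {κ : Type*} [Fintype κ] {R : Type*} [NormedCommRing R] [NormedAlgebra ℂ R]
  [FiniteDimensional ℂ R] (S : SiteData κ R)

/-- Invertible matrices which commute with the translations at the other sites. -/
def IsLocalAt (i : κ) (γ : Mat R) : Prop :=
  IsUnit γ.det ∧ ∀ j, j ≠ i → ∀ h : ℂ, γ * unip (h • S.ω j) = unip (h • S.ω j) * γ

theorem IsLocalAt.mul {S : SiteData κ R} {i : κ} {γ γ' : Mat R} (h : S.IsLocalAt i γ)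
    (h' : S.IsLocalAt i γ') : S.IsLocalAt i (γ * γ') := by
  refine ⟨by rw [Mat.det_mul]; exact h.1.mul h'.1, fun j hj z => ?_⟩
  rw [mul_assoc, h'.2 j hj z, ← mul_assoc, h.2 j hj z, mul_assoc]

theorem isLocalAt_one (i : κ) : S.IsLocalAt i 1 := ⟨by simp, fun j _ z => by simp⟩

/-- The lower triangular unipotent matrices. -/
def lowerUnip (x : R) : Mat R := ⟨1, 0, x, 1⟩

theorem isLocalAt_lowerUnip (i : κ) (z : ℂ) : S.IsLocalAt i (lowerUnip (z • S.e i)) := by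
  refine ⟨by simp [lowerUnip, Mat.det], fun j hj h => ?_⟩
  have := S.e_mul_ω_ne hj.symm
  have h2 : S.ω j * S.e i = 0 := by rw [mul_comm, this]
  ext <;> simp [lowerUnip, unip, this, h2]

theorem lowerUnip_mul_unip_mul_lowerUnip {t w : R} (h : t * t * w = w) :
    lowerUnip (-t) * unip w * lowerUnip t = ⟨1 + w * t, w, -w, 1 - t * w⟩ := by
  ext <;> simp only [lowerUnip, unip, Mat.mul_a, Mat.mul_b, Mat.mul_c, Mat.mul_d]
  · ring
  · ring
  · linear_combination -h
  · ring

/-- The Weyl element at the site `i`. -/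
def weyl (i : κ) : Mat R := ⟨1 - S.e i, S.e i, -S.e i, 1 - S.e i⟩

theorem det_weyl (i : κ) : (S.weyl i).det = 1 := by
  have := S.e_mul_e i
  simp only [weyl, Mat.det]
  linear_combination 2 * this

theorem isLocalAt_weyl (i : κ) : S.IsLocalAt i (S.weyl i) := by
  refine ⟨by simp [det_weyl], fun j hj h => ?_⟩
  have := S.e_mul_ω_ne hj.symm
  have h2 : S.ω j * S.e i = 0 := by rw [mul_comm, this]
  ext <;> simp [weyl, unip, this, h2, mul_sub, sub_mul, add_comm]

variable [MeasurableSpace R] [BorelSpace R] (μ : Measure R) [μ.IsAddHaarMeasure]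

theorem rhoFun_unip (h : R) (f : R → ℂ) (v : R) : S.rhoFun (unip h) f v = f (v + h) := by
  simp [rhoFun, den, act, unip, Mat.det]

/-- The elements whose residue at `i` has absolute value at most one. -/
def unitBall (i : κ) : Set R := {v | ‖S.proj i v‖ ≤ 1}

theorem measurableSet_unitBall (i : κ) : MeasurableSet (S.unitBall i) :=
  (isClosed_le ((S.continuous_proj i).norm) continuous_const).measurableSet

theorem lintegral_compl_unitBall_le (i : κ) (g : Lp ℂ 2 μ) :
    ∫⁻ v in (S.unitBall i)ᶜ, ‖g v‖ₑ ^ 2 ∂μ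
      ≤ ∫⁻ v in S.unitBall i, ‖S.rho μ (S.weyl i) g v‖ₑ ^ 2 ∂μ := by
  have hdet : IsUnit (S.weyl i).det := by simp [det_weyl]
  have hB := S.measurableSet_unitBall i
  set B' : Set R := {v | 1 ≤ ‖S.proj i v‖} with hB'
  have hBm : MeasurableSet B' :=
    (isClosed_le continuous_const ((S.continuous_proj i).norm)).measurableSet
  have h1 : ∫⁻ v in S.unitBall i, ‖S.rho μ (S.weyl i) g v‖ₑ ^ 2 ∂μ
      = ∫⁻ v in B', ‖g v‖ₑ ^ 2 ∂μ := by
    rw [← lintegral_indicator hB, ← lintegral_indicator hBm,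
      ← S.lintegral_act μ hdet (B'.indicator fun v => ‖g v‖ₑ ^ 2)]
    refine lintegral_congr_ae ?_
    filter_upwards [S.rho_ae μ (S.weyl i) g, S.ae_isUnit_den μ hdet] with v hv hu
    have e1 : v ∈ S.unitBall i ↔ act (S.weyl i) v ∈ B' := by
      have h2 : S.proj i (den (S.weyl i) v) = -S.proj i v := by
        simp [den, weyl, S.proj_e]
      have h3 : S.proj i (act (S.weyl i) v) * S.proj i (den (S.weyl i) v) = 1 := by
        rw [← map_mul, act, mul_assoc, Ring.inverse_mul_cancel _ hu, mul_one]
        simp [weyl, S.proj_e]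
      rw [h2] at h3
      have h4 := congrArg norm h3
      rw [norm_mul, norm_neg, norm_one] at h4
      simp only [unitBall, hB', mem_ofPred_eq]
      have h5 := norm_nonneg (S.proj i v)
      have h6 := norm_nonneg (S.proj i (act (S.weyl i) v))
      constructor <;> intro h7 <;> nlinarith
    by_cases hvB : v ∈ S.unitBall i
    · rw [indicator_of_mem hvB, indicator_of_mem (e1.1 hvB), hv, S.enorm_rhoFun_sq]
    · rw [indicator_of_notMem hvB, indicator_of_notMem (fun h => hvB (e1.2 h)), mul_zero]
  rw [h1]
  refine lintegral_mono_set fun v hv => ?_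
  simp only [unitBall, mem_compl_iff, mem_ofPred_eq, not_le] at hv
  exact hv.le

/-- The estimate of the mass on the unit ball at a site of multiplicity one. -/
theorem lintegral_unitBall_le_tame {i : κ} (hi : S.n i = 0) {g : Lp ℂ 2 μ} {η : ℝ}
    (h : ∀ z : ℂ, ‖z‖ ≤ 24 → ‖g - S.rho μ (unip (z • S.ω i)) g‖ ≤ η) :
    ∫⁻ v in S.unitBall i, ‖g v‖ₑ ^ 2 ∂μ ≤ ENNReal.ofReal (‖g‖ ^ 2 / 4 + 2 * η ^ 2) := by
  have hB := S.measurableSet_unitBall i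
  have hη : 0 ≤ η := (norm_nonneg _).trans (h 0 (by simp))
  have hω : S.proj i (S.ω i) = 1 := by rw [S.ω_tame hi, S.proj_e]
  let A : Fin 8 → Set R := fun k => {v | ‖S.proj i v - 3 * (k : ℂ)‖ ≤ 1}
  have hA : ∀ k, MeasurableSet (A k) := fun k =>
    (isClosed_le (((S.continuous_proj i).sub continuous_const).norm) continuous_const).measurableSet
  have hdisj : Pairwise (Function.onFun Disjoint A) := by
    intro k l hkl
    refine Set.disjoint_left.2 fun v hv hv' => ?_
    simp only [A, mem_ofPred_eq] at hv hv'
    have h1 : ‖(3 * (k : ℂ)) - 3 * (l : ℂ)‖ ≤ 2 := by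
      have := norm_sub_le (S.proj i v - 3 * (l : ℂ)) (S.proj i v - 3 * (k : ℂ))
      rw [sub_sub_sub_cancel_left] at this
      linarith
    have h2 : ((3 * (k : ℂ)) - 3 * (l : ℂ)) = ((3 * ((k : ℤ) - (l : ℤ)) : ℤ) : ℂ) := by
      push_cast; ring
    rw [h2, Complex.norm_intCast] at h1
    have h3 : |(3 * ((k : ℤ) - (l : ℤ)))| ≤ 2 := by exact_mod_cast h1
    have h4 : (k : ℤ) ≠ (l : ℤ) := by
      intro h5; exact hkl (Fin.ext (by exact_mod_cast h5))
    rw [abs_le] at h3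
    omega
  have hk : ∀ k : Fin 8, ∫⁻ v in S.unitBall i, ‖g v‖ₑ ^ 2 ∂μ
      ≤ 2 * ∫⁻ v in A k, ‖g v‖ₑ ^ 2 ∂μ + 2 * ENNReal.ofReal (η ^ 2) := by
    intro k
    set t : Lp ℂ 2 μ := S.rho μ (unip ((3 * (k : ℂ)) • S.ω i)) g with ht
    have h24 : ‖(3 * (k : ℂ))‖ ≤ 24 := by
      rw [norm_mul, Complex.norm_natCast]
      have : ((k : ℕ) : ℝ) ≤ 8 := by exact_mod_cast k.2.le
      norm_num
      linarith
    have e1 : ∫⁻ v in S.unitBall i, ‖t v‖ₑ ^ 2 ∂μ = ∫⁻ v in A k, ‖g v‖ₑ ^ 2 ∂μ := by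
      rw [← lintegral_indicator hB, ← lintegral_indicator (hA k),
        ← lintegral_add_right_eq_self ((A k).indicator fun v => ‖g v‖ₑ ^ 2) ((3 * (k : ℂ)) • S.ω i)]
      refine lintegral_congr_ae ?_
      filter_upwards [S.rho_ae μ (unip ((3 * (k : ℂ)) • S.ω i)) g] with v hv
      have e2 : v ∈ S.unitBall i ↔ v + (3 * (k : ℂ)) • S.ω i ∈ A k := by
        simp [unitBall, A, hω]
      by_cases hvB : v ∈ S.unitBall i
      · rw [indicator_of_mem hvB, indicator_of_mem (e2.1 hvB), hv, S.rhoFun_unip]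
      · rw [indicator_of_notMem hvB, indicator_of_notMem (fun h => hvB (e2.2 h))]
    have e3 : ∫⁻ v, ‖(g - t) v‖ₑ ^ 2 ∂μ ≤ ENNReal.ofReal (η ^ 2) := by
      rw [← ofReal_norm_sq]
      exact ENNReal.ofReal_le_ofReal (pow_le_pow_left₀ (norm_nonneg _) (h _ h24) 2)
    calc ∫⁻ v in S.unitBall i, ‖g v‖ₑ ^ 2 ∂μ
        ≤ ∫⁻ v in S.unitBall i, (2 * ‖t v‖ₑ ^ 2 + 2 * ‖(g - t) v‖ₑ ^ 2) ∂μ := by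
          refine lintegral_mono_ae (ae_restrict_of_ae ?_)
          filter_upwards [Lp.coeFn_sub g t] with v hv
          rw [hv, Pi.sub_apply]
          refine le_trans (le_of_eq ?_) (enorm_add_sq_le _ _)
          rw [add_sub_cancel]
      _ = 2 * ∫⁻ v in S.unitBall i, ‖t v‖ₑ ^ 2 ∂μ
          + 2 * ∫⁻ v in S.unitBall i, ‖(g - t) v‖ₑ ^ 2 ∂μ := by
          rw [lintegral_add_left', lintegral_const_mul' _ _ (by finiteness),
            lintegral_const_mul' _ _ (by finiteness)]
          exact ((Lp.aestronglyMeasurable t).enorm.pow_const 2).const_mul 2 |>.restrict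
      _ ≤ _ := by
          rw [e1]
          gcongr
          exact (setLIntegral_le_lintegral _ _).trans e3
  have hsum : ∑ k, ∫⁻ v in A k, ‖g v‖ₑ ^ 2 ∂μ ≤ ENNReal.ofReal (‖g‖ ^ 2) := by
    rw [ofReal_norm_sq, ← tsum_fintype (L := .unconditional _), ← lintegral_iUnion hA hdisj]
    exact setLIntegral_le_lintegral _ _
  have h8 := Finset.sum_le_sum fun k (_ : k ∈ Finset.univ) => hk k
  rw [Finset.sum_add_distrib, ← Finset.mul_sum] at h8
  simp only [Finset.sum_const, Finset.card_univ, Fintype.card_fin, nsmul_eq_mul, Nat.cast_ofNat] at h8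
  have h9 : 8 * ∫⁻ v in S.unitBall i, ‖g v‖ₑ ^ 2 ∂μ
      ≤ ENNReal.ofReal (2 * ‖g‖ ^ 2 + 8 * (2 * η ^ 2)) := by
    refine h8.trans ?_
    rw [ENNReal.ofReal_add (by positivity) (by positivity), ENNReal.ofReal_mul (by norm_num),
      ENNReal.ofReal_mul (by norm_num), ENNReal.ofReal_mul (by norm_num)]
    simp only [ENNReal.ofReal_ofNat]
    gcongr
  have h10 : ENNReal.ofReal (2 * ‖g‖ ^ 2 + 8 * (2 * η ^ 2))
      = 8 * ENNReal.ofReal (‖g‖ ^ 2 / 4 + 2 * η ^ 2) := by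
    rw [← ENNReal.ofReal_ofNat 8, ← ENNReal.ofReal_mul (by norm_num)]
    congr 1; ring
  rw [h10] at h9
  exact (ENNReal.mul_le_mul_iff_right (by norm_num) (by norm_num)).1 h9

/-- Displacements by at most `r` are controlled by translations by at most `2 r`. -/
theorem lintegral_displacement_le {i : κ} (hi : S.n i ≠ 0) {G : R → ℂ} (hG : Measurable G) {β : ℂ}
    (hβ : β ≠ 0) {E : ENNReal}
    (h : ∀ z : ℂ, ‖z‖ ≤ 2 * ‖β‖ → ∫⁻ v, ‖G v - G (v + z • S.ω i)‖ₑ ^ 2 ∂μ ≤ E) :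
    ∫⁻ v in S.unitBall i, ‖G ((1 + β • S.ω i) * v) - G v‖ₑ ^ 2 ∂μ ≤ 10 * E := by
  have hR : ProperSpace R := FiniteDimensional.proper ℂ R
  set u : R := 1 + β • S.ω i with hu
  have huv : ∀ v, u * v = v + (β * S.proj i v) • S.ω i := by
    intro v
    rw [hu, add_mul, one_mul, smul_mul_assoc, mul_comm (S.ω i), S.mul_ω, smul_smul]
  have hnm : S.nm u = 1 := by
    rw [nm]
    refine Finset.prod_eq_one fun j _ => ?_
    have : S.proj j (S.ω i) = 0 := by
      by_cases hj : j = i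
      · rw [hj]; exact S.proj_ω_wild hi
      · rw [← S.e_mul_ω i, map_mul, S.proj_e_ne hj, zero_mul]
    simp [hu, this]
  have huu : IsUnit u := S.isUnit_iff_nm_ne_zero.2 (by rw [hnm]; exact one_ne_zero)
  set B := S.unitBall i
  have hr : 0 < ‖β‖ := norm_pos_iff.2 hβ
  set D : Set ℂ := Metric.ball 0 ‖β‖ with hD
  set D₂ : Set ℂ := Metric.ball 0 (2 * ‖β‖) with hD₂
  set V := volume D with hV
  have hV0 : V ≠ 0 := (Metric.measure_ball_pos _ _ hr).ne'
  have hVt : V ≠ ⊤ := measure_ball_lt_top.ne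
  have hV₂ : volume D₂ = 4 * V := by
    rw [hV, hD, hD₂, Complex.volume_ball, Complex.volume_ball, ENNReal.ofReal_mul (by norm_num),
      mul_pow]
    norm_num
    ring
  set X := ∫⁻ v in B, ‖G (u * v) - G v‖ₑ ^ 2 ∂μ with hX
  have hm1 : Measurable fun q : ℂ × R => ‖G (u * q.2) - G (q.2 + q.1 • S.ω i)‖ₑ ^ 2 :=
    ((hG.comp (by fun_prop)).sub (hG.comp (by fun_prop))).enorm.pow_const 2
  have hm2 : Measurable fun q : R × ℂ => ‖G (u * q.1) - G (u * q.1 + q.2 • S.ω i)‖ₑ ^ 2 :=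
    ((hG.comp (by fun_prop)).sub (hG.comp (by fun_prop))).enorm.pow_const 2
  have h1 : ∀ z ∈ D, X ≤ 2 * ∫⁻ v in B, ‖G (u * v) - G (v + z • S.ω i)‖ₑ ^ 2 ∂μ + 2 * E := by
    intro z hz
    have hz' : ‖z‖ ≤ 2 * ‖β‖ := by
      rw [hD, mem_ball_zero_iff] at hz; linarith
    calc X ≤ ∫⁻ v in B, (2 * ‖G (u * v) - G (v + z • S.ω i)‖ₑ ^ 2
          + 2 * ‖G v - G (v + z • S.ω i)‖ₑ ^ 2) ∂μ := by
          refine lintegral_mono fun v => ?_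
          rw [← enorm_neg (G v - G (v + z • S.ω i)), neg_sub]
          refine le_trans (le_of_eq ?_) (enorm_add_sq_le _ _)
          rw [sub_add_sub_cancel]
      _ = 2 * ∫⁻ v in B, ‖G (u * v) - G (v + z • S.ω i)‖ₑ ^ 2 ∂μ
          + 2 * ∫⁻ v in B, ‖G v - G (v + z • S.ω i)‖ₑ ^ 2 ∂μ := by
          rw [lintegral_add_left, lintegral_const_mul' _ _ (by finiteness),
            lintegral_const_mul' _ _ (by finiteness)]
          exact (hm1.comp measurable_prodMk_left).const_mul 2
      _ ≤ _ := by
          gcongr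
          exact (setLIntegral_le_lintegral _ _).trans (h z hz')
  have h2 : V * X ≤ 2 * (∫⁻ z in D, ∫⁻ v in B, ‖G (u * v) - G (v + z • S.ω i)‖ₑ ^ 2 ∂μ)
      + 2 * E * V := by
    have e1 : V * X = ∫⁻ _ in D, X := by rw [setLIntegral_const, mul_comm]
    rw [e1]
    refine (setLIntegral_mono' measurableSet_ball h1).trans ?_
    rw [lintegral_add_right _ measurable_const, setLIntegral_const,
      lintegral_const_mul' _ _ (by finiteness)]
  have h3 : ∫⁻ z in D, ∫⁻ v in B, ‖G (u * v) - G (v + z • S.ω i)‖ₑ ^ 2 ∂μ ≤ 4 * V * E := by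
    rw [lintegral_lintegral_swap hm1.aemeasurable]
    have e1 : ∀ v ∈ B, ∫⁻ z in D, ‖G (u * v) - G (v + z • S.ω i)‖ₑ ^ 2
        ≤ ∫⁻ z in D₂, ‖G (u * v) - G (u * v + z • S.ω i)‖ₑ ^ 2 := by
      intro v hv
      rw [← lintegral_indicator measurableSet_ball, ← lintegral_indicator measurableSet_ball,
        ← lintegral_add_right_eq_self
          (D.indicator fun z => ‖G (u * v) - G (v + z • S.ω i)‖ₑ ^ 2) (β * S.proj i v)]
      refine lintegral_mono fun z => ?_
      by_cases hz : z + β * S.proj i v ∈ D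
      · have hz2 : z ∈ D₂ := by
          rw [hD, mem_ball_zero_iff] at hz
          rw [hD₂, mem_ball_zero_iff]
          have e2 : ‖β * S.proj i v‖ ≤ ‖β‖ := by
            rw [norm_mul]; exact mul_le_of_le_one_right (norm_nonneg _) hv
          have e3 := norm_sub_le (z + β * S.proj i v) (β * S.proj i v)
          rw [add_sub_cancel_right] at e3
          linarith
        rw [indicator_of_mem hz, indicator_of_mem hz2, huv, add_smul, add_assoc,
          add_comm (z • S.ω i)]
      · rw [indicator_of_notMem hz]; exact zero_le
    refine (setLIntegral_mono' (S.measurableSet_unitBall i) e1).trans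
      ((setLIntegral_le_lintegral _ _).trans ?_)
    rw [lintegral_lintegral_swap hm2.aemeasurable]
    have e4 : ∀ z ∈ D₂, ∫⁻ v, ‖G (u * v) - G (u * v + z • S.ω i)‖ₑ ^ 2 ∂μ ≤ E := by
      intro z hz
      have e5 := S.lintegral_comp_mul μ huu 0 fun w => ‖G w - G (w + z • S.ω i)‖ₑ ^ 2
      simp only [sub_zero, hnm, inv_one, ENNReal.ofReal_one, one_mul] at e5
      rw [e5]
      refine h z ?_
      rw [hD₂, mem_ball_zero_iff] at hz; exact hz.le
    refine (setLIntegral_mono' measurableSet_ball e4).trans (le_of_eq ?_)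
    rw [setLIntegral_const, hV₂]; ring
  have h4 : V * X ≤ V * (10 * E) := by
    refine h2.trans (le_trans (add_le_add (mul_le_mul_right h3 2) le_rfl) (le_of_eq ?_))
    ring
  exact (ENNReal.mul_le_mul_iff_right hV0 hVt).1 h4

/-- The estimate of the mass on the unit ball at a site of higher multiplicity. -/
theorem lintegral_unitBall_le_wild {i : κ} (hi : S.n i ≠ 0) : ∃ r : ℝ, ∀ (g : Lp ℂ 2 μ) (η : ℝ),
    (∀ γ ∈ [1, lowerUnip ((1 : ℂ) • S.e i), lowerUnip ((-1 : ℂ) • S.e i)], ∀ z : ℂ, ‖z‖ ≤ r →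
      ‖S.rho μ γ g - S.rho μ (unip (z • S.ω i)) (S.rho μ γ g)‖ ≤ η) →
    ∫⁻ v in S.unitBall i, ‖g v‖ₑ ^ 2 ∂μ ≤ ENNReal.ofReal (7 * η ^ 2) := by
  obtain ⟨c, hc, hχ⟩ := S.χ_wild hi
  set β : ℂ := 2 * Real.pi / c with hβ
  have hβ0 : β ≠ 0 := by
    rw [hβ]; exact div_ne_zero (by simp [Real.pi_ne_zero]) hc
  refine ⟨2 * ‖β‖, fun g η hg => ?_⟩
  have hη : 0 ≤ η := (norm_nonneg _).trans (hg 1 (by simp) 0 (by simp))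
  have hωω : S.ω i * S.ω i = 0 := by rw [S.mul_ω, S.proj_ω_wild hi, zero_smul]
  have heω := S.e_mul_ω i
  have hee := S.e_mul_e i
  -- the diagonal element as a product of conjugates of unipotent elements
  have hconj : ∀ (x z : ℂ), ‖S.rho μ (lowerUnip (x • S.e i)) g
      - S.rho μ (unip (z • S.ω i)) (S.rho μ (lowerUnip (x • S.e i)) g)‖ ≤ η →
      ‖g - S.rho μ (lowerUnip (x • S.e i) * unip (z • S.ω i) * lowerUnip (-(x • S.e i))) g‖ ≤ η := by
    intro x z hxz
    have e1 : lowerUnip (x • S.e i) * lowerUnip (-(x • S.e i)) = (1 : Mat R) := by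
      ext <;> simp [lowerUnip]
    have e2 : S.rho μ (lowerUnip (-(x • S.e i))) (S.rho μ (lowerUnip (x • S.e i)) g) = g := by
      rw [← mul_apply_eq_comp, ← S.rho_mul, e1, S.rho_one]; rfl
    have e3 : g - S.rho μ (lowerUnip (x • S.e i) * unip (z • S.ω i) * lowerUnip (-(x • S.e i))) g
        = S.rho μ (lowerUnip (-(x • S.e i))) (S.rho μ (lowerUnip (x • S.e i)) g
      - S.rho μ (unip (z • S.ω i)) (S.rho μ (lowerUnip (x • S.e i)) g)) := by
      rw [map_sub, e2, S.rho_mul, S.rho_mul]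
      rfl
    rw [e3]
    exact (S.norm_rho_apply_le μ _ _).trans hxz
  have h1 := hconj (-1) (β / 4) (hg _ (by simp) _ (by
    rw [norm_div]; simp only [Complex.norm_ofNat]; linarith [norm_nonneg β]))
  have h2 := hconj 1 (-(β / 4)) (hg _ (by simp) _ (by
    rw [norm_neg, norm_div]; simp only [Complex.norm_ofNat]; linarith [norm_nonneg β]))
  set A₁ := lowerUnip ((-1 : ℂ) • S.e i) * unip ((β / 4) • S.ω i) * lowerUnip (-((-1 : ℂ) • S.e i))
    with hA₁
  set A₂ := lowerUnip ((1 : ℂ) • S.e i) * unip ((-(β / 4)) • S.ω i) * lowerUnip (-((1 : ℂ) • S.e i))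
    with hA₂
  have hA : A₁ * A₂ = (1 - (β / 2) • S.ω i) • (⟨1 + β • S.ω i, 0, 0, 1⟩ : Mat R) := by
    have e2 : (β / 2) • S.ω i = 2 * ((β / 4) • S.ω i) := by
      rw [two_mul, ← add_smul]; congr 1; ring
    have e3 : β • S.ω i = 4 * ((β / 4) • S.ω i) := by
      have : (4 : R) = ((4 : ℂ) • (1 : R)) := by
        rw [← Algebra.algebraMap_eq_smul_one, map_ofNat]
      rw [this, smul_mul_assoc, one_mul, smul_smul]; congr 1; ring
    have e4 : ((β / 4) • S.ω i) * ((β / 4) • S.ω i) = 0 := by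
      rw [smul_mul_smul_comm, hωω, smul_zero]
    have e5 : S.e i * ((β / 4) • S.ω i) = (β / 4) • S.ω i := by rw [mul_smul_comm, heω]
    rw [hA₁, hA₂, e2, e3, neg_smul, neg_smul, one_smul, neg_neg]
    generalize (β / 4) • S.ω i = w at e4 e5
    have e6 := lowerUnip_mul_unip_mul_lowerUnip (t := S.e i) (w := w) (by rw [mul_assoc, e5, e5])
    have e7 := lowerUnip_mul_unip_mul_lowerUnip (t := -S.e i) (w := -w)
      (by rw [neg_mul_neg, mul_neg, mul_assoc, e5, e5])
    rw [neg_neg] at e7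
    rw [e6, e7]
    have e8 : w * S.e i = w := by rw [mul_comm, e5]
    ext <;> simp only [Mat.mul_a, Mat.mul_b, Mat.mul_c, Mat.mul_d, Mat.smul_a, Mat.smul_b,
      Mat.smul_c, Mat.smul_d, neg_mul_neg, e5, e8]
    · linear_combination 10 * e4
    · linear_combination (-2 : R) * e4
    · linear_combination (-2 : R) * e4
    · linear_combination 2 * e4
  set δ := S.rho μ (⟨1 + β • S.ω i, 0, 0, 1⟩ : Mat R) g with hδ
  have hAδ : S.rho μ (A₁ * A₂) g = -δ := by
    rw [hA, S.rho_smul, _root_.smul_apply, ← hδ]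
    have e1 : (1 : R) - (β / 2) • S.ω i = 1 + (-(β / 2)) • S.ω i := by rw [neg_smul]; ring
    have e2 : c * -(β / 2) = ((-Real.pi : ℝ) : ℂ) := by
      rw [hβ]; push_cast; field_simp
    rw [e1, hχ, e2, Complex.ofReal_re]
    have e3 : Complex.exp (Complex.I * ((-Real.pi : ℝ) : ℂ)) = -1 := by
      push_cast
      rw [mul_neg, mul_comm, Complex.exp_neg, Complex.exp_pi_mul_I]; norm_num
    rw [e3, neg_one_smul]
  have h3 : ‖g + δ‖ ≤ 2 * η := by
    have e1 : g + δ = (g - S.rho μ A₂ g) + S.rho μ A₂ (g - S.rho μ A₁ g) := by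
      have : S.rho μ A₂ (S.rho μ A₁ g) = -δ := by rw [← hAδ, S.rho_mul μ A₁ A₂]; rfl
      rw [map_sub, this]; abel
    rw [e1]
    refine (norm_add_le _ _).trans ?_
    have := (S.norm_rho_apply_le μ A₂ (g - S.rho μ A₁ g)).trans h1
    linarith
  have hGm : Measurable g := (Lp.stronglyMeasurable g).measurable
  have h4 : ∫⁻ v in S.unitBall i, ‖g ((1 + β • S.ω i) * v) - g v‖ₑ ^ 2 ∂μ
      ≤ 10 * ENNReal.ofReal (η ^ 2) := by
    refine S.lintegral_displacement_le μ hi hGm hβ0 fun z hz => ?_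
    have e1 := hg 1 (by simp) z hz
    rw [S.rho_one] at e1
    have e2 := ENNReal.ofReal_le_ofReal (pow_le_pow_left₀ (norm_nonneg _) e1 2)
    rw [ofReal_norm_sq] at e2
    refine le_trans (le_of_eq (lintegral_congr_ae ?_)) e2
    filter_upwards [Lp.coeFn_sub g (S.rho μ (unip (z • S.ω i)) g),
      S.rho_ae μ (unip (z • S.ω i)) g] with v hv hv'
    rw [one_apply_eq_self, hv, Pi.sub_apply, hv', S.rhoFun_unip]
  have hδv : ∀ᵐ v ∂μ, δ v = g ((1 + β • S.ω i) * v) := by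
    filter_upwards [S.rho_ae μ (⟨1 + β • S.ω i, 0, 0, 1⟩ : Mat R) g] with v hv
    have hnm : S.nm (1 + β • S.ω i) = 1 := by
      rw [nm]
      refine Finset.prod_eq_one fun j _ => ?_
      have : S.proj j (S.ω i) = 0 := by
        by_cases hj : j = i
        · rw [hj]; exact S.proj_ω_wild hi
        · rw [← S.e_mul_ω i, map_mul, S.proj_e_ne hj, zero_mul]
      simp [this]
    rw [hv]
    simp [rhoFun, den, act, Mat.det, hnm]
  have h5 : 4 * ∫⁻ v in S.unitBall i, ‖g v‖ₑ ^ 2 ∂μ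
      ≤ 2 * ENNReal.ofReal ((2 * η) ^ 2) + 2 * (10 * ENNReal.ofReal (η ^ 2)) := by
    have e1 : ∫⁻ v, ‖(g + δ) v‖ₑ ^ 2 ∂μ ≤ ENNReal.ofReal ((2 * η) ^ 2) := by
      rw [← ofReal_norm_sq]
      exact ENNReal.ofReal_le_ofReal (pow_le_pow_left₀ (norm_nonneg _) h3 2)
    calc 4 * ∫⁻ v in S.unitBall i, ‖g v‖ₑ ^ 2 ∂μ
        = ∫⁻ v in S.unitBall i, 4 * ‖g v‖ₑ ^ 2 ∂μ := (lintegral_const_mul' _ _ (by finiteness)).symm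
      _ ≤ ∫⁻ v in S.unitBall i, (2 * ‖(g + δ) v‖ₑ ^ 2
          + 2 * ‖g ((1 + β • S.ω i) * v) - g v‖ₑ ^ 2) ∂μ := by
          refine lintegral_mono_ae (ae_restrict_of_ae ?_)
          filter_upwards [Lp.coeFn_add g δ, hδv] with v hv hv'
          rw [hv, Pi.add_apply, hv', ← enorm_neg (g ((1 + β • S.ω i) * v) - g v)]
          refine le_trans (le_of_eq ?_) (enorm_add_sq_le _ _)
          have : g v + g ((1 + β • S.ω i) * v) + -(g ((1 + β • S.ω i) * v) - g v) = 2 * g v := by ring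
          rw [this, enorm_mul, mul_pow]
          congr 1
          rw [← ofReal_norm]; norm_num
      _ = 2 * ∫⁻ v in S.unitBall i, ‖(g + δ) v‖ₑ ^ 2 ∂μ
          + 2 * ∫⁻ v in S.unitBall i, ‖g ((1 + β • S.ω i) * v) - g v‖ₑ ^ 2 ∂μ := by
          rw [lintegral_add_left', lintegral_const_mul' _ _ (by finiteness),
            lintegral_const_mul' _ _ (by finiteness)]
          exact ((Lp.aestronglyMeasurable (g + δ)).enorm.pow_const 2).const_mul 2 |>.restrict
      _ ≤ _ := by
          gcongr
          exact (setLIntegral_le_lintegral _ _).trans e1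
  have h6 : 2 * ENNReal.ofReal ((2 * η) ^ 2) + 2 * (10 * ENNReal.ofReal (η ^ 2))
      = 4 * ENNReal.ofReal (7 * η ^ 2) := by
    rw [mul_pow, ENNReal.ofReal_mul (by norm_num), ENNReal.ofReal_mul (by norm_num)]
    norm_num
    ring
  rw [h6] at h5
  exact (ENNReal.mul_le_mul_iff_right (by norm_num) (by norm_num)).1 h5

end SiteData

theorem isCompactOperator_of_norm_le' {E F G : Type*} [NormedAddCommGroup E] [NormedSpace ℂ E]
    [NormedAddCommGroup F] [NormedSpace ℂ F] [CompleteSpace F] [NormedAddCommGroup G]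
    [NormedSpace ℂ G] {T : E →L[ℂ] F}
    (h : ∀ ε > 0, ∃ (ι : Type) (_ : Fintype ι) (S : ι → E →L[ℂ] G) (C : ℝ),
      (∀ i, IsCompactOperator (S i)) ∧ ∀ x, ‖T x‖ ≤ C * ∑ i, ‖S i x‖ + ε * ‖x‖) :
    IsCompactOperator T := by
  refine isCompactOperator_of_norm_le (G := G) fun ε hε => ?_
  obtain ⟨ι, _, S, C, hS, hC⟩ := h ε hε
  refine ⟨Fintype.card ι, fun j => S ((Fintype.equivFin ι).symm j), C, fun j => hS _, fun x => ?_⟩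
  rw [(Fintype.equivFin ι).symm.sum_comp fun i => ‖S i x‖]
  exact hC x

namespace SiteData

variable {κ : Type*} [Fintype κ] {R : Type*} [NormedCommRing R] [NormedAlgebra ℂ R]
  [FiniteDimensional ℂ R] (S : SiteData κ R)
  [MeasurableSpace R] [BorelSpace R] (μ : Measure R) [μ.IsAddHaarMeasure]

theorem exists_unitBall_bound (i : κ) : ∃ (r : ℝ) (Γ : List (Mat R)), (∀ γ ∈ Γ, S.IsLocalAt i γ) ∧
    ∀ (g : Lp ℂ 2 μ) (η : ℝ), (∀ γ ∈ Γ, ∀ z : ℂ, ‖z‖ ≤ r →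
      ‖S.rho μ γ g - S.rho μ (unip (z • S.ω i)) (S.rho μ γ g)‖ ≤ η) →
    ∫⁻ v in S.unitBall i, ‖g v‖ₑ ^ 2 ∂μ ≤ ENNReal.ofReal (‖g‖ ^ 2 / 4 + 7 * η ^ 2) := by
  by_cases hi : S.n i = 0
  · refine ⟨24, [1], by simp [S.isLocalAt_one], fun g η h => ?_⟩
    refine (S.lintegral_unitBall_le_tame μ hi (g := g) (η := η) fun z hz => ?_).trans
      (ENNReal.ofReal_le_ofReal (by nlinarith [sq_nonneg η]))
    have := h 1 (by simp) z hz
    rwa [S.rho_one, one_apply_eq_self] at this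
  · obtain ⟨r, hr⟩ := S.lintegral_unitBall_le_wild μ hi
    refine ⟨r, _, ?_, fun g η h => (hr g η h).trans (ENNReal.ofReal_le_ofReal (by
      nlinarith [sq_nonneg ‖g‖]))⟩
    intro γ hγ
    simp only [List.mem_cons, List.not_mem_nil, or_false] at hγ
    rcases hγ with rfl | rfl | rfl
    · exact S.isLocalAt_one i
    · exact S.isLocalAt_lowerUnip i 1
    · exact S.isLocalAt_lowerUnip i (-1)

/-- The norm is controlled by small translations at one site, after finitely many transformations
at this site. -/
theorem exists_site_bound (i : κ) : ∃ (r : ℝ) (Γ : List (Mat R)), (∀ γ ∈ Γ, S.IsLocalAt i γ) ∧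
    ∀ (g : Lp ℂ 2 μ) (η : ℝ), 0 ≤ η → (∀ γ ∈ Γ, ∀ z : ℂ, ‖z‖ ≤ r →
      ‖S.rho μ γ g - S.rho μ (unip (z • S.ω i)) (S.rho μ γ g)‖ ≤ η) → ‖g‖ ≤ 6 * η := by
  obtain ⟨r, Γ, hΓ, h⟩ := S.exists_unitBall_bound μ i
  refine ⟨r, Γ ++ Γ.map fun γ => S.weyl i * γ, ?_, fun g η hη hg => ?_⟩
  · intro γ hγ
    rw [List.mem_append, List.mem_map] at hγ
    rcases hγ with hγ | ⟨γ', hγ', rfl⟩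
    · exact hΓ γ hγ
    · exact (S.isLocalAt_weyl i).mul (hΓ γ' hγ')
  · have h1 := h g η fun γ hγ => hg γ (List.mem_append_left _ hγ)
    have h2 := h (S.rho μ (S.weyl i) g) η fun γ hγ z hz => by
      have := hg (S.weyl i * γ) (List.mem_append_right _ (List.mem_map_of_mem hγ)) z hz
      rwa [S.rho_mul, mul_apply_eq_comp] at this
    rw [S.norm_rho_apply μ (by simp [det_weyl])] at h2
    have h3 := S.lintegral_compl_unitBall_le μ i g
    have h4 : ENNReal.ofReal (‖g‖ ^ 2)
        ≤ ENNReal.ofReal ((‖g‖ ^ 2 / 4 + 7 * η ^ 2) + (‖g‖ ^ 2 / 4 + 7 * η ^ 2)) := by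
      rw [ofReal_norm_sq, ← lintegral_add_compl _ (S.measurableSet_unitBall i),
        ENNReal.ofReal_add (by positivity) (by positivity)]
      exact add_le_add h1 (h3.trans h2)
    rw [ENNReal.ofReal_le_ofReal_iff (by positivity)] at h4
    refine le_of_sq_le_sq ?_ (by positivity)
    nlinarith [sq_nonneg η]

theorem exists_mul_eq_one {g : Mat R} (hg : IsUnit g.det) : ∃ g' : Mat R, g * g' = 1 ∧ g' * g = 1 := by
  refine ⟨Ring.inverse g.det • g.adj, ?_, ?_⟩
  · have h1 : g * (Ring.inverse g.det • g.adj) = Ring.inverse g.det • (g * g.adj) := by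
      ext <;> simp <;> ring
    rw [h1, Mat.mul_adj, smul_smul, Ring.inverse_mul_cancel _ hg, one_smul]
  · have h1 : (Ring.inverse g.det • g.adj) * g = Ring.inverse g.det • (g.adj * g) := by
      ext <;> simp <;> ring
    rw [h1, Mat.adj_mul, smul_smul, Ring.inverse_mul_cancel _ hg, one_smul]

variable {μ} {S}

theorem RhoContinuous.tendsto {W : Lp ℂ 2 μ →L[ℂ] Lp ℂ 2 μ} (hW : S.RhoContinuous μ W) {g₀ : Mat R}
    (hg : IsUnit g₀.det) : Tendsto (fun g => S.rho μ g * W) (𝓝 g₀) (𝓝 (S.rho μ g₀ * W)) := by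
  obtain ⟨g', h1, h2⟩ := exists_mul_eq_one hg
  have h3 : Tendsto (fun g => g * g') (𝓝 g₀) (𝓝 1) := by
    have : Continuous fun g : Mat R => g * g' := by fun_prop
    simpa [h1] using this.tendsto g₀
  have h4 := (hW.comp h3).const_mul (S.rho μ g₀)
  refine h4.congr fun g => ?_
  rw [Function.comp_apply, ← mul_assoc, ← S.rho_mul, mul_assoc, h2, mul_one]

theorem RhoContinuous.rho_mul {W : Lp ℂ 2 μ →L[ℂ] Lp ℂ 2 μ} (hW : S.RhoContinuous μ W) {γ : Mat R}
    (hγ : IsUnit γ.det) : S.RhoContinuous μ (S.rho μ γ * W) := by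
  have h1 : Tendsto (fun g => γ * g) (𝓝 1) (𝓝 γ) := by
    have : Continuous fun g : Mat R => γ * g := by fun_prop
    simpa using this.tendsto 1
  refine ((hW.tendsto hγ).comp h1).congr fun g => ?_
  rw [Function.comp_apply, S.rho_mul, mul_assoc]

variable (μ) (S)

theorem norm_adjoint_one_sub_rho_unip (h : R) (x : Lp ℂ 2 μ) :
    ‖ContinuousLinearMap.adjoint (1 - S.rho μ (unip h)) x‖ = ‖(1 - S.rho μ (unip h)) x‖ := by
  have h1 : ContinuousLinearMap.adjoint (1 - S.rho μ (unip h)) = 1 - S.rho μ (unip (-h)) := by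
    have e1 : (unip h : Mat R).adj = unip (-h) := by ext <;> simp [unip, Mat.adj]
    have e2 : (unip h : Mat R).det = 1 := by simp [unip, Mat.det]
    rw [map_sub, S.adjoint_rho, e1, e2, S.χ_one]
    simp
    exact ContinuousLinearMap.adjoint_id
  have h2 : S.rho μ (unip h) (S.rho μ (unip (-h)) x) = x := by
    rw [← mul_apply_eq_comp, ← S.rho_mul]
    have : (unip (-h) * unip h : Mat R) = 1 := by ext <;> simp [unip]
    rw [this, S.rho_one, one_apply_eq_self]
  have hu : IsUnit (unip h : Mat R).det := by simp [unip, Mat.det]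
  rw [h1, _root_.sub_apply, _root_.sub_apply, one_apply_eq_self, ← S.norm_rho_apply μ hu, map_sub, h2,
    norm_sub_rev]

theorem commute_rho_diffProd {i : κ} {γ : Mat R} (hγ : S.IsLocalAt i γ) (h : κ → ℂ) {L : List κ}
    (hL : i ∉ L) : Commute (S.rho μ γ) (S.diffProd μ h L) := by
  refine Commute.list_prod_right _ _ fun x hx => ?_
  obtain ⟨j, hj, rfl⟩ := List.mem_map.1 hx
  have hji : j ≠ i := fun h => hL (h ▸ hj)
  refine Commute.pow_right (Commute.sub_right (Commute.one_right _) ?_) _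
  rw [Commute, SemiconjBy, ← S.rho_mul, ← S.rho_mul, hγ.2 j hji]

theorem isLocalAt_unip (i : κ) (h : R) : S.IsLocalAt i (unip h) := by
  refine ⟨by simp [unip, Mat.det], fun j _ z => ?_⟩
  ext <;> simp [unip, add_comm]

theorem continuous_unip : Continuous (unip : R → Mat R) := by
  have : (unip : R → Mat R) = fun h => Mat.mkL (1, h, 0, 1) := rfl
  rw [this]; fun_prop

theorem isCompactOperator_diffProd_of_cons {i : κ} {L : List κ} (hL : i ∉ L)
    (hcons : ∀ (h : κ → ℂ) (W : Lp ℂ 2 μ →L[ℂ] Lp ℂ 2 μ), S.RhoContinuous μ W →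
      IsCompactOperator (S.diffProd μ h (i :: L) * W))
    (h : κ → ℂ) {W : Lp ℂ 2 μ →L[ℂ] Lp ℂ 2 μ} (hW : S.RhoContinuous μ W) :
    IsCompactOperator (S.diffProd μ h L * W) := by
  classical
  obtain ⟨r, Γ, hΓ, hbound⟩ := S.exists_site_bound μ i
  set V := S.diffProd μ h L * W with hV
  have hcomp : ∀ γ ∈ Γ, ∀ z : ℂ, IsCompactOperator
      ((1 - S.rho μ (unip (z • S.ω i))) * (S.rho μ γ * V) : Lp ℂ 2 μ →L[ℂ] Lp ℂ 2 μ) := by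
    intro γ hγ z
    have h1 := hcons (Function.update h i z) (S.rho μ γ * W) (hW.rho_mul (hΓ γ hγ).1)
    have h2 : S.diffProd μ (Function.update h i z) (i :: L)
        = (1 - S.rho μ (unip (z • S.ω i))) ^ (S.n i + 1) * S.diffProd μ h L := by
      rw [diffProd, List.map_cons, List.prod_cons, Function.update_self, diffProd]
      congr 2
      refine List.map_congr_left fun j hj => ?_
      rw [Function.update_of_ne (show j ≠ i from fun hji => hL (by rw [← hji]; exact hj))]
    have h3 : S.diffProd μ h L * (S.rho μ γ * W) = S.rho μ γ * V := by
      rw [hV, ← mul_assoc, ← mul_assoc, (S.commute_rho_diffProd μ (hΓ γ hγ) h hL).eq]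
    rw [h2, mul_assoc, h3] at h1
    exact isCompactOperator_of_normal (S.norm_adjoint_one_sub_rho_unip μ _) h1
  have hcont : ∀ γ ∈ Γ, Continuous fun z : ℂ => S.rho μ (unip (z • S.ω i)) * (S.rho μ γ * V) := by
    intro γ hγ
    have h1 : ∀ z : ℂ, S.rho μ (unip (z • S.ω i)) * (S.rho μ γ * V)
        = S.diffProd μ h L * (S.rho μ (unip (z • S.ω i)) * (S.rho μ γ * W)) := by
      intro z
      have e1 := (S.commute_rho_diffProd μ (hΓ γ hγ) h hL).eq
      have e2 := (S.commute_rho_diffProd μ (S.isLocalAt_unip i (z • S.ω i)) h hL).eq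
      rw [hV, ← mul_assoc (S.rho μ γ), e1, mul_assoc, ← mul_assoc, e2, mul_assoc]
    simp only [h1]
    refine continuous_const.mul (continuous_iff_continuousAt.2 fun z₀ => ?_)
    have h2 : Continuous fun z : ℂ => (unip (z • S.ω i) : Mat R) := continuous_unip.comp (by fun_prop)
    exact ((hW.rho_mul (hΓ γ hγ).1).tendsto (by simp [unip, Mat.det])).comp (h2.tendsto z₀)
  have hprod : Continuous fun (z : ℂ) (j : Fin Γ.length) =>
      S.rho μ (unip (z • S.ω i)) * (S.rho μ (Γ.get j) * V) :=
    continuous_pi fun j => hcont _ (List.get_mem _ _)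
  have htb := ((isCompact_closedBall (0 : ℂ) r).image hprod).totallyBounded
  refine isCompactOperator_of_norm_le' (G := Lp ℂ 2 μ) fun ε hε => ?_
  obtain ⟨t, ht, htf, hcov⟩ := Metric.finite_approx_of_totallyBounded htb (ε / 6) (by positivity)
  choose! c hc hct using fun y (hy : y ∈ t) => ht hy
  have : Fintype t := htf.fintype
  obtain ⟨N, ⟨e⟩⟩ := Finite.exists_equiv_fin t
  refine ⟨Fin Γ.length × Fin N, inferInstance, fun q =>
    (1 - S.rho μ (unip (c (e.symm q.2).1 • S.ω i))) * (S.rho μ (Γ.get q.1) * V), 6,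
    fun q => hcomp _ (List.get_mem _ _) _, fun x => ?_⟩
  set M₀ := ∑ q : Fin Γ.length × Fin N,
    ‖((1 - S.rho μ (unip (c (e.symm q.2).1 • S.ω i))) * (S.rho μ (Γ.get q.1) * V)) x‖ with hM
  have hM0 : 0 ≤ M₀ := Finset.sum_nonneg fun _ _ => norm_nonneg _
  have hb := hbound (V x) (M₀ + ε / 6 * ‖x‖) (by positivity) ?_
  · refine hb.trans (le_of_eq ?_)
    ring
  · intro γ hγ z hz
    obtain ⟨j, rfl⟩ := List.mem_iff_get.1 hγ
    obtain ⟨y, hy, hzy⟩ := mem_iUnion₂.1 (hcov (mem_image_of_mem _ (mem_closedBall_zero_iff.2 hz)))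
    rw [Metric.mem_ball, ← hct y hy, dist_pi_lt_iff (by positivity)] at hzy
    have h1 := (hzy j).le
    rw [dist_eq_norm] at h1
    have h2 : S.rho μ (Γ.get j) (V x) - S.rho μ (unip (z • S.ω i)) (S.rho μ (Γ.get j) (V x))
        = ((1 - S.rho μ (unip (c y • S.ω i))) * (S.rho μ (Γ.get j) * V)) x
          - (S.rho μ (unip (z • S.ω i)) * (S.rho μ (Γ.get j) * V)
            - S.rho μ (unip (c y • S.ω i)) * (S.rho μ (Γ.get j) * V)) x := by
      simp only [mul_apply_eq_comp, _root_.sub_apply, one_apply_eq_self]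
      abel
    rw [h2]
    refine (norm_sub_le _ _).trans (add_le_add ?_ (ContinuousLinearMap.le_of_opNorm_le _ h1 x))
    have h3 := Finset.single_le_sum (f := fun q : Fin Γ.length × Fin N =>
      ‖((1 - S.rho μ (unip (c (e.symm q.2).1 • S.ω i))) * (S.rho μ (Γ.get q.1) * V)) x‖)
      (fun _ _ => norm_nonneg _) (Finset.mem_univ (j, e ⟨y, hy⟩))
    simpa only [Equiv.symm_apply_apply] using h3

/-- Operators `W` such that `g ↦ rho g * W` is norm-continuous are compact. -/
theorem isCompactOperator_of_rhoContinuous {W : Lp ℂ 2 μ →L[ℂ] Lp ℂ 2 μ}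
    (hW : S.RhoContinuous μ W) : IsCompactOperator W := by
  have key : ∀ L : List κ, L.Nodup → (∀ (h : κ → ℂ) (W : Lp ℂ 2 μ →L[ℂ] Lp ℂ 2 μ),
      S.RhoContinuous μ W → IsCompactOperator (S.diffProd μ h L * W)) →
      ∀ W : Lp ℂ 2 μ →L[ℂ] Lp ℂ 2 μ, S.RhoContinuous μ W → IsCompactOperator W := by
    intro L
    induction L with
    | nil =>
      intro _ h W hW
      simpa [diffProd] using h 0 W hW
    | cons i L ih =>
      intro hnd h
      rw [List.nodup_cons] at hnd
      exact ih hnd.2 fun h' W hW => S.isCompactOperator_diffProd_of_cons μ hnd.1 h h' hW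
  exact key Finset.univ.toList (Finset.nodup_toList _)
    (fun h W hW => S.isCompactOperator_diffProd_mul μ hW h) W hW

end SiteData

section WordSpan

open Submodule

variable {A : Type*} [Ring A] [Algebra ℂ A] [FiniteDimensional ℂ A]

theorem span_unit_mul_inv (u : Aˣ) : span ℂ {(u : A)} * span ℂ {((u⁻¹ : Aˣ) : A)} = 1 := by
  rw [span_mul_span, singleton_mul_singleton, Units.mul_inv, one_eq_span]

theorem span_inv_mul_unit (u : Aˣ) : span ℂ {((u⁻¹ : Aˣ) : A)} * span ℂ {(u : A)} = 1 := by
  rw [span_mul_span, singleton_mul_singleton, Units.inv_mul, one_eq_span]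

theorem finrank_mul_span_unit (V : Submodule ℂ A) (u : Aˣ) :
    Module.finrank ℂ ↥(V * span ℂ {(u : A)}) = Module.finrank ℂ V := by
  have h : V * span ℂ {(u : A)} = V.map (LinearMap.mulRight ℂ (u : A)) := by
    ext y
    simp [Submodule.mem_mul_span_singleton]
  rw [h]
  refine (LinearEquiv.finrank_eq (Submodule.equivMapOfInjective _ ?_ V)).symm
  exact u.isUnit.mul_left_injective

theorem finrank_span_unit_mul (V : Submodule ℂ A) (u : Aˣ) :
    Module.finrank ℂ ↥(span ℂ {(u : A)} * V) = Module.finrank ℂ V := by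
  have h : span ℂ {(u : A)} * V = V.map (LinearMap.mulLeft ℂ (u : A)) := by
    ext y
    simp [Submodule.mem_span_singleton_mul]
  rw [h]
  refine (LinearEquiv.finrank_eq (Submodule.equivMapOfInjective _ ?_ V)).symm
  exact u.isUnit.mul_right_injective

theorem top_mul_span_unit (u : Aˣ) : (⊤ : Submodule ℂ A) * span ℂ {(u : A)} = ⊤ := by
  apply Submodule.eq_top_of_finrank_eq
  rw [finrank_mul_span_unit, finrank_top]

variable {ι : Type*} (g : ι → Aˣ) (g' : ι → A) (L₀ : Submodule ℂ A)

/-- The product of the letters of a word, the first letter being the last factor. -/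
def wordProd : List ι → Aˣ
  | [] => 1
  | s :: l => wordProd l * g s

/-- The space of tangent vectors at the product of a word which arise by multiplying it with `L₀`
and moving one of the letters `g s` in the direction `g' s`. -/
def wordSpan : List ι → Submodule ℂ A
  | [] => L₀
  | s :: l => wordSpan l * span ℂ {(g s : A)} ⊔ span ℂ {(wordProd g l : A)} * span ℂ {g' s}

theorem wordProd_append (m l : List ι) : wordProd g (m ++ l) = wordProd g l * wordProd g m := by
  induction m with
  | nil => simp [wordProd]
  | cons s m ih => simp [wordProd, ih, mul_assoc]

theorem span_wordProd_append (m l : List ι) : span ℂ {(wordProd g (m ++ l) : A)}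
    = span ℂ {(wordProd g l : A)} * span ℂ {(wordProd g m : A)} := by
  rw [span_mul_span, singleton_mul_singleton, wordProd_append, Units.val_mul]

theorem span_wordProd_cons (s : ι) (l : List ι) : span ℂ {(wordProd g (s :: l) : A)}
    = span ℂ {(wordProd g l : A)} * span ℂ {(g s : A)} := by
  rw [span_mul_span, singleton_mul_singleton, wordProd, Units.val_mul]

theorem wordSpan_mul_le (m l : List ι) :
    wordSpan g g' L₀ l * span ℂ {(wordProd g m : A)} ≤ wordSpan g g' L₀ (m ++ l) := by
  induction m with
  | nil => rw [wordProd, Units.val_one, ← one_eq_span, mul_one]; rfl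
  | cons s m ih =>
    rw [span_wordProd_cons, ← mul_assoc]
    exact (mul_le_mul_left ih _).trans le_sup_left

theorem mul_wordSpan_le (hL₀ : ∀ s, L₀ * span ℂ {(g s : A)} = span ℂ {(g s : A)} * L₀)
    (m l : List ι) :
    span ℂ {(wordProd g l : A)} * wordSpan g g' L₀ m ≤ wordSpan g g' L₀ (m ++ l) := by
  induction m with
  | nil =>
    rw [List.nil_append]
    induction l with
    | nil => rw [wordProd, Units.val_one, ← one_eq_span, one_mul]
    | cons s l ih =>
      rw [span_wordProd_cons, mul_assoc, wordSpan, ← hL₀, ← mul_assoc]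
      exact (mul_le_mul_left ih _).trans le_sup_left
  | cons s m ih =>
    rw [wordSpan, Submodule.mul_sup, ← mul_assoc, ← mul_assoc, List.cons_append, wordSpan,
      span_wordProd_append]
    exact sup_le_sup (mul_le_mul_left ih _) le_rfl

theorem exists_wordSpan_eq_top
    (hL₀ : ∀ s, L₀ * span ℂ {(g s : A)} = span ℂ {(g s : A)} * L₀)
    (hK : ∀ K : Submodule ℂ A, L₀ ≤ K →
      (∀ s, span ℂ {(g s : A)} * K = K * span ℂ {(g s : A)}) →
      (∀ s, span ℂ {g' s} ≤ K * span ℂ {(g s : A)}) → K = ⊤) :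
    ∃ l, wordSpan g g' L₀ l = ⊤ := by
  obtain ⟨l, hl⟩ : ∃ l, ∀ m, Module.finrank ℂ (wordSpan g g' L₀ m)
      ≤ Module.finrank ℂ (wordSpan g g' L₀ l) := by
    have hb : BddAbove (Set.range fun l => Module.finrank ℂ (wordSpan g g' L₀ l)) :=
      ⟨Module.finrank ℂ A, by rintro _ ⟨l, rfl⟩; exact Submodule.finrank_le _⟩
    obtain ⟨l, hl⟩ := Nat.sSup_mem (Set.range_nonempty _) hb
    exact ⟨l, fun m => by
      have := le_csSup hb (Set.mem_range_self m)
      rw [← hl] at this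
      exact this⟩
  set V := wordSpan g g' L₀ l with hV
  set Γ := span ℂ {(wordProd g l : A)} with hΓ
  set Γ' := span ℂ {(((wordProd g l)⁻¹ : Aˣ) : A)} with hΓ'
  have e1 : ∀ m, wordSpan g g' L₀ (m ++ l) = V * span ℂ {(wordProd g m : A)} := fun m =>
    (Submodule.eq_of_le_of_finrank_le (wordSpan_mul_le g g' L₀ m l)
      (by rw [finrank_mul_span_unit]; exact hl _)).symm
  have e2 : ∀ m, wordSpan g g' L₀ (l ++ m) = span ℂ {(wordProd g m : A)} * V := fun m =>
    (Submodule.eq_of_le_of_finrank_le (mul_wordSpan_le g g' L₀ hL₀ l m)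
      (by rw [finrank_span_unit_mul]; exact hl _)).symm
  have f1 : ∀ m, Γ * wordSpan g g' L₀ m ≤ V * span ℂ {(wordProd g m : A)} := fun m =>
    (mul_wordSpan_le g g' L₀ hL₀ m l).trans (e1 m).le
  have f2 : ∀ m, wordSpan g g' L₀ m * Γ ≤ span ℂ {(wordProd g m : A)} * V := fun m =>
    (wordSpan_mul_le g g' L₀ l m).trans (e2 m).le
  have i1 : Γ * Γ' = 1 := span_unit_mul_inv _
  have i2 : Γ' * Γ = 1 := span_inv_mul_unit _
  have hcomm : Γ * V = V * Γ := le_antisymm (f1 l) (f2 l)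
  have hcancel : ∀ {X Y : Submodule ℂ A}, Γ * X ≤ Γ * Y → X ≤ Y := fun {X Y} h => by
    have := mul_le_mul_right h Γ'
    rwa [← mul_assoc, ← mul_assoc, i2, one_mul, one_mul] at this
  have hcancel' : ∀ {X Y : Submodule ℂ A}, X * Γ ≤ Y * Γ → X ≤ Y := fun {X Y} h => by
    have := mul_le_mul_left h Γ'
    rwa [mul_assoc, mul_assoc, i1, mul_one, mul_one] at this
  clear_value V Γ Γ'
  obtain ⟨K, hKdef⟩ : ∃ K, K = V * Γ' := ⟨_, rfl⟩
  have hVK : V = K * Γ := by rw [hKdef, mul_assoc, i2, mul_one]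
  have hVK' : V = Γ * K := by rw [hKdef, ← mul_assoc, hcomm, mul_assoc, i1, mul_one]
  have hone : ∀ s, span ℂ {(wordProd g [s] : A)} = span ℂ {(g s : A)} := fun s => by
    simp [wordProd]
  have htop : K = ⊤ := by
    refine hK K ?_ ?_ ?_
    · apply hcancel
      rw [← hVK']
      have := f1 []
      rwa [wordProd, Units.val_one, ← one_eq_span, mul_one] at this
    · intro s
      have h1 : K * span ℂ {(g s : A)} ≤ span ℂ {(g s : A)} * K := by
        have h2 : V * span ℂ {(g s : A)} * Γ ≤ Γ * span ℂ {(g s : A)} * V := by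
          have h3 := f2 ([s] ++ l)
          rwa [e1, hone, span_wordProd_append, hone, ← hΓ] at h3
        generalize span ℂ {(g s : A)} = G at h2 ⊢
        have h3 : Γ * (K * G * Γ) ≤ Γ * (G * K * Γ) := by
          calc Γ * (K * G * Γ) = (Γ * K) * G * Γ := by simp only [mul_assoc]
            _ = V * G * Γ := by rw [← hVK']
            _ ≤ Γ * G * V := h2
            _ = Γ * G * (K * Γ) := by rw [← hVK]
            _ = Γ * (G * K * Γ) := by simp only [mul_assoc]
        exact hcancel' (hcancel h3)
      exact (Submodule.eq_of_le_of_finrank_le h1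
        (by rw [finrank_span_unit_mul, finrank_mul_span_unit])).symm
    · intro s
      have h1 := f1 [s]
      rw [hone, hVK', mul_assoc] at h1
      refine le_trans ?_ (hcancel h1)
      rw [wordSpan, wordSpan, wordProd, Units.val_one, ← one_eq_span, one_mul]
      exact le_sup_right
  exact ⟨l, by rw [← hV, hVK, htop, hΓ, top_mul_span_unit]⟩

end WordSpan

namespace Mat

variable {R : Type*} [NormedCommRing R] [NormedAlgebra ℂ R]

theorem csmul_eq (r : ℂ) (g : Mat R) : r • g = algebraMap ℂ R r • g := by
  ext <;> exact Algebra.smul_def _ _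

theorem isUnit_of_isUnit_det {g : Mat R} (hg : IsUnit g.det) : IsUnit g := by
  obtain ⟨r, hr⟩ := hg
  refine ⟨⟨g, ((r⁻¹ : Rˣ) : R) • adj g, ?_, ?_⟩, rfl⟩
  · have : g * (((r⁻¹ : Rˣ) : R) • adj g) = ((r⁻¹ : Rˣ) : R) • (g * adj g) := by
      ext <;> simp <;> ring
    rw [this, mul_adj, ← hr, smul_smul, Units.inv_mul, one_smul]
  · have : ((r⁻¹ : Rˣ) : R) • adj g * g = ((r⁻¹ : Rˣ) : R) • (adj g * g) := by
      ext <;> simp <;> ring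
    rw [this, adj_mul, ← hr, smul_smul, Units.inv_mul, one_smul]

theorem continuous_adj' [FiniteDimensional ℂ R] : Continuous (adj : Mat R → Mat R) := by
  have : (adj : Mat R → Mat R) = fun g => mkL (g.d, -g.b, -g.c, g.a) := rfl
  rw [this]; fun_prop

variable (R) in
/-- The scalar matrices. -/
def scalars : Submodule ℂ (Mat R) where
  carrier := {g | g.b = 0 ∧ g.c = 0 ∧ g.a = g.d}
  add_mem' := by
    rintro g h ⟨h1, h2, h3⟩ ⟨k1, k2, k3⟩
    exact ⟨by simp [h1, k1], by simp [h2, k2], by simp [h3, k3]⟩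
  zero_mem' := by simp
  smul_mem' := by
    rintro c g ⟨h1, h2, h3⟩
    exact ⟨by simp [h1], by simp [h2], by simp [h3]⟩

theorem mem_scalars {g : Mat R} : g ∈ scalars R ↔ ∃ r : R, g = r • (1 : Mat R) := by
  constructor
  · rintro ⟨h1, h2, h3⟩
    exact ⟨g.a, by ext <;> simp [h1, h2, h3]⟩
  · rintro ⟨r, rfl⟩
    exact ⟨by simp, by simp, by simp⟩

theorem scalars_mul_span (g : Mat R) :
    scalars R * Submodule.span ℂ {g} = Submodule.span ℂ {g} * scalars R := by
  ext y
  rw [Submodule.mem_mul_span_singleton, Submodule.mem_span_singleton_mul]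
  constructor
  · rintro ⟨k, hk, rfl⟩
    obtain ⟨r, rfl⟩ := mem_scalars.1 hk
    exact ⟨_, hk, by ext <;> simp [mul_comm]⟩
  · rintro ⟨k, hk, rfl⟩
    obtain ⟨r, rfl⟩ := mem_scalars.1 hk
    exact ⟨_, hk, by ext <;> simp [mul_comm]⟩

end Mat

/-- An element `z` of `R` (the coordinate function on the divisor of glued points) and two points
`tp`, `tq`, the positions of the two points which are not glued. -/
structure HeckeData (R : Type*) [NormedCommRing R] [NormedAlgebra ℂ R] where
  /-- the position of the first distinguished point -/
  tp : ℂ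
  /-- the position of the second distinguished point -/
  tq : ℂ
  /-- the coordinate function on the glued points -/
  z : R
  tp_ne_tq : tp ≠ tq
  isUnit_sub_tp : IsUnit (z - algebraMap ℂ R tp)
  isUnit_sub_tq : IsUnit (z - algebraMap ℂ R tq)
  adjoin_z : Algebra.adjoin ℂ {z} = ⊤

namespace HeckeData

variable {R : Type*} [NormedCommRing R] [NormedAlgebra ℂ R] (H : HeckeData R)

/-- The admissible positions of the Hecke modification. -/
def Regular (x : ℂ) : Prop := x ≠ H.tp ∧ x ≠ H.tq ∧ IsUnit (H.z - algebraMap ℂ R x)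

/-- The linear function with values `tp - x` at `0` and `tq - x` at `1`. -/
def lin (x s : ℂ) : ℂ := (H.tq - H.tp) * s + (H.tp - x)

/-- The matrix of the Hecke modification at `x` with parameter `s`, in normalized coordinates. -/
def mat (x s : ℂ) : Mat R :=
  ⟨algebraMap ℂ R ((H.tp - x) * (s - 1)), algebraMap ℂ R (s * (s - 1)) * (H.z - algebraMap ℂ R H.tp),
    algebraMap ℂ R (-H.lin x s), algebraMap ℂ R (H.lin x s * s)⟩

/-- The derivative of `mat` in the parameter `s`. -/
def matDeriv (x s : ℂ) : Mat R :=
  ⟨algebraMap ℂ R (H.tp - x), algebraMap ℂ R (2 * s - 1) * (H.z - algebraMap ℂ R H.tp),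
    algebraMap ℂ R (-(H.tq - H.tp)), algebraMap ℂ R ((H.tq - H.tp) * s + H.lin x s)⟩

/-- The parameters for which the matrix of the Hecke modification is invertible. -/
def good (x : ℂ) : Set ℂ := {s | s ≠ 0 ∧ s ≠ 1 ∧ H.lin x s ≠ 0}

theorem det_mat (x s : ℂ) : (H.mat x s).det
    = algebraMap ℂ R (H.lin x s * (s * (s - 1))) * (H.z - algebraMap ℂ R x) := by
  simp only [Mat.det, mat, lin, map_mul, map_sub, map_add, map_neg, map_one]
  ring

theorem isUnit_det_mat {x s : ℂ} (hx : H.Regular x) (hs : s ∈ H.good x) : IsUnit (H.mat x s).det := by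
  rw [det_mat]
  refine IsUnit.mul (IsUnit.map _ (IsUnit.mk0 _ ?_)) hx.2.2
  exact mul_ne_zero hs.2.2 (mul_ne_zero hs.1 (sub_ne_zero.2 hs.2.1))

theorem dense_good (x : ℂ) : Dense (H.good x) := by
  have h : ({0, 1, -(H.tp - x) / (H.tq - H.tp)} : Set ℂ)ᶜ ⊆ H.good x := by
    intro s hs
    simp only [mem_compl_iff, mem_insert_iff, mem_singleton_iff, not_or] at hs
    refine ⟨hs.1, hs.2.1, fun h0 => hs.2.2 ?_⟩
    rw [eq_div_iff (sub_ne_zero.2 H.tp_ne_tq.symm)]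
    rw [lin] at h0
    linear_combination h0
  exact ((Set.toFinite _).countable.dense_compl ℝ).mono h

variable [FiniteDimensional ℂ R]

@[fun_prop] theorem continuous_algebraMap' : Continuous (algebraMap ℂ R) := continuous_algebraMap ℂ R

theorem continuous_mat (x : ℂ) : Continuous (H.mat x) := by
  have : H.mat x = fun s => Mat.mkL (algebraMap ℂ R ((H.tp - x) * (s - 1)),
    algebraMap ℂ R (s * (s - 1)) * (H.z - algebraMap ℂ R H.tp),
    algebraMap ℂ R (-H.lin x s), algebraMap ℂ R (H.lin x s * s)) := rfl
  rw [this]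
  unfold lin
  fun_prop

theorem continuous_matDeriv (x : ℂ) : Continuous (H.matDeriv x) := by
  have : H.matDeriv x = fun s => Mat.mkL (algebraMap ℂ R (H.tp - x),
    algebraMap ℂ R (2 * s - 1) * (H.z - algebraMap ℂ R H.tp),
    algebraMap ℂ R (-(H.tq - H.tp)), algebraMap ℂ R ((H.tq - H.tp) * s + H.lin x s)) := rfl
  rw [this]
  unfold lin
  fun_prop

/-- A linear space of matrices containing the scalars which is invariant under conjugation by the
Hecke matrices and contains their logarithmic derivatives is the space of all matrices. -/
theorem eq_top_of_invariant {x : ℂ} (hx : H.Regular x) (K : Submodule ℂ (Mat R))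
    (h0 : Mat.scalars R ≤ K)
    (hconj : ∀ s ∈ H.good x, ∀ Y ∈ K, ∃ Y' ∈ K, H.mat x s * Y = Y' * H.mat x s)
    (hder : ∀ s ∈ H.good x, ∃ Y ∈ K, H.matDeriv x s = Y * H.mat x s) : K = ⊤ := by
  obtain ⟨b, hb⟩ := hx.2.2.exists_left_inv
  have hap : H.tp - x ≠ 0 := sub_ne_zero.2 hx.1.symm
  have haq : H.tq - x ≠ 0 := sub_ne_zero.2 hx.2.1.symm
  have hδ : H.tq - H.tp ≠ 0 := sub_ne_zero.2 H.tp_ne_tq.symm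
  have hKc : IsClosed (K : Set (Mat R)) := Submodule.closed_of_finiteDimensional K
  have hscale : ∀ (s : ℂ) (Y Y' G : Mat R), Y' ∈ K → G = Y' * H.mat x s →
      b • (G * (H.mat x s).adj) ∈ K := by
    intro s Y Y' G hY' hG
    have : b • (G * (H.mat x s).adj) = (H.lin x s * (s * (s - 1))) • Y' := by
      rw [hG, mul_assoc, Mat.mul_adj, det_mat]
      generalize H.lin x s * (s * (s - 1)) = k
      ext
      · simp [Mat.csmul_eq]; linear_combination algebraMap ℂ R k * Y'.a * hb
      · simp [Mat.csmul_eq]; linear_combination algebraMap ℂ R k * Y'.b * hb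
      · simp [Mat.csmul_eq]; linear_combination algebraMap ℂ R k * Y'.c * hb
      · simp [Mat.csmul_eq]; linear_combination algebraMap ℂ R k * Y'.d * hb
    rw [this]
    exact K.smul_mem _ hY'
  have hcont : Continuous fun G : Mat R => b • G := by
    have : (fun G : Mat R => b • G) = fun G => (b • (1 : Mat R)) * G := by
      funext G; ext <;> simp
    rw [this]; fun_prop
  have hadj : Continuous (Mat.adj : Mat R → Mat R) := Mat.continuous_adj'
  have hrule : ∀ s, ∀ Y ∈ K, b • (H.mat x s * Y * (H.mat x s).adj) ∈ K := by
    intro s Y hY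
    have hc : IsClosed {s | b • (H.mat x s * Y * (H.mat x s).adj) ∈ K} := by
      refine hKc.preimage (hcont.comp ?_)
      exact ((H.continuous_mat x).mul continuous_const).mul (hadj.comp (H.continuous_mat x))
    refine (hc.closure_subset_iff.2 ?_) ((H.dense_good x).closure_eq.symm ▸ mem_univ s)
    intro s hs
    obtain ⟨Y', hY', h1⟩ := hconj s hs Y hY
    exact hscale s Y Y' _ hY' h1
  have hstart : ∀ s, b • (H.matDeriv x s * (H.mat x s).adj) ∈ K := by
    intro s
    have hc : IsClosed {s | b • (H.matDeriv x s * (H.mat x s).adj) ∈ K} := by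
      refine hKc.preimage (hcont.comp ?_)
      exact (H.continuous_matDeriv x).mul (hadj.comp (H.continuous_mat x))
    refine (hc.closure_subset_iff.2 ?_) ((H.dense_good x).closure_eq.symm ▸ mem_univ s)
    intro s hs
    obtain ⟨Y', hY', h1⟩ := hder s hs
    exact hscale s Y' Y' _ hY' h1
  set u := H.z - algebraMap ℂ R H.tp with hu
  -- the rule obtained from the parameter `0`
  have rule0 : ∀ Y ∈ K, (⟨-(b * Y.b), b * Y.b, -(b * Y.b), b * Y.b⟩ : Mat R) ∈ K := by
    intro Y hY
    have h1 : b • (H.mat x 0 * Y * (H.mat x 0).adj)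
        = ((H.tp - x) ^ 2) • (⟨-(b * Y.b), b * Y.b, -(b * Y.b), b * Y.b⟩ : Mat R) := by
      ext <;> simp [mat, lin, Mat.adj, Mat.csmul_eq] <;> ring
    exact (K.smul_mem_iff (pow_ne_zero 2 hap)).1 (h1 ▸ hrule 0 Y hY)
  -- the rule obtained from the parameter `1`
  have rule1 : ∀ Y ∈ K, (⟨0, 0, b * (-Y.a - Y.b + Y.c + Y.d), 0⟩ : Mat R) ∈ K := by
    intro Y hY
    have h1 : b • (H.mat x 1 * Y * (H.mat x 1).adj)
        = ((H.tq - x) ^ 2) • (⟨0, 0, b * (-Y.a - Y.b + Y.c + Y.d), 0⟩ : Mat R) := by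
      ext <;> simp [mat, lin, Mat.adj, Mat.csmul_eq] <;> ring
    exact (K.smul_mem_iff (pow_ne_zero 2 haq)).1 (h1 ▸ hrule 1 Y hY)
  -- the rule obtained from the zero of `lin`
  set σ : ℂ := -(H.tp - x) / (H.tq - H.tp) with hσ
  have hσ1 : (H.tq - H.tp) * σ = -(H.tp - x) := by rw [hσ]; field_simp
  have hσ0 : σ * (σ - 1) ≠ 0 := by
    have h1 : σ - 1 = -(H.tq - x) / (H.tq - H.tp) := by rw [hσ]; field_simp; ring
    rw [h1, hσ]
    exact mul_ne_zero (div_ne_zero (neg_ne_zero.2 hap) hδ) (div_ne_zero (neg_ne_zero.2 haq) hδ)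
  have hmatσ : H.mat x σ = (σ * (σ - 1)) • (⟨-algebraMap ℂ R (H.tq - H.tp), u, 0, 0⟩ : Mat R) := by
    have e1 : H.lin x σ = 0 := by rw [lin, hσ1]; ring
    have e2 : H.tp - x = -((H.tq - H.tp) * σ) := by rw [hσ1]; ring
    ext
    · simp only [mat, e2, Mat.csmul_eq, Mat.smul_a, map_mul, map_sub, map_neg]; ring
    · simp only [mat, Mat.csmul_eq, Mat.smul_b, map_mul, map_sub, hu]
    · simp [mat, e1]
    · simp [mat, e1]
  have ruleσ : ∀ Y ∈ K, (⟨0, b * (algebraMap ℂ R (H.tq - H.tp) * u * Y.a - u ^ 2 * Y.c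
      + algebraMap ℂ R (H.tq - H.tp) ^ 2 * Y.b - algebraMap ℂ R (H.tq - H.tp) * u * Y.d), 0, 0⟩ : Mat R)
      ∈ K := by
    intro Y hY
    have h1 : b • (H.mat x σ * Y * (H.mat x σ).adj) = ((σ * (σ - 1)) ^ 2) •
        (⟨0, b * (algebraMap ℂ R (H.tq - H.tp) * u * Y.a - u ^ 2 * Y.c
      + algebraMap ℂ R (H.tq - H.tp) ^ 2 * Y.b - algebraMap ℂ R (H.tq - H.tp) * u * Y.d), 0, 0⟩ : Mat R) := by
      rw [hmatσ]
      generalize H.tq - H.tp = δ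
      generalize σ * (σ - 1) = k
      ext <;> simp [Mat.adj, Mat.csmul_eq] <;> ring
    exact (K.smul_mem_iff (pow_ne_zero 2 hσ0)).1 (h1 ▸ hrule σ Y hY)
  have hE12 : ∀ r : R, (⟨0, r, 0, 0⟩ : Mat R) ∈ K → (⟨0, b * r, 0, 0⟩ : Mat R) ∈ K := by
    intro r hr
    have h1 := ruleσ _ hr
    have h2 : (⟨0, b * (algebraMap ℂ R (H.tq - H.tp) * u * 0 - u ^ 2 * 0
      + algebraMap ℂ R (H.tq - H.tp) ^ 2 * r - algebraMap ℂ R (H.tq - H.tp) * u * 0), 0, 0⟩ : Mat R)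
        = ((H.tq - H.tp) ^ 2) • (⟨0, b * r, 0, 0⟩ : Mat R) := by
      ext <;> simp [Mat.csmul_eq]
      ring
    exact (K.smul_mem_iff (pow_ne_zero 2 hδ)).1 (h2 ▸ h1)
  set r₀ := b ^ 2 * u * (H.z - algebraMap ℂ R H.tq) with hr₀
  have hbu : IsUnit b := ⟨⟨b, _, hb, by rw [mul_comm]; exact hb⟩, rfl⟩
  have hr₀u : IsUnit r₀ := ((hbu.pow 2).mul H.isUnit_sub_tp).mul H.isUnit_sub_tq
  have hr₀K : (⟨0, r₀, 0, 0⟩ : Mat R) ∈ K := by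
    have h1 : b • (H.matDeriv x 0 * (H.mat x 0).adj)
        = (H.tp - x) • (⟨-(b * u), b * u, b * algebraMap ℂ R (H.tp - x),
          -(b * algebraMap ℂ R (H.tp - x))⟩ : Mat R) := by
      ext <;> simp [mat, matDeriv, lin, Mat.adj, Mat.csmul_eq] <;> ring
    have h2 := ruleσ _ ((K.smul_mem_iff hap).1 (h1 ▸ hstart 0))
    have h3 : (⟨0, b * (algebraMap ℂ R (H.tq - H.tp) * u * (-(b * u))
        - u ^ 2 * (b * algebraMap ℂ R (H.tp - x))
        + algebraMap ℂ R (H.tq - H.tp) ^ 2 * (b * u)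
        - algebraMap ℂ R (H.tq - H.tp) * u * -(b * algebraMap ℂ R (H.tp - x))), 0, 0⟩ : Mat R)
        = (-(H.tq - x)) • (⟨0, r₀, 0, 0⟩ : Mat R) := by
      ext <;> simp [Mat.csmul_eq, hr₀, hu]
      ring
    exact (K.smul_mem_iff (neg_ne_zero.2 haq)).1 (h3 ▸ h2)
  -- hence all upper triangular nilpotent matrices
  let P : Submodule ℂ R :=
    { carrier := {r | (⟨0, r * r₀, 0, 0⟩ : Mat R) ∈ K}
      add_mem' := by
        intro r r' hr hr'
        have := K.add_mem hr hr'
        rw [mem_ofPred_eq]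
        convert this using 1
        ext <;> simp [add_mul]
      zero_mem' := by
        rw [mem_ofPred_eq]
        convert K.zero_mem using 1
        ext <;> simp
      smul_mem' := by
        intro c r hr
        have := K.smul_mem c hr
        rw [mem_ofPred_eq]
        convert this using 1
        ext <;> simp }
  have hP1 : (1 : R) ∈ P := by
    change (⟨0, 1 * r₀, 0, 0⟩ : Mat R) ∈ K
    rwa [one_mul]
  have hPb : ∀ r ∈ P, b * r ∈ P := by
    intro r hr
    change (⟨0, b * r * r₀, 0, 0⟩ : Mat R) ∈ K
    rw [mul_assoc]
    exact hE12 _ hr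
  have hPb' : P.map (LinearMap.mulLeft ℂ b) = P := by
    refine Submodule.eq_of_le_of_finrank_le ?_ ?_
    · rintro _ ⟨r, hr, rfl⟩
      exact hPb r hr
    · exact (LinearEquiv.finrank_eq (Submodule.equivMapOfInjective _ hbu.mul_right_injective P)).le
  have hPz : ∀ r ∈ P, H.z * r ∈ P := by
    intro r hr
    obtain ⟨r', hr', h1⟩ := hPb'.symm ▸ hr
    have h2 : H.z * r = r' + x • r := by
      rw [Algebra.smul_def]
      change b * r' = r at h1
      linear_combination r' * hb - (H.z - algebraMap ℂ R x) * h1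
    rw [h2]
    exact P.add_mem hr' (P.smul_mem x hr)
  have hPtop : ∀ r : R, r ∈ P := by
    intro r
    have hr : r ∈ Algebra.adjoin ℂ {H.z} := by rw [H.adjoin_z]; trivial
    have h1 : ∀ y ∈ Algebra.adjoin ℂ {H.z}, ∀ r ∈ P, y * r ∈ P := by
      intro y hy
      induction hy using Algebra.adjoin_induction with
      | mem y hy => rw [mem_singleton_iff.1 hy]; exact hPz
      | algebraMap c => intro r hr; rw [← Algebra.smul_def]; exact P.smul_mem c hr
      | add y y' _ _ h h' => intro r hr; rw [add_mul]; exact P.add_mem (h r hr) (h' r hr)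
      | mul y y' _ _ h h' => intro r hr; rw [mul_assoc]; exact h _ (h' r hr)
    simpa using h1 r hr 1 hP1
  have hup : ∀ r : R, (⟨0, r, 0, 0⟩ : Mat R) ∈ K := by
    intro r
    obtain ⟨c, hc⟩ := hr₀u.exists_left_inv
    have h1 : (⟨0, r * c * r₀, 0, 0⟩ : Mat R) ∈ K := hPtop (r * c)
    rwa [mul_assoc, hc, mul_one] at h1
  have hlow : ∀ r : R, (⟨0, 0, r, 0⟩ : Mat R) ∈ K := by
    intro r
    have h1 := K.neg_mem (rule1 _ (hup ((H.z - algebraMap ℂ R x) * r)))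
    convert h1 using 1
    ext <;> simp
    linear_combination -r * hb
  have hJ : ∀ r : R, (⟨-r, r, -r, r⟩ : Mat R) ∈ K := by
    intro r
    have h1 := rule0 _ (hup ((H.z - algebraMap ℂ R x) * r))
    simp only [← mul_assoc, hb, one_mul] at h1
    exact h1
  rw [eq_top_iff]
  intro g _
  have h1 : g = ((g.d + g.a) * algebraMap ℂ R (1 / 2)) • (1 : Mat R)
      + ((⟨-((g.d - g.a) * algebraMap ℂ R (1 / 2)), (g.d - g.a) * algebraMap ℂ R (1 / 2),
        -((g.d - g.a) * algebraMap ℂ R (1 / 2)), (g.d - g.a) * algebraMap ℂ R (1 / 2)⟩ : Mat R)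
      + ((⟨0, g.b - (g.d - g.a) * algebraMap ℂ R (1 / 2), 0, 0⟩ : Mat R)
      + (⟨0, 0, g.c + (g.d - g.a) * algebraMap ℂ R (1 / 2), 0⟩ : Mat R))) := by
    have hhalf : algebraMap ℂ R (1 / 2) + algebraMap ℂ R (1 / 2) = 1 := by
      rw [← map_add]; norm_num
    ext
    · simp only [Mat.add_a, Mat.smul_a, Mat.one_a]; linear_combination -g.a * hhalf
    · simp only [Mat.add_b, Mat.smul_b, Mat.one_b]; ring
    · simp only [Mat.add_c, Mat.smul_c, Mat.one_c]; ring
    · simp only [Mat.add_d, Mat.smul_d, Mat.one_d]; linear_combination -g.d * hhalf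
  rw [h1]
  exact K.add_mem (h0 (Mat.mem_scalars.2 ⟨_, rfl⟩)) (K.add_mem (hJ _) (K.add_mem (hup _) (hlow _)))

end HeckeData

section Submersion

open scoped ContDiff

/-- A real analytic map which is a submersion at one point is a submersion almost everywhere. -/
theorem ae_range_fderiv_eq_top {E F : Type*} [NormedAddCommGroup E] [NormedSpace ℝ E]
    [FiniteDimensional ℝ E] [MeasurableSpace E] [BorelSpace E] (μ : Measure E) [μ.IsAddHaarMeasure]
    [NormedAddCommGroup F] [NormedSpace ℝ F] [FiniteDimensional ℝ F] {f : E → F}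
    (hf : AnalyticOnNhd ℝ f univ) {s₀ : E} (h : (fderiv ℝ f s₀).range = ⊤) :
    ∀ᵐ s ∂μ, (fderiv ℝ f s).range = ⊤ := by
  have hF : CompleteSpace F := FiniteDimensional.complete ℝ F
  obtain ⟨B, hB⟩ := LinearMap.exists_rightInverse_of_surjective
    (fderiv ℝ f s₀ : E →ₗ[ℝ] F) h
  let b := Module.finBasis ℝ F
  let δ : E → ℂ := fun s => ((LinearMap.det ((fderiv ℝ f s : E →ₗ[ℝ] F) ∘ₗ B) : ℝ) : ℂ)
  have hδ : AnalyticOnNhd ℝ δ univ := by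
    have h1 : δ = fun s => ∑ σ : Equiv.Perm (Fin (Module.finrank ℝ F)),
        ((Equiv.Perm.sign σ : ℤ) : ℂ) * ∏ i, ((b.repr (fderiv ℝ f s (B (b i))) (σ i) : ℝ) : ℂ) := by
      funext s
      simp only [δ]
      rw [← LinearMap.det_toMatrix b, Matrix.det_apply]
      push_cast [Units.smul_def, zsmul_eq_mul]
      simp only [LinearMap.toMatrix_apply]
      rfl
    rw [h1]
    refine Finset.analyticOnNhd_fun_sum _ fun σ _ => AnalyticOnNhd.mul analyticOnNhd_const ?_
    refine Finset.analyticOnNhd_fun_prod _ fun i _ => ?_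
    have h2 : AnalyticOnNhd ℝ (fun s => fderiv ℝ f s) univ := hf.fderiv
    let c : F →L[ℝ] ℂ := Complex.ofRealCLM.comp
      (LinearMap.toContinuousLinearMap (b.coord (σ i)))
    exact (c.comp (ContinuousLinearMap.apply ℝ F (B (b i)))).comp_analyticOnNhd h2
  have hδ0 : δ s₀ ≠ 0 := by
    simp only [δ]
    rw [hB, LinearMap.det_id]
    simp
  filter_upwards [ae_ne_zero_of_analytic μ hδ hδ0] with s hs
  have hu : IsUnit (LinearMap.det ((fderiv ℝ f s : E →ₗ[ℝ] F) ∘ₗ B)) :=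
    IsUnit.mk0 _ fun h0 => hs (by simp only [δ]; rw [h0]; simp)
  have hs' := (Module.End.isUnit_iff _).1 ((LinearMap.isUnit_iff_isUnit_det _).2 hu)
  rw [eq_top_iff]
  intro y _
  obtain ⟨z, hz⟩ := hs'.2 y
  exact ⟨B z, hz⟩

theorem Mat.smul_mul' {R : Type*} [NormedCommRing R] [NormedAlgebra ℂ R] (r : R) (g h : Mat R) :
    r • g * h = r • (g * h) := by
  ext <;> simp <;> ring

theorem Mat.smul_eq_mul' {R : Type*} [NormedCommRing R] [NormedAlgebra ℂ R] [FiniteDimensional ℂ R]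
    (r : R) (g : Mat R) : r • g = Mat.mkL (r, 0, 0, r) * g := by
  rw [Mat.mkL_apply]; ext <;> simp

namespace HeckeData

variable {R : Type*} [NormedCommRing R] [NormedAlgebra ℂ R] [FiniteDimensional ℂ R] (H : HeckeData R)

theorem contDiff_algebraMap {n : WithTop ℕ∞} : ContDiff ℝ n (algebraMap ℂ R) :=
  ((algebraMapCLM ℂ R).restrictScalars ℝ).contDiff

theorem contDiff_mkL {n : WithTop ℕ∞} : ContDiff ℝ n (Mat.mkL : R × R × R × R → Mat R) :=
  ContinuousLinearMap.contDiff (Mat.mkL.restrictScalars ℝ : (R × R × R × R) →L[ℝ] Mat R)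

theorem contDiff_mat {n : WithTop ℕ∞} : ContDiff ℝ n fun q : ℂ × ℂ => H.mat q.1 q.2 := by
  have h : (fun q : ℂ × ℂ => H.mat q.1 q.2) = fun q =>
    Mat.mkL (algebraMap ℂ R ((H.tp - q.1) * (q.2 - 1)),
    algebraMap ℂ R (q.2 * (q.2 - 1)) * (H.z - algebraMap ℂ R H.tp),
    algebraMap ℂ R (-H.lin q.1 q.2), algebraMap ℂ R (H.lin q.1 q.2 * q.2)) := rfl
  rw [h]
  unfold lin
  refine contDiff_mkL.comp (ContDiff.prodMk ?_ (ContDiff.prodMk ?_ (ContDiff.prodMk ?_ ?_)))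
  · exact contDiff_algebraMap.comp (by fun_prop)
  · exact (contDiff_algebraMap.comp (by fun_prop)).mul contDiff_const
  · exact contDiff_algebraMap.comp (by fun_prop)
  · exact contDiff_algebraMap.comp (by fun_prop)

theorem hasDerivAt_mat (x s : ℂ) : HasDerivAt (H.mat x) (H.matDeriv x s) s := by
  have hA : ∀ {f : ℂ → ℂ} {f' : ℂ}, HasDerivAt f f' s →
      HasDerivAt (fun s => algebraMap ℂ R (f s)) (algebraMap ℂ R f') s := fun hf =>
    (algebraMapCLM ℂ R).hasFDerivAt.comp_hasDerivAt s hf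
  have hlin : HasDerivAt (H.lin x) (H.tq - H.tp) s := by
    unfold lin
    simpa using ((hasDerivAt_id s).const_mul (H.tq - H.tp)).add_const (H.tp - x)
  have h1 : HasDerivAt (fun s => (H.tp - x) * (s - 1)) (H.tp - x) s := by
    simpa using ((hasDerivAt_id s).sub_const 1).const_mul (H.tp - x)
  have h2 : HasDerivAt (fun s : ℂ => s * (s - 1)) (2 * s - 1) s := by
    exact ((hasDerivAt_id s).mul ((hasDerivAt_id s).sub_const 1)).congr_deriv
      (by simp only [id_eq]; ring)
  have h4 : HasDerivAt (fun s => H.lin x s * s) ((H.tq - H.tp) * s + H.lin x s) s := by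
    exact (hlin.mul (hasDerivAt_id s)).congr_deriv (by simp only [id_eq]; ring)
  exact Mat.mkL.hasFDerivAt.comp_hasDerivAt s ((hA h1).prodMk (((hA h2).mul_const _).prodMk
    ((hA hlin.neg).prodMk (hA h4))))

/-- The matrix of a succession of Hecke modifications. -/
def wordMat : ∀ N : ℕ, (Fin N → ℂ) → (Fin N → ℂ) → Mat R
  | 0, _, _ => 1
  | N + 1, x, s => wordMat N (Fin.tail x) (Fin.tail s) * H.mat (x 0) (s 0)

theorem contDiff_wordMat {n : WithTop ℕ∞} (N : ℕ) :
    ContDiff ℝ n fun q : (Fin N → ℂ) × (Fin N → ℂ) => H.wordMat N q.1 q.2 := by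
  induction N with
  | zero => exact contDiff_const
  | succ N ih =>
    have h1 : ContDiff ℝ n fun q : (Fin (N + 1) → ℂ) × (Fin (N + 1) → ℂ) =>
        ((Fin.tail q.1 : Fin N → ℂ), (Fin.tail q.2 : Fin N → ℂ)) := by
      unfold Fin.tail
      fun_prop
    have h2 : ContDiff ℝ n fun q : (Fin (N + 1) → ℂ) × (Fin (N + 1) → ℂ) => (q.1 0, q.2 0) := by
      fun_prop
    exact (ih.comp h1).mul (H.contDiff_mat.comp h2)

/-- The invertible matrix of the Hecke modification with an admissible parameter. -/
def matUnit {x : ℂ} (hx : H.Regular x) (s : H.good x) : (Mat R)ˣ :=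
  (Mat.isUnit_of_isUnit_det (H.isUnit_det_mat hx s.2)).unit

theorem coe_matUnit {x : ℂ} (hx : H.Regular x) (s : H.good x) :
    (H.matUnit hx s : Mat R) = H.mat x s := rfl

theorem exists_wordSpan_mat_eq_top {x : ℂ} (hx : H.Regular x) :
    ∃ M, ∀ N ≥ M, ∃ s : Fin N → H.good x,
      wordSpan (H.matUnit hx) (fun s => H.matDeriv x s) (Mat.scalars R) (List.ofFn s) = ⊤ := by
  obtain ⟨l, hl⟩ := exists_wordSpan_eq_top (H.matUnit hx) (fun s => H.matDeriv x s) (Mat.scalars R)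
    (fun s => Mat.scalars_mul_span _) (by
      intro K hK h1 h2
      refine H.eq_top_of_invariant hx K hK ?_ ?_
      · intro s hs Y hY
        have h3 : H.mat x s * Y ∈ Submodule.span ℂ {(H.matUnit hx ⟨s, hs⟩ : Mat R)} * K :=
          Submodule.mul_mem_mul (Submodule.mem_span_singleton_self _) hY
        rw [h1, Submodule.mem_mul_span_singleton] at h3
        obtain ⟨Y', hY', h4⟩ := h3
        exact ⟨Y', hY', h4.symm⟩
      · intro s hs
        have h3 := h2 ⟨s, hs⟩ (Submodule.mem_span_singleton_self _)
        rw [Submodule.mem_mul_span_singleton] at h3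
        obtain ⟨Y', hY', h4⟩ := h3
        exact ⟨Y', hY', h4.symm⟩)
  obtain ⟨s₀, hs₀⟩ := (H.dense_good x).nonempty
  refine ⟨l.length, fun N hN => ?_⟩
  obtain ⟨k, rfl⟩ := Nat.exists_eq_add_of_le' hN
  have h : ∀ k, ∃ l' : List (H.good x), l'.length = k + l.length ∧
      wordSpan (H.matUnit hx) (fun s => H.matDeriv x s) (Mat.scalars R) l' = ⊤ := by
    intro k
    induction k with
    | zero => exact ⟨l, by simp, hl⟩
    | succ k ih =>
      obtain ⟨l', h1, h2⟩ := ih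
      refine ⟨⟨s₀, hs₀⟩ :: l', by simp [h1]; ring, ?_⟩
      rw [wordSpan, h2, top_mul_span_unit, top_sup_eq]
  obtain ⟨l', h1, h2⟩ := h k
  refine ⟨fun i => l'.get (i.cast h1.symm), ?_⟩
  rw [← h2]
  congr 1
  apply List.ext_get
  · simp [h1]
  · intro n h3 h4
    simp

theorem wordMat_eq_wordProd {x : ℂ} (hx : H.Regular x) {N : ℕ} (s : Fin N → H.good x) :
    H.wordMat N (fun _ => x) (fun i => s i) = wordProd (H.matUnit hx) (List.ofFn s) := by
  induction N with
  | zero => simp [wordMat, wordProd]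
  | succ N ih =>
    rw [List.ofFn_succ, wordProd, Units.val_mul, ← ih, coe_matUnit, wordMat]
    rfl

theorem exists_hasDerivAt_wordMat {x : ℂ} (hx : H.Regular x) {N : ℕ} (s : Fin N → H.good x)
    {Y : Mat R} (hY : Y ∈ wordSpan (H.matUnit hx) (fun s => H.matDeriv x s) (Mat.scalars R)
      (List.ofFn s)) :
    ∃ (v : Fin N → ℂ) (r : R), HasDerivAt (fun t : ℝ =>
      (1 + t • r) • H.wordMat N (fun _ => x) ((fun i => (s i : ℂ)) + t • v)) Y 0 := by
  induction N generalizing Y with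
  | zero =>
    rw [List.ofFn_zero, wordSpan] at hY
    obtain ⟨r, rfl⟩ := Mat.mem_scalars.1 hY
    refine ⟨0, r, ?_⟩
    have h1 : (fun t : ℝ => (1 + t • r) • H.wordMat 0 (fun _ => x) ((fun i => (s i : ℂ)) + t • 0))
        = fun t : ℝ => (1 : Mat R) + t • (r • (1 : Mat R)) := by
      funext t
      rw [wordMat, add_smul, one_smul]
      congr 1
      ext
      · simp [← Complex.coe_smul]
      · simp [← Complex.coe_smul]
      · simp [← Complex.coe_smul]
      · simp [← Complex.coe_smul]
    rw [h1]
    simpa using ((hasDerivAt_id (0 : ℝ)).smul_const (r • (1 : Mat R))).const_add (1 : Mat R)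
  | succ N ih =>
    rw [List.ofFn_succ, wordSpan] at hY
    obtain ⟨Y₁, h1, Y₂, h2, rfl⟩ := Submodule.mem_sup.1 hY
    rw [Submodule.mem_mul_span_singleton] at h1
    obtain ⟨Y₀, hY₀, rfl⟩ := h1
    rw [Submodule.span_mul_span, Set.singleton_mul_singleton, Submodule.mem_span_singleton] at h2
    obtain ⟨c, rfl⟩ := h2
    obtain ⟨v, r, hv⟩ := ih (fun i => s i.succ) hY₀
    refine ⟨Fin.cons c v, r, ?_⟩
    have h3 : HasDerivAt (fun t : ℝ => H.mat x (s 0 + t • c)) (c • H.matDeriv x (s 0)) 0 := by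
      have h4 : HasDerivAt (fun t : ℝ => (s 0 : ℂ) + t • c) c 0 := by
        simpa using ((hasDerivAt_id (0 : ℝ)).smul_const c).const_add (s 0 : ℂ)
      have h5 : HasDerivAt (H.mat x) (H.matDeriv x (s 0)) ((s 0 : ℂ) + (0 : ℝ) • c) := by
        simpa using H.hasDerivAt_mat x (s 0)
      exact h5.scomp (0 : ℝ) h4
    have h6 := hv.mul h3
    convert h6 using 1
    · funext t
      rw [Pi.mul_apply, Mat.smul_mul', wordMat]
      rfl
    · rw [← H.wordMat_eq_wordProd hx]
      simp [coe_matUnit]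

/-- The maps whose pushforwards describe the products of Hecke operators, translated by elements
of `GL₂ R`. -/
def wordMap (N : ℕ) (q : ((Fin N → ℂ) × Mat R) × ((Fin N → ℂ) × R)) : Mat R :=
  q.2.2 • (H.wordMat N q.1.1 q.2.1 * q.1.2)

theorem contDiff_wordMap {n : WithTop ℕ∞} (N : ℕ) : ContDiff ℝ n (H.wordMap N) := by
  have h : H.wordMap N = fun q : ((Fin N → ℂ) × Mat R) × ((Fin N → ℂ) × R) =>
      Mat.mkL (q.2.2, 0, 0, q.2.2) * (H.wordMat N q.1.1 q.2.1 * q.1.2) := by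
    funext q
    exact Mat.smul_eq_mul' _ _
  rw [h]
  refine ContDiff.mul (contDiff_mkL.comp (by fun_prop)) (ContDiff.mul ?_ (by fun_prop))
  exact (H.contDiff_wordMat N).comp (f := fun q : ((Fin N → ℂ) × Mat R) × ((Fin N → ℂ) × R) =>
    (q.1.1, q.2.1)) (by fun_prop)

theorem exists_submersion {x : ℂ} (hx : H.Regular x) : ∃ M, ∀ N ≥ M, ∃ s,
    (fderiv ℝ (fun s => H.wordMap N (((fun _ => x), 1), s)) s).range = ⊤ := by
  obtain ⟨M, hM⟩ := H.exists_wordSpan_mat_eq_top hx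
  refine ⟨M, fun N hN => ?_⟩
  obtain ⟨s, hs⟩ := hM N hN
  refine ⟨((fun i => s i), 1), ?_⟩
  rw [eq_top_iff]
  intro Y _
  obtain ⟨v, r, hv⟩ := H.exists_hasDerivAt_wordMat hx s (Y := Y) (by rw [hs]; trivial)
  have hd : DifferentiableAt ℝ (fun s => H.wordMap N (((fun _ => x), 1), s))
      ((fun i => (s i : ℂ)), (1 : R)) :=
    (((H.contDiff_wordMap (n := 1) N).comp (f := fun s : (Fin N → ℂ) × R =>
      ((((fun _ => x), 1), s) : ((Fin N → ℂ) × Mat R) × ((Fin N → ℂ) × R)))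
      (by fun_prop)).differentiable one_ne_zero) _
  refine ⟨(v, r), ?_⟩
  have hl : HasLineDerivAt ℝ (fun s => H.wordMap N (((fun _ => x), 1), s)) Y
      ((fun i => (s i : ℂ)), (1 : R)) (v, r) := by
    rw [HasLineDerivAt]
    refine hv.congr_of_eventuallyEq (Eventually.of_forall fun t => ?_)
    simp [wordMap]
  change fderiv ℝ _ _ (v, r) = Y
  rw [← hd.lineDeriv_eq_fderiv, hl.lineDeriv]

theorem pushforwardContinuousAt_wordMap [MeasurableSpace R] [BorelSpace R] (μ : Measure R)
    [μ.IsAddHaarMeasure] {x : ℂ} (hx : H.Regular x) : ∃ M, ∀ N ≥ M,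
    ∀ k : (Fin N → ℂ) × R → ℂ, Integrable k ((volume : Measure (Fin N → ℂ)).prod μ) →
      PushforwardContinuousAt ((volume : Measure (Fin N → ℂ)).prod μ) (H.wordMap N)
        ((fun _ => x), 1) k := by
  have hR : ProperSpace R := FiniteDimensional.proper ℂ R
  obtain ⟨M, hM⟩ := H.exists_submersion hx
  refine ⟨M, fun N hN k hk => ?_⟩
  obtain ⟨s, hs⟩ := hM N hN
  have hμ : ((volume : Measure (Fin N → ℂ)).prod μ).IsAddHaarMeasure :=
    Measure.prod.instIsAddHaarMeasure _ _
  refine pushforwardContinuousAt_of_ae_submersion (E := (Fin N → ℂ) × R)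
    (H.contDiff_wordMap N) ?_ hk
  refine ae_range_fderiv_eq_top (E := (Fin N → ℂ) × R) (volume.prod μ) ?_ hs
  rw [← contDiff_omega_iff_analyticOnNhd]
  exact (H.contDiff_wordMap (n := ω) N).comp (by fun_prop)

end HeckeData

end Submersion

/-- If `A x - B x → 0` and the operators `A x`, `B x` are bounded near `x₀`, then the differences of
their words tend to zero. -/
theorem tendsto_word_sub_word {X H : Type*} [TopologicalSpace X] [NormedRing H]
    {A B : X → H} {x₀ : X} {C : ℝ} (hA : ∀ᶠ x in 𝓝 x₀, ‖A x‖ ≤ C) (hB : ∀ᶠ x in 𝓝 x₀, ‖B x‖ ≤ C)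
    (hAB : Tendsto (fun x => A x - B x) (𝓝 x₀) (𝓝 0)) (N : ℕ) :
    Tendsto (fun y : Fin N → X => (List.ofFn fun i => A (y i)).prod - (List.ofFn fun i => B (y i)).prod)
      (𝓝 fun _ => x₀) (𝓝 0) := by
  have hC : 0 ≤ C := (norm_nonneg _).trans hA.self_of_nhds
  suffices h : Tendsto (fun y : Fin N → X =>
      (List.ofFn fun i => A (y i)).prod - (List.ofFn fun i => B (y i)).prod)
        (𝓝 fun _ => x₀) (𝓝 0) ∧ ∃ C', ∀ᶠ y : Fin N → X in 𝓝 fun _ => x₀,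
          ‖(List.ofFn fun i => B (y i)).prod‖ ≤ C' from h.1
  induction N with
  | zero => exact ⟨by simp, ‖(1 : H)‖, by simp⟩
  | succ N ih =>
    obtain ⟨ih1, C', ih2⟩ := ih
    have ht : Tendsto (fun y : Fin (N + 1) → X => fun i : Fin N => y i.succ) (𝓝 fun _ => x₀)
        (𝓝 fun _ => x₀) := by
      have h : Continuous (fun y : Fin (N + 1) → X => fun i : Fin N => y i.succ) := by fun_prop
      exact h.tendsto _
    have h0 : Tendsto (fun y : Fin (N + 1) → X => y 0) (𝓝 fun _ => x₀) (𝓝 x₀) :=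
      (continuous_apply (0 : Fin (N + 1))).tendsto (fun _ : Fin (N + 1) => x₀)
    have ih1' := ih1.comp ht
    have ih2' := ht.eventually ih2
    have hA' := h0.eventually hA
    have hB' := h0.eventually hB
    have hAB' := hAB.comp h0
    constructor
    · simp only [List.ofFn_succ, List.prod_cons]
      have hb : Tendsto (fun y : Fin (N + 1) → X =>
          C * ‖(List.ofFn fun i : Fin N => A (y i.succ)).prod - (List.ofFn fun i : Fin N => B (y i.succ)).prod‖
          + ‖A (y 0) - B (y 0)‖ * C') (𝓝 fun _ => x₀) (𝓝 0) := by
        simpa using (ih1'.norm.const_mul C).add (hAB'.norm.mul_const C')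
      refine squeeze_zero_norm' ?_ hb
      filter_upwards [hA', ih2'] with y h1 h2
      have e : A (y 0) * (List.ofFn fun i : Fin N => A (y i.succ)).prod
          - B (y 0) * (List.ofFn fun i : Fin N => B (y i.succ)).prod
          = A (y 0) * ((List.ofFn fun i : Fin N => A (y i.succ)).prod
            - (List.ofFn fun i : Fin N => B (y i.succ)).prod)
          + (A (y 0) - B (y 0)) * (List.ofFn fun i : Fin N => B (y i.succ)).prod := by noncomm_ring
      rw [e]
      refine (norm_add_le _ _).trans (add_le_add ((norm_mul_le _ _).trans ?_) ((norm_mul_le _ _).trans ?_))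
      · gcongr
      · gcongr
    · refine ⟨C * C', ?_⟩
      filter_upwards [hB', ih2'] with y h1 h2
      simp only [List.ofFn_succ, List.prod_cons]
      exact (norm_mul_le _ _).trans (mul_le_mul h1 h2 (norm_nonneg _) hC)

namespace HeckeData

variable {R : Type*} [NormedCommRing R] [NormedAlgebra ℂ R] [FiniteDimensional ℂ R] (H : HeckeData R)

theorem measurable_mat (x : ℂ) : Measurable (H.mat x) := (H.continuous_mat x).measurable

theorem measurable_wordMat {N : ℕ} (y : Fin N → ℂ) : Measurable (H.wordMat N y) := by
  have h : Continuous fun s => H.wordMat N y s :=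
    (H.contDiff_wordMat (n := 1) N).continuous.comp (by fun_prop : Continuous fun s => (y, s))
  exact h.measurable

end HeckeData

namespace SiteData

variable {κ : Type*} [Fintype κ] {R : Type*} [NormedCommRing R] [NormedAlgebra ℂ R]
  [FiniteDimensional ℂ R] (S : SiteData κ R) (H : HeckeData R)
  [MeasurableSpace R] [BorelSpace R] (μ : Measure R) [μ.IsAddHaarMeasure]
  {T : Type*} [MeasurableSpace T] {ν : Measure T} [SFinite ν] {k k' : T → ℂ} {Φ Φ' : T → Mat R}

theorem exists_integral_mul_χ_eq_one :
    ∃ φ : R → ℂ, Integrable φ μ ∧ ∫ r, φ r * S.χ r ∂μ = 1 := by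
  have hR : ProperSpace R := FiniteDimensional.proper ℂ R
  obtain ⟨ε, hε, hball⟩ := Metric.isOpen_iff.1 (isOpen_units (R := R)) 1 isUnit_one
  have hfin : μ (Metric.ball 1 ε) ≠ ⊤ := measure_ball_lt_top.ne
  have hpos : μ (Metric.ball (1 : R) ε) ≠ 0 := (Metric.measure_ball_pos μ _ hε).ne'
  have hint : Integrable ((Metric.ball (1 : R) ε).indicator fun r => starRingEnd ℂ (S.χ r)) μ := by
    refine IntegrableOn.integrable_indicator ?_ Metric.isOpen_ball.measurableSet
    refine Measure.integrableOn_of_bounded (M := 1) hfin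
      (Complex.continuous_conj.measurable.comp S.measurable_χ).aestronglyMeasurable ?_
    exact Eventually.of_forall fun r => by simpa using S.norm_χ_le r
  refine ⟨fun r => (μ.real (Metric.ball 1 ε) : ℂ)⁻¹ *
    (Metric.ball (1 : R) ε).indicator (fun r => starRingEnd ℂ (S.χ r)) r, hint.const_mul _, ?_⟩
  have h1 : ∀ r, (μ.real (Metric.ball 1 ε) : ℂ)⁻¹ *
      (Metric.ball (1 : R) ε).indicator (fun r => starRingEnd ℂ (S.χ r)) r * S.χ r
      = (Metric.ball (1 : R) ε).indicator (fun _ => (μ.real (Metric.ball 1 ε) : ℂ)⁻¹) r := by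
    intro r
    by_cases hr : r ∈ Metric.ball (1 : R) ε
    · rw [indicator_of_mem hr, indicator_of_mem hr, mul_assoc, ← Complex.normSq_eq_conj_mul_self,
        Complex.normSq_eq_norm_sq, S.norm_χ (hball hr)]
      simp
    · simp [indicator_of_notMem hr]
  simp only [h1]
  rw [integral_indicator_const _ Metric.isOpen_ball.measurableSet, Complex.real_smul,
    mul_inv_cancel₀]
  exact_mod_cast (ENNReal.toReal_pos hpos hfin).ne'

theorem measurable_smul_mat : Measurable fun q : R × Mat R => q.1 • q.2 := by
  have hR : ProperSpace R := FiniteDimensional.proper ℂ R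
  have h : (fun q : R × Mat R => q.1 • q.2) = fun q => Mat.mkL (q.1, 0, 0, q.1) * q.2 := by
    funext q
    exact Mat.smul_eq_mul' _ _
  rw [h]
  have : Continuous fun q : R × Mat R => Mat.mkL (q.1, 0, 0, q.1) * q.2 := by fun_prop
  exact this.measurable

/-- Multiplying the matrices by scalars and averaging does not change an average. -/
theorem avgOp_eq_avgOp_prod (hk : Integrable k ν) (hΦ : Measurable Φ) {φ : R → ℂ}
    (hφ : Integrable φ μ) (hφ1 : ∫ r, φ r * S.χ r ∂μ = 1) :
    S.avgOp μ ν k Φ = S.avgOp μ (ν.prod μ) (fun q => k q.1 * φ q.2) fun q => q.2 • Φ q.1 := by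
  have hR : ProperSpace R := FiniteDimensional.proper ℂ R
  have hm : Measurable fun q : T × R => q.2 • Φ q.1 :=
    measurable_smul_mat.comp (measurable_snd.prodMk (hΦ.comp measurable_fst))
  have hkφ := hk.mul_prod hφ
  refine clm_ext_inner fun x y => ?_
  rw [S.inner_avgOp μ hk hΦ, S.inner_avgOp μ hkφ hm]
  have h1 : ∀ q : T × R, k q.1 * φ q.2 * inner ℂ x (S.rho μ (q.2 • Φ q.1) y)
      = (k q.1 * inner ℂ x (S.rho μ (Φ q.1) y)) * (φ q.2 * S.χ q.2) := by
    intro q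
    rw [S.rho_smul, _root_.smul_apply, inner_smul_right]
    ring
  simp only [h1]
  rw [integral_prod_mul (fun s => k s * inner ℂ x (S.rho μ (Φ s) y)) fun r => φ r * S.χ r, hφ1,
    mul_one]

variable {K : ℂ → ℂ}

theorem word_avgOp (hK : Integrable K) (N : ℕ) (y : Fin N → ℂ) :
    (List.ofFn fun i => S.avgOp μ volume K (H.mat (y i))).prod
      = S.avgOp μ volume (fun s : Fin N → ℂ => ∏ i, K (s i)) (H.wordMat N y) := by
  induction N with
  | zero =>
    rw [List.ofFn_zero, List.prod_nil]
    have hk : Integrable (fun s : Fin 0 → ℂ => ∏ i, K (s i)) := Integrable.fintype_prod fun _ => hK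
    refine clm_ext_inner fun x z => ?_
    rw [S.inner_avgOp μ hk (H.measurable_wordMat y)]
    simp [HeckeData.wordMat, S.rho_one, Measure.real, volume_pi]
  | succ N ih =>
    have hk : Integrable (fun s : Fin N → ℂ => ∏ i, K (s i)) := Integrable.fintype_prod fun _ => hK
    rw [List.ofFn_succ, List.prod_cons, ih fun i => y i.succ,
      S.avgOp_mul μ hK (H.measurable_mat _) hk (H.measurable_wordMat _)]
    have hm : Measurable fun q : ℂ × (Fin N → ℂ) =>
        H.wordMat N (fun i => y i.succ) q.2 * H.mat (y 0) q.1 :=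
      ((H.measurable_wordMat _).comp measurable_snd).mul ((H.measurable_mat _).comp measurable_fst)
    refine (S.avgOp_comp_measurePreserving μ (MeasurableEquiv.piFinSuccAbove (fun _ => ℂ) 0)
      (volume_preserving_piFinSuccAbove (fun _ => ℂ) 0) (hK.mul_prod hk) hm).symm.trans ?_
    congr 1
    funext s
    rw [Fin.prod_univ_succ]
    rfl

theorem continuousAt_avgOp_wordMat {x : ℂ} (hx : H.Regular x) : ∃ M, ∀ N ≥ M,
    ∀ k : (Fin N → ℂ) → ℂ, Integrable k →
      ContinuousAt (fun q : (Fin N → ℂ) × Mat R => S.avgOp μ volume k fun s => H.wordMat N q.1 s * q.2)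
        ((fun _ => x), 1) := by
  have hR : ProperSpace R := FiniteDimensional.proper ℂ R
  obtain ⟨M, hM⟩ := H.pushforwardContinuousAt_wordMap μ hx
  obtain ⟨φ, hφ, hφ1⟩ := S.exists_integral_mul_χ_eq_one μ
  refine ⟨M, fun N hN k hk => ?_⟩
  have hkφ : Integrable (fun q : (Fin N → ℂ) × R => k q.1 * φ q.2) (volume.prod μ) := hk.mul_prod hφ
  have hTV := hM N hN _ hkφ
  have hm : ∀ q : (Fin N → ℂ) × Mat R, Measurable fun s => H.wordMat N q.1 s * q.2 := fun q =>
    (H.measurable_wordMat q.1).mul_const _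
  have hm' : ∀ q : (Fin N → ℂ) × Mat R, Measurable fun s : (Fin N → ℂ) × R =>
      s.2 • (H.wordMat N q.1 s.1 * q.2) := fun q =>
    measurable_smul_mat.comp (measurable_snd.prodMk ((hm q).comp measurable_fst))
  rw [Metric.continuousAt_iff']
  intro ε hε
  filter_upwards [hTV (ε / 2) (by positivity)] with q hq
  rw [dist_eq_norm, S.avgOp_eq_avgOp_prod μ hk (hm q) hφ hφ1,
    S.avgOp_eq_avgOp_prod μ hk (hm ((fun _ => x), 1)) hφ hφ1]
  refine lt_of_le_of_lt (S.norm_avgOp_sub_le_of_forall μ hkφ (hm' q) (hm' _) (by positivity) ?_)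
    (half_lt_self hε)
  exact hq

theorem norm_avgOp_le (hk : Integrable k ν) (hΦ : Measurable Φ) :
    ‖S.avgOp μ ν k Φ‖ ≤ ∫ s, ‖k s‖ ∂ν := by
  have h0 : S.avgOp μ ν (fun _ => 0) Φ = 0 := by
    refine clm_ext_inner fun x y => ?_
    rw [S.inner_avgOp μ (k := fun _ => 0) (integrable_zero _ _ _) hΦ]
    simp
  simpa [h0] using S.norm_avgOp_sub_le μ hk (k' := fun _ => 0) (integrable_zero _ _ _) hΦ

theorem rhoContinuous_pow (hK : Integrable K) {x : ℂ} (hx : H.Regular x) : ∃ M, ∀ N ≥ M,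
    S.RhoContinuous μ (S.avgOp μ volume K (H.mat x) ^ N) := by
  obtain ⟨M, hM⟩ := S.continuousAt_avgOp_wordMat H μ hx
  refine ⟨M, fun N hN => ?_⟩
  have hk : Integrable (fun s : Fin N → ℂ => ∏ i, K (s i)) := Integrable.fintype_prod fun _ => hK
  have h1 := hM N hN _ hk
  have h2 : S.avgOp μ volume K (H.mat x) ^ N
      = S.avgOp μ volume (fun s : Fin N → ℂ => ∏ i, K (s i)) (H.wordMat N fun _ => x) := by
    rw [← S.word_avgOp H μ hK, List.ofFn_const, List.prod_replicate]
  rw [RhoContinuous, h2]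
  have h3 : Tendsto (fun g : Mat R => (((fun _ => x), g) : (Fin N → ℂ) × Mat R)) (𝓝 1)
      (𝓝 ((fun _ => x), 1)) := (by fun_prop : Continuous fun g : Mat R =>
        (((fun _ => x), g) : (Fin N → ℂ) × Mat R)).tendsto 1
  have h4 := h1.tendsto.comp h3
  simp only [mul_one] at h4
  refine h4.congr fun g => ?_
  rw [Function.comp_apply, S.rho_mul_avgOp μ hk (H.measurable_wordMat _)]

/-- An average of the operators of the Hecke modifications at a regular point which is, up to a
scalar of absolute value one, self-adjoint, is compact. -/
theorem isCompactOperator_avgOp_mat (hK : Integrable K) {x : ℂ} (hx : H.Regular x) {c : ℂ}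
    (hc : ‖c‖ = 1) (hadj : ContinuousLinearMap.adjoint (S.avgOp μ volume K (H.mat x))
      = c • S.avgOp μ volume K (H.mat x)) :
    IsCompactOperator (S.avgOp μ volume K (H.mat x)) := by
  obtain ⟨M, hM⟩ := S.rhoContinuous_pow H μ hK hx
  exact isCompactOperator_of_pow hc hadj
    (S.isCompactOperator_of_rhoContinuous μ (hM (M + 1) (Nat.le_succ M)))

/-- Averages of the operators of the Hecke modifications depend continuously on the point in the
operator norm if their kernels do so in `L¹`. -/
theorem continuousAt_avgOp_mat {k : ℂ → ℂ → ℂ} {x : ℂ} (hx : H.Regular x)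
    (hk : ∀ᶠ y in 𝓝 x, Integrable (k y))
    (hkx : Tendsto (fun y => ∫ s, ‖k y s - k x s‖) (𝓝 x) (𝓝 0))
    {c : ℂ → ℂ} (hc : ContinuousAt c x)
    (hadj : ∀ᶠ y in 𝓝 x, ContinuousLinearMap.adjoint (S.avgOp μ volume (k y) (H.mat y))
      = c y • S.avgOp μ volume (k y) (H.mat y)) :
    ContinuousAt (fun y => S.avgOp μ volume (k y) (H.mat y)) x := by
  have hkx0 : Integrable (k x) := hk.self_of_nhds
  obtain ⟨M, hM⟩ := S.continuousAt_avgOp_wordMat H μ hx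
  have hdiff : Tendsto (fun y => S.avgOp μ volume (k y) (H.mat y) - S.avgOp μ volume (k x) (H.mat y))
      (𝓝 x) (𝓝 0) := by
    refine squeeze_zero_norm' ?_ hkx
    filter_upwards [hk] with y hy
    exact S.norm_avgOp_sub_le μ hy hkx0 (H.measurable_mat y)
  have hb : ∀ y, ‖S.avgOp μ volume (k x) (H.mat y)‖ ≤ (∫ s, ‖k x s‖) + 1 := fun y =>
    (S.norm_avgOp_le μ hkx0 (H.measurable_mat y)).trans (by linarith)
  have hb' : ∀ᶠ y in 𝓝 x, ‖S.avgOp μ volume (k y) (H.mat y)‖ ≤ (∫ s, ‖k x s‖) + 1 := by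
    have h1 : ∀ᶠ y in 𝓝 x, ‖S.avgOp μ volume (k y) (H.mat y) - S.avgOp μ volume (k x) (H.mat y)‖ < 1 := by
      have := hdiff.norm
      rw [norm_zero] at this
      exact this.eventually_lt_const one_pos
    filter_upwards [h1] with y hy
    have h2 := S.norm_avgOp_le μ hkx0 (H.measurable_mat y)
    have h3 := norm_le_norm_add_norm_sub' (S.avgOp μ volume (k y) (H.mat y))
      (S.avgOp μ volume (k x) (H.mat y))
    linarith
  refine continuousAt_of_continuousAt_words (T := fun y => S.avgOp μ volume (k y) (H.mat y)) (k := M)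
    hc hadj ?_
  have hN : 2 * 2 ^ M ≥ M := by
    have := Nat.lt_two_pow_self (n := M)
    omega
  have h1 := tendsto_word_sub_word hb' (Eventually.of_forall hb) hdiff (2 * 2 ^ M)
  have hkN : Integrable (fun s : Fin (2 * 2 ^ M) → ℂ => ∏ i, k x (s i)) :=
    Integrable.fintype_prod fun _ => hkx0
  have h2 : ContinuousAt (fun y : Fin (2 * 2 ^ M) → ℂ =>
      (List.ofFn fun i => S.avgOp μ volume (k x) (H.mat (y i))).prod) fun _ => x := by
    simp only [S.word_avgOp H μ hkx0]
    have h3 := hM _ hN _ hkN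
    have h4 : ContinuousAt (fun y : Fin (2 * 2 ^ M) → ℂ => (y, (1 : Mat R))) fun _ => x := by fun_prop
    have h5 := ContinuousAt.comp (f := fun y : Fin (2 * 2 ^ M) → ℂ => (y, (1 : Mat R)))
      (x := fun _ => x) h3 h4
    refine h5.congr (Eventually.of_forall fun y => ?_)
    simp
  have h6 := h1.add h2.tendsto
  simp only [zero_add, sub_add_cancel] at h6
  exact h6

end SiteData

section PlaneKernel

/-- The function `1 / |s|` on the disc of radius `δ`. -/
def invNormBall (δ : ℝ) (s : ℂ) : ℝ := (Metric.ball (0 : ℂ) δ).indicator (fun s => ‖s‖⁻¹) s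

theorem invNormBall_nonneg (δ : ℝ) (s : ℂ) : 0 ≤ invNormBall δ s :=
  indicator_nonneg (fun _ _ => by positivity) _

theorem integrable_invNormBall (δ : ℝ) : Integrable (invNormBall δ) := by
  have h : invNormBall δ = fun s : ℂ => (Iio δ).indicator (fun y : ℝ => y⁻¹) ‖s‖ := by
    funext s
    by_cases hs : ‖s‖ < δ
    · rw [invNormBall, indicator_of_mem (by simpa using hs), indicator_of_mem (by simpa using hs)]
    · rw [invNormBall, indicator_of_notMem (by simpa using hs),
        indicator_of_notMem (by simpa using hs)]
  rw [h, integrable_fun_norm_addHaar volume (f := (Iio δ).indicator (fun y : ℝ => y⁻¹)),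
    Complex.finrank_real_complex]
  have h1 : IntegrableOn ((Iio δ).indicator fun _ : ℝ => (1 : ℝ)) (Ioi (0 : ℝ)) := by
    rw [IntegrableOn, integrable_indicator_iff measurableSet_Iio, IntegrableOn,
      Measure.restrict_restrict measurableSet_Iio, ← IntegrableOn]
    refine integrableOn_const (ne_of_lt ?_)
    refine (measure_mono (t := Ioo 0 δ) ?_).trans_lt measure_Ioo_lt_top
    exact fun y hy => ⟨hy.2, hy.1⟩
  refine h1.congr_fun (fun y hy => ?_) measurableSet_Ioi
  have hy' : y ≠ 0 := (mem_Ioi.1 hy).ne'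
  by_cases h2 : y < δ
  · rw [indicator_of_mem (by simpa using h2), indicator_of_mem (by simpa using h2)]
    simp [hy']
  · rw [indicator_of_notMem (by simpa using h2), indicator_of_notMem (by simpa using h2)]
    simp

theorem tendsto_integral_invNormBall :
    Tendsto (fun δ => ∫ s, invNormBall δ s) (𝓝[>] 0) (𝓝 0) := by
  have h : Tendsto (fun δ => ∫ s, invNormBall δ s) (𝓝[>] 0) (𝓝 (∫ _ : ℂ, (0 : ℝ))) := by
    refine tendsto_integral_filter_of_dominated_convergence (invNormBall 1)
      (Eventually.of_forall fun δ => (integrable_invNormBall δ).aestronglyMeasurable) ?_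
      (integrable_invNormBall 1) ?_
    · have h1 : ∀ᶠ δ : ℝ in 𝓝[>] 0, δ < 1 := nhdsWithin_le_nhds (Iio_mem_nhds one_pos)
      filter_upwards [h1] with δ hδ
      refine Eventually.of_forall fun s => ?_
      rw [Real.norm_of_nonneg (invNormBall_nonneg _ _)]
      exact indicator_le_indicator_of_subset (Metric.ball_subset_ball hδ.le)
        (fun _ => by positivity) s
    · filter_upwards [Measure.ae_ne volume (0 : ℂ)] with s hs
      refine tendsto_const_nhds.congr' ?_
      have h1 : ∀ᶠ δ : ℝ in 𝓝[>] 0, δ < ‖s‖ :=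
        nhdsWithin_le_nhds (Iio_mem_nhds (norm_pos_iff.2 hs))
      filter_upwards [h1] with δ hδ
      rw [invNormBall, indicator_of_notMem]
      simpa using hδ.le
  simpa using h

/-- A function with poles at `0` and `1`, decaying like `|s| ^ (-3)`. -/
def poleWeight (s : ℂ) : ℝ := ‖s‖⁻¹ * ‖s - 1‖⁻¹ * (1 + ‖s‖)⁻¹

theorem poleWeight_nonneg (s : ℂ) : 0 ≤ poleWeight s := by rw [poleWeight]; positivity

theorem measurable_poleWeight : Measurable poleWeight := by unfold poleWeight; fun_prop

theorem integrable_poleWeight : Integrable poleWeight := by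
  have h1 : Integrable fun s : ℂ => (1 + ‖s‖) ^ (-(3 : ℝ)) :=
    integrable_one_add_norm (by rw [Complex.finrank_real_complex]; norm_num)
  have h2 := (integrable_invNormBall (1 / 2)).const_mul 2
  have h3 := h2.comp_sub_right (1 : ℂ)
  refine ((h2.add h3).add (h1.const_mul 15)).mono' measurable_poleWeight.aestronglyMeasurable
    (Eventually.of_forall fun s => ?_)
  rw [Real.norm_of_nonneg (poleWeight_nonneg s)]
  simp only [Pi.add_apply]
  have t1 : 1 ≤ ‖s‖ + ‖s - 1‖ := by
    calc (1 : ℝ) = ‖s - (s - 1)‖ := by simp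
      _ ≤ _ := norm_sub_le _ _
  have t2 : ‖s‖ ≤ ‖s - 1‖ + 1 := by
    calc ‖s‖ = ‖(s - 1) + 1‖ := by simp
      _ ≤ _ := (norm_add_le _ _).trans (by simp)
  have p1 := invNormBall_nonneg (1 / 2) s
  have p2 := invNormBall_nonneg (1 / 2) (s - 1)
  have p3 : 0 ≤ (1 + ‖s‖) ^ (-(3 : ℝ)) := by positivity
  have p0 := norm_nonneg s
  by_cases c1 : ‖s‖ < 1 / 2
  · have e1 : invNormBall (1 / 2) s = ‖s‖⁻¹ := by
      rw [invNormBall, indicator_of_mem (by simpa using c1)]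
    have : poleWeight s ≤ 2 * ‖s‖⁻¹ := by
      rw [poleWeight]
      have e2 : ‖s - 1‖⁻¹ ≤ 2 := by
        rw [inv_le_comm₀ (by linarith) two_pos]; linarith
      have e3 : (1 + ‖s‖)⁻¹ ≤ 1 := inv_le_one_of_one_le₀ (by linarith)
      calc ‖s‖⁻¹ * ‖s - 1‖⁻¹ * (1 + ‖s‖)⁻¹ ≤ ‖s‖⁻¹ * 2 * 1 := by gcongr
        _ = _ := by ring
    linarith
  by_cases c2 : ‖s - 1‖ < 1 / 2
  · have e1 : invNormBall (1 / 2) (s - 1) = ‖s - 1‖⁻¹ := by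
      rw [invNormBall, indicator_of_mem (by simpa using c2)]
    have : poleWeight s ≤ 2 * ‖s - 1‖⁻¹ := by
      rw [poleWeight]
      have e2 : ‖s‖⁻¹ ≤ 2 := by
        rw [inv_le_comm₀ (by linarith) two_pos]; linarith
      have e3 : (1 + ‖s‖)⁻¹ ≤ 1 := inv_le_one_of_one_le₀ (by linarith)
      calc ‖s‖⁻¹ * ‖s - 1‖⁻¹ * (1 + ‖s‖)⁻¹ ≤ 2 * ‖s - 1‖⁻¹ * 1 := by gcongr
        _ = _ := by ring
    linarith
  have : poleWeight s ≤ 15 * (1 + ‖s‖) ^ (-(3 : ℝ)) := by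
    have q : (0 : ℝ) < 1 + ‖s‖ := by positivity
    have e4 : (1 + ‖s‖) ^ (-(3 : ℝ)) = (1 + ‖s‖)⁻¹ * (1 + ‖s‖)⁻¹ * (1 + ‖s‖)⁻¹ := by
      rw [Real.rpow_neg q.le, show (3 : ℝ) = ((3 : ℕ) : ℝ) by norm_num, Real.rpow_natCast]
      rw [pow_succ, pow_two, mul_inv, mul_inv]
    rw [e4, poleWeight]
    push Not at c1 c2
    have e1 : ‖s‖⁻¹ ≤ 3 * (1 + ‖s‖)⁻¹ := by
      rw [← div_eq_mul_inv, le_div_iff₀ q, inv_mul_le_iff₀ (by linarith)]; linarith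
    have e2 : ‖s - 1‖⁻¹ ≤ 5 * (1 + ‖s‖)⁻¹ := by
      rw [← div_eq_mul_inv, le_div_iff₀ q, inv_mul_le_iff₀ (by linarith)]; linarith
    calc ‖s‖⁻¹ * ‖s - 1‖⁻¹ * (1 + ‖s‖)⁻¹
        ≤ (3 * (1 + ‖s‖)⁻¹) * (5 * (1 + ‖s‖)⁻¹) * (1 + ‖s‖)⁻¹ := by gcongr
      _ = _ := by ring
  linarith

/-- The bound for functions with three poles which are apart from each other. -/
theorem inv_norm_mul_le {w s : ℂ} {ρ δ B : ℝ} (hδ : 0 < δ) (hρ : δ ≤ ρ) (h0 : 2 * ρ ≤ ‖w‖)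
    (h1 : 2 * ρ ≤ ‖w - 1‖) (hB : ‖w‖ ≤ B) :
    ‖s - w‖⁻¹ * ‖s‖⁻¹ * ‖s - 1‖⁻¹ ≤ (ρ⁻¹) ^ 2 * invNormBall δ (s - w)
      + ((1 + B) / δ + 1) * poleWeight s := by
  have hρ0 : 0 < ρ := hδ.trans_le hρ
  have q := poleWeight_nonneg s
  have q' := invNormBall_nonneg δ (s - w)
  have hB0 : 0 ≤ B := (norm_nonneg _).trans hB
  by_cases hs : ‖s - w‖ < δ
  · have e1 : invNormBall δ (s - w) = ‖s - w‖⁻¹ := by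
      rw [invNormBall, indicator_of_mem (by simpa using hs)]
    have t1 : ρ ≤ ‖s‖ := by
      have : ‖w‖ ≤ ‖s‖ + ‖s - w‖ := by
        calc ‖w‖ = ‖s - (s - w)‖ := by simp
          _ ≤ _ := norm_sub_le _ _
      linarith
    have t2 : ρ ≤ ‖s - 1‖ := by
      have : ‖w - 1‖ ≤ ‖s - 1‖ + ‖s - w‖ := by
        calc ‖w - 1‖ = ‖(s - 1) - (s - w)‖ := by congr 1; ring
          _ ≤ _ := norm_sub_le _ _
      linarith
    have : ‖s - w‖⁻¹ * ‖s‖⁻¹ * ‖s - 1‖⁻¹ ≤ (ρ⁻¹) ^ 2 * invNormBall δ (s - w) := by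
      rw [e1]
      calc ‖s - w‖⁻¹ * ‖s‖⁻¹ * ‖s - 1‖⁻¹ ≤ ‖s - w‖⁻¹ * ρ⁻¹ * ρ⁻¹ := by gcongr
        _ = _ := by ring
    have : 0 ≤ ((1 + B) / δ + 1) * poleWeight s := by positivity
    linarith
  · push Not at hs
    have hsw : 0 < ‖s - w‖ := hδ.trans_le hs
    have t1 : ‖s - w‖⁻¹ ≤ ((1 + B) / δ + 1) * (1 + ‖s‖)⁻¹ := by
      rw [← div_eq_mul_inv, le_div_iff₀ (by positivity), inv_mul_le_iff₀ hsw]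
      have t2 : ‖s‖ ≤ ‖s - w‖ + B := by
        calc ‖s‖ = ‖(s - w) + w‖ := by simp
          _ ≤ _ := (norm_add_le _ _).trans (by linarith)
      have t3 : 1 + B ≤ ‖s - w‖ * ((1 + B) / δ) := by
        rw [mul_div_assoc', le_div_iff₀ hδ]
        nlinarith
      linarith
    have : ‖s - w‖⁻¹ * ‖s‖⁻¹ * ‖s - 1‖⁻¹ ≤ ((1 + B) / δ + 1) * poleWeight s := by
      rw [poleWeight]
      calc ‖s - w‖⁻¹ * ‖s‖⁻¹ * ‖s - 1‖⁻¹
          ≤ (((1 + B) / δ + 1) * (1 + ‖s‖)⁻¹) * ‖s‖⁻¹ * ‖s - 1‖⁻¹ := by gcongr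
        _ = _ := by ring
    have : 0 ≤ (ρ⁻¹) ^ 2 * invNormBall δ (s - w) := by positivity
    linarith

theorem integrable_of_three_poles {k : ℂ → ℂ} (hk : Measurable k) {w : ℂ} (h0 : w ≠ 0) (h1 : w ≠ 1)
    {A : ℝ} (hA : ∀ s, ‖k s‖ ≤ A * (‖s - w‖⁻¹ * ‖s‖⁻¹ * ‖s - 1‖⁻¹)) (hA0 : 0 ≤ A) :
    Integrable k := by
  set ρ := min ‖w‖ ‖w - 1‖ / 2 with hρ
  have hmin : 0 < min ‖w‖ ‖w - 1‖ := lt_min (norm_pos_iff.2 h0) (norm_pos_iff.2 (sub_ne_zero.2 h1))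
  have hρ0 : 0 < ρ := by positivity
  refine ((((integrable_invNormBall ρ).comp_sub_right w).const_mul ((ρ⁻¹) ^ 2)).add
    (integrable_poleWeight.const_mul ((1 + ‖w‖) / ρ + 1)) |>.const_mul A).mono'
    hk.aestronglyMeasurable (Eventually.of_forall fun s => (hA s).trans ?_)
  refine mul_le_mul_of_nonneg_left (inv_norm_mul_le hρ0 le_rfl ?_ ?_ le_rfl) hA0
  · have := min_le_left ‖w‖ ‖w - 1‖; linarith
  · have := min_le_right ‖w‖ ‖w - 1‖; linarith

/-- Kernels with three moving poles depend continuously on the parameter in `L¹`. -/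
theorem tendsto_integral_norm_sub_of_three_poles {k : ℂ → ℂ → ℂ} (hk : ∀ y, Measurable (k y))
    {w : ℂ → ℂ} {A : ℂ → ℝ} {x : ℂ} (hw : ContinuousAt w x) (hA : ContinuousAt A x)
    (h0 : w x ≠ 0) (h1 : w x ≠ 1)
    (hkA : ∀ y s, ‖k y s‖ ≤ A y * (‖s - w y‖⁻¹ * ‖s‖⁻¹ * ‖s - 1‖⁻¹))
    (hlim : ∀ᵐ s, Tendsto (fun y => k y s) (𝓝 x) (𝓝 (k x s))) :
    Tendsto (fun y => ∫ s, ‖k y s - k x s‖) (𝓝 x) (𝓝 0) := by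
  have hmin : 0 < min ‖w x‖ ‖w x - 1‖ :=
    lt_min (norm_pos_iff.2 h0) (norm_pos_iff.2 (sub_ne_zero.2 h1))
  set ρ := min ‖w x‖ ‖w x - 1‖ / 4 with hρ
  have hρ0 : 0 < ρ := by positivity
  set B := ‖w x‖ + ρ with hB
  set A₀ := |A x| + 1 with hA₀
  have hA₀0 : 0 < A₀ := by positivity
  have hev : ∀ᶠ y in 𝓝 x, ‖w y - w x‖ < ρ ∧ A y ≤ A₀ := by
    have e1 : ∀ᶠ y in 𝓝 x, dist (w y) (w x) < ρ := Metric.continuousAt_iff'.1 hw ρ hρ0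
    have e2 : ∀ᶠ y in 𝓝 x, A y < A₀ := hA.eventually_lt_const (by
      have := le_abs_self (A x); linarith)
    filter_upwards [e1, e2] with y h2 h3
    exact ⟨by rwa [← dist_eq_norm], h3.le⟩
  have hbound : ∀ δ, 0 < δ → δ ≤ ρ → ∀ y, ‖w y - w x‖ < ρ → A y ≤ A₀ → ∀ s,
      ‖k y s‖ ≤ A₀ * (ρ⁻¹) ^ 2 * invNormBall δ (s - w y)
        + A₀ * ((1 + B) / δ + 1) * poleWeight s := by
    intro δ hδ hδρ y hy hyA s
    have m1 := min_le_left ‖w x‖ ‖w x - 1‖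
    have m2 := min_le_right ‖w x‖ ‖w x - 1‖
    have t1 : ‖w x‖ ≤ ‖w y‖ + ‖w y - w x‖ := by
      calc ‖w x‖ = ‖w y - (w y - w x)‖ := by simp
        _ ≤ _ := norm_sub_le _ _
    have t2 : ‖w x - 1‖ ≤ ‖w y - 1‖ + ‖w y - w x‖ := by
      calc ‖w x - 1‖ = ‖(w y - 1) - (w y - w x)‖ := by congr 1; ring
        _ ≤ _ := norm_sub_le _ _
    have t3 : ‖w y‖ ≤ B := by
      calc ‖w y‖ = ‖(w y - w x) + w x‖ := by simp
        _ ≤ _ := (norm_add_le _ _).trans (by linarith)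
    have := inv_norm_mul_le (w := w y) (s := s) hδ hδρ (by linarith) (by linarith) t3
    calc ‖k y s‖ ≤ A₀ * (‖s - w y‖⁻¹ * ‖s‖⁻¹ * ‖s - 1‖⁻¹) := by
          refine (hkA y s).trans ?_
          gcongr
      _ ≤ A₀ * ((ρ⁻¹) ^ 2 * invNormBall δ (s - w y) + ((1 + B) / δ + 1) * poleWeight s) := by gcongr
      _ = _ := by ring
  have hx : ‖w x - w x‖ < ρ ∧ A x ≤ A₀ := hev.self_of_nhds
  have hint : ∀ y, ‖w y - w x‖ < ρ → A y ≤ A₀ → Integrable (k y) := by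
    intro y h2 h3
    refine ((((integrable_invNormBall ρ).comp_sub_right (w y)).const_mul (A₀ * (ρ⁻¹) ^ 2)).add
      (integrable_poleWeight.const_mul (A₀ * ((1 + B) / ρ + 1)))).mono' (hk y).aestronglyMeasurable
      (Eventually.of_forall fun s => hbound ρ hρ0 le_rfl y h2 h3 s)
  rw [Metric.tendsto_nhds]
  intro ε hε
  obtain ⟨δ, hδρ, hδ, hδε⟩ : ∃ δ, δ ≤ ρ ∧ 0 < δ ∧
      A₀ * (ρ⁻¹) ^ 2 * ∫ s, invNormBall δ s < ε / 4 := by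
    have e1 : Tendsto (fun δ => A₀ * (ρ⁻¹) ^ 2 * ∫ s, invNormBall δ s) (𝓝[>] 0) (𝓝 0) := by
      have e4 := tendsto_integral_invNormBall.const_mul (A₀ * (ρ⁻¹) ^ 2)
      rwa [mul_zero] at e4
    have e2 : ∀ᶠ δ : ℝ in 𝓝[>] 0, δ ≤ ρ := nhdsWithin_le_nhds (Iic_mem_nhds hρ0)
    have e3 : ∀ᶠ δ : ℝ in 𝓝[>] 0, 0 < δ := self_mem_nhdsWithin
    exact (e2.and (e3.and (e1.eventually_lt_const (by positivity)))).exists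
  set J : ℂ → ℝ := fun s => 2 * (A₀ * ((1 + B) / δ + 1)) * poleWeight s with hJ
  have hJi : Integrable J := integrable_poleWeight.const_mul _
  have hJ0 : ∀ s, 0 ≤ J s := fun s => by
    have := poleWeight_nonneg s
    simp only [hJ]; positivity
  have hminlim : Tendsto (fun y => ∫ s, min ‖k y s - k x s‖ (J s)) (𝓝 x) (𝓝 0) := by
    have e1 : Tendsto (fun y => ∫ s, min ‖k y s - k x s‖ (J s)) (𝓝 x) (𝓝 (∫ _ : ℂ, (0 : ℝ))) := by
      refine tendsto_integral_filter_of_dominated_convergence J (Eventually.of_forall fun y => ?_)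
        (Eventually.of_forall fun y => Eventually.of_forall fun s => ?_) hJi ?_
      · exact ((((hk y).sub (hk x)).norm).min
          (measurable_poleWeight.const_mul _)).aestronglyMeasurable
      · rw [Real.norm_of_nonneg (le_min (norm_nonneg _) (hJ0 s))]
        exact min_le_right _ _
      · filter_upwards [hlim] with s hs
        have e2 : Tendsto (fun y => ‖k y s - k x s‖) (𝓝 x) (𝓝 0) := by
          simpa using (hs.sub_const (k x s)).norm
        have e3 := e2.min (tendsto_const_nhds (x := J s))
        rwa [min_eq_left (hJ0 s)] at e3
    simpa using e1
  filter_upwards [hev, hminlim.eventually_lt_const (half_pos hε)] with y hy hy2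
  rw [Real.dist_0_eq_abs, abs_of_nonneg (by positivity)]
  have hd : Integrable fun s => ‖k y s - k x s‖ := ((hint y hy.1 hy.2).sub (hint x hx.1 hx.2)).norm
  have i1 := ((integrable_invNormBall δ).comp_sub_right (w y)).const_mul (A₀ * (ρ⁻¹) ^ 2)
  have i2 := ((integrable_invNormBall δ).comp_sub_right (w x)).const_mul (A₀ * (ρ⁻¹) ^ 2)
  have i12 : Integrable fun s => A₀ * (ρ⁻¹) ^ 2 * invNormBall δ (s - w y)
      + A₀ * (ρ⁻¹) ^ 2 * invNormBall δ (s - w x) := i1.add i2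
  have i0 : Integrable fun s => min ‖k y s - k x s‖ (J s) := by
    refine hJi.mono' ((((hk y).sub (hk x)).norm).min
      (measurable_poleWeight.const_mul _)).aestronglyMeasurable (Eventually.of_forall fun s => ?_)
    rw [Real.norm_of_nonneg (le_min (norm_nonneg _) (hJ0 s))]
    exact min_le_right _ _
  have hpt : ∀ s, ‖k y s - k x s‖ ≤ min ‖k y s - k x s‖ (J s)
      + (A₀ * (ρ⁻¹) ^ 2 * invNormBall δ (s - w y) + A₀ * (ρ⁻¹) ^ 2 * invNormBall δ (s - w x)) := by
    intro s
    have b1 := hbound δ hδ hδρ y hy.1 hy.2 s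
    have b2 := hbound δ hδ hδρ x hx.1 hx.2 s
    have b3 := norm_sub_le (k y s) (k x s)
    have p1 := invNormBall_nonneg δ (s - w y)
    have p2 := invNormBall_nonneg δ (s - w x)
    have p3 : 0 ≤ A₀ * (ρ⁻¹) ^ 2 * invNormBall δ (s - w y) := by positivity
    have p4 : 0 ≤ A₀ * (ρ⁻¹) ^ 2 * invNormBall δ (s - w x) := by positivity
    rcases le_total ‖k y s - k x s‖ (J s) with h | h
    · rw [min_eq_left h]; linarith
    · rw [min_eq_right h]; simp only [hJ] at h ⊢; linarith
  calc ∫ s, ‖k y s - k x s‖ ≤ ∫ s, (min ‖k y s - k x s‖ (J s)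
      + (A₀ * (ρ⁻¹) ^ 2 * invNormBall δ (s - w y) + A₀ * (ρ⁻¹) ^ 2 * invNormBall δ (s - w x))) :=
        integral_mono hd (i0.add i12) hpt
    _ = (∫ s, min ‖k y s - k x s‖ (J s)) + (A₀ * (ρ⁻¹) ^ 2 * (∫ s, invNormBall δ s)
        + A₀ * (ρ⁻¹) ^ 2 * ∫ s, invNormBall δ s) := by
        rw [integral_add i0 i12, integral_add i1 i2, integral_const_mul, integral_const_mul,
          integral_sub_right_eq_self (invNormBall δ) (w y),
          integral_sub_right_eq_self (invNormBall δ) (w x)]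
    _ < ε := by linarith

end PlaneKernel

/-- Two unitary characters `α`, `β` of `ℂ ˣ` whose product is the inverse of the restriction of
the character `χ` to the constants. -/
structure CharPair {κ : Type*} [Fintype κ] {R : Type*} [NormedCommRing R] [NormedAlgebra ℂ R]
    (S : SiteData κ R) where
  /-- the character at the first distinguished point -/
  α : ℂ → ℂ
  /-- the character at the second distinguished point -/
  β : ℂ → ℂ
  α_mul : ∀ {a b : ℂ}, a ≠ 0 → b ≠ 0 → α (a * b) = α a * α b
  β_mul : ∀ {a b : ℂ}, a ≠ 0 → b ≠ 0 → β (a * b) = β a * β b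
  norm_α : ∀ {a : ℂ}, a ≠ 0 → ‖α a‖ = 1
  norm_β : ∀ {a : ℂ}, a ≠ 0 → ‖β a‖ = 1
  α_zero : α 0 = 0
  β_zero : β 0 = 0
  continuousOn_α : ContinuousOn α {0}ᶜ
  continuousOn_β : ContinuousOn β {0}ᶜ
  rel : ∀ {a : ℂ}, a ≠ 0 → α a * β a * S.χ (algebraMap ℂ R a) = 1

theorem measurable_of_continuousOn_ne_zero {f : ℂ → ℂ} (hf : ContinuousOn f {0}ᶜ) (h0 : f 0 = 0) :
    Measurable f := by
  classical
  have h1 : f = Set.piecewise {0}ᶜ f (fun _ => 0) := by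
    funext s
    by_cases hs : s = 0 <;> simp [Set.piecewise, hs, h0]
  rw [h1]
  exact ContinuousOn.measurable_piecewise hf continuousOn_const isOpen_compl_singleton.measurableSet

namespace CharPair

variable {κ : Type*} [Fintype κ] {R : Type*} [NormedCommRing R] [NormedAlgebra ℂ R]
  {S : SiteData κ R} (Q : CharPair S)

theorem norm_α_le (a : ℂ) : ‖Q.α a‖ ≤ 1 := by
  rcases eq_or_ne a 0 with rfl | ha
  · simp [Q.α_zero]
  · exact (Q.norm_α ha).le

theorem norm_β_le (a : ℂ) : ‖Q.β a‖ ≤ 1 := by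
  rcases eq_or_ne a 0 with rfl | ha
  · simp [Q.β_zero]
  · exact (Q.norm_β ha).le

theorem measurable_α : Measurable Q.α := measurable_of_continuousOn_ne_zero Q.continuousOn_α Q.α_zero

theorem measurable_β : Measurable Q.β := measurable_of_continuousOn_ne_zero Q.continuousOn_β Q.β_zero

theorem χ_eq {a : ℂ} (ha : a ≠ 0) :
    S.χ (algebraMap ℂ R a) = starRingEnd ℂ (Q.α a * Q.β a) := by
  have h1 := Q.rel ha
  have h2 : Q.α a * Q.β a * starRingEnd ℂ (Q.α a * Q.β a) = 1 := by
    rw [Complex.mul_conj, Complex.normSq_eq_norm_sq, norm_mul, Q.norm_α ha, Q.norm_β ha]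
    norm_num
  have h3 : Q.α a * Q.β a ≠ 0 := left_ne_zero_of_mul (h1.trans_ne one_ne_zero)
  exact mul_left_cancel₀ h3 (h1.trans h2.symm)

theorem α_inv_mul {a b : ℂ} (ha : a ≠ 0) (hb : b ≠ 0) :
    Q.α (b / a) = starRingEnd ℂ (Q.α a) * Q.α b := by
  have h1 := Q.α_mul (div_ne_zero hb ha) ha
  rw [div_mul_cancel₀ _ ha] at h1
  have h2 : Q.α a * starRingEnd ℂ (Q.α a) = 1 := by
    rw [Complex.mul_conj, Complex.normSq_eq_norm_sq, Q.norm_α ha]; norm_num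
  rw [h1]; linear_combination (-Q.α (b / a)) * h2

theorem β_inv_mul {a b : ℂ} (ha : a ≠ 0) (hb : b ≠ 0) :
    Q.β (b / a) = starRingEnd ℂ (Q.β a) * Q.β b := by
  have h1 := Q.β_mul (div_ne_zero hb ha) ha
  rw [div_mul_cancel₀ _ ha] at h1
  have h2 : Q.β a * starRingEnd ℂ (Q.β a) = 1 := by
    rw [Complex.mul_conj, Complex.normSq_eq_norm_sq, Q.norm_β ha]; norm_num
  rw [h1]; linear_combination (-Q.β (b / a)) * h2

end CharPair

namespace SiteData

variable {κ : Type*} [Fintype κ] {R : Type*} [NormedCommRing R] [NormedAlgebra ℂ R]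
  [FiniteDimensional ℂ R] (S : SiteData κ R) (H : HeckeData R) (Q : CharPair S)
  [MeasurableSpace R] [BorelSpace R] (μ : Measure R) [μ.IsAddHaarMeasure]

/-- The weight of the Hecke modification with parameter `s`. -/
def heckeKernel (x s : ℂ) : ℂ :=
  Q.α (s * H.lin x s) * Q.β ((s - 1) * H.lin x s) *
    ((‖H.lin x s‖⁻¹ * ‖s‖⁻¹ * ‖s - 1‖⁻¹ * (√(S.nm (H.z - algebraMap ℂ R x)))⁻¹ : ℝ) : ℂ)

/-- The modified Hecke operator in normalized coordinates. -/
def heckeOp (x : ℂ) : Lp ℂ 2 μ →L[ℂ] Lp ℂ 2 μ :=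
  S.avgOp μ volume (S.heckeKernel H Q x) (H.mat x)

theorem measurable_heckeKernel (x : ℂ) : Measurable (S.heckeKernel H Q x) := by
  have h1 : Continuous (H.lin x) := by unfold HeckeData.lin; fun_prop
  have h2 := h1.measurable
  unfold heckeKernel
  refine ((Q.measurable_α.comp (measurable_id.mul h2)).mul
    (Q.measurable_β.comp ((measurable_id.sub_const 1).mul h2))).mul ?_
  refine Complex.measurable_ofReal.comp ?_
  exact (((h2.norm.inv).mul measurable_norm.inv).mul (measurable_id.sub_const 1).norm.inv).mul_const _

/-- The zero of `lin`. -/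
def _root_.WildHecke.HeckeData.root (x : ℂ) : ℂ := -(H.tp - x) / (H.tq - H.tp)

theorem _root_.WildHecke.HeckeData.lin_eq (x s : ℂ) :
    H.lin x s = (H.tq - H.tp) * (s - H.root x) := by
  have h : H.tq - H.tp ≠ 0 := sub_ne_zero.2 H.tp_ne_tq.symm
  rw [HeckeData.lin, HeckeData.root]
  field_simp
  ring

theorem _root_.WildHecke.HeckeData.root_ne_zero {x : ℂ} (hx : H.Regular x) : H.root x ≠ 0 :=
  div_ne_zero (neg_ne_zero.2 (sub_ne_zero.2 hx.1.symm)) (sub_ne_zero.2 H.tp_ne_tq.symm)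

theorem _root_.WildHecke.HeckeData.root_ne_one {x : ℂ} (hx : H.Regular x) : H.root x ≠ 1 := by
  intro h
  have h1 := H.lin_eq x 1
  rw [h, sub_self, mul_zero, HeckeData.lin] at h1
  exact sub_ne_zero.2 hx.2.1 (by linear_combination -h1)

theorem norm_heckeKernel_le (x s : ℂ) : ‖S.heckeKernel H Q x s‖ ≤
    (‖H.tq - H.tp‖⁻¹ * (√(S.nm (H.z - algebraMap ℂ R x)))⁻¹) *
      (‖s - H.root x‖⁻¹ * ‖s‖⁻¹ * ‖s - 1‖⁻¹) := by
  rw [heckeKernel, norm_mul, norm_mul, Complex.norm_real, Real.norm_of_nonneg (by positivity),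
    H.lin_eq x s, norm_mul, mul_inv]
  have h1 := Q.norm_α_le (s * ((H.tq - H.tp) * (s - H.root x)))
  have h2 := Q.norm_β_le ((s - 1) * ((H.tq - H.tp) * (s - H.root x)))
  have h3 := mul_le_mul h1 h2 (norm_nonneg _) zero_le_one
  rw [one_mul] at h3
  calc _ ≤ 1 * (‖H.tq - H.tp‖⁻¹ * ‖s - H.root x‖⁻¹ * ‖s‖⁻¹ * ‖s - 1‖⁻¹ *
        (√(S.nm (H.z - algebraMap ℂ R x)))⁻¹) := mul_le_mul_of_nonneg_right h3 (by positivity)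
    _ = _ := by ring

theorem integrable_heckeKernel {x : ℂ} (hx : H.Regular x) : Integrable (S.heckeKernel H Q x) :=
  integrable_of_three_poles (S.measurable_heckeKernel H Q x) (H.root_ne_zero hx)
    (H.root_ne_one hx) (S.norm_heckeKernel_le H Q x) (by positivity)

theorem _root_.WildHecke.HeckeData.isOpen_regular : IsOpen {x | H.Regular x} := by
  have h : {x | H.Regular x} = {H.tp}ᶜ ∩ ({H.tq}ᶜ ∩ {x | IsUnit (H.z - algebraMap ℂ R x)}) := by
    ext x
    rfl
  rw [h]
  refine isOpen_compl_singleton.inter (isOpen_compl_singleton.inter ?_)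
  exact (isOpen_units (R := R)).preimage (f := fun x : ℂ => H.z - algebraMap ℂ R x) (by fun_prop)

theorem ae_good (x : ℂ) : ∀ᵐ s : ℂ, s ∈ H.good x := by
  filter_upwards [Measure.ae_ne volume (0 : ℂ), Measure.ae_ne volume (1 : ℂ),
    Measure.ae_ne volume (H.root x)] with s h0 h1 h2
  refine ⟨h0, h1, ?_⟩
  rw [H.lin_eq]
  exact mul_ne_zero (sub_ne_zero.2 H.tp_ne_tq.symm) (sub_ne_zero.2 h2)

theorem tendsto_heckeKernel {x : ℂ} (hx : H.Regular x) :
    Tendsto (fun y => ∫ s, ‖S.heckeKernel H Q y s - S.heckeKernel H Q x s‖) (𝓝 x) (𝓝 0) := by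
  have hnm : ContinuousAt (fun y => (√(S.nm (H.z - algebraMap ℂ R y)))⁻¹) x := by
    refine ContinuousAt.inv₀ ?_ (Real.sqrt_pos.2 (S.nm_pos hx.2.2)).ne'
    have : Continuous fun y => √(S.nm (H.z - algebraMap ℂ R y)) :=
      Real.continuous_sqrt.comp (S.continuous_nm.comp (by fun_prop))
    exact this.continuousAt
  have hroot : Continuous H.root := by unfold HeckeData.root; fun_prop
  refine tendsto_integral_norm_sub_of_three_poles (S.measurable_heckeKernel H Q)
    hroot.continuousAt (continuousAt_const.mul hnm) (H.root_ne_zero hx) (H.root_ne_one hx)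
    (S.norm_heckeKernel_le H Q) ?_
  filter_upwards [ae_good H x] with s hs
  have hlin : ContinuousAt (fun y => H.lin y s) x := by
    have : Continuous fun y => H.lin y s := by unfold HeckeData.lin; fun_prop
    exact this.continuousAt
  have h1 : ContinuousAt (fun y => Q.α (s * H.lin y s)) x :=
    ContinuousAt.comp (f := fun y => s * H.lin y s) (Q.continuousOn_α.continuousAt
      (isOpen_compl_singleton.mem_nhds (mul_ne_zero hs.1 hs.2.2))) (continuousAt_const.mul hlin)
  have h2 : ContinuousAt (fun y => Q.β ((s - 1) * H.lin y s)) x :=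
    ContinuousAt.comp (f := fun y => (s - 1) * H.lin y s) (Q.continuousOn_β.continuousAt
      (isOpen_compl_singleton.mem_nhds (mul_ne_zero (sub_ne_zero.2 hs.2.1) hs.2.2)))
      (continuousAt_const.mul hlin)
  have h3 : ContinuousAt (fun y => ‖H.lin y s‖⁻¹) x := hlin.norm.inv₀ (norm_ne_zero_iff.2 hs.2.2)
  have h4 : ContinuousAt (fun y => S.heckeKernel H Q y s) x :=
    (h1.mul h2).mul (Complex.continuous_ofReal.continuousAt.comp
      (((h3.mul continuousAt_const).mul continuousAt_const).mul hnm))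
  exact h4.tendsto

/-- The involution of the parameter which corresponds to passing to the inverse modification. -/
def flip (x s : ℂ) : ℂ := -((H.tp - x) * (s - 1)) / H.lin x s

variable {x s : ℂ}

theorem lin_flip (hs : H.lin x s ≠ 0) :
    H.lin x (flip H x s) = (H.tp - x) * (H.tq - x) / H.lin x s := by
  rw [HeckeData.lin, flip]
  field_simp
  rw [HeckeData.lin]
  ring

theorem flip_sub_one (hs : H.lin x s ≠ 0) : flip H x s - 1 = -((H.tq - x) * s) / H.lin x s := by
  rw [flip, div_sub_one hs]
  congr 1
  rw [HeckeData.lin]; ring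

theorem flip_mem_good (hx : H.Regular x) (hs : s ∈ H.good x) : flip H x s ∈ H.good x := by
  have hp := sub_ne_zero.2 hx.1.symm
  have hq := sub_ne_zero.2 hx.2.1.symm
  refine ⟨?_, sub_ne_zero.1 ?_, ?_⟩
  · exact div_ne_zero (neg_ne_zero.2 (mul_ne_zero hp (sub_ne_zero.2 hs.2.1))) hs.2.2
  · rw [flip_sub_one H hs.2.2]
    exact div_ne_zero (neg_ne_zero.2 (mul_ne_zero hq hs.1)) hs.2.2
  · rw [lin_flip H hs.2.2]
    exact div_ne_zero (mul_ne_zero hp hq) hs.2.2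

theorem flip_flip (hx : H.Regular x) (hs : s ∈ H.good x) : flip H x (flip H x s) = s := by
  have hp := sub_ne_zero.2 hx.1.symm
  have hq := sub_ne_zero.2 hx.2.1.symm
  have hl := hs.2.2
  rw [flip, lin_flip H hl, flip_sub_one H hl]
  field_simp

theorem adj_mat (hx : H.Regular x) (hs : s ∈ H.good x) : (H.mat x s).adj
    = algebraMap ℂ R (-(H.lin x s ^ 2 / ((H.tp - x) * (H.tq - x)))) • H.mat x (flip H x s) := by
  have hp := sub_ne_zero.2 hx.1.symm
  have hq := sub_ne_zero.2 hx.2.1.symm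
  have hl := hs.2.2
  have e1 := lin_flip H hl
  have e2 := flip_sub_one H hl
  ext
  · simp only [Mat.adj, HeckeData.mat, Mat.smul_a, e2, ← map_mul]
    congr 1
    field_simp
  · simp only [Mat.adj, HeckeData.mat, Mat.smul_b, e2, ← mul_assoc, ← map_mul, ← neg_mul, ← map_neg]
    congr 2
    rw [flip]
    field_simp
  · simp only [Mat.adj, HeckeData.mat, Mat.smul_c, e1, ← map_mul, ← map_neg]
    congr 1
    field_simp
  · simp only [Mat.adj, HeckeData.mat, Mat.smul_d, e1, ← map_mul]
    congr 1
    rw [flip]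
    field_simp

theorem hasDerivAt_flip (hs : H.lin x s ≠ 0) : HasDerivAt (flip H x)
    (-((H.tp - x) * (H.tq - x)) / H.lin x s ^ 2) s := by
  have hlin : HasDerivAt (H.lin x) (H.tq - H.tp) s := by
    unfold HeckeData.lin
    simpa using ((hasDerivAt_id s).const_mul (H.tq - H.tp)).add_const (H.tp - x)
  have h1 : HasDerivAt (fun s => -((H.tp - x) * (s - 1))) (-(H.tp - x)) s := by
    exact ((((hasDerivAt_id s).sub_const 1).const_mul (H.tp - x)).neg).congr_deriv (by ring)
  refine (h1.div hlin hs).congr_deriv ?_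
  congr 1
  rw [HeckeData.lin]; ring

theorem abs_det_smul_one (c : ℂ) : |(c • (1 : ℂ →L[ℝ] ℂ)).det| = ‖c‖ ^ 2 := by
  have h : (c • (1 : ℂ →L[ℝ] ℂ)).det = Algebra.norm ℝ c := by
    rw [Algebra.norm_apply]
    rfl
  rw [h, Algebra.norm_complex_apply, Complex.normSq_eq_norm_sq, abs_of_nonneg (by positivity)]

/-- The substitution rule for the involution `flip`. -/
theorem integral_comp_flip (hx : H.Regular x) (F : ℂ → ℂ) : ∫ s, F s
    = ∫ s, ((‖(H.tp - x) * (H.tq - x)‖ / ‖H.lin x s‖ ^ 2) ^ 2 : ℝ) * F (flip H x s) := by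
  have hU : MeasurableSet (H.good x) := by
    have h1 : Continuous (H.lin x) := by unfold HeckeData.lin; fun_prop
    exact (((isOpen_ne (x := (0 : ℂ))).inter ((isOpen_ne (x := (1 : ℂ))).inter
      (isOpen_ne.preimage h1))).measurableSet)
  have himg : flip H x '' H.good x = H.good x := by
    ext s
    constructor
    · rintro ⟨s, hs, rfl⟩
      exact flip_mem_good H hx hs
    · intro hs
      exact ⟨_, flip_mem_good H hx hs, flip_flip H hx hs⟩
  have hinj : InjOn (flip H x) (H.good x) := fun s hs s' hs' h => by
    rw [← flip_flip H hx hs, h, flip_flip H hx hs']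
  have hae : (volume : Measure ℂ).restrict (H.good x) = volume := by
    rw [Measure.restrict_eq_self_of_ae_mem (ae_good H x)]
  have h := integral_image_eq_integral_abs_det_fderiv_smul volume hU
    (fun s hs => (hasDerivAt_flip H hs.2.2).complexToReal_fderiv.hasFDerivWithinAt) hinj F
  rw [himg, hae] at h
  rw [h]
  refine integral_congr_ae (Eventually.of_forall fun s => ?_)
  simp only
  rw [abs_det_smul_one, Complex.real_smul, norm_div, norm_neg, norm_pow]

/-- The scalar by which the adjoint of the Hecke operator differs from it. -/
def heckeSign (x : ℂ) : ℂ :=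
  starRingEnd ℂ (Q.α (H.tp - x) * Q.β (H.tq - x) * S.χ (H.z - algebraMap ℂ R x))

theorem norm_heckeSign (hx : H.Regular x) : ‖S.heckeSign H Q x‖ = 1 := by
  rw [heckeSign, RCLike.norm_conj, norm_mul, norm_mul, Q.norm_α (sub_ne_zero.2 hx.1.symm),
    Q.norm_β (sub_ne_zero.2 hx.2.1.symm), S.norm_χ hx.2.2]
  norm_num

theorem continuousAt_heckeSign (hx : H.Regular x) : ContinuousAt (S.heckeSign H Q) x := by
  have h1 : ContinuousAt (fun y => Q.α (H.tp - y)) x :=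
    ContinuousAt.comp (f := fun y => H.tp - y) (Q.continuousOn_α.continuousAt
      (isOpen_compl_singleton.mem_nhds (sub_ne_zero.2 hx.1.symm))) (by fun_prop)
  have h2 : ContinuousAt (fun y => Q.β (H.tq - y)) x :=
    ContinuousAt.comp (f := fun y => H.tq - y) (Q.continuousOn_β.continuousAt
      (isOpen_compl_singleton.mem_nhds (sub_ne_zero.2 hx.2.1.symm))) (by fun_prop)
  have h3 : ContinuousAt (fun y => S.χ (H.z - algebraMap ℂ R y)) x :=
    ContinuousAt.comp (f := fun y => H.z - algebraMap ℂ R y) (S.continuousOn_χ.continuousAt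
      ((isOpen_units (R := R)).mem_nhds hx.2.2)) (by fun_prop)
  exact Complex.continuous_conj.continuousAt.comp ((h1.mul h2).mul h3)

theorem heckeKernel_flip (hx : H.Regular x) (hs : s ∈ H.good x) :
    ((‖(H.tp - x) * (H.tq - x)‖ / ‖H.lin x s‖ ^ 2) ^ 2 : ℝ) *
      (starRingEnd ℂ (S.heckeKernel H Q x (flip H x s) * S.χ (H.mat x (flip H x s)).det) *
        S.χ (algebraMap ℂ R (-(H.lin x (flip H x s) ^ 2 / ((H.tp - x) * (H.tq - x))))))
      = S.heckeSign H Q x * S.heckeKernel H Q x s := by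
  have hp := sub_ne_zero.2 hx.1.symm
  have hq := sub_ne_zero.2 hx.2.1.symm
  have hl := hs.2.2
  have hs0 := hs.1
  have hs1 := sub_ne_zero.2 hs.2.1
  have hf := flip_mem_good H hx hs
  have hf1 := sub_ne_zero.2 hf.2.1
  set a := H.tp - x with ha
  set b := H.tq - x with hb
  set d := H.lin x s with hd
  set ν := √(S.nm (H.z - algebraMap ℂ R x)) with hν
  have e0 : flip H x s = -(a * (s - 1)) / d := rfl
  have e1 : H.lin x (flip H x s) = a * b / d := lin_flip H hl
  have e2 : flip H x s - 1 = -(b * s) / d := flip_sub_one H hl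
  -- the phases
  have hphase : starRingEnd ℂ (Q.α (flip H x s * H.lin x (flip H x s))
        * Q.β ((flip H x s - 1) * H.lin x (flip H x s))
        * S.χ (algebraMap ℂ R (H.lin x (flip H x s) * (flip H x s * (flip H x s - 1)))))
        * S.χ (algebraMap ℂ R (-(H.lin x (flip H x s) ^ 2 / (a * b))))
      = starRingEnd ℂ (Q.α a * Q.β b) * (Q.α (s * d) * Q.β ((s - 1) * d)) := by
    have n1 : H.lin x (flip H x s) * (flip H x s * (flip H x s - 1)) ≠ 0 :=
      mul_ne_zero hf.2.2 (mul_ne_zero hf.1 hf1)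
    have n2 : -(H.lin x (flip H x s) ^ 2 / (a * b)) ≠ 0 :=
      neg_ne_zero.2 (div_ne_zero (pow_ne_zero 2 hf.2.2) (mul_ne_zero hp hq))
    rw [Q.χ_eq n1, Q.χ_eq n2]
    have m1 : H.lin x (flip H x s) * (flip H x s * (flip H x s - 1))
        = (flip H x s * H.lin x (flip H x s)) * (flip H x s - 1) := by ring
    have m2 : H.lin x (flip H x s) * (flip H x s * (flip H x s - 1))
        = ((flip H x s - 1) * H.lin x (flip H x s)) * flip H x s := by ring
    have f1 : Q.α (flip H x s * H.lin x (flip H x s)) * starRingEnd ℂ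
        (Q.α (H.lin x (flip H x s) * (flip H x s * (flip H x s - 1))))
        = starRingEnd ℂ (Q.α (flip H x s - 1)) := by
      rw [m1, mul_comm, ← Q.α_inv_mul (mul_ne_zero (mul_ne_zero hf.1 hf.2.2) hf1) (mul_ne_zero hf.1 hf.2.2)]
      have := Q.α_inv_mul hf1 one_ne_zero
      have h11 : Q.α 1 = 1 := by
        have := Q.α_mul (one_ne_zero) (one_ne_zero)
        rw [one_mul] at this
        exact (mul_eq_left₀ (norm_ne_zero_iff.1 (by rw [Q.norm_α one_ne_zero]; norm_num))).1 this.symm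
      rw [h11, mul_one] at this
      rw [← this]
      congr 1
      rw [div_mul_eq_div_div, div_self (mul_ne_zero hf.1 hf.2.2)]
    have f2 : Q.β ((flip H x s - 1) * H.lin x (flip H x s)) * starRingEnd ℂ
        (Q.β (H.lin x (flip H x s) * (flip H x s * (flip H x s - 1))))
        = starRingEnd ℂ (Q.β (flip H x s)) := by
      rw [m2, mul_comm, ← Q.β_inv_mul (mul_ne_zero (mul_ne_zero hf1 hf.2.2) hf.1) (mul_ne_zero hf1 hf.2.2)]
      have := Q.β_inv_mul hf.1 one_ne_zero
      have h11 : Q.β 1 = 1 := by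
        have := Q.β_mul (one_ne_zero) (one_ne_zero)
        rw [one_mul] at this
        exact (mul_eq_left₀ (norm_ne_zero_iff.1 (by rw [Q.norm_β one_ne_zero]; norm_num))).1 this.symm
      rw [h11, mul_one] at this
      rw [← this]
      congr 1
      rw [div_mul_eq_div_div, div_self (mul_ne_zero hf1 hf.2.2)]
    have g1 : starRingEnd ℂ (Q.α (-(H.lin x (flip H x s) ^ 2 / (a * b)))) * Q.α (flip H x s - 1)
        = starRingEnd ℂ (Q.α a) * Q.α (s * d) := by
      rw [← Q.α_inv_mul n2 hf1, ← Q.α_inv_mul hp (mul_ne_zero hs0 hl)]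
      congr 1
      rw [e1, e2]
      field_simp
    have g2 : starRingEnd ℂ (Q.β (-(H.lin x (flip H x s) ^ 2 / (a * b)))) * Q.β (flip H x s)
        = starRingEnd ℂ (Q.β b) * Q.β ((s - 1) * d) := by
      rw [← Q.β_inv_mul n2 hf.1, ← Q.β_inv_mul hq (mul_ne_zero hs1 hl)]
      congr 1
      rw [e1, e0]
      field_simp
    have key : starRingEnd ℂ (Q.α (flip H x s * H.lin x (flip H x s))
        * Q.β ((flip H x s - 1) * H.lin x (flip H x s))
        * starRingEnd ℂ (Q.α (H.lin x (flip H x s) * (flip H x s * (flip H x s - 1)))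
          * Q.β (H.lin x (flip H x s) * (flip H x s * (flip H x s - 1)))))
        = Q.α (flip H x s - 1) * Q.β (flip H x s) := by
      rw [← Complex.conj_conj (Q.α (flip H x s - 1)), ← Complex.conj_conj (Q.β (flip H x s)), ← f1,
        ← f2, ← map_mul]
      congr 1
      rw [map_mul]
      ring
    rw [key, map_mul, map_mul]
    linear_combination (Q.β (flip H x s) *
      starRingEnd ℂ (Q.β (-(H.lin x (flip H x s) ^ 2 / (a * b))))) * g1
      + starRingEnd ℂ (Q.α a) * Q.α (s * d) * g2
  -- the absolute values
  have habs : (‖a * b‖ / ‖d‖ ^ 2) ^ 2 *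
      (‖H.lin x (flip H x s)‖⁻¹ * ‖flip H x s‖⁻¹ * ‖flip H x s - 1‖⁻¹ * ν⁻¹)
      = ‖d‖⁻¹ * ‖s‖⁻¹ * ‖s - 1‖⁻¹ * ν⁻¹ := by
    rw [e1, e2, e0]
    simp only [norm_div, norm_mul, norm_neg]
    have := norm_ne_zero_iff.2 hp
    have := norm_ne_zero_iff.2 hq
    have := norm_ne_zero_iff.2 hl
    have := norm_ne_zero_iff.2 hs0
    have := norm_ne_zero_iff.2 hs1
    field_simp
  rw [H.det_mat, S.χ_mul', heckeKernel, heckeKernel, heckeSign, ← hν, ← habs]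
  simp only [map_mul, Complex.conj_ofReal] at hphase ⊢
  push_cast at hphase ⊢
  linear_combination (((‖a * b‖ / ‖d‖ ^ 2) ^ 2 : ℂ) *
      (‖H.lin x (flip H x s)‖⁻¹ * ‖flip H x s‖⁻¹ * ‖flip H x s - 1‖⁻¹ * (ν : ℂ)⁻¹) *
      starRingEnd ℂ (S.χ (H.z - algebraMap ℂ R x))) * hphase

theorem adjoint_heckeOp (hx : H.Regular x) : ContinuousLinearMap.adjoint (S.heckeOp H Q μ x)
    = S.heckeSign H Q x • S.heckeOp H Q μ x := by
  have hk := S.integrable_heckeKernel H Q hx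
  have hm := H.measurable_mat x
  refine clm_ext_inner fun y z => ?_
  have hk' : Integrable (fun s => starRingEnd ℂ (S.heckeKernel H Q x s * S.χ (H.mat x s).det)) := by
    have := hk.mul_bdd (c := 1) (g := fun s => S.χ (H.mat x s).det) (S.measurable_χ.comp
      (Mat.continuous_det.measurable.comp hm)).aestronglyMeasurable
      (Eventually.of_forall fun s => S.norm_χ_le _)
    exact (LinearIsometryEquiv.integrable_comp_iff Complex.conjLIE).2 this
  have hm' : Measurable fun s => (H.mat x s).adj := Mat.continuous_adj'.measurable.comp hm
  rw [heckeOp, S.adjoint_avgOp μ hk hm, S.inner_avgOp μ hk' hm',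
    integral_comp_flip H hx, _root_.smul_apply, inner_smul_right, S.inner_avgOp μ hk hm,
    ← integral_const_mul]
  refine integral_congr_ae ?_
  filter_upwards [ae_good H x] with s hs
  have h1 := S.heckeKernel_flip H Q hx hs
  rw [adj_mat H hx (flip_mem_good H hx hs), flip_flip H hx hs, S.rho_smul, _root_.smul_apply,
    inner_smul_right, ← mul_assoc (S.heckeSign H Q x), ← h1]
  ring

theorem isCompactOperator_heckeOp (hx : H.Regular x) : IsCompactOperator (S.heckeOp H Q μ x) :=
  S.isCompactOperator_avgOp_mat H μ (S.integrable_heckeKernel H Q hx) hx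
    (S.norm_heckeSign H Q hx) (S.adjoint_heckeOp H Q μ hx)

theorem continuousAt_heckeOp (hx : H.Regular x) : ContinuousAt (S.heckeOp H Q μ) x := by
  have hreg : ∀ᶠ y in 𝓝 x, H.Regular y := H.isOpen_regular.mem_nhds hx
  exact S.continuousAt_avgOp_mat H μ hx (hreg.mono fun y hy => S.integrable_heckeKernel H Q hy)
    (S.tendsto_heckeKernel H Q hx) (S.continuousAt_heckeSign H Q hx)
    (hreg.mono fun y hy => S.adjoint_heckeOp H Q μ hy)

end SiteData

/-- The algebra `ℂ[ε] = ℂ[X] / (X ^ (n + 1))`, an element being given by its coefficients. -/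
def Jet (n : ℕ) : Type := Fin (n + 1) → ℂ

namespace Jet

variable {n : ℕ}

instance : AddCommGroup (Jet n) := inferInstanceAs (AddCommGroup (Fin (n + 1) → ℂ))
instance : Module ℂ (Jet n) := inferInstanceAs (Module ℂ (Fin (n + 1) → ℂ))
instance : MeasurableSpace (Jet n) := inferInstanceAs (MeasurableSpace (Fin (n + 1) → ℂ))
instance : MeasureSpace (Jet n) := inferInstanceAs (MeasureSpace (Fin (n + 1) → ℂ))
instance : FiniteDimensional ℂ (Jet n) := inferInstanceAs (FiniteDimensional ℂ (Fin (n + 1) → ℂ))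

@[ext] theorem ext {a b : Jet n} (h : ∀ j, a j = b j) : a = b := funext h

@[simp] theorem add_apply (a b : Jet n) (j) : (a + b) j = a j + b j := rfl
@[simp] theorem zero_apply (j) : (0 : Jet n) j = 0 := rfl
@[simp] theorem smul_apply (c : ℂ) (a : Jet n) (j) : (c • a) j = c * a j := rfl
@[simp] theorem sub_apply (a b : Jet n) (j) : (a - b) j = a j - b j := rfl

/-- The class of a power series. -/
def ofSeries (n : ℕ) (f : ℂ⟦X⟧) : Jet n := fun j => coeff (j : ℕ) f

@[simp] theorem ofSeries_apply (f : ℂ⟦X⟧) (j : Fin (n + 1)) : ofSeries n f j = coeff (j : ℕ) f := rfl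

theorem coeff_toSeries (a : Jet n) (j : Fin (n + 1)) : coeff (j : ℕ) (toSeries a) = a j := by
  simp only [toSeries, coeff_mk]
  exact dif_pos j.2

@[simp] theorem ofSeries_toSeries (a : Jet n) : ofSeries n (toSeries a) = a := by
  ext j; exact coeff_toSeries a j

theorem ofSeries_eq_iff {f g : ℂ⟦X⟧} : ofSeries n f = ofSeries n g ↔ X ^ (n + 1) ∣ f - g := by
  rw [X_pow_dvd_iff]
  constructor
  · intro h m hm
    rw [map_sub, sub_eq_zero]
    exact congrFun h ⟨m, hm⟩
  · intro h
    ext j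
    have := h j j.2
    rwa [map_sub, sub_eq_zero] at this

theorem dvd_toSeries_ofSeries_sub (f : ℂ⟦X⟧) : X ^ (n + 1) ∣ toSeries (ofSeries n f) - f :=
  ofSeries_eq_iff.1 (ofSeries_toSeries _)

instance : One (Jet n) := ⟨ofSeries n 1⟩
instance : Mul (Jet n) := ⟨fun a b => ofSeries n (toSeries a * toSeries b)⟩

theorem ofSeries_mul (f g : ℂ⟦X⟧) : ofSeries n (f * g) = ofSeries n f * ofSeries n g := by
  change _ = ofSeries n (toSeries (ofSeries n f) * toSeries (ofSeries n g))
  rw [ofSeries_eq_iff, dvd_sub_comm]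
  have h1 : toSeries (ofSeries n f) * toSeries (ofSeries n g) - f * g
      = (toSeries (ofSeries n f) - f) * toSeries (ofSeries n g)
        + f * (toSeries (ofSeries n g) - g) := by ring
  rw [h1]
  exact dvd_add ((dvd_toSeries_ofSeries_sub f).mul_right _) ((dvd_toSeries_ofSeries_sub g).mul_left _)

theorem ofSeries_add (f g : ℂ⟦X⟧) : ofSeries n (f + g) = ofSeries n f + ofSeries n g := by
  ext j; simp

theorem surjective_ofSeries (a : Jet n) : ∃ f, ofSeries n f = a := ⟨toSeries a, ofSeries_toSeries a⟩

theorem ofSeries_one : ofSeries n 1 = 1 := rfl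

theorem mul_comm' (a b : Jet n) : a * b = b * a := by
  change ofSeries n _ = ofSeries n _
  rw [mul_comm]

theorem mul_assoc' (a b c : Jet n) : a * b * c = a * (b * c) := by
  obtain ⟨f, rfl⟩ := surjective_ofSeries a
  obtain ⟨g, rfl⟩ := surjective_ofSeries b
  obtain ⟨h, rfl⟩ := surjective_ofSeries c
  simp only [← ofSeries_mul, mul_assoc]

theorem one_mul' (a : Jet n) : 1 * a = a := by
  obtain ⟨f, rfl⟩ := surjective_ofSeries a
  rw [← ofSeries_one, ← ofSeries_mul, one_mul]

theorem left_distrib' (a b c : Jet n) : a * (b + c) = a * b + a * c := by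
  obtain ⟨f, rfl⟩ := surjective_ofSeries a
  obtain ⟨g, rfl⟩ := surjective_ofSeries b
  obtain ⟨h, rfl⟩ := surjective_ofSeries c
  simp only [← ofSeries_mul, ← ofSeries_add, mul_add]

theorem zero_mul' (a : Jet n) : 0 * a = 0 := by
  have h0 : (0 : Jet n) = ofSeries n 0 := by ext j; simp
  obtain ⟨f, rfl⟩ := surjective_ofSeries a
  rw [h0, ← ofSeries_mul, zero_mul]

theorem smul_mul' (c : ℂ) (a b : Jet n) : c • a * b = c • (a * b) := by
  obtain ⟨f, rfl⟩ := surjective_ofSeries a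
  obtain ⟨g, rfl⟩ := surjective_ofSeries b
  have h : ∀ f : ℂ⟦X⟧, c • ofSeries n f = ofSeries n (c • f) := fun f => by ext j; simp
  rw [h, ← ofSeries_mul, ← ofSeries_mul, h, smul_mul_assoc]

instance : CommRing (Jet n) :=
  { (inferInstance : AddCommGroup (Jet n)), (inferInstance : One (Jet n)),
    (inferInstance : Mul (Jet n)) with
    left_distrib := left_distrib'
    right_distrib := fun a b c => by rw [mul_comm', left_distrib', mul_comm' c a, mul_comm' c b]
    zero_mul := zero_mul'
    mul_zero := fun a => by rw [mul_comm', zero_mul']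
    mul_assoc := mul_assoc'
    one_mul := one_mul'
    mul_one := fun a => by rw [mul_comm', one_mul']
    mul_comm := mul_comm' }

instance : Algebra ℂ (Jet n) :=
  Algebra.ofModule smul_mul' (fun c a b => by rw [mul_comm', smul_mul', mul_comm'])

theorem mul_apply (a b : Jet n) (j : Fin (n + 1)) :
    (a * b) j = coeff (j : ℕ) (toSeries a * toSeries b) := rfl

@[simp] theorem one_apply_zero : (1 : Jet n) 0 = 1 := by
  rw [← ofSeries_one]; simp

@[simp] theorem mul_apply_zero (a b : Jet n) : (a * b) 0 = a 0 * b 0 := by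
  rw [mul_apply, Fin.val_zero, coeff_zero_eq_constantCoeff_apply, map_mul]
  rfl

instance : Norm (Jet n) := ⟨fun a => ∑ j, ‖a j‖⟩

theorem norm_def (a : Jet n) : ‖a‖ = ∑ j, ‖a j‖ := rfl

instance : NormedAddCommGroup (Jet n) :=
  NormedAddCommGroup.ofCore (𝕜 := ℂ)
    { norm_nonneg := fun g => by rw [norm_def]; positivity
      norm_smul := fun c g => by simp only [norm_def, smul_apply, norm_mul, Finset.mul_sum]
      norm_triangle := fun g h => by
        simp only [norm_def, ← Finset.sum_add_distrib]
        exact Finset.sum_le_sum fun j _ => norm_add_le _ _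
      norm_eq_zero_iff := fun g => by
        constructor
        · intro h
          ext j
          exact norm_eq_zero.1 ((Finset.sum_eq_zero_iff_of_nonneg fun _ _ => norm_nonneg _).1 h j
            (Finset.mem_univ j))
        · rintro rfl
          exact Finset.sum_eq_zero fun _ _ => norm_zero }

theorem norm_mul_le' (a b : Jet n) : ‖a * b‖ ≤ ‖a‖ * ‖b‖ := by
  have h1 : ∀ c : Jet n, ‖c‖ = ∑ m ∈ Finset.range (n + 1), ‖coeff m (toSeries c)‖ := by
    intro c
    rw [norm_def, Finset.sum_range]
    simp [coeff_toSeries]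
  have h2 : ‖a * b‖ = ∑ m ∈ Finset.range (n + 1), ‖coeff m (toSeries a * toSeries b)‖ := by
    rw [norm_def, Finset.sum_range]
    rfl
  rw [h2, h1 a, h1 b, Finset.sum_mul_sum, ← Finset.sum_product']
  calc ∑ m ∈ Finset.range (n + 1), ‖coeff m (toSeries a * toSeries b)‖
      ≤ ∑ m ∈ Finset.range (n + 1), ∑ q ∈ Finset.HasAntidiagonal.antidiagonal m,
          ‖coeff q.1 (toSeries a)‖ * ‖coeff q.2 (toSeries b)‖ := by
        refine Finset.sum_le_sum fun m _ => ?_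
        rw [coeff_mul]
        refine (norm_sum_le _ _).trans (le_of_eq ?_)
        simp only [norm_mul]
    _ = ∑ q ∈ (Finset.range (n + 1)).sigma fun m => Finset.HasAntidiagonal.antidiagonal m,
          ‖coeff q.2.1 (toSeries a)‖ * ‖coeff q.2.2 (toSeries b)‖ := by rw [Finset.sum_sigma]
    _ = ∑ q ∈ ((Finset.range (n + 1)).sigma fun m => Finset.HasAntidiagonal.antidiagonal m).image fun q => q.2,
          ‖coeff q.1 (toSeries a)‖ * ‖coeff q.2 (toSeries b)‖ := by
        rw [Finset.sum_image]
        rintro ⟨m, q⟩ hq ⟨m', q'⟩ hq' h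
        simp only [Finset.coe_sigma, Set.mem_sigma_iff, Finset.mem_coe, Finset.HasAntidiagonal.mem_antidiagonal] at hq hq' h
        obtain rfl := h
        obtain rfl : m = m' := hq.2.symm.trans hq'.2
        rfl
    _ ≤ _ := by
        refine Finset.sum_le_sum_of_subset_of_nonneg ?_ fun _ _ _ => by positivity
        intro q hq
        simp only [Finset.mem_image, Finset.mem_sigma, Finset.mem_range, Finset.HasAntidiagonal.mem_antidiagonal] at hq
        obtain ⟨⟨m, q'⟩, ⟨h3, h4⟩, rfl⟩ := hq
        simp only [Finset.mem_product, Finset.mem_range]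
        simp only at h3 h4
        omega

instance : NormedCommRing (Jet n) :=
  { (inferInstance : NormedAddCommGroup (Jet n)), (inferInstance : CommRing (Jet n)) with
    norm_mul_le := norm_mul_le' }

instance : NormedAlgebra ℂ (Jet n) where
  norm_smul_le c g := by
    simp only [norm_def, smul_apply, norm_mul, Finset.mul_sum, le_refl]

/-- The identification with the space of coefficients. -/
def equivPi (n : ℕ) : Jet n ≃L[ℂ] (Fin (n + 1) → ℂ) :=
  LinearEquiv.toContinuousLinearEquiv
    { toFun := fun a => a
      invFun := fun a => a
      map_add' := fun _ _ => rfl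
      map_smul' := fun _ _ => rfl
      left_inv := fun _ => rfl
      right_inv := fun _ => rfl }

instance : BorelSpace (Jet n) := by
  have h2 : (Pi.topologicalSpace : TopologicalSpace (Fin (n + 1) → ℂ))
      = (UniformSpace.toTopologicalSpace : TopologicalSpace (Jet n)) := by
    have h3 := (equivPi n).toHomeomorph.isInducing.eq_induced
    exact (h3.trans (@induced_id (Fin (n + 1) → ℂ) Pi.topologicalSpace)).symm
  have h1 : (MeasurableSpace.pi : MeasurableSpace (Fin (n + 1) → ℂ))
      = @borel (Fin (n + 1) → ℂ) Pi.topologicalSpace := BorelSpace.measurable_eq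
  exact ⟨h1.trans (congrArg (@borel (Fin (n + 1) → ℂ)) h2)⟩

instance : (volume : Measure (Jet n)).IsAddHaarMeasure := by
  have h1 := (equivPi n).symm.isAddHaarMeasure_map (volume : Measure (Fin (n + 1) → ℂ))
  have h2 : ((volume : Measure (Fin (n + 1) → ℂ)).map (equivPi n).symm : Measure (Jet n)) = volume :=
    Measure.map_id
  rwa [h2] at h1

/-- The reduction of power series, as a ring homomorphism. -/
def ofSeriesHom (n : ℕ) : ℂ⟦X⟧ →+* Jet n where
  toFun := ofSeries n
  map_one' := rfl
  map_mul' := ofSeries_mul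
  map_zero' := by ext j; simp
  map_add' := ofSeries_add

theorem ofSeries_C (a : ℂ) : ofSeries n (C a) = algebraMap ℂ (Jet n) a := by
  rw [Algebra.algebraMap_eq_smul_one, ← ofSeries_one]
  ext j
  simp [coeff_C, coeff_one]

/-- The residue map. -/
def residue (n : ℕ) : Jet n →ₐ[ℂ] ℂ where
  toFun := fun a => a 0
  map_one' := one_apply_zero
  map_mul' := mul_apply_zero
  map_zero' := rfl
  map_add' := fun _ _ => rfl
  commutes' := fun r => by
    rw [Algebra.algebraMap_eq_smul_one, smul_apply, one_apply_zero, mul_one]; rfl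

theorem constantCoeff_toSeries (a : Jet n) : constantCoeff (toSeries a) = a 0 := by
  rw [← coeff_zero_eq_constantCoeff_apply]
  exact coeff_toSeries a 0

theorem ofSeries_mul_inv {f : ℂ⟦X⟧} (hf : constantCoeff f ≠ 0) :
    ofSeries n f * ofSeries n f⁻¹ = 1 := by
  rw [← ofSeries_mul, PowerSeries.mul_inv_cancel f hf, ofSeries_one]

theorem isUnit_iff (a : Jet n) : IsUnit a ↔ a 0 ≠ 0 := by
  constructor
  · intro h
    exact (h.map (residue n)).ne_zero
  · intro h
    have h1 := ofSeries_mul_inv (n := n) (f := toSeries a) (by rwa [constantCoeff_toSeries])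
    rw [ofSeries_toSeries] at h1
    exact IsUnit.of_mul_eq_one _ h1

theorem inverse_ofSeries {f : ℂ⟦X⟧} (hf : constantCoeff f ≠ 0) :
    Ring.inverse (ofSeries n f) = ofSeries n f⁻¹ := by
  have h1 := ofSeries_mul_inv (n := n) hf
  have h2 : IsUnit (ofSeries n f) := IsUnit.of_mul_eq_one _ h1
  have h3 : Ring.inverse (ofSeries n f) * (ofSeries n f * ofSeries n f⁻¹) = ofSeries n f⁻¹ := by
    rw [← mul_assoc, Ring.inverse_mul_cancel _ h2, one_mul]
  rw [← h3, h1, mul_one]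

/-- The nilpotent generator. -/
def eps (n : ℕ) : Jet n := ofSeries n X

theorem eps_pow (k : ℕ) : eps n ^ k = ofSeries n (X ^ k) := (map_pow (ofSeriesHom n) X k).symm

theorem eps_pow_apply (k : ℕ) (j : Fin (n + 1)) : (eps n ^ k) j = if (j : ℕ) = k then 1 else 0 := by
  rw [eps_pow, ofSeries_apply, coeff_X_pow]

theorem mul_eps_pow_apply (a : Jet n) (k : ℕ) (j : Fin (n + 1)) :
    (a * eps n ^ k) j = if h : k ≤ (j : ℕ) then a ⟨j - k, by omega⟩ else 0 := by
  conv_lhs => rw [← ofSeries_toSeries a, eps_pow, ← ofSeries_mul]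
  rw [ofSeries_apply, coeff_mul_X_pow']
  split_ifs with h
  · exact coeff_toSeries a ⟨j - k, by omega⟩
  · rfl

theorem mul_eps_pow_last (a : Jet n) : a * eps n ^ n = a 0 • eps n ^ n := by
  ext j
  rw [mul_eps_pow_apply, smul_apply, eps_pow_apply]
  by_cases h : (j : ℕ) = n
  · rw [dif_pos h.ge, if_pos h, mul_one]
    congr 1
    ext
    simp [h]
  · rw [dif_neg (by omega), if_neg h, mul_zero]

theorem eq_sum (a : Jet n) : a = ∑ j, a j • eps n ^ (j : ℕ) := by
  ext k
  have h1 : (∑ j, a j • eps n ^ (j : ℕ)) k = ∑ j, (a j • eps n ^ (j : ℕ)) k :=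
    Finset.sum_apply k _ _
  rw [h1]
  simp only [smul_apply, eps_pow_apply]
  rw [Finset.sum_eq_single k]
  · simp
  · intro b _ hb
    rw [if_neg (fun h => hb (Fin.ext h.symm)), mul_zero]
  · simp

end Jet

theorem mul_logCoeff (ℓ : ℂ) {f : ℂ⟦X⟧} (hf : constantCoeff f ≠ 0) (j : ℕ) :
    ((j : ℂ) + 1) * logCoeff ℓ f (j + 1) = coeff j (d⁄dX ℂ f * f⁻¹) := by
  set g : ℂ⟦X⟧ := C ((constantCoeff f)⁻¹) * f - 1 with hg
  have hg0 : constantCoeff g = 0 := by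
    rw [hg, map_sub, map_mul, constantCoeff_C, inv_mul_cancel₀ hf, map_one, sub_self]
  have hg1 : constantCoeff (1 + g) ≠ 0 := by simp [hg0]
  have hgf : 1 + g = C ((constantCoeff f)⁻¹) * f := by rw [hg]; ring
  have hd : d⁄dX ℂ g = C ((constantCoeff f)⁻¹) * d⁄dX ℂ f := by
    rw [hg, map_sub, Derivation.leibniz, PowerSeries.derivative_C, smul_zero, add_zero, smul_eq_mul,
      Derivation.map_one_eq_zero, sub_zero]
  have hquot : d⁄dX ℂ f * f⁻¹ = d⁄dX ℂ g * (1 + g)⁻¹ := by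
    rw [PowerSeries.eq_mul_inv_iff_mul_eq hg1, hgf, hd]
    have h1 := PowerSeries.mul_inv_cancel f hf
    linear_combination (C ((constantCoeff f)⁻¹) * d⁄dX ℂ f) * h1
  have h1 : ∀ r, r ∈ Finset.range (j + 1) → ((j : ℂ) + 1) *
      ((-1 : ℂ) ^ (r + 1 + 1) / ((r + 1 : ℕ) : ℂ) * coeff (j + 1) (g ^ (r + 1)))
      = coeff j ((-g) ^ r * d⁄dX ℂ g) := by
    intro r _
    have h2 : coeff j (d⁄dX ℂ (g ^ (r + 1))) = coeff (j + 1) (g ^ (r + 1)) * (j + 1) :=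
      coeff_derivative _ _
    have h3 : d⁄dX ℂ (g ^ (r + 1)) = C ((r + 1 : ℕ) : ℂ) * (g ^ r * d⁄dX ℂ g) := by
      rw [Derivation.leibniz_pow, Nat.add_sub_cancel, smul_eq_mul, nsmul_eq_mul, map_natCast]
    rw [h3, coeff_C_mul] at h2
    have h4 : (-g) ^ r * d⁄dX ℂ g = C ((-1 : ℂ) ^ r) * (g ^ r * d⁄dX ℂ g) := by
      rw [neg_pow, map_pow, map_neg, map_one]; ring
    have h5 : ((r + 1 : ℕ) : ℂ) ≠ 0 := Nat.cast_ne_zero.2 (Nat.succ_ne_zero r)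
    rw [h4, coeff_C_mul]
    field_simp
    rw [mul_comm (_ * _) (coeff (j + 1) _)] at *
    linear_combination -((-1 : ℂ) ^ r) * h2
  have h6 : (∑ r ∈ Finset.range (j + 1), (-g) ^ r) * (1 + g) = 1 - (-g) ^ (j + 1) := by
    have := geom_sum_mul_neg (-g) (j + 1)
    rwa [sub_neg_eq_add] at this
  have h7 : (∑ r ∈ Finset.range (j + 1), (-g) ^ r) * d⁄dX ℂ g
      = d⁄dX ℂ g * (1 + g)⁻¹ - (-g) ^ (j + 1) * (d⁄dX ℂ g * (1 + g)⁻¹) := by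
    have h8 := PowerSeries.mul_inv_cancel _ hg1
    linear_combination (d⁄dX ℂ g * (1 + g)⁻¹) * h6
      - (∑ r ∈ Finset.range (j + 1), (-g) ^ r) * d⁄dX ℂ g * h8
  have h9 : coeff j ((-g) ^ (j + 1) * (d⁄dX ℂ g * (1 + g)⁻¹)) = 0 := by
    have h10 : X ^ (j + 1) ∣ (-g) ^ (j + 1) * (d⁄dX ℂ g * (1 + g)⁻¹) :=
      (pow_dvd_pow_of_dvd (X_dvd_iff.2 (by simp [hg0])) _).mul_right _
    exact X_pow_dvd_iff.1 h10 j (Nat.lt_succ_self j)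
  have h11 : ∀ F : ℕ → ℂ, ∑ i ∈ Finset.Icc 1 (j + 1), F i = ∑ r ∈ Finset.range (j + 1), F (r + 1) := by
    intro F
    rw [← Finset.Ico_add_one_right_eq_Icc, Finset.sum_Ico_eq_sum_range]
    simp only [Nat.add_sub_cancel, add_comm 1]
  rw [hquot, logCoeff, if_neg (Nat.succ_ne_zero j), ← hg, Finset.mul_sum,
    h11, Finset.sum_congr rfl h1, ← map_sum, ← Finset.sum_mul, h7,
    map_sub, h9, sub_zero]

theorem logCoeff_mul (ℓ ℓ' : ℂ) {f g : ℂ⟦X⟧} (hf : constantCoeff f ≠ 0) (hg : constantCoeff g ≠ 0)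
    (j : ℕ) : logCoeff (ℓ + ℓ') (f * g) j = logCoeff ℓ f j + logCoeff ℓ' g j := by
  rcases j with _ | j
  · simp [logCoeff]
  · have h0 : ((j : ℂ) + 1) ≠ 0 := Nat.cast_add_one_ne_zero j
    apply mul_left_cancel₀ h0
    rw [mul_add, mul_logCoeff _ hf, mul_logCoeff _ hg,
      mul_logCoeff _ (by rw [map_mul]; exact mul_ne_zero hf hg), ← map_add]
    congr 1
    rw [Derivation.leibniz, PowerSeries.mul_inv_rev, smul_eq_mul, smul_eq_mul]
    have h1 := PowerSeries.mul_inv_cancel f hf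
    have h2 := PowerSeries.mul_inv_cancel g hg
    linear_combination (d⁄dX ℂ g * g⁻¹) * h1 + (d⁄dX ℂ f * f⁻¹) * h2

namespace Jet

variable {n : ℕ}

/-- The coefficients of positive degree of the logarithm. -/
def logTail (a : Jet n) (j : Fin (n + 1)) : ℂ :=
  if (j : ℕ) = 0 then 0
  else ∑ r ∈ Finset.Icc 1 (j : ℕ), (-1 : ℂ) ^ (r + 1) / (r : ℂ) * (((a 0)⁻¹ • a - 1) ^ r : Jet n) j

theorem logCoeff_eq (ℓ : ℂ) (f : ℂ⟦X⟧) (j : Fin (n + 1)) :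
    logCoeff ℓ f j = (if j = 0 then ℓ else 0) + logTail (ofSeries n f) j := by
  by_cases hj : (j : ℕ) = 0
  · have h0 : j = 0 := Fin.ext hj
    rw [logCoeff, logTail, if_pos hj, if_pos h0, if_pos hj, add_zero]
  · have h0 : j ≠ 0 := fun h => hj (by rw [h]; rfl)
    rw [logCoeff, logTail, if_neg hj, if_neg h0, if_neg hj, zero_add]
    refine Finset.sum_congr rfl fun r _ => ?_
    congr 1
    have h1 : ofSeries n f 0 = constantCoeff f := by
      rw [← coeff_zero_eq_constantCoeff_apply]; rfl
    rw [h1, Algebra.smul_def, ← ofSeries_C, ← ofSeries_one]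
    change _ = ((ofSeriesHom n (C _) * ofSeriesHom n f - ofSeriesHom n 1) ^ r : Jet n) j
    rw [← map_mul, ← map_sub, ← map_pow]
    rfl

/-- The contribution of the coefficients of positive degree of the logarithm. -/
def tail (c : Fin (n + 1) → ℂ) (a : Jet n) : ℂ := ∑ j, c j * logTail a j

theorem chi_logCoeff (c : Fin (n + 1) → ℂ) (ℓ : ℂ) (f : ℂ⟦X⟧) :
    chi c (logCoeff ℓ f) = Complex.I * ((c 0 * ℓ + tail c (ofSeries n f)).re : ℝ) := by
  rw [chi, tail]
  congr 4
  simp only [logCoeff_eq, mul_add, Finset.sum_add_distrib, mul_ite, mul_zero, Finset.sum_ite_eq',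
    Finset.mem_univ, if_true]

theorem tail_mul (c : Fin (n + 1) → ℂ) {a b : Jet n} (ha : a 0 ≠ 0) (hb : b 0 ≠ 0) :
    tail c (a * b) = tail c a + tail c b := by
  rw [tail, tail, tail, ← Finset.sum_add_distrib]
  refine Finset.sum_congr rfl fun j _ => ?_
  rw [← mul_add]
  congr 1
  have h1 := logCoeff_mul 0 0 (f := toSeries a) (g := toSeries b)
    (by rwa [constantCoeff_toSeries]) (by rwa [constantCoeff_toSeries]) j
  simpa [logCoeff_eq, ofSeries_mul] using h1

theorem tail_algebraMap (c : Fin (n + 1) → ℂ) {r : ℂ} (hr : r ≠ 0) :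
    tail c (algebraMap ℂ (Jet n) r) = 0 := by
  refine Finset.sum_eq_zero fun j _ => ?_
  have h1 : (algebraMap ℂ (Jet n) r) 0 = r := (residue n).commutes r
  have h2 : ((algebraMap ℂ (Jet n) r) 0)⁻¹ • algebraMap ℂ (Jet n) r - 1 = 0 := by
    rw [h1, Algebra.algebraMap_eq_smul_one, smul_smul, inv_mul_cancel₀ hr, one_smul, sub_self]
  rw [logTail]
  split_ifs
  · exact mul_zero _
  · rw [Finset.sum_eq_zero, mul_zero]
    intro r hr
    rw [h2, zero_pow (by have := (Finset.mem_Icc.1 hr).1; omega), zero_apply, mul_zero]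

theorem tail_one_add (c : Fin (n + 1) → ℂ) (hn : n ≠ 0) (β : ℂ) :
    tail c (1 + β • eps n ^ n) = c (Fin.last n) * β := by
  have h0 : (1 + β • eps n ^ n : Jet n) 0 = 1 := by
    rw [add_apply, one_apply_zero, smul_apply, eps_pow_apply, if_neg (by simpa using hn.symm),
      mul_zero, add_zero]
  have h1 : ((1 + β • eps n ^ n : Jet n) 0)⁻¹ • (1 + β • eps n ^ n : Jet n) - 1 = β • eps n ^ n := by
    rw [h0, inv_one, one_smul, add_sub_cancel_left]
  have h2 : ∀ r, 2 ≤ r → (β • eps n ^ n : Jet n) ^ r = 0 := by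
    intro r hr
    rw [smul_pow, ← pow_mul]
    ext j
    rw [smul_apply, eps_pow_apply, if_neg, mul_zero, zero_apply]
    have : n * 2 ≤ n * r := Nat.mul_le_mul_left n hr
    omega
  have h3 : ∀ j : Fin (n + 1), (j : ℕ) ≠ 0 → logTail (1 + β • eps n ^ n) j
      = (β • eps n ^ n : Jet n) j := by
    intro j hj
    rw [logTail, if_neg hj, h1, Finset.sum_eq_single 1]
    · norm_num
    · intro r hr hr1
      rw [h2 r (by have := (Finset.mem_Icc.1 hr).1; omega), zero_apply, mul_zero]
    · intro h; exact absurd (Finset.mem_Icc.2 ⟨le_rfl, by omega⟩) h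
  rw [tail, Finset.sum_eq_single (Fin.last n)]
  · rw [h3 _ (by simpa using hn), smul_apply, eps_pow_apply, if_pos (Fin.val_last n), mul_one]
  · intro j _ hj
    by_cases hj0 : (j : ℕ) = 0
    · rw [logTail, if_pos hj0, mul_zero]
    · rw [h3 j hj0, smul_apply, eps_pow_apply, if_neg, mul_zero, mul_zero]
      exact fun h => hj (Fin.ext (by simpa using h))
  · simp

theorem continuous_apply (j : Fin (n + 1)) : Continuous fun a : Jet n => a j :=
  (_root_.continuous_apply j).comp (equivPi n).continuous

theorem continuousOn_tail (c : Fin (n + 1) → ℂ) : ContinuousOn (tail c) {a : Jet n | a 0 ≠ 0} := by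
  refine continuousOn_finsetSum _ fun j _ => continuousOn_const.mul ?_
  unfold logTail
  split_ifs
  · exact continuousOn_const
  · refine continuousOn_finsetSum _ fun r _ => continuousOn_const.mul ?_
    refine (continuous_apply j).comp_continuousOn ?_
    have h1 : ContinuousOn (fun a : Jet n => (a 0)⁻¹) {a : Jet n | a 0 ≠ 0} :=
      (continuous_apply 0).continuousOn.inv₀ fun a ha => ha
    exact ((h1.smul continuousOn_id).sub continuousOn_const).pow r

end Jet

/-- The function `exp (i Re (c log s))`. -/
def powChar (c s : ℂ) : ℂ := Complex.exp (Complex.I * ((c * Complex.log s).re : ℝ))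

theorem exp_I_mul_re_eq {c : ℂ} (hc : ∃ k : ℤ, c.im = k) {ℓ ℓ' : ℂ}
    (h : Complex.exp ℓ = Complex.exp ℓ') :
    Complex.exp (Complex.I * ((c * ℓ).re : ℝ)) = Complex.exp (Complex.I * ((c * ℓ').re : ℝ)) := by
  obtain ⟨k, hk⟩ := hc
  obtain ⟨N, hN⟩ := Complex.exp_eq_exp_iff_exists_int.1 h
  rw [Complex.exp_eq_exp_iff_exists_int]
  refine ⟨-(k * N), ?_⟩
  have h1 : (c * ℓ).re = (c * ℓ').re - k * (N * (2 * Real.pi)) := by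
    rw [hN, mul_add, Complex.add_re, ← hk]
    simp [Complex.mul_re, Complex.mul_im, sub_eq_add_neg]
  rw [h1]
  push_cast
  ring

theorem powChar_eq {c : ℂ} (hc : ∃ k : ℤ, c.im = k) {ℓ s : ℂ} (h : Complex.exp ℓ = s) :
    Complex.exp (Complex.I * ((c * ℓ).re : ℝ)) = powChar c s := by
  refine exp_I_mul_re_eq hc ?_
  rw [Complex.exp_log (h ▸ Complex.exp_ne_zero ℓ), h]

theorem powChar_mul {c : ℂ} (hc : ∃ k : ℤ, c.im = k) {a b : ℂ} (ha : a ≠ 0) (hb : b ≠ 0) :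
    powChar c (a * b) = powChar c a * powChar c b := by
  rw [← powChar_eq hc (ℓ := Complex.log a + Complex.log b)
    (by rw [Complex.exp_add, Complex.exp_log ha, Complex.exp_log hb]), powChar, powChar,
    ← Complex.exp_add, ← mul_add, mul_add, Complex.add_re, Complex.ofReal_add]

theorem norm_exp_I_mul (r : ℝ) : ‖Complex.exp (Complex.I * (r : ℂ))‖ = 1 := by
  rw [mul_comm]; exact Complex.norm_exp_ofReal_mul_I r

theorem norm_powChar (c s : ℂ) : ‖powChar c s‖ = 1 := norm_exp_I_mul _

theorem continuousOn_powChar {c : ℂ} (hc : ∃ k : ℤ, c.im = k) :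
    ContinuousOn (powChar c) {0}ᶜ := by
  intro s hs
  have hs : s ≠ 0 := hs
  refine ContinuousAt.continuousWithinAt ?_
  have h1 : ContinuousAt (fun s' => powChar c s * powChar c (s⁻¹ * s')) s := by
    refine continuousAt_const.mul ?_
    have h2 : ContinuousAt (powChar c) (s⁻¹ * s) := by
      rw [inv_mul_cancel₀ hs]
      have h3 : ContinuousAt Complex.log 1 := continuousAt_clog Complex.one_mem_slitPlane
      exact (continuousAt_const.mul (Complex.continuous_ofReal.continuousAt.comp
        (Complex.continuous_re.continuousAt.comp (continuousAt_const.mul h3)))).cexp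
    exact ContinuousAt.comp (f := fun s' => s⁻¹ * s') h2 (continuousAt_const.mul continuousAt_id)
  refine h1.congr ?_
  filter_upwards [isOpen_ne.mem_nhds hs] with s' hs'
  rw [← powChar_mul hc hs (mul_ne_zero (inv_ne_zero hs) hs'), mul_inv_cancel_left₀ hs]

namespace Jet

variable {n : ℕ}

/-- The character `exp (χ (log a))` of the units. -/
def char (c : Fin (n + 1) → ℂ) (a : Jet n) : ℂ :=
  powChar (c 0) (a 0) * Complex.exp (Complex.I * ((tail c a).re : ℝ))

theorem exp_chi_logCoeff {c : Fin (n + 1) → ℂ} (hc : ∃ k : ℤ, (c 0).im = k) {ℓ : ℂ} {f : ℂ⟦X⟧}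
    (h : Complex.exp ℓ = constantCoeff f) :
    Complex.exp (chi c (logCoeff ℓ f)) = char c (ofSeries n f) := by
  have h1 : ofSeries n f 0 = constantCoeff f := by
    rw [← coeff_zero_eq_constantCoeff_apply]; rfl
  rw [chi_logCoeff, char, h1, ← powChar_eq hc h, ← Complex.exp_add, ← mul_add, Complex.add_re,
    Complex.ofReal_add]

theorem char_mul {c : Fin (n + 1) → ℂ} (hc : ∃ k : ℤ, (c 0).im = k) {a b : Jet n} (ha : a 0 ≠ 0)
    (hb : b 0 ≠ 0) : char c (a * b) = char c a * char c b := by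
  rw [char, mul_apply_zero, powChar_mul hc ha hb, tail_mul c ha hb, Complex.add_re,
    Complex.ofReal_add, mul_add, Complex.exp_add, char, char]
  ring

theorem norm_char (c : Fin (n + 1) → ℂ) (a : Jet n) : ‖char c a‖ = 1 := by
  rw [char, norm_mul, norm_powChar, norm_exp_I_mul, one_mul]

theorem continuousOn_char {c : Fin (n + 1) → ℂ} (hc : ∃ k : ℤ, (c 0).im = k) :
    ContinuousOn (char c) {a : Jet n | a 0 ≠ 0} := by
  refine ContinuousOn.mul ((continuousOn_powChar hc).comp (continuous_apply 0).continuousOn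
    fun a ha => ha) ?_
  exact (continuousOn_const.mul (Complex.continuous_ofReal.comp_continuousOn
    (Complex.continuous_re.comp_continuousOn (continuousOn_tail c)))).cexp

theorem char_algebraMap (c : Fin (n + 1) → ℂ) {r : ℂ} (hr : r ≠ 0) :
    char c (algebraMap ℂ (Jet n) r) = powChar (c 0) r := by
  have h1 : (algebraMap ℂ (Jet n) r) 0 = r := (residue n).commutes r
  rw [char, tail_algebraMap c hr, h1]
  simp

theorem powChar_one (c : ℂ) : powChar c 1 = 1 := by simp [powChar]

theorem char_one (c : Fin (n + 1) → ℂ) : char c 1 = 1 := by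
  rw [← map_one (algebraMap ℂ (Jet n)), char_algebraMap c one_ne_zero, powChar_one]

theorem char_one_add (c : Fin (n + 1) → ℂ) (hn : n ≠ 0) (β : ℂ) :
    char c (1 + β • eps n ^ n) = Complex.exp (Complex.I * ((c (Fin.last n) * β).re : ℝ)) := by
  have h0 : (1 + β • eps n ^ n : Jet n) 0 = 1 := by
    rw [add_apply, one_apply_zero, smul_apply, eps_pow_apply, if_neg (by simpa using hn.symm),
      mul_zero, add_zero]
  rw [char, h0, powChar_one, one_mul, tail_one_add c hn]

end Jet

namespace Jet

/-- The basis of powers of the nilpotent generator. -/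
def basis (n : ℕ) : Module.Basis (Fin (n + 1)) ℂ (Jet n) :=
  Module.Basis.ofEquivFun (equivPi n).toLinearEquiv

theorem basis_repr {n : ℕ} (a : Jet n) (j : Fin (n + 1)) : (basis n).repr a j = a j := rfl

theorem basis_apply {n : ℕ} (j : Fin (n + 1)) : basis n j = eps n ^ (j : ℕ) := by
  apply (basis n).repr.injective
  ext k
  rw [Module.Basis.repr_self, basis_repr, eps_pow_apply, Finsupp.single_apply]
  simp only [Fin.ext_iff, eq_comm]

instance (n : ℕ) : ProperSpace (Jet n) := FiniteDimensional.proper ℂ (Jet n)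

theorem eps_pow_zero_of_lt {n k : ℕ} (hk : n < k) : eps n ^ k = 0 := by
  ext j
  rw [eps_pow_apply, if_neg (by omega), zero_apply]

end Jet

variable {κ : Type*} [Fintype κ] [DecidableEq κ]

/-- A product of algebras of jets. -/
abbrev JetProd (n : κ → ℕ) : Type _ := ∀ i, Jet (n i)

namespace JetProd

variable {n : κ → ℕ}

theorem isUnit_iff (x : JetProd n) : IsUnit x ↔ ∀ i, x i 0 ≠ 0 := by
  rw [Pi.isUnit_iff]
  exact forall_congr' fun i => Jet.isUnit_iff _

theorem det_mulLeft (x : JetProd n) :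
    LinearMap.det (LinearMap.mulLeft ℂ x) = ∏ i, x i 0 ^ (n i + 1) := by
  set v := Pi.basis fun i => Jet.basis (n i) with hv
  let f : (Σ i, Fin (n i + 1)) → ℕ ×ₗ Fin (Fintype.card (Σ i, Fin (n i + 1))) :=
    fun a => toLex ((a.2 : ℕ), Fintype.equivFin _ a)
  have hf : Function.Injective f := by
    intro a b h
    have h1 := congrArg (fun z => (ofLex z).2) h
    exact (Fintype.equivFin _).injective h1
  let _ : LinearOrder (Σ i, Fin (n i + 1)) := LinearOrder.lift' f hf
  have hM : ∀ a b, LinearMap.toMatrix v v (LinearMap.mulLeft ℂ x) a b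
      = if a.1 = b.1 then if (b.2 : ℕ) ≤ a.2 then x a.1 ⟨a.2 - b.2, by omega⟩ else 0 else 0 := by
    rintro ⟨i, j⟩ ⟨i', j'⟩
    rw [LinearMap.toMatrix_apply, hv, Pi.basis_repr, Pi.basis_apply, Jet.basis_repr,
      LinearMap.mulLeft_apply, Pi.mul_apply]
    dsimp only
    by_cases h : i = i'
    · subst h
      rw [Pi.single_eq_same, if_pos rfl, Jet.basis_apply, Jet.mul_eps_pow_apply]
      split_ifs <;> rfl
    · rw [Pi.single_eq_of_ne h, if_neg h, mul_zero, Jet.zero_apply]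
  rw [← LinearMap.det_toMatrix v, Matrix.det_of_isLowerTriangular, Fintype.prod_sigma]
  · refine Finset.prod_congr rfl fun i _ => ?_
    have hd : ∀ j, LinearMap.toMatrix v v (LinearMap.mulLeft ℂ x) ⟨i, j⟩ ⟨i, j⟩ = x i 0 := by
      intro j
      rw [hM, if_pos rfl, if_pos le_rfl]
      exact congrArg (x i) (Fin.ext (Nat.sub_self _))
    rw [Finset.prod_congr rfl fun j _ => hd j, Finset.prod_const, Finset.card_univ, Fintype.card_fin]
  · intro a b hab
    have hab' : f a < f b := hab
    rw [hM]
    split_ifs with h1 h2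
    swap
    · rfl
    swap
    · rfl
    exfalso
    rcases Prod.Lex.toLex_lt_toLex.1 hab' with h3 | ⟨h3, h4⟩
    · exact absurd h2 (not_le.2 h3)
    · obtain ⟨i, j⟩ := a
      obtain ⟨i', j'⟩ := b
      dsimp only at h1
      subst h1
      obtain rfl : j = j' := Fin.ext h3
      exact lt_irrefl _ h4

variable (n) in
/-- The data of the characters and residues of a product of algebras of jets. -/
def siteData (c : ∀ i, Fin (n i + 1) → ℂ) (hc : ∀ i, ∃ k : ℤ, (c i 0).im = k)
    (hlast : ∀ i, n i ≠ 0 → c i (Fin.last (n i)) ≠ 0) : SiteData κ (JetProd n) where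
  proj i := (Jet.residue (n i)).comp (Pi.evalAlgHom ℂ (fun i => Jet (n i)) i)
  n := n
  abs_det x := by
    have h1 : LinearMap.mulLeft ℝ x = (LinearMap.mulLeft ℂ x).restrictScalars ℝ := rfl
    rw [h1, LinearMap.det_restrictScalars, Algebra.norm_complex_apply, det_mulLeft,
      Complex.normSq_eq_norm_sq, abs_of_nonneg (by positivity), norm_prod, ← Finset.prod_pow]
    refine Finset.prod_congr rfl fun i _ => ?_
    rw [norm_pow, ← pow_mul, mul_comm 2]
    rfl
  χ x := open Classical in if IsUnit x then ∏ i, Jet.char (c i) (x i) else 0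
  χ_mul {x y} hx hy := by
    rw [if_pos hx, if_pos hy, if_pos (hx.mul hy), ← Finset.prod_mul_distrib]
    exact Finset.prod_congr rfl fun i _ => Jet.char_mul (hc i) ((isUnit_iff x).1 hx i)
      ((isUnit_iff y).1 hy i)
  norm_χ {x} hx := by
    rw [if_pos hx, norm_prod]
    exact Finset.prod_eq_one fun i _ => Jet.norm_char _ _
  χ_nonunit {x} hx := if_neg hx
  continuousOn_χ := by
    have h1 : ContinuousOn (fun x : JetProd n => ∏ i, Jet.char (c i) (x i)) {x | IsUnit x} :=
      continuousOn_finsetProd _ fun i _ => (Jet.continuousOn_char (hc i)).comp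
        (continuous_apply i).continuousOn fun x hx => (isUnit_iff x).1 hx i
    exact h1.congr fun x hx => if_pos hx
  e i := Pi.single i 1
  ω i := Pi.single i (Jet.eps (n i) ^ n i)
  e_mul_e i := by rw [← Pi.single_mul, mul_one]
  e_mul_ω i := by rw [← Pi.single_mul, one_mul]
  e_mul_ω_ne {i j} hij := by
    ext k : 1
    rw [Pi.mul_apply, Pi.zero_apply]
    by_cases hk : k = i
    · subst hk
      rw [Pi.single_eq_of_ne hij, mul_zero]
    · rw [Pi.single_eq_of_ne hk, zero_mul]
  mul_ω i x := by
    ext k : 1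
    rw [Pi.mul_apply, Pi.smul_apply]
    by_cases hk : k = i
    · subst hk
      rw [Pi.single_eq_same, Jet.mul_eps_pow_last]
      rfl
    · rw [Pi.single_eq_of_ne hk, mul_zero, smul_zero]
  proj_e i := by
    change (Pi.single i (1 : Jet (n i)) : JetProd n) i 0 = 1
    rw [Pi.single_eq_same, Jet.one_apply_zero]
  proj_e_ne {i j} hij := by
    change (Pi.single j (1 : Jet (n j)) : JetProd n) i 0 = 0
    rw [Pi.single_eq_of_ne hij, Jet.zero_apply]
  ω_tame {i} hi := by
    have h1 : Jet.eps (n i) ^ n i = Jet.eps (n i) ^ 0 := by rw [hi]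
    rw [h1, pow_zero]
  proj_ω_wild {i} hi := by
    change (Pi.single i (Jet.eps (n i) ^ n i) : JetProd n) i 0 = 0
    rw [Pi.single_eq_same, Jet.eps_pow_apply, if_neg (by simpa using hi.symm)]
  χ_wild {i} hi := by
    refine ⟨c i (Fin.last (n i)), hlast i hi, fun β => ?_⟩
    have h0 : ∀ k, k ≠ i → (1 + β • (Pi.single i (Jet.eps (n i) ^ n i) : JetProd n)) k = 1 := by
      intro k hk
      rw [Pi.add_apply, Pi.smul_apply, Pi.single_eq_of_ne hk, smul_zero, add_zero, Pi.one_apply]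
    have h1 : (1 + β • (Pi.single i (Jet.eps (n i) ^ n i) : JetProd n)) i
        = 1 + β • Jet.eps (n i) ^ n i := by
      rw [Pi.add_apply, Pi.smul_apply, Pi.single_eq_same, Pi.one_apply]
    rw [if_pos, Finset.prod_eq_single i, h1, Jet.char_one_add _ hi]
    · intro k _ hk
      rw [h0 k hk, Jet.char_one]
    · simp
    · rw [isUnit_iff]
      intro k
      by_cases hk : k = i
      · subst hk
        rw [h1, Jet.add_apply, Jet.one_apply_zero, Jet.smul_apply, Jet.eps_pow_apply,
          if_neg (by simpa using hi.symm), mul_zero, add_zero]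
        exact one_ne_zero
      · rw [h0 k hk, Jet.one_apply_zero]
        exact one_ne_zero
  ℓ :=
    { toFun := fun x => ∑ i, x i (Fin.last (n i))
      map_add' := fun x y => Finset.sum_add_distrib
      map_smul' := fun r x => (Finset.mul_sum _ _ _).symm }
  ℓ_ω i := by
    change ∑ k, (Pi.single i (Jet.eps (n i) ^ n i) : JetProd n) k (Fin.last (n k)) = 1
    rw [Finset.sum_eq_single i]
    · rw [Pi.single_eq_same, Jet.eps_pow_apply, if_pos (Fin.val_last _)]
    · intro k _ hk
      rw [Pi.single_eq_of_ne hk, Jet.zero_apply]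
    · simp
  ℓ_nondeg ζ hζ := by
    ext i j
    have h1 := hζ (Pi.single i (Jet.eps (n i) ^ (n i - j)))
    change ∑ k, ((Pi.single i (Jet.eps (n i) ^ (n i - j)) : JetProd n) * ζ) k (Fin.last (n k)) = 0 at h1
    rw [Finset.sum_eq_single i] at h1
    · rw [Pi.mul_apply, Pi.single_eq_same, mul_comm, Jet.mul_eps_pow_apply,
        dif_pos (by simp)] at h1
      have h2 : (⟨(Fin.last (n i) : ℕ) - (n i - j), by omega⟩ : Fin (n i + 1)) = j := by
        ext
        simp only [Fin.val_last]
        omega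
      rwa [h2] at h1
    · intro k _ hk
      rw [Pi.mul_apply, Pi.single_eq_of_ne hk, zero_mul, Jet.zero_apply]
    · simp

/-- The element with components `t i + ε`. -/
def pos (n : κ → ℕ) (t : κ → ℂ) : JetProd n := fun i => Jet.ofSeries (n i) (C (t i) + X)

theorem pos_sub_apply (t : κ → ℂ) (x : ℂ) (i : κ) :
    (pos n t - algebraMap ℂ (JetProd n) x) i = Jet.ofSeries (n i) (C (t i - x) + X) := by
  have h1 : C (t i - x) + (X : ℂ⟦X⟧) = (C (t i) + X) - C x := by rw [map_sub]; ring
  rw [h1, Pi.sub_apply, Pi.algebraMap_apply, ← Jet.ofSeries_C]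
  exact (map_sub (Jet.ofSeriesHom (n i)) _ _).symm

theorem isUnit_pos_sub_iff (t : κ → ℂ) (x : ℂ) :
    IsUnit (pos n t - algebraMap ℂ (JetProd n) x) ↔ x ∉ range t := by
  rw [isUnit_iff]
  simp only [pos_sub_apply, Jet.ofSeries_apply, Fin.val_zero, map_add, coeff_zero_eq_constantCoeff_apply,
    constantCoeff_C, constantCoeff_X, add_zero, sub_ne_zero, mem_range, not_exists]

theorem adjoin_pos {t : κ → ℂ} (ht : Function.Injective t) :
    Algebra.adjoin ℂ {pos n t} = ⊤ := by
  rw [eq_top_iff]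
  intro x _
  set A := Algebra.adjoin ℂ {pos n t} with hA
  have hz : ∀ r : ℂ, pos n t - algebraMap ℂ (JetProd n) r ∈ A := fun r =>
    sub_mem (Algebra.subset_adjoin rfl) (A.algebraMap_mem r)
  have hdiag : ∀ i, (pos n t - algebraMap ℂ (JetProd n) (t i)) i = Jet.eps (n i) := by
    intro i
    rw [pos_sub_apply, sub_self, map_zero, zero_add]
    rfl
  have key : ∀ i (b : Jet (n i)), (Pi.single i b : JetProd n) ∈ A := by
    intro i b
    set P : JetProd n := ∏ k ∈ Finset.univ.erase i, (pos n t - algebraMap ℂ (JetProd n) (t k)) ^ (n k + 1)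
      with hP
    have hPA : P ∈ A := prod_mem fun k _ => pow_mem (hz _) _
    have hPne : ∀ k, k ≠ i → P k = 0 := by
      intro k hk
      rw [hP, Finset.prod_apply]
      refine Finset.prod_eq_zero (Finset.mem_erase.2 ⟨hk, Finset.mem_univ k⟩) ?_
      rw [Pi.pow_apply, hdiag, Jet.eps_pow_zero_of_lt (Nat.lt_succ_self _)]
    have hPi : IsUnit (P i) := by
      rw [hP, Finset.prod_apply]
      refine Finset.prod_induction _ IsUnit (fun _ _ => IsUnit.mul) isUnit_one fun k hk => ?_
      rw [Pi.pow_apply, pos_sub_apply]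
      refine IsUnit.pow _ ((Jet.isUnit_iff _).2 ?_)
      rw [Jet.ofSeries_apply]
      simpa [sub_eq_zero] using fun h => (Finset.ne_of_mem_erase hk) (ht h).symm
    obtain ⟨u, hu⟩ := hPi
    have h1 : (Pi.single i b : JetProd n) = ∑ j, ((↑u⁻¹ : Jet (n i)) * b) j •
        (P * (pos n t - algebraMap ℂ (JetProd n) (t i)) ^ (j : ℕ)) := by
      ext k : 1
      rw [Finset.sum_apply]
      by_cases hk : k = i
      · subst hk
        rw [Pi.single_eq_same]
        simp only [Pi.smul_apply, Pi.mul_apply, Pi.pow_apply, hdiag, ← hu]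
        simp only [← mul_smul_comm, ← Finset.mul_sum]
        rw [← Jet.eq_sum, Units.mul_inv_cancel_left]
      · rw [Pi.single_eq_of_ne hk]
        refine (Finset.sum_eq_zero fun j _ => ?_).symm
        rw [Pi.smul_apply, Pi.mul_apply, hPne k hk, zero_mul, smul_zero]
    rw [h1]
    exact sum_mem fun j _ => A.smul_mem (mul_mem hPA (pow_mem (hz _) _)) _
  have h2 : x = ∑ i, Pi.single i (x i) := (Finset.univ_sum_single x).symm
  rw [h2]
  exact sum_mem fun i _ => key i _

/-- The data of the Hecke operators for a product of algebras of jets. -/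
def heckeData (n : κ → ℕ) {t : κ → ℂ} (ht : Function.Injective t) {tp tq : ℂ} (h : tp ≠ tq)
    (hp : tp ∉ range t) (hq : tq ∉ range t) : HeckeData (JetProd n) where
  tp := tp
  tq := tq
  z := pos n t
  tp_ne_tq := h
  isUnit_sub_tp := (isUnit_pos_sub_iff t tp).2 hp
  isUnit_sub_tq := (isUnit_pos_sub_iff t tq).2 hq
  adjoin_z := adjoin_pos ht

theorem χ_algebraMap (c : ∀ i, Fin (n i + 1) → ℂ) (hc : ∀ i, ∃ k : ℤ, (c i 0).im = k)
    (hlast : ∀ i, n i ≠ 0 → c i (Fin.last (n i)) ≠ 0) {a : ℂ} (ha : a ≠ 0) :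
    (siteData n c hc hlast).χ (algebraMap ℂ (JetProd n) a) = ∏ i, powChar (c i 0) a := by
  refine (if_pos ((IsUnit.mk0 a ha).map (algebraMap ℂ (JetProd n)))).trans ?_
  refine Finset.prod_congr rfl fun i _ => ?_
  rw [Pi.algebraMap_apply, Jet.char_algebraMap _ ha]

/-- The characters `powChar cp` and `powChar cq`, if `cp + cq` and the coefficients `c i 0` add up
to zero. -/
def charPair (c : ∀ i, Fin (n i + 1) → ℂ) (hc : ∀ i, ∃ k : ℤ, (c i 0).im = k)
    (hlast : ∀ i, n i ≠ 0 → c i (Fin.last (n i)) ≠ 0) {cp cq : ℂ} (hp : ∃ k : ℤ, cp.im = k)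
    (hq : ∃ k : ℤ, cq.im = k) (hsum : cp + cq + ∑ i, c i 0 = 0) :
    CharPair (siteData n c hc hlast) where
  α s := if s = 0 then 0 else powChar cp s
  β s := if s = 0 then 0 else powChar cq s
  α_mul {a b} ha hb := by rw [if_neg ha, if_neg hb, if_neg (mul_ne_zero ha hb), powChar_mul hp ha hb]
  β_mul {a b} ha hb := by rw [if_neg ha, if_neg hb, if_neg (mul_ne_zero ha hb), powChar_mul hq ha hb]
  norm_α {a} ha := by rw [if_neg ha, norm_powChar]
  norm_β {a} ha := by rw [if_neg ha, norm_powChar]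
  α_zero := if_pos rfl
  β_zero := if_pos rfl
  continuousOn_α := (continuousOn_powChar hp).congr fun a ha => if_neg ha
  continuousOn_β := (continuousOn_powChar hq).congr fun a ha => if_neg ha
  rel {a} ha := by
    rw [χ_algebraMap c hc hlast ha, if_neg ha, if_neg ha]
    simp only [powChar]
    rw [← Complex.exp_sum, ← Complex.exp_add, ← Complex.exp_add, ← Finset.mul_sum, ← mul_add, ← mul_add,
      ← Complex.ofReal_sum, ← Complex.ofReal_add, ← Complex.ofReal_add, ← Complex.re_sum,
      ← Complex.add_re, ← Complex.add_re, ← Finset.sum_mul, ← add_mul, ← add_mul, hsum]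
    simp

end JetProd

theorem inverse_algebraMap {R : Type*} [CommRing R] [Algebra ℂ R] {r : ℂ} (hr : r ≠ 0) :
    Ring.inverse (algebraMap ℂ R r) = algebraMap ℂ R r⁻¹ := by
  have h1 := Ring.inverse_mul_cancel_left (algebraMap ℂ R r) (algebraMap ℂ R r⁻¹)
    ((IsUnit.mk0 r hr).map _)
  rwa [← map_mul, mul_inv_cancel₀ hr, map_one, mul_one] at h1

namespace RamificationData

variable {ι : Type*} [Fintype ι] (D : RamificationData ι)

/-- The class of `s - 𝐮_i`. -/
def diff (s : ℂ) (u : D.Conf) (i : ι) : Jet (D.n i) := Jet.ofSeries (D.n i) (C s - toSeries (u i))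

theorem diff_apply (s : ℂ) (u : D.Conf) (i : ι) (j : Fin (D.n i + 1)) :
    D.diff s u i j = (if j = 0 then s else 0) - u i j := by
  rw [diff, Jet.ofSeries_apply, map_sub, coeff_C]
  congr 1
  · simp only [Fin.ext_iff, Fin.val_zero]
  · exact Jet.coeff_toSeries (u i) j

theorem constantCoeff_diff (s : ℂ) (u : D.Conf) (i : ι) :
    constantCoeff (C s - toSeries (u i)) = s - u i 0 := by
  rw [map_sub, constantCoeff_C]
  exact congrArg (s - ·) (Jet.constantCoeff_toSeries (u i))

theorem isUnit_diff {s : ℂ} {u : D.Conf} {i : ι} (h : s ≠ u i 0) : IsUnit (D.diff s u i) := by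
  rw [Jet.isUnit_iff, diff_apply, if_pos rfl]
  exact sub_ne_zero.2 h

theorem phase_eq {s : ℂ} {u : D.Conf} (h : ∀ i, s ≠ u i 0) :
    D.phase s u = ∏ i, Jet.char (D.c i) (D.diff s u i) := by
  rw [phase, Complex.exp_sum]
  refine Finset.prod_congr rfl fun i _ => ?_
  refine Jet.exp_chi_logCoeff (D.im_c_zero i) ?_
  rw [Complex.exp_log (sub_ne_zero.2 (h i)), constantCoeff_diff]

theorem modify_eq (x : ℂ) {s : ℂ} {u : D.Conf} {i : ι} (h : s ≠ u i 0) :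
    D.modify x s u i = Jet.ofSeries (D.n i) (C (D.t i - x) + X) * Ring.inverse (D.diff s u i) := by
  rw [diff, Jet.inverse_ofSeries (by rw [constantCoeff_diff]; exact sub_ne_zero.2 h),
    ← Jet.ofSeries_mul]
  rfl

theorem modify_zero (x s : ℂ) (u : D.Conf) (i : ι) :
    D.modify x s u i 0 = (D.t i - x) / (s - u i 0) := by
  rw [modify, Fin.val_zero, coeff_zero_eq_constantCoeff_apply, map_mul, constantCoeff_inv,
    constantCoeff_diff]
  simp [div_eq_mul_inv]

theorem diff_affine (l τ s : ℂ) (u : D.Conf) (i : ι) :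
    D.diff (l * s + τ) (D.affine l τ u) i = algebraMap ℂ (Jet (D.n i)) l * D.diff s u i := by
  ext j
  rw [← Algebra.smul_def, Jet.smul_apply, diff_apply, diff_apply, affine]
  split_ifs <;> ring

theorem m_add_one : D.m + 1 = ∑ i, (D.n i + 1) := by
  rw [m]
  refine Nat.sub_add_cancel ?_
  exact (Nat.succ_le_succ (Nat.zero_le _)).trans
    (Finset.single_le_sum (f := fun i => D.n i + 1) (fun _ _ => Nat.zero_le _) (Finset.mem_univ D.p))

theorem prod_powChar {l : ℂ} : ∏ i, powChar (D.c i 0) l = 1 := by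
  simp only [powChar]
  rw [← Complex.exp_sum, ← Finset.mul_sum, ← Complex.ofReal_sum, ← Complex.re_sum, ← Finset.sum_mul,
    D.sum_c_zero]
  simp

theorem integrand_affine (x : ℂ) (f : D.Slice → ℂ) {l : ℂ} (hl : l ≠ 0) (τ : ℂ) {s : ℂ} {u : D.Conf}
    (h : ∀ i, s ≠ u i 0) : D.integrand x (D.homogExt f) (D.affine l τ u) (l * s + τ)
      = ((‖l‖ ^ (D.m + 2))⁻¹ : ℝ) * D.integrand x (D.homogExt f) u s := by
  have h0 : ∀ i, D.affine l τ u i 0 = l * u i 0 + τ := fun i => by rw [affine, if_pos rfl]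
  have h' : ∀ i, l * s + τ ≠ D.affine l τ u i 0 := by
    intro i heq
    rw [h0] at heq
    exact h i (mul_left_cancel₀ hl (add_right_cancel heq))
  have hmod : D.modify x (l * s + τ) (D.affine l τ u) = D.affine l⁻¹ 0 (D.modify x s u) := by
    funext i
    rw [D.modify_eq x (h' i), diff_affine]
    have h1 : Ring.inverse (algebraMap ℂ (Jet (D.n i)) l * D.diff s u i)
        = algebraMap ℂ (Jet (D.n i)) l⁻¹ * Ring.inverse (D.diff s u i) := by
      rw [Ring.mul_inverse_rev, mul_comm, inverse_algebraMap hl]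
    funext j
    rw [h1, mul_left_comm, ← Algebra.smul_def]
    simp only [affine, ite_self, add_zero]
    exact congrArg (l⁻¹ * ·) (congrFun (D.modify_eq x (h i)).symm j)
  have hphase : D.phase (l * s + τ) (D.affine l τ u) = D.phase s u := by
    rw [D.phase_eq h', D.phase_eq h]
    have h1 : ∀ i, Jet.char (D.c i) (D.diff (l * s + τ) (D.affine l τ u) i)
        = powChar (D.c i 0) l * Jet.char (D.c i) (D.diff s u i) := by
      intro i
      rw [diff_affine, Jet.char_mul (D.im_c_zero i), Jet.char_algebraMap _ hl]
      · exact (Jet.isUnit_iff _).1 ((IsUnit.mk0 l hl).map _)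
      · exact (Jet.isUnit_iff _).1 (D.isUnit_diff (h i))
    simp only [h1, Finset.prod_mul_distrib, D.prod_powChar, one_mul]
  have hden : ∏ i, ‖l * s + τ - D.affine l τ u i 0‖ ^ (2 * D.n i + 2)
      = ‖l‖ ^ (2 * (D.m + 1)) * ∏ i, ‖s - u i 0‖ ^ (2 * D.n i + 2) := by
    rw [m_add_one, Finset.mul_sum, ← Finset.prod_pow_eq_pow_sum, ← Finset.prod_mul_distrib]
    refine Finset.prod_congr rfl fun i _ => ?_
    have h1 : l * s + τ - (l * u i 0 + τ) = l * (s - u i 0) := by ring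
    rw [h0, h1, norm_mul, mul_pow, mul_add, mul_one]
  have hl' : ‖l‖ ≠ 0 := norm_ne_zero_iff.2 hl
  rw [integrand, integrand, hmod, homogExt_affine D f (inv_ne_zero hl), hphase, hden, norm_inv]
  have h2 : ((‖l‖⁻¹ ^ D.m)⁻¹ : ℝ) = (‖l‖ ^ (D.m + 2))⁻¹ * ‖l‖ ^ (2 * (D.m + 1)) := by
    rw [inv_pow, inv_inv, eq_inv_mul_iff_mul_eq₀ (pow_ne_zero _ hl'), ← pow_add]
    congr 1
    ring
  have h3 : ((‖l‖ : ℂ)) ≠ 0 := Complex.ofReal_ne_zero.2 hl'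
  rw [h2]
  push_cast
  field_simp

theorem ae_ne_coord (u : D.Conf) : ∀ᵐ s : ℂ, ∀ i, s ≠ u i 0 :=
  ae_all_iff.2 fun i => Measure.ae_ne volume (u i 0)

theorem integrand_affine_change (x : ℂ) (f : D.Slice → ℂ) {l : ℂ} (hl : l ≠ 0) (τ : ℂ) {u : D.Conf}
    (h : Integrable (D.integrand x (D.homogExt f) u)) :
    Integrable (D.integrand x (D.homogExt f) (D.affine l τ u)) ∧
      ∫ s, D.integrand x (D.homogExt f) (D.affine l τ u) s
        = ((‖l‖ ^ D.m)⁻¹ : ℝ) * ∫ s, D.integrand x (D.homogExt f) u s := by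
  set F := D.integrand x (D.homogExt f) (D.affine l τ u)
  have hl' : ‖l‖ ≠ 0 := norm_ne_zero_iff.2 hl
  have hder : ∀ s ∈ (univ : Set ℂ), HasFDerivWithinAt (fun s : ℂ => l * s + τ)
      (l • (1 : ℂ →L[ℝ] ℂ)) univ s := by
    intro s _
    have h1 : HasDerivAt (fun s : ℂ => l * s + τ) l s := by
      simpa using ((hasDerivAt_id s).const_mul l).add_const τ
    exact h1.complexToReal_fderiv.hasFDerivWithinAt
  have hinj : InjOn (fun s : ℂ => l * s + τ) univ := fun a _ b _ hab =>
    mul_left_cancel₀ hl (add_right_cancel hab)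
  have himg : (fun s : ℂ => l * s + τ) '' univ = univ := by
    rw [image_univ, range_eq_univ]
    intro s
    exact ⟨l⁻¹ * (s - τ), by dsimp only; rw [mul_inv_cancel_left₀ hl, sub_add_cancel]⟩
  have hF : (fun s => |(l • (1 : ℂ →L[ℝ] ℂ)).det| • F (l * s + τ))
      =ᵐ[volume] fun s => ((‖l‖ ^ D.m)⁻¹ : ℝ) * D.integrand x (D.homogExt f) u s := by
    filter_upwards [D.ae_ne_coord u] with s hs
    change _ • D.integrand x (D.homogExt f) (D.affine l τ u) (l * s + τ) = _
    rw [SiteData.abs_det_smul_one, D.integrand_affine x f hl τ hs, Complex.real_smul, ← mul_assoc,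
      ← Complex.ofReal_mul]
    congr 2
    rw [pow_add, mul_inv, mul_left_comm, mul_inv_cancel₀ (pow_ne_zero _ hl'), mul_one]
  have h1 := integrableOn_image_iff_integrableOn_abs_det_fderiv_smul volume MeasurableSet.univ hder
    hinj F
  have h2 := integral_image_eq_integral_abs_det_fderiv_smul volume MeasurableSet.univ hder hinj F
  rw [himg, integrableOn_univ, integrableOn_univ, integrable_congr hF] at h1
  rw [himg, setIntegral_univ, setIntegral_univ, integral_congr_ae hF, integral_const_mul] at h2
  exact ⟨h1.2 (h.const_mul _), h2⟩

end RamificationData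

@[to_additive]
theorem prod_eq_mul_mul_prod_rest {ι M : Type*} [Fintype ι] [DecidableEq ι] [CommMonoid M] {p q : ι}
    (hpq : p ≠ q) (F : ι → M) :
    ∏ i, F i = F p * (F q * ∏ i : {i // i ≠ p ∧ i ≠ q}, F i) := by
  rw [← Finset.mul_prod_erase Finset.univ F (Finset.mem_univ p),
    ← Finset.mul_prod_erase (Finset.univ.erase p) F
      (Finset.mem_erase.2 ⟨hpq.symm, Finset.mem_univ q⟩)]
  congr 2
  exact Finset.prod_subtype _ (fun i => by simp [and_comm]) F

theorem JetProd.algebraMap_mul_apply {κ : Type*} {n : κ → ℕ} (r : ℂ) (y : JetProd n) (i : κ)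
    (j : Fin (n i + 1)) : (algebraMap ℂ (JetProd n) r * y) i j = r * y i j := by
  rw [← Algebra.smul_def]
  rfl

namespace RamificationData

variable {ι : Type*} [Fintype ι] [DecidableEq ι] (D : RamificationData ι)

/-- The nilpotency orders at the points different from the two normalized ones. -/
abbrev restN (i : {i : ι // i ≠ D.p ∧ i ≠ D.q}) : ℕ := D.n i

theorem sum_rest_c_zero :
    D.c D.p 0 + D.c D.q 0 + ∑ i : {i : ι // i ≠ D.p ∧ i ≠ D.q}, D.c i 0 = 0 := by
  rw [add_assoc, ← sum_eq_add_add_sum_rest D.p_ne_q fun i => D.c i 0, D.sum_c_zero]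

theorem m_eq : D.m = 1 + ∑ i, (D.restN i + 1) := by
  have h1 := D.m_add_one
  rw [sum_eq_add_add_sum_rest D.p_ne_q fun i => D.n i + 1, D.n_p, D.n_q] at h1
  change D.m + 1 = 0 + 1 + (0 + 1 + ∑ i, (D.restN i + 1)) at h1
  omega

/-- The characters and residues attached to the points different from the normalized ones. -/
def site : SiteData {i : ι // i ≠ D.p ∧ i ≠ D.q} (JetProd D.restN) :=
  JetProd.siteData D.restN (fun i => D.c i) (fun i => D.im_c_zero i) (fun i => D.c_last i)

/-- The positions of the points. -/
def hecke : HeckeData (JetProd D.restN) :=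
  JetProd.heckeData D.restN (t := fun i => D.t i) (tp := D.t D.p) (tq := D.t D.q)
    (fun _ _ h => Subtype.ext (D.t_injective h)) (fun h => D.p_ne_q (D.t_injective h))
    (fun ⟨i, hi⟩ => i.2.1 (D.t_injective hi)) (fun ⟨i, hi⟩ => i.2.2 (D.t_injective hi))

/-- The characters at the two normalized points. -/
def pair : CharPair D.site :=
  JetProd.charPair (n := D.restN) (fun i => D.c i) (fun i => D.im_c_zero i) (fun i => D.c_last i)
    (D.im_c_zero D.p) (D.im_c_zero D.q) D.sum_rest_c_zero

theorem regular_iff (x : ℂ) : D.hecke.Regular x ↔ x ∉ range D.t := by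
  have h1 : IsUnit (D.hecke.z - algebraMap ℂ (JetProd D.restN) x)
      ↔ x ∉ range fun i : {i : ι // i ≠ D.p ∧ i ≠ D.q} => D.t i :=
    JetProd.isUnit_pos_sub_iff (n := D.restN) _ x
  rw [HeckeData.Regular, h1]
  constructor
  · rintro ⟨hp, hq, h⟩ ⟨i, rfl⟩
    exact h ⟨⟨i, fun hi => hp (by rw [hi]; rfl), fun hi => hq (by rw [hi]; rfl)⟩, rfl⟩
  · intro h
    exact ⟨fun hx => h ⟨D.p, hx.symm⟩, fun hx => h ⟨D.q, hx.symm⟩, fun ⟨i, hi⟩ => h ⟨i, hi⟩⟩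

theorem point_p (v : D.Slice) (j) : D.point v D.p j = 0 := by simp [point, D.p_ne_q]

theorem point_q (v : D.Slice) (j) : D.point v D.q j = 1 := by simp [point]

theorem point_rest (v : D.Slice) (i : {i : ι // i ≠ D.p ∧ i ≠ D.q}) : D.point v i = v i := by
  funext j
  simp [point, i.2.1, i.2.2]

theorem _root_.WildHecke.Jet.char_of_eq_zero {n : ℕ} (hn : n = 0) (c : Fin (n + 1) → ℂ) (a : Jet n) :
    Jet.char c a = powChar (c 0) (a 0) := by
  have h1 : Jet.tail c a = 0 := Finset.sum_eq_zero fun j _ => by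
    rw [Jet.logTail, if_pos (by omega), mul_zero]
  rw [Jet.char, h1]
  simp

/-- The coordinates as an element of the product of algebras of jets. -/
def toJets (v : D.Slice) : JetProd D.restN := v

/-- The coordinates given by an element of the product of algebras of jets. -/
def ofJets (r : JetProd D.restN) : D.Slice := r

variable {x s : ℂ} {v : D.Slice}

theorem diff_point (i : {i : ι // i ≠ D.p ∧ i ≠ D.q}) :
    D.diff s (D.point v) i = (algebraMap ℂ (JetProd D.restN) s - D.toJets v) i := by
  rw [diff, point_rest, Pi.sub_apply, Pi.algebraMap_apply, ← Jet.ofSeries_C]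
  have h1 : Jet.ofSeries (D.n i) (toSeries (v i)) = D.toJets v i := Jet.ofSeries_toSeries _
  exact ((map_sub (Jet.ofSeriesHom (D.n i)) _ _)).trans (congrArg (_ - ·) h1)

theorem den_mat : SiteData.den (D.hecke.mat x s) (D.toJets v)
    = algebraMap ℂ (JetProd D.restN) (D.hecke.lin x s) * (algebraMap ℂ (JetProd D.restN) s - D.toJets v) := by
  simp only [SiteData.den, HeckeData.mat, map_neg, map_mul]
  ring

theorem isUnit_sub_iff : IsUnit (algebraMap ℂ (JetProd D.restN) s - D.toJets v) ↔ ∀ i, s ≠ v i 0 := by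
  rw [JetProd.isUnit_iff]
  refine forall_congr' fun i => ?_
  rw [Pi.sub_apply, Jet.sub_apply, Pi.algebraMap_apply]
  have h1 : (algebraMap ℂ (Jet (D.restN i)) s) 0 = s := (Jet.residue _).commutes s
  rw [h1, sub_ne_zero]
  rfl

theorem ne_point (hs : s ∈ D.hecke.good x) (hv : ∀ i, s ≠ v i 0) (i : ι) : s ≠ D.point v i 0 := by
  by_cases hp : i = D.p
  · subst hp; rw [point_p]; exact hs.1
  by_cases hq : i = D.q
  · subst hq; rw [point_q]; exact hs.2.1
  · have h1 := D.point_rest v ⟨i, hp, hq⟩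
    rw [show D.point v i = _ from h1]
    exact hv ⟨i, hp, hq⟩

theorem modify_q_sub_modify_p (hs : s ∈ D.hecke.good x) :
    D.modify x s (D.point v) D.q 0 - D.modify x s (D.point v) D.p 0
      = D.hecke.lin x s / (s * (s - 1)) := by
  have h0 := hs.1
  have h1 := sub_ne_zero.2 hs.2.1
  rw [modify_zero, modify_zero, point_p, point_q, sub_zero, HeckeData.lin]
  change _ = ((D.t D.q - D.t D.p) * s + (D.t D.p - x)) / _
  field_simp
  ring

theorem slice_modify (hs : s ∈ D.hecke.good x) (hv : ∀ i, s ≠ v i 0) :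
    D.slice (D.modify x s (D.point v)) = D.ofJets (SiteData.act (D.hecke.mat x s) (D.toJets v)) := by
  have h0 := hs.1
  have h1 := sub_ne_zero.2 hs.2.1
  have hl := hs.2.2
  have hw := D.isUnit_sub_iff.2 hv
  set w := algebraMap ℂ (JetProd D.restN) s - D.toJets v with hwdef
  have hact : SiteData.act (D.hecke.mat x s) (D.toJets v) = algebraMap ℂ (JetProd D.restN) (s * (s - 1) / D.hecke.lin x s) *
      ((D.hecke.z - algebraMap ℂ (JetProd D.restN) x) * Ring.inverse w
        - algebraMap ℂ (JetProd D.restN) ((D.t D.p - x) / s)) := by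
    rw [SiteData.act, den_mat, Ring.mul_inverse_rev, inverse_algebraMap hl, ← hwdef]
    have h2 := Ring.mul_inverse_cancel _ hw
    have h3 : algebraMap ℂ (JetProd D.restN) s * algebraMap ℂ (JetProd D.restN) s⁻¹ = 1 := by
      rw [← map_mul, mul_inv_cancel₀ h0, map_one]
    have h4 : D.toJets v = algebraMap ℂ (JetProd D.restN) s - w := by rw [hwdef]; ring
    conv_lhs => rw [h4]
    simp only [HeckeData.mat, div_eq_mul_inv, map_mul]
    have htp : D.hecke.tp = D.t D.p := rfl
    rw [htp]
    simp only [map_sub, map_one]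
    set a := algebraMap ℂ (JetProd D.restN) s
    set b := algebraMap ℂ (JetProd D.restN) s⁻¹
    set L := algebraMap ℂ (JetProd D.restN) (D.hecke.lin x s)⁻¹
    set P := algebraMap ℂ (JetProd D.restN) (D.t D.p)
    set y := algebraMap ℂ (JetProd D.restN) x
    linear_combination (-(P - y) * (a - 1) * L) * h2 + ((P - y) * (a - 1) * L) * h3
  rw [hact]
  funext i
  have h5 : ∀ j : Fin (D.n i + 1), D.modify x s (D.point v) i j
      = (((D.hecke.z - algebraMap ℂ (JetProd D.restN) x) * Ring.inverse w) i) j := by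
    intro j
    rw [D.modify_eq x (D.ne_point hs hv i), diff_point]
    have h6 : (D.hecke.z - algebraMap ℂ (JetProd D.restN) x) i
        = Jet.ofSeries (D.n i) (C (D.t i - x) + X) := JetProd.pos_sub_apply (n := D.restN) _ x i
    have h7 : (Ring.inverse w) i = Ring.inverse (w i) := by
      have h8 := congrFun (Ring.mul_inverse_cancel _ hw) i
      have h9 : IsUnit (w i) := Pi.isUnit_iff.1 hw i
      have h10 := Ring.inverse_mul_cancel_left (w i) ((Ring.inverse w) i) h9
      rw [Pi.mul_apply] at h8
      rw [← h10, h8, Pi.one_apply, mul_one]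
    rw [Pi.mul_apply, h6, h7]
  funext j
  have h6 : (algebraMap ℂ (JetProd D.restN) ((D.t D.p - x) / s) i) j
      = if j = 0 then (D.t D.p - x) / s else 0 := by
    rw [Pi.algebraMap_apply, ← Jet.ofSeries_C, Jet.ofSeries_apply, coeff_C]
    simp only [Fin.ext_iff, Fin.val_zero]
  rw [slice, D.modify_q_sub_modify_p hs, h5, modify_zero, point_p, sub_zero, ← h6,
    div_div_eq_mul_div, mul_comm, mul_div_right_comm]
  exact (JetProd.algebraMap_mul_apply (n := D.restN) (s * (s - 1) / D.hecke.lin x s)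
    ((D.hecke.z - algebraMap ℂ (JetProd D.restN) x) * Ring.inverse w -
      algebraMap ℂ (JetProd D.restN) ((D.t D.p - x) / s)) i j).symm

theorem nm_algebraMap (a : ℂ) : D.site.nm (algebraMap ℂ (JetProd D.restN) a)
    = (‖a‖ ^ (∑ i, (D.restN i + 1))) ^ 2 := by
  rw [SiteData.nm, ← Finset.prod_pow_eq_pow_sum, ← Finset.prod_pow]
  refine Finset.prod_congr rfl fun i _ => ?_
  rw [AlgHom.commutes, ← pow_mul, mul_comm 2]
  rfl

theorem integrand_point (hx : D.hecke.Regular x) (hs : s ∈ D.hecke.good x) (hv : ∀ i, s ≠ v i 0)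
    (f : D.Slice → ℂ) : D.integrand x (D.homogExt f) (D.point v) s
      = D.site.heckeKernel D.hecke D.pair x s * D.site.rhoFun (D.hecke.mat x s) (fun r => f (D.ofJets r)) (D.toJets v) := by
  have h0 := hs.1
  have h1 := sub_ne_zero.2 hs.2.1
  have hl := hs.2.2
  have hw := D.isUnit_sub_iff.2 hv
  set w := algebraMap ℂ (JetProd D.restN) s - D.toJets v with hwdef
  set N := ∑ i, (D.restN i + 1) with hN
  have hphase : D.phase s (D.point v)
      = D.pair.α s * D.pair.β (s - 1) * D.site.χ w := by
    rw [D.phase_eq (D.ne_point hs hv), prod_eq_mul_mul_prod_rest D.p_ne_q,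
      Jet.char_of_eq_zero D.n_p, Jet.char_of_eq_zero D.n_q, diff_apply, diff_apply, if_pos rfl,
      if_pos rfl, point_p, point_q, sub_zero, mul_assoc]
    have e1 : D.pair.α s = powChar (D.c D.p 0) s := if_neg h0
    have e2 : D.pair.β (s - 1) = powChar (D.c D.q 0) (s - 1) := if_neg h1
    have e3 : D.site.χ w = ∏ i : {i : ι // i ≠ D.p ∧ i ≠ D.q}, Jet.char (D.c i) (w i) := if_pos hw
    rw [e1, e2, e3]
    congr 2
    refine Finset.prod_congr rfl fun i _ => ?_
    rw [diff_point]
  have hden : ∏ i, ‖s - D.point v i 0‖ ^ (2 * D.n i + 2)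
      = ‖s‖ ^ 2 * (‖s - 1‖ ^ 2 * D.site.nm w) := by
    rw [prod_eq_mul_mul_prod_rest D.p_ne_q, point_p, point_q, sub_zero]
    rw [D.n_p, D.n_q]
    congr 2
    refine Finset.prod_congr rfl fun i _ => ?_
    rw [point_rest]
    congr 2
    change _ = (algebraMap ℂ (JetProd D.restN) s i) 0 - v i 0
    congr 1
    exact ((Jet.residue _).commutes s).symm
  have hχ : D.pair.α (s * D.hecke.lin x s) * D.pair.β ((s - 1) * D.hecke.lin x s) *
      D.site.χ (SiteData.den (D.hecke.mat x s) (D.toJets v)) = D.pair.α s * D.pair.β (s - 1) * D.site.χ w := by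
    rw [den_mat, D.site.χ_mul ((IsUnit.mk0 _ hl).map _) hw, D.pair.α_mul h0 hl, D.pair.β_mul h1 hl]
    linear_combination (D.pair.α s * D.pair.β (s - 1) * D.site.χ w) * D.pair.rel hl
  have hdet : √(D.site.nm (D.hecke.mat x s).det)
      = (‖D.hecke.lin x s‖ * (‖s‖ * ‖s - 1‖)) ^ N *
        √(D.site.nm (D.hecke.z - algebraMap ℂ (JetProd D.restN) x)) := by
    rw [HeckeData.det_mat, D.site.nm_mul, nm_algebraMap, Real.sqrt_mul (by positivity),
      Real.sqrt_sq (by positivity), norm_mul, norm_mul]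
  have hnden : D.site.nm (SiteData.den (D.hecke.mat x s) (D.toJets v))
      = (‖D.hecke.lin x s‖ ^ N) ^ 2 * D.site.nm w := by
    rw [den_mat, D.site.nm_mul, nm_algebraMap]
  have hreal : (‖D.hecke.lin x s / (s * (s - 1))‖ ^ D.m)⁻¹ * (‖s‖ ^ 2 * (‖s - 1‖ ^ 2 * D.site.nm w))⁻¹
      = ‖D.hecke.lin x s‖⁻¹ * ‖s‖⁻¹ * ‖s - 1‖⁻¹ *
        (√(D.site.nm (D.hecke.z - algebraMap ℂ (JetProd D.restN) x)))⁻¹ *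
        (√(D.site.nm (D.hecke.mat x s).det) * (D.site.nm (SiteData.den (D.hecke.mat x s) (D.toJets v)))⁻¹) := by
    rw [hdet, hnden, m_eq, ← hN, norm_div, norm_mul]
    have p1 : ‖s‖ ≠ 0 := norm_ne_zero_iff.2 h0
    have p2 : ‖s - 1‖ ≠ 0 := norm_ne_zero_iff.2 h1
    have p3 : ‖D.hecke.lin x s‖ ≠ 0 := norm_ne_zero_iff.2 hl
    have p4 : D.site.nm w ≠ 0 := (D.site.nm_pos hw).ne'
    have p5 : √(D.site.nm (D.hecke.z - algebraMap ℂ (JetProd D.restN) x)) ≠ 0 :=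
      (Real.sqrt_pos.2 (D.site.nm_pos hx.2.2)).ne'
    generalize ‖s‖ = a at *
    generalize ‖s - 1‖ = b at *
    generalize ‖D.hecke.lin x s‖ = L at *
    generalize D.site.nm w = W at *
    generalize √(D.site.nm (D.hecke.z - algebraMap ℂ (JetProd D.restN) x)) = Z at *
    simp only [div_pow, mul_pow, pow_add, pow_one]
    field_simp
  rw [integrand, homogExt, D.modify_q_sub_modify_p hs, D.slice_modify hs hv, hphase, hden,
    SiteData.heckeKernel, SiteData.rhoFun, ← hχ]
  have hc := congrArg (fun r : ℝ => (r : ℂ)) hreal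
  simp only [Complex.ofReal_mul, Complex.ofReal_inv] at hc ⊢
  rw [div_eq_mul_inv, mul_inv, mul_inv]
  rw [mul_inv, mul_inv] at hc
  linear_combination (f (D.ofJets (SiteData.act (D.hecke.mat x s) (D.toJets v))) * D.pair.α (s * D.hecke.lin x s) *
    D.pair.β ((s - 1) * D.hecke.lin x s) * D.site.χ (SiteData.den (D.hecke.mat x s) (D.toJets v))) * hc

end RamificationData

namespace RamificationData

variable {ι : Type*} [Fintype ι] [DecidableEq ι] (D : RamificationData ι)

/-- The modified Hecke operator. -/
def heckeMap (x : ℂ) : D.HilbertSp →L[ℂ] D.HilbertSp :=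
  D.site.heckeOp D.hecke D.pair (volume : Measure (JetProd D.restN)) x

theorem isModifiedHecke_heckeMap {x : ℂ} (hx : x ∉ range D.t) : D.IsModifiedHecke x (D.heckeMap x) := by
  have hreg := (D.regular_iff x).2 hx
  have hk := D.site.integrable_heckeKernel D.hecke D.pair hreg
  have hm := D.hecke.measurable_mat x
  intro f
  have h1 : ∀ᵐ v : D.Slice, Integrable fun s : ℂ => D.site.heckeKernel D.hecke D.pair x s *
      D.site.rhoFun (D.hecke.mat x s) (fun r => f (D.ofJets r)) (D.toJets v) :=
    D.site.ae_integrable_average (volume : Measure (JetProd D.restN)) volume hk hm f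
  have h2 : ∀ᵐ v : D.Slice, D.heckeMap x f v = ∫ s : ℂ, D.site.heckeKernel D.hecke D.pair x s *
      D.site.rhoFun (D.hecke.mat x s) (fun r => f (D.ofJets r)) (D.toJets v) :=
    D.site.avgOp_ae (volume : Measure (JetProd D.restN)) hk hm f
  filter_upwards [h1, h2] with v hv1 hv2 l τ hl
  have h3 : D.integrand x (D.homogExt f) (D.point v) =ᵐ[volume] fun s : ℂ =>
      D.site.heckeKernel D.hecke D.pair x s *
      D.site.rhoFun (D.hecke.mat x s) (fun r => f (D.ofJets r)) (D.toJets v) := by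
    have h4 : ∀ᵐ s : ℂ, ∀ i, s ≠ v i 0 := ae_all_iff.2 fun i => Measure.ae_ne volume (v i 0)
    filter_upwards [SiteData.ae_good D.hecke x, h4] with s hs hsv
    exact D.integrand_point hreg hs hsv f
  have h5 := D.integrand_affine_change x f hl τ (u := D.point v) ((integrable_congr h3).2 hv1)
  refine ⟨h5.1, ?_⟩
  rw [h5.2, integral_congr_ae h3, ← hv2, homogExt_affine D _ hl, homogExt_point]

theorem isCompactOperator_heckeMap {x : ℂ} (hx : x ∉ range D.t) : IsCompactOperator (D.heckeMap x) :=
  D.site.isCompactOperator_heckeOp D.hecke D.pair (volume : Measure (JetProd D.restN))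
    ((D.regular_iff x).2 hx)

theorem continuousAt_heckeMap {x : ℂ} (hx : x ∉ range D.t) : ContinuousAt D.heckeMap x :=
  D.site.continuousAt_heckeOp D.hecke D.pair (volume : Measure (JetProd D.restN))
    ((D.regular_iff x).2 hx)

theorem ofSeries_pos_apply_zero (x : ℂ) (i : ι) :
    Jet.ofSeries (D.n i) (C (D.t i - x) + X) 0 = D.t i - x := by
  simp

theorem heckeFactor_eq (x : ℂ) (ℓ : ι → ℂ) : D.heckeFactor x ℓ
    = ∏ i, ((‖D.t i - x‖ ^ (D.n i + 1) : ℝ) : ℂ) *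
      Complex.exp (-(1 / 2) * (Complex.I * ((D.c i 0 * ℓ i +
        Jet.tail (D.c i) (Jet.ofSeries (D.n i) (C (D.t i - x) + X))).re : ℝ))) := by
  simp only [heckeFactor, Jet.chi_logCoeff]

theorem continuousOn_heckeFactor :
    ContinuousOn (fun z : ℂ × (ι → ℂ) => D.heckeFactor z.1 z.2) {z | z.1 ∉ range D.t} := by
  simp only [heckeFactor_eq]
  refine continuousOn_finsetProd _ fun i _ => ContinuousOn.mul ?_ ?_
  · exact Continuous.continuousOn (by fun_prop)
  · have h1 : Continuous fun z : ℂ × (ι → ℂ) => Jet.ofSeries (D.n i) (C (D.t i - z.1) + X) := by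
      have h2 : ∀ x, Jet.ofSeries (D.n i) (C (D.t i - x) + X)
          = algebraMap ℂ (Jet (D.n i)) (D.t i - x) + Jet.eps (D.n i) := by
        intro x
        rw [Jet.ofSeries_add, Jet.ofSeries_C]
        rfl
      simp only [h2]
      exact ((continuous_algebraMap ℂ (Jet (D.n i))).comp
        (continuous_const.sub continuous_fst)).add continuous_const
    have h3 : ContinuousOn (fun z : ℂ × (ι → ℂ) =>
        Jet.tail (D.c i) (Jet.ofSeries (D.n i) (C (D.t i - z.1) + X))) {z | z.1 ∉ range D.t} := by
      refine (Jet.continuousOn_tail (D.c i)).comp h1.continuousOn fun z hz => ?_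
      rw [Set.mem_ofPred_eq, ofSeries_pos_apply_zero]
      exact sub_ne_zero.2 fun h => hz ⟨i, h⟩
    have h4 : Continuous fun z : ℂ × (ι → ℂ) => D.c i 0 * z.2 i := by fun_prop
    exact (continuousOn_const.mul (continuousOn_const.mul (Complex.continuous_ofReal.comp_continuousOn
      (Complex.continuous_re.comp_continuousOn (h4.continuousOn.add h3))))).cexp

theorem heckeFactor_congr (h : ∀ i, ∃ k : ℤ, (D.c i 0).im = 2 * (k : ℝ)) (x : ℂ) {ℓ ℓ' : ι → ℂ}
    (hℓ : ∀ i, Complex.exp (ℓ i) = Complex.exp (ℓ' i)) : D.heckeFactor x ℓ = D.heckeFactor x ℓ' := by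
  rw [heckeFactor_eq, heckeFactor_eq]
  refine Finset.prod_congr rfl fun i _ => ?_
  congr 1
  set w := Jet.tail (D.c i) (Jet.ofSeries (D.n i) (C (D.t i - x) + X))
  obtain ⟨k, hk⟩ := h i
  have h1 : ∀ a : ℂ, Complex.exp (-(1 / 2) * (Complex.I * ((D.c i 0 * a + w).re : ℝ)))
      = Complex.exp (Complex.I * ((-(1 / 2) * D.c i 0 * a).re : ℝ)) *
        Complex.exp (-(1 / 2) * (Complex.I * (w.re : ℝ))) := by
    intro a
    have h2 : (-(1 / 2) * D.c i 0 * a).re = -(1 / 2) * (D.c i 0 * a).re := by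
      have h3 : (-(1 / 2) * D.c i 0 * a) = ((-(1 / 2) : ℝ) : ℂ) * (D.c i 0 * a) := by
        push_cast; ring
      rw [h3, Complex.re_ofReal_mul]
    rw [h2, ← Complex.exp_add, Complex.add_re]
    congr 1
    push_cast
    ring
  rw [h1, h1]
  congr 1
  refine exp_I_mul_re_eq ⟨-k, ?_⟩ (hℓ i)
  have h3 : (-(1 / 2) * D.c i 0) = ((-(1 / 2) : ℝ) : ℂ) * D.c i 0 := by push_cast; ring
  rw [h3, Complex.im_ofReal_mul, hk]
  push_cast
  ring

theorem continuousAt_heckeFactor_log (h : ∀ i, ∃ k : ℤ, (D.c i 0).im = 2 * (k : ℝ)) {x : ℂ}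
    (hx : x ∉ range D.t) :
    ContinuousAt (fun x => D.heckeFactor x fun i => Complex.log (D.t i - x)) x := by
  have hne : ∀ {y}, y ∉ range D.t → ∀ i, D.t i - y ≠ 0 := fun hy i =>
    sub_ne_zero.2 fun hi => hy ⟨i, hi⟩
  have hopen : IsOpen {y | y ∉ range D.t} := (Set.finite_range D.t).isClosed.isOpen_compl
  set L : ℂ → ι → ℂ := fun y i => Complex.log (D.t i - x) + Complex.log ((D.t i - x)⁻¹ * (D.t i - y))
  have hL : ContinuousAt L x := by
    refine continuousAt_pi.2 fun i => continuousAt_const.add ?_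
    refine ContinuousAt.clog (by fun_prop) ?_
    rw [inv_mul_cancel₀ (hne hx i)]
    exact Complex.one_mem_slitPlane
  have h1 : ContinuousAt (fun y => D.heckeFactor y (L y)) x := by
    have hopen' : IsOpen {z : ℂ × (ι → ℂ) | z.1 ∉ range D.t} := hopen.preimage continuous_fst
    have h2 : ContinuousAt (fun z : ℂ × (ι → ℂ) => D.heckeFactor z.1 z.2) (x, L x) :=
      D.continuousOn_heckeFactor.continuousAt (hopen'.mem_nhds hx)
    exact ContinuousAt.comp (f := fun y => (y, L y)) h2 (continuousAt_id.prodMk hL)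
  refine h1.congr ?_
  filter_upwards [hopen.mem_nhds hx] with y hy
  refine D.heckeFactor_congr h y fun i => ?_
  rw [Complex.exp_add, Complex.exp_log (hne hx i), Complex.exp_log (hne hy i),
    Complex.exp_log (mul_ne_zero (inv_ne_zero (hne hx i)) (hne hy i)),
    mul_inv_cancel_left₀ (hne hx i)]

end RamificationData

end WildHecke

end

theorem proposition3p11 {ι : Type*} [Fintype ι] [DecidableEq ι]
    (D : WildHecke.RamificationData ι) :
    ∃ M : ℂ → (D.HilbertSp →L[ℂ] D.HilbertSp),
      -- `M x` is the modified Hecke operator; it is compact and norm-continuous in `x`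
      (∀ x ∉ Set.range D.t, D.IsModifiedHecke x (M x)) ∧
      (∀ x ∉ Set.range D.t, IsCompactOperator (M x)) ∧
      ContinuousOn M (Set.range D.t)ᶜ ∧
      -- the Hecke operator `D.heckeFactor x ℓ • M x`, for all choices of the logarithms
      (∀ z ∈ D.logChoices, IsCompactOperator (D.heckeFactor z.1 z.2 • M z.1)) ∧
      ContinuousOn (fun z : ℂ × (ι → ℂ) => D.heckeFactor z.1 z.2 • M z.1) D.logChoices ∧
      -- if the Hecke operator is single-valued, it is norm-continuous on the whole set of `x`
      ((∀ i, ∃ k : ℤ, (D.c i 0).im = 2 * (k : ℝ)) →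
        (∀ x ∉ Set.range D.t, ∀ ℓ : ι → ℂ, (x, ℓ) ∈ D.logChoices →
          D.heckeFactor x ℓ = D.heckeFactor x (fun i => Complex.log (D.t i - x))) ∧
        ContinuousOn (fun x => D.heckeFactor x (fun i => Complex.log (D.t i - x)) • M x)
          (Set.range D.t)ᶜ) := by
  have hcomp : ∀ (a : ℂ) {x : ℂ}, x ∉ Set.range D.t → IsCompactOperator (a • D.heckeMap x) :=
    fun a _ hx => (D.isCompactOperator_heckeMap hx).smul a
  refine ⟨D.heckeMap, fun x hx => D.isModifiedHecke_heckeMap hx,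
    fun x hx => D.isCompactOperator_heckeMap hx,
    fun x hx => (D.continuousAt_heckeMap hx).continuousWithinAt,
    fun z hz => hcomp _ hz.1, ?_, fun h => ⟨?_, ?_⟩⟩
  · refine (D.continuousOn_heckeFactor.mono fun z hz => hz.1).smul fun z hz => ?_
    exact (ContinuousAt.comp (f := Prod.fst) (D.continuousAt_heckeMap hz.1)
      continuousAt_fst).continuousWithinAt
  · intro x hx ℓ hℓ
    refine D.heckeFactor_congr h x fun i => ?_
    rw [hℓ.2 i, Complex.exp_log (sub_ne_zero.2 fun hi => hx ⟨i, hi⟩)]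
  · exact fun x hx => ((D.continuousAt_heckeFactor_log h hx).smul
      (D.continuousAt_heckeMap hx)).continuousWithinAt
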